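/- Let $N\ge 3$ be an integer and $p>p_S:=\frac{N+2}{N-2}$; put $f(u):=-u+u^p$, $\theta:=\frac{2}{p-1}$, $A:=\{\theta(N-2-\theta)\}^{1/(p-1)}$, and $p_{JL}:=1+\frac{4}{N-4-2\sqrt{N-1}}$ if $N\ge 11$, $p_{JL}:=\infty$ if $N\le 10$. Consider $$U''+\tfrac{N-1}{r}U'+\lambda f(U)=0\ (0<r<1),\qquad U'(1)=0,\qquad U>0,\qquad \lambda>0. \tag{N}$$ Let $\mathcal S\subset(0,\infty)\times C([0,1])$ be the set of regular solutions $(\lambda,U)$ of (N) ($U\in C^2([0,1])$, $U'(0)=0$, $U>0$ on $[0,1]$), and let $\mathcal C_0:=\{(\lambda,1):\lambda>0\}$. Let $0=\mu_0<\mu_1<\mu_2<\cdots$ be the eigenvalues of the negative Neumann Laplacian on the unit ball $B\subset\mathbb R^N$ in the space of radial functions, and $\bar\lambda_n:=\mu_n/(p-1)$. For $n\ge1$ let $\mathcal C_n$ be the branch of nontrivial solutions emanating from $(\bar\lambda_n,1)$, i.e. the connected component containing $(\bar\lambda_n,1)$ of the closure of $\mathcal S\setminus\mathcal C_0$ in $\mathbb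 R\times C([0,1])$, and let $\mathcal C_n^{+}$, $\mathcal C_n^-$ be its parts with $U(0)>1$, $U(0)<1$ respectively. For each $n\ge1$ there is exactly one $\lambda=\lambda_n^*>0$ for which (N) has a singular solution $U^*\in C^2(0,1)\cap C^1(0,1]\cap H^1(B)$, positive on $(0,1]$, with $U^*(r)=A(\sqrt{\lambda}\,r)^{-\theta}(1+o(1))$ as $r\downarrow0$ and such that $U^*-1$ has exactly $n$ zeros in $(0,1]$. Moreover $$\mathcal S=\mathcal C_0\cup\bigcup_{n=1}^\infty(\mathcal C_n^+\cup\mathcal C_n^-),$$ and each $\mathcal C_n$ $(n\ge1)$ is parametrized by $\gamma=U(0)$: $\mathcal C_n=\{(\lambda_n(\gamma),U_n(\cdot,\gamma)):\gamma>0\}$ with $U_n(0,\gamma)=\gamma$, where $\lambda_n\in C^1(0,\infty)$ and $\gamma\mapsto U_n(\cdot,\gamma)\in C([0,1])$ is continuous. Furthermore: (i) $\lambda_n(1)=\bar\lambda_n$ for each $n\ge1$. (ii) $\lambda_n(\gamma)\to\lambda_n^*$ as $\gamma\to\infty$ for each $n\ge1$. (iii) If $p<p_{JL}$, then for each $n\ge1$,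 $\lambda_n(\gamma)$ oscillates around $\lambda_n^*$ infinitely many times as $\gamma\to\infty$: there are arbitrarily large $\gamma$ with $\lambda_n(\gamma)>\lambda_n^*$ and arbitrarily large $\gamma$ with $\lambda_n(\gamma)<\lambda_n^*$. (iv) $\lambda_n(\gamma)\to\infty$ as $\gamma\downarrow0$ for each $n\ge1$. (v) For all sufficiently small $\gamma>0$, $U_1(\cdot,\gamma)$ is nondegenerate among radial functions: the only $\varphi\in C^2([0,1])$ with $\varphi''+\frac{N-1}{r}\varphi'+\lambda_1(\gamma)f'(U_1(r,\gamma))\varphi=0$ on $(0,1)$ and $\varphi'(0)=\varphi'(1)=0$ is $\varphi=0$. As $\gamma\downarrow0$, $U_1(\cdot,\gamma)$ becomes a boundary concentrating solution: $\lambda_1(\gamma)\to\infty$ and $\sup_{0\le r\le1}\bigl|U_1(r,\gamma)-w^*\bigl(\sqrt{\lambda_1(\gamma)}\,(1-r)\bigr)\bigr|\to0$, where $w^*(y)=\left(\frac{p+1}{2}\right)^{\frac1{p-1}}\left(\cosh\frac{(p-1)y}{2}\right)^{-\frac{2}{p-1}}$. (vi) $\lambda_1(\gamma)<\lambda_2(\gamma)<\cdots$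 for every $\gamma>0$. -/

import Mathlib

open Set Filter Topology

noncomputable section

namespace SupercriticalNeumann

/-- The Sobolev critical exponent `p_S` (for `N ≥ 3`). -/
def pS (N : ℕ) : ℝ := ((N : ℝ) + 2) / ((N : ℝ) - 2)

/-- The Joseph-Lundgren exponent `p_JL`, equal to `∞` in dimensions `N ≤ 10`. -/
def pJL (N : ℕ) : EReal :=
  if 11 ≤ N then ((1 + 4 / ((N : ℝ) - 4 - 2 * √((N : ℝ) - 1)) : ℝ) : EReal) else ⊤

/-- The nonlinearity `f(u) = -u + u^p`. -/
def f (p u : ℝ) : ℝ := -u + u ^ p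

/-- The derivative `f'(u) = -1 + p u^(p-1)` of the nonlinearity, for `u > 0`. -/
def f' (p u : ℝ) : ℝ := -1 + p * u ^ (p - 1)

/-- The radial Laplacian `U'' + ((N-1)/r) U'` at `r > 0`. -/
def radialLaplacian (N : ℕ) (U : ℝ → ℝ) (r : ℝ) : ℝ :=
  deriv (deriv U) r + ((N : ℝ) - 1) / r * deriv U r

/-- `x ↦ U(|x|)` is of class `C²` on the closed unit ball and has zero normal derivative on the
boundary: `U ∈ C²[0,1]` and `U'(0) = U'(1) = 0`. Only the values of `U` on `[0,1]` matter. -/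
structure IsRadialNeumann (U : ℝ → ℝ) : Prop where
  contDiffOn : ContDiffOn ℝ 2 U (Icc 0 1)
  deriv_zero : derivWithin U (Icc 0 1) 0 = 0
  deriv_one : derivWithin U (Icc 0 1) 1 = 0

/-- The eigenvalues of the negative Neumann Laplacian on the unit ball of `ℝ^N` in the space of
radial functions. -/
def radialNeumannEigenvalues (N : ℕ) : Set ℝ :=
  {μ | ∃ φ : ℝ → ℝ, IsRadialNeumann φ ∧ (∃ r ∈ Icc (0 : ℝ) 1, φ r ≠ 0) ∧
    ∀ r ∈ Ioo (0 : ℝ) 1, radialLaplacian N φ r + μ * φ r = 0}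

/-- A function on `[0,1]` as a function on the line (its extension by constants). -/
def ext (U : C(unitInterval, ℝ)) : ℝ → ℝ := Set.IccExtend zero_le_one U

/-- The set `S` of the regular solutions `(λ, U)` of
`U'' + ((N-1)/r) U' + λ f(U) = 0` on `(0,1)`, `U'(1) = 0`, `U > 0` on `[0,1]`, with `λ > 0`. -/
def regularSolutions (N : ℕ) (p : ℝ) : Set (ℝ × C(unitInterval, ℝ)) :=
  {q | 0 < q.1 ∧ IsRadialNeumann (ext q.2) ∧ (∀ r, 0 < q.2 r) ∧
    ∀ r ∈ Ioo (0 : ℝ) 1, radialLaplacian N (ext q.2) r + q.1 * f p (ext q.2 r) = 0}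

/-- The trivial branch `C_0 = {(λ, 1)}`. -/
def trivialBranch : Set (ℝ × C(unitInterval, ℝ)) := {q | 0 < q.1 ∧ q.2 = 1}

/-- The branch of nontrivial solutions that emanates from the trivial branch at `(lam₀, 1)`:
the connected component that contains this point, in the closure (in `ℝ × C[0,1]`) of the set of
nontrivial regular solutions. It is empty if `(lam₀, 1)` is not a bifurcation point. -/
def branch (N : ℕ) (p lam₀ : ℝ) : Set (ℝ × C(unitInterval, ℝ)) :=
  connectedComponentIn (closure (regularSolutions N p \ trivialBranch)) (lam₀, 1)

/-- The part `U(0) > 1` of a branch. -/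
def branchPlus (N : ℕ) (p lam₀ : ℝ) : Set (ℝ × C(unitInterval, ℝ)) :=
  branch N p lam₀ ∩ {q | 1 < q.2 0}

/-- The part `U(0) < 1` of a branch. -/
def branchMinus (N : ℕ) (p lam₀ : ℝ) : Set (ℝ × C(unitInterval, ℝ)) :=
  branch N p lam₀ ∩ {q | q.2 0 < 1}

/-- The exponent `θ = 2/(p-1)`. -/
def theta (p : ℝ) : ℝ := 2 / (p - 1)

/-- The constant `A(p,N) = (θ (N-2-θ))^(1/(p-1))`. -/
def A (N : ℕ) (p : ℝ) : ℝ := (theta p * ((N : ℝ) - 2 - theta p)) ^ (1 / (p - 1))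

/-- `(lam, U)` is a singular solution of the Neumann problem with
`U(r) = A(p,N) (√lam r)^(-θ) (1 + o(1))` as `r ↓ 0` and with `U - 1` having exactly `n` zeros in
`(0,1]`. Only the values of `U` on `(0,1]` matter. -/
structure IsSingularSolution (N : ℕ) (p : ℝ) (n : ℕ) (lam : ℝ) (U : ℝ → ℝ) : Prop where
  lam_pos : 0 < lam
  contDiffOn_two : ContDiffOn ℝ 2 U (Ioo 0 1)
  contDiffOn_one : ContDiffOn ℝ 1 U (Ioc 0 1)
  /-- `x ↦ U(|x|)` belongs to `H¹` of the unit ball of `ℝ^N` -/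
  memH1 : MeasureTheory.IntegrableOn (fun r => r ^ (N - 1) * (U r ^ 2 + deriv U r ^ 2)) (Ioo 0 1)
  equation : ∀ r ∈ Ioo (0 : ℝ) 1, radialLaplacian N U r + lam * f p (U r) = 0
  neumann : derivWithin U (Ioc 0 1) 1 = 0
  pos : ∀ r ∈ Ioc (0 : ℝ) 1, 0 < U r
  asymptotics : Tendsto (fun r => U r / (A N p * (√lam * r) ^ (-theta p))) (𝓝[>] 0) (𝓝 1)
  zeros : {r ∈ Ioc (0 : ℝ) 1 | U r - 1 = 0}.encard = n

/-- A regular solution `(lam, U)` is nondegenerate (in the class of radial functions): the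
linearized Neumann problem has only the zero solution. -/
def IsNondegenerate (N : ℕ) (p lam : ℝ) (U : C(unitInterval, ℝ)) : Prop :=
  ∀ φ : ℝ → ℝ, IsRadialNeumann φ →
    (∀ r ∈ Ioo (0 : ℝ) 1, radialLaplacian N φ r + lam * f' p (ext U r) * φ r = 0) →
    ∀ r ∈ Icc (0 : ℝ) 1, φ r = 0

/-- The one-dimensional ground state
`w(y) = ((p+1)/2)^(1/(p-1)) (cosh((p-1)y/2))^(-2/(p-1))`, the even homoclinic solution of
`w'' + f(w) = 0`. -/
def groundState (p y : ℝ) : ℝ :=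
  ((p + 1) / 2) ^ (1 / (p - 1)) * Real.cosh ((p - 1) / 2 * y) ^ (-(2 / (p - 1)))

/-- The family of solutions `(lam γ, U γ)` becomes boundary concentrating as `γ ↓ 0`:
`lam γ → ∞`, and in the stretched variable `y = √(lam γ) (1 - r)`, which measures the distance to
the boundary in units of `ε = 1/√(lam γ)`, `U γ` converges to the ground state uniformly
on `[0,1]`. -/
def IsBoundaryConcentrating (p : ℝ) (lam : ℝ → ℝ) (U : ℝ → C(unitInterval, ℝ)) : Prop :=
  Tendsto lam (𝓝[>] 0) atTop ∧
    ∀ δ > 0, ∀ᶠ γ in 𝓝[>] (0 : ℝ), ∀ r : unitInterval,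
      |U γ r - groundState p (√(lam γ) * (1 - (r : ℝ)))| < δ

end SupercriticalNeumann

end

/-! ### Radial initial value problems, solved globally and continuously in a parameter -/

open Set Filter Topology MeasureTheory

noncomputable section

namespace SupercriticalNeumann

/-! With `s = √λ r` the problem becomes `u'' + ((N-1)/s) u' + f(u) = 0`, `u(0) = γ`, and a regular
solution of (N) is such a `u(·,γ)` together with a positive zero `s = √λ` of `u'`. Everything is
therefore a statement about the `n`-th positive critical point `s_n(γ)`, with `λ_n = s_n²`.

Global existence and positivity come from the Pohozaev functional. In the supercritical range it
decreases strictly from the value `0` at the origin, while at a zero of `u` it would be nonnegative.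
Together with the energy it also keeps `u` away from zero at infinity. The normalized difference `v
= (u-1)/(γ-1)` solves a linear equation with positive coefficient `f(u)/(u-1)`, and for `γ = 1` it
is the solution of the linearization at `1`. Its Prüfer angle increases through each level `nπ` and
tends to infinity, so `s_n(γ)` exists and is unique for every `γ > 0` and every `n`. The value `γ =
1` is not exceptional: `s_n(1)` gives the Neumann eigenvalues, and no bifurcation theory is needed.
The curves `γ ↦ (s_n(γ)², U_n)` are continuous, pairwise separated, and their union is closed; hence
they are exactly the branches. The `C¹` dependence on `γ` follows from a divided difference of `v'`
that is jointly continuous (`exists_divided_difference`).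

For `γ → ∞` one passes to `x(t) = e^{θt} u(e^t)`, an autonomous oscillator with positive friction up
to a perturbation `e^{2t} x` that vanishes as `t → -∞`. Its energy is the Pohozaev functional.
Outside a core of size `γ^{-1/θ}` the energy is at most `-c` uniformly in `γ` (`exists_core`), so
for large `γ` the solutions have settled near the equilibrium `A` at any prescribed early time.
There any two solutions attract each other exponentially, so the family is Cauchy, and its limit is
the singular solution (`exists_sq_dist_lt`, `exists_ef_limit`). The same attraction yields
uniqueness of the singular solution. Prüfer angles converge, hence so do the critical points. If `p
< p_JL`, the equilibrium is a spiral: the difference between the singular solution and `u(·,γ)`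
rotates arbitrarily often as `γ` grows, and the intermediate value theorem in `γ` gives crossings
with both signs (`exists_crossing`).

For `γ → 0` the bound `u ≤ γ e^s` on the increasing part sends `s_1` to infinity. Friction is then
negligible where `u` is not small, the energy is almost `0`, and `u` read backward from `s_1`
follows the ground state. Nondegeneracy compares a solution `ψ` of the linearized equation with
`u'`: their Wronskian has a sign and is relatively small, so `ψ` stays positive until close to
`s_1`, where a Neumann condition for `ψ` is impossible (`eventually_linSol_ne`). -/

/-- The mean `∫₀¹ τⁿ h(rτ) dτ`. -/
def radialMean (n : ℕ) (h : ℝ → ℝ) (r : ℝ) : ℝ := ∫ τ in (0 : ℝ)..1, τ ^ n * h (r * τ)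

/-- Substitution `t = rτ`. The mean is the form of `r^{-(n+1)} ∫₀^r tⁿ h` that still makes sense at
`r = 0`, so the singular point of the radial equation needs no separate treatment. -/
theorem pow_mul_radialMean (n : ℕ) (h : ℝ → ℝ) (r : ℝ) :
    r ^ (n + 1) * radialMean n h r = ∫ t in (0 : ℝ)..r, t ^ n * h t := by
  have := intervalIntegral.smul_integral_comp_mul_left (a := 0) (b := 1)
    (fun t => t ^ n * h t) r
  simp only [mul_zero, mul_one, smul_eq_mul] at this
  rw [← this, radialMean, pow_succ', mul_assoc, ← intervalIntegral.integral_const_mul]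
  congr 1
  exact intervalIntegral.integral_congr fun τ _ => by ring

theorem continuous_radialMean_param {P : Type*} [TopologicalSpace P] (n : ℕ) {h : ℝ → P → ℝ}
    (hh : Continuous fun q : ℝ × P => h q.1 q.2) :
    Continuous fun q : ℝ × P => radialMean n (fun t => h t q.2) q.1 := by
  unfold radialMean
  apply intervalIntegral.continuous_parametric_intervalIntegral_of_continuous' (f :=
    fun (q : ℝ × P) τ => τ ^ n * h (q.1 * τ) q.2)
  have : Continuous fun x : (ℝ × P) × ℝ => h (x.1.1 * x.2) x.1.2 :=
    hh.comp (f := fun x : (ℝ × P) × ℝ => (x.1.1 * x.2, x.1.2)) (by fun_prop)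
  exact (continuous_snd.pow n).mul this

theorem continuous_radialMean (n : ℕ) {h : ℝ → ℝ} (hh : Continuous h) :
    Continuous (radialMean n h) := by
  have := continuous_radialMean_param (P := Unit) n (h := fun t _ => h t) (by fun_prop)
  exact this.comp (f := fun s : ℝ => (s, ())) (by fun_prop)

theorem radialMean_sub (n : ℕ) {h₁ h₂ : ℝ → ℝ} (c₁ : Continuous h₁) (c₂ : Continuous h₂)
    (r : ℝ) : radialMean n (fun t => h₁ t - h₂ t) r = radialMean n h₁ r - radialMean n h₂ r := by
  simp only [radialMean]
  rw [← intervalIntegral.integral_sub]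
  · simp only [mul_sub]
  · exact Continuous.intervalIntegrable (by fun_prop) _ _
  · exact Continuous.intervalIntegrable (by fun_prop) _ _

theorem radialMean_zero (n : ℕ) (h : ℝ → ℝ) : radialMean n h 0 = h 0 / (n + 1) := by
  simp [radialMean, integral_pow, div_eq_inv_mul]

/-- This is the second derivative of the radial inverse: with `v' = -r m` and `m` the mean of `h`,
it reads `-v'' = h - n m`. At `r = 0` it agrees with the value `h(0)/(n+1)` of the mean. -/
theorem hasDerivAt_mul_radialMean (n : ℕ) {h : ℝ → ℝ} (hh : Continuous h) (r : ℝ) :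
    HasDerivAt (fun r => r * radialMean n h r) (h r - n * radialMean n h r) r := by
  rcases eq_or_ne r 0 with rfl | hr
  · have h1 : h 0 - n * radialMean n h 0 = radialMean n h 0 := by
      rw [radialMean_zero]
      have : (n : ℝ) + 1 ≠ 0 := by positivity
      field_simp
      ring
    rw [h1, hasDerivAt_iff_tendsto_slope]
    refine ((continuous_radialMean n hh).continuousAt.tendsto.mono_left
      nhdsWithin_le_nhds).congr' ?_
    filter_upwards [self_mem_nhdsWithin] with x hx
    have : x ≠ 0 := hx
    simp [slope_def_field]
    field_simp
  · have hI : HasDerivAt (fun r => ∫ t in (0 : ℝ)..r, t ^ n * h t) (r ^ n * h r) r :=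
      intervalIntegral.integral_hasDerivAt_right
        ((Continuous.intervalIntegrable (by fun_prop) _ _))
        (Continuous.stronglyMeasurableAtFilter (by fun_prop) _ _)
        (by fun_prop)
    have hp : HasDerivAt (fun r : ℝ => r ^ n) (n * r ^ (n - 1)) r := hasDerivAt_pow n r
    have hd := hI.div hp (pow_ne_zero n hr)
    have heq : (fun r => r * radialMean n h r) =ᶠ[𝓝 r]
        ((fun r => ∫ t in (0 : ℝ)..r, t ^ n * h t) / fun r : ℝ => r ^ n) := by
      filter_upwards [isOpen_ne.mem_nhds hr] with x hx
      have : x ≠ 0 := hx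
      simp only [Pi.div_apply]
      rw [← pow_mul_radialMean]
      field_simp
      ring
    refine (hd.congr_of_eventuallyEq heq).congr_deriv ?_
    rw [← pow_mul_radialMean]
    rcases n with _ | k
    · simp
    · simp only [Nat.add_sub_cancel]
      field_simp
      push_cast
      ring

theorem abs_radialMean_le (n : ℕ) {h : ℝ → ℝ} {C L r : ℝ} (hL : 0 ≤ L) (hC : 0 ≤ C)
    (hb : ∀ t, |h t| ≤ C * Real.exp (L * t ^ 2)) :
    |radialMean n h r| ≤ C * Real.exp (L * r ^ 2) := by
  have : ‖∫ τ in (0 : ℝ)..1, τ ^ n * h (r * τ)‖ ≤ C * Real.exp (L * r ^ 2) * |1 - 0| := by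
    refine intervalIntegral.norm_integral_le_of_norm_le_const fun τ hτ => ?_
    rw [uIoc_of_le zero_le_one] at hτ
    rw [Real.norm_eq_abs, abs_mul, abs_of_nonneg (pow_nonneg hτ.1.le n)]
    have h1 : τ ^ n ≤ 1 := pow_le_one₀ hτ.1.le hτ.2
    have h2 : Real.exp (L * (r * τ) ^ 2) ≤ Real.exp (L * r ^ 2) := by
      apply Real.exp_le_exp.2
      apply mul_le_mul_of_nonneg_left _ hL
      rw [mul_pow]
      exact mul_le_of_le_one_right (sq_nonneg r) (pow_le_one₀ hτ.1.le hτ.2)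
    calc τ ^ n * |h (r * τ)| ≤ 1 * |h (r * τ)| := by gcongr
      _ ≤ C * Real.exp (L * (r * τ) ^ 2) := by rw [one_mul]; exact hb _
      _ ≤ _ := by gcongr
  simpa [radialMean] using this

/-- The inverse of the radial Laplacian in dimension `n + 1` with zero data at the origin. -/
def radialInverse (n : ℕ) (h : ℝ → ℝ) (s : ℝ) : ℝ := s ^ 2 * radialMean 1 (radialMean n h) s

theorem hasDerivAt_radialInverse (n : ℕ) {h : ℝ → ℝ} (hh : Continuous h) (s : ℝ) :
    HasDerivAt (radialInverse n h) (s * radialMean n h s) s := by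
  have hm := continuous_radialMean n hh
  have : radialInverse n h = fun s => ∫ t in (0 : ℝ)..s, t ^ 1 * radialMean n h t := by
    funext s
    rw [← pow_mul_radialMean]
    rfl
  rw [this]
  have := intervalIntegral.integral_hasDerivAt_right (a := 0) (b := s)
    (f := fun t => t ^ 1 * radialMean n h t)
        ((Continuous.intervalIntegrable (by fun_prop) _ _))
        (Continuous.stronglyMeasurableAtFilter (by fun_prop) _ _)
        (by fun_prop)
  simpa using this

/-- A Gaussian bound `e^{L s²}` is reproduced with the gain `1/(2L)`, because `s² σ e^{L s² σ²}` is
`1/(2L)` times a `σ`-derivative. A large exponent thus makes the integral operator a contraction on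
the whole line at once. -/
theorem abs_radialInverse_le (n : ℕ) {h : ℝ → ℝ} {C L : ℝ} (hh : Continuous h) (hL : 0 < L)
    (hC : 0 ≤ C) (hb : ∀ t, |h t| ≤ C * Real.exp (L * t ^ 2)) (s : ℝ) :
    |radialInverse n h s| ≤ C / (2 * L) * Real.exp (L * s ^ 2) := by
  have hm := continuous_radialMean n hh
  have h1 : ∀ σ, HasDerivAt (fun σ => C / (2 * L) * Real.exp (L * (s * σ) ^ 2))
      (s ^ 2 * (σ * (C * Real.exp (L * (s * σ) ^ 2)))) σ := by
    intro σ
    have h2 : HasDerivAt (fun σ => L * (s * σ) ^ 2) (L * (2 * (s * σ) * s)) σ := by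
      have := (((hasDerivAt_id σ).const_mul s).pow 2).const_mul L
      simpa using this
    refine (h2.exp.const_mul (C / (2 * L))).congr_deriv ?_
    field_simp
  have h3 : ∫ σ in (0 : ℝ)..1, s ^ 2 * (σ * (C * Real.exp (L * (s * σ) ^ 2)))
      = C / (2 * L) * Real.exp (L * s ^ 2) - C / (2 * L) := by
    rw [intervalIntegral.integral_eq_sub_of_hasDerivAt (fun σ _ => h1 σ)
      (Continuous.intervalIntegrable (by fun_prop) _ _)]
    simp
  have h4 : |radialInverse n h s| ≤
      ∫ σ in (0 : ℝ)..1, s ^ 2 * (σ * (C * Real.exp (L * (s * σ) ^ 2))) := by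
    rw [radialInverse, radialMean, ← intervalIntegral.integral_const_mul, ← Real.norm_eq_abs]
    refine intervalIntegral.norm_integral_le_of_norm_le zero_le_one ?_
      (Continuous.intervalIntegrable (by fun_prop) _ _)
    refine Eventually.of_forall fun σ hσ => ?_
    rw [Real.norm_eq_abs, abs_mul, abs_mul, abs_of_nonneg (sq_nonneg s), pow_one,
      abs_of_nonneg hσ.1.le]
    have := abs_radialMean_le n (r := s * σ) hL.le hC hb
    have := hσ.1.le
    gcongr
  have : 0 ≤ C / (2 * L) := by positivity
  linarith

/-- Picard iteration for `v = c - (radial inverse of F(·,v))` in a weighted sup norm. The iteration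
runs in bounded continuous functions on `ℝ × P`, so joint continuity in time and parameter is part
of the conclusion. The weight depends on the parameter because the Lipschitz constant does. -/
theorem exists_radial_solution {P : Type*} [TopologicalSpace P] (n : ℕ) {F : ℝ → P → ℝ → ℝ}
    (hF : Continuous fun q : ℝ × P × ℝ => F q.1 q.2.1 q.2.2) {L B c : P → ℝ}
    (hL : Continuous L) (hB : Continuous B) (hc : Continuous c)
    (hLip : ∀ s π x y, |F s π x - F s π y| ≤ L π * |x - y|) (hbd : ∀ s π, |F s π 0| ≤ B π) :
    ∃ v m : ℝ → P → ℝ, Continuous (fun q : ℝ × P => v q.1 q.2) ∧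
      Continuous (fun q : ℝ × P => m q.1 q.2) ∧ ∀ π, v 0 π = c π ∧ ∀ s,
        HasDerivAt (fun s => v s π) (-(s * m s π)) s ∧
        HasDerivAt (fun s => s * m s π) (F s π (v s π) - n * m s π) s := by
  have hL0 : ∀ π, 0 ≤ L π := fun π => by
    have := hLip 0 π 0 1
    simp only [zero_sub, abs_neg, abs_one, mul_one] at this
    exact (abs_nonneg _).trans this
  have hB0 : ∀ π, 0 ≤ B π := fun π => (abs_nonneg _).trans (hbd 0 π)
  -- The contraction factor is `L/(2K) ≤ 1/2`; the `+ 1` keeps `K` positive when `L = 0`.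
  set K : P → ℝ := fun π => L π + 1 with hK
  have hK0 : ∀ π, 0 < K π := fun π => by have := hL0 π; simp only [hK]; linarith
  have hKc : Continuous K := by fun_prop
  -- This factor absorbs the initial value and the inhomogeneity, so that the iteration is bounded
  -- uniformly in the parameter.
  set k : P → ℝ := fun π => 1 + |c π| + B π with hk
  have hk0 : ∀ π, 0 < k π := fun π => by
    have := hB0 π; have := abs_nonneg (c π); simp only [hk]; linarith
  have hkc : Continuous k := by fun_prop
  set W : ℝ → P → ℝ := fun s π => k π * Real.exp (K π * s ^ 2) with hW
  have hW0 : ∀ s π, 0 < W s π := fun s π => mul_pos (hk0 π) (Real.exp_pos _)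
  have hWc : Continuous fun q : ℝ × P => W q.1 q.2 := by
    simp only [hW]
    fun_prop
  -- the nonlinear term along a weighted function
  have hNc : ∀ w : BoundedContinuousFunction (ℝ × P) ℝ,
      Continuous fun q : ℝ × P => F q.1 q.2 (W q.1 q.2 * w q) := fun w =>
    hF.comp (f := fun q : ℝ × P => (q.1, q.2, W q.1 q.2 * w q))
      (by have := w.continuous; fun_prop)
  have hNs : ∀ (w : BoundedContinuousFunction (ℝ × P) ℝ) π,
      Continuous fun t => F t π (W t π * w (t, π)) := fun w π =>
    (hNc w).comp (f := fun t : ℝ => (t, π)) (by fun_prop)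
  set T0 : BoundedContinuousFunction (ℝ × P) ℝ → ℝ × P → ℝ := fun w q =>
    (c q.2 - radialInverse n (fun t => F t q.2 (W t q.2 * w (t, q.2))) q.1) / W q.1 q.2 with hT0
  have hT0c : ∀ w, Continuous (T0 w) := fun w => by
    have h1 := continuous_radialMean_param n (h := fun t π => F t π (W t π * w (t, π)))
      (by simpa using hNc w)
    have h2 := continuous_radialMean_param 1
      (h := fun t π => radialMean n (fun t => F t π (W t π * w (t, π))) t) h1
    refine Continuous.div ?_ hWc fun q => (hW0 _ _).ne'
    simp only [radialInverse]
    fun_prop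
  have hT0b : ∀ w q, ‖T0 w q‖ ≤ 1 + (1 + ‖w‖) := fun w q => by
    obtain ⟨s, π⟩ := q
    have hb : ∀ t, |F t π (W t π * w (t, π))| ≤
        (B π + L π * (k π * ‖w‖)) * Real.exp (K π * t ^ 2) := fun t => by
      have h1 := hLip t π (W t π * w (t, π)) 0
      have h2 := hbd t π
      have h3 : |W t π * w (t, π) - 0| ≤ k π * ‖w‖ * Real.exp (K π * t ^ 2) := by
        rw [sub_zero, abs_mul, abs_of_pos (hW0 t π)]
        have := w.norm_coe_le_norm (t, π)
        rw [Real.norm_eq_abs] at this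
        calc W t π * |w (t, π)| ≤ W t π * ‖w‖ := by have := (hW0 t π).le; gcongr
          _ = _ := by simp only [hW]; ring
      have h4 : |F t π (W t π * w (t, π))| ≤ L π * |W t π * w (t, π) - 0| + B π := by
        have := abs_sub_abs_le_abs_sub (F t π (W t π * w (t, π))) (F t π 0)
        linarith
      have h5 : 1 ≤ Real.exp (K π * t ^ 2) := Real.one_le_exp (by have := hK0 π; positivity)
      have h6 := mul_le_mul_of_nonneg_left h3 (hL0 π)
      have h7 := mul_le_mul_of_nonneg_left h5 (hB0 π)
      nlinarith
    have hC : 0 ≤ B π + L π * (k π * ‖w‖) := by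
      have := hB0 π; have := hL0 π; have := (hk0 π).le; positivity
    have hr := abs_radialInverse_le n (hNs w π) (hK0 π) hC hb s
    have hX : 1 ≤ Real.exp (K π * s ^ 2) := Real.one_le_exp (by have := hK0 π; positivity)
    rw [Real.norm_eq_abs]
    simp only [hT0]
    rw [abs_div, abs_of_pos (hW0 s π), div_le_iff₀ (hW0 s π)]
    have h8 : (B π + L π * (k π * ‖w‖)) / (2 * K π) ≤ k π * (1 + ‖w‖) := by
      rw [div_le_iff₀ (by have := hK0 π; positivity)]
      have e1 : B π ≤ k π * K π := by
        have : B π ≤ k π := by simp only [hk]; have := abs_nonneg (c π); linarith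
        have : k π ≤ k π * K π := le_mul_of_one_le_right (hk0 π).le (by
          simp only [hK]; have := hL0 π; linarith)
        linarith
      have e2 : L π * (k π * ‖w‖) ≤ K π * (k π * ‖w‖) := by
        have := (hk0 π).le
        have : L π ≤ K π := by simp only [hK]; linarith
        gcongr
      have e3 : 0 ≤ k π * K π := by have := hk0 π; have := hK0 π; positivity
      have e4 : 0 ≤ K π * (k π * ‖w‖) := by have := (hk0 π).le; have := (hK0 π).le; positivity
      nlinarith
    have h9 : |c π| ≤ k π := by simp only [hk]; have := hB0 π; linarith
    calc |c π - radialInverse n (fun t => F t π (W t π * w (t, π))) s|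
        ≤ |c π| + |radialInverse n (fun t => F t π (W t π * w (t, π))) s| := abs_sub _ _
      _ ≤ k π * Real.exp (K π * s ^ 2) + k π * (1 + ‖w‖) * Real.exp (K π * s ^ 2) := by
          refine add_le_add ?_ (hr.trans (by gcongr))
          exact h9.trans (le_mul_of_one_le_right (hk0 π).le hX)
      _ = _ := by simp only [hW]; ring
  set T : BoundedContinuousFunction (ℝ × P) ℝ → BoundedContinuousFunction (ℝ × P) ℝ := fun w =>
    BoundedContinuousFunction.ofNormedAddCommGroup (T0 w) (hT0c w) _ (hT0b w) with hT
  have hcon : ContractingWith (1 / 2) T := by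
    refine ⟨?_, LipschitzWith.of_dist_le_mul fun w₁ w₂ => ?_⟩
    · rw [one_div]; exact NNReal.inv_lt_one_iff (by norm_num) |>.2 (by norm_num)
    · rw [BoundedContinuousFunction.dist_le (by positivity)]
      rintro ⟨s, π⟩
      have hTw : T w₁ (s, π) - T w₂ (s, π) = radialInverse n (fun t =>
          F t π (W t π * w₂ (t, π)) - F t π (W t π * w₁ (t, π))) s / W s π := by
        have hsub : radialInverse n (fun t =>
          F t π (W t π * w₂ (t, π)) - F t π (W t π * w₁ (t, π))) s =
          radialInverse n (fun t => F t π (W t π * w₂ (t, π))) s -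
          radialInverse n (fun t => F t π (W t π * w₁ (t, π))) s := by
          have c1 := continuous_radialMean n (hNs w₁ π)
          have c2 := continuous_radialMean n (hNs w₂ π)
          rw [radialInverse, funext (radialMean_sub n (hNs w₂ π) (hNs w₁ π)),
            radialMean_sub 1 c2 c1, mul_sub]
          rfl
        rw [hsub]
        simp only [hT, hT0, BoundedContinuousFunction.coe_ofNormedAddCommGroup]
        ring
      rw [Real.dist_eq, hTw, abs_div, abs_of_pos (hW0 s π), div_le_iff₀ (hW0 s π)]
      have hb : ∀ t, |F t π (W t π * w₂ (t, π)) - F t π (W t π * w₁ (t, π))| ≤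
          (L π * (k π * dist w₁ w₂)) * Real.exp (K π * t ^ 2) := fun t => by
        refine (hLip t π _ _).trans ?_
        rw [← mul_sub, abs_mul, abs_of_pos (hW0 t π)]
        have h1 := BoundedContinuousFunction.dist_coe_le_dist (f := w₁) (g := w₂) (t, π)
        rw [Real.dist_eq, abs_sub_comm] at h1
        have := hL0 π
        have := (hW0 t π).le
        calc L π * (W t π * |w₂ (t, π) - w₁ (t, π)|) ≤ L π * (W t π * dist w₁ w₂) := by gcongr
          _ = _ := by simp only [hW]; ring
      have hC : 0 ≤ L π * (k π * dist w₁ w₂) := by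
        have := hL0 π; have := (hk0 π).le; positivity
      refine (abs_radialInverse_le n ((hNs w₂ π).sub (hNs w₁ π)) (hK0 π) hC hb s).trans ?_
      have : L π * (k π * dist w₁ w₂) / (2 * K π) ≤ 1 / 2 * dist w₁ w₂ * k π := by
        rw [div_le_iff₀ (by have := hK0 π; positivity)]
        have : L π * (k π * dist w₁ w₂) ≤ K π * (k π * dist w₁ w₂) := by
          have := (hk0 π).le
          have : L π ≤ K π := by simp only [hK]; linarith
          gcongr
        linarith
      calc _ ≤ 1 / 2 * dist w₁ w₂ * k π * Real.exp (K π * s ^ 2) := by gcongr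
        _ = _ := by simp only [hW]; push_cast; ring
  set w := ContractingWith.fixedPoint T hcon with hw
  have hfix : T w = w := ContractingWith.fixedPoint_isFixedPt hcon
  set v : ℝ → P → ℝ := fun s π => W s π * w (s, π) with hv
  have hvc : Continuous fun q : ℝ × P => v q.1 q.2 := hWc.mul w.continuous
  have hveq : ∀ s π, v s π = c π - radialInverse n (fun t => F t π (v t π)) s := fun s π => by
    have h1 : w (s, π) = T0 w (s, π) := by
      conv_lhs => rw [← hfix]
      rfl
    simp only [hv]
    conv_lhs => rw [h1]
    simp only [hT0]
    rw [mul_div_cancel₀ _ (hW0 s π).ne']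
  have hFc : Continuous fun q : ℝ × P => F q.1 q.2 (v q.1 q.2) := hNc w
  have hFs : ∀ π, Continuous fun t => F t π (v t π) := hNs w
  refine ⟨v, fun s π => radialMean n (fun t => F t π (v t π)) s, hvc,
    continuous_radialMean_param n (h := fun t π => F t π (v t π)) hFc, fun π => ⟨?_, fun s =>
      ⟨?_, hasDerivAt_mul_radialMean n (hFs π) s⟩⟩⟩
  · rw [hveq]; simp [radialInverse]
  · have := (hasDerivAt_radialInverse n (hFs π) s).const_sub (c π)
    exact this.congr_of_eventuallyEq (Eventually.of_forall fun s => hveq s π)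

end SupercriticalNeumann

end

/-! ### Monotonicity, Grönwall inequalities and Prüfer angles -/

open Set Filter Topology MeasureTheory

noncomputable section

namespace SupercriticalNeumann

theorem le_of_hasDerivAt_nonneg {h h' : ℝ → ℝ} {a b : ℝ} (hab : a ≤ b)
    (hc : ContinuousOn h (Icc a b)) (hd : ∀ x ∈ Ioo a b, HasDerivAt h (h' x) x)
    (hn : ∀ x ∈ Ioo a b, 0 ≤ h' x) : h a ≤ h b := by
  refine monotoneOn_of_deriv_nonneg (convex_Icc a b) hc ?_ ?_ (left_mem_Icc.2 hab)
    (right_mem_Icc.2 hab) hab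
  · rw [interior_Icc]
    exact fun x hx => (hd x hx).differentiableAt.differentiableWithinAt
  · rw [interior_Icc]
    exact fun x hx => by rw [(hd x hx).deriv]; exact hn x hx

theorem lt_of_hasDerivAt_pos {h h' : ℝ → ℝ} {a b : ℝ} (hab : a < b)
    (hc : ContinuousOn h (Icc a b)) (hd : ∀ x ∈ Ioo a b, HasDerivAt h (h' x) x)
    (hn : ∀ x ∈ Ioo a b, 0 < h' x) : h a < h b := by
  refine strictMonoOn_of_deriv_pos (convex_Icc a b) hc ?_ (left_mem_Icc.2 hab.le)
    (right_mem_Icc.2 hab.le) hab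
  rw [interior_Icc]
  exact fun x hx => by rw [(hd x hx).deriv]; exact hn x hx

theorem le_of_hasDerivAt_nonpos {h h' : ℝ → ℝ} {a b : ℝ} (hab : a ≤ b)
    (hc : ContinuousOn h (Icc a b)) (hd : ∀ x ∈ Ioo a b, HasDerivAt h (h' x) x)
    (hn : ∀ x ∈ Ioo a b, h' x ≤ 0) : h b ≤ h a := by
  have := le_of_hasDerivAt_nonneg (h := fun x => -h x) (h' := fun x => -h' x) hab hc.neg
    (fun x hx => (hd x hx).neg) (fun x hx => neg_nonneg.2 (hn x hx))
  linarith

/-- Grönwall's inequality, forward in time. -/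
theorem le_mul_exp_of_deriv_le {V V' : ℝ → ℝ} {a b C : ℝ} (hab : a ≤ b)
    (hc : ContinuousOn V (Icc a b)) (hd : ∀ x ∈ Ioo a b, HasDerivAt V (V' x) x)
    (hn : ∀ x ∈ Ioo a b, V' x ≤ C * V x) : V b ≤ V a * Real.exp (C * (b - a)) := by
  have hE : ∀ x, HasDerivAt (fun x => Real.exp (-C * x)) (Real.exp (-C * x) * (-C)) x := fun x =>
    by simpa using ((hasDerivAt_id x).const_mul (-C)).exp
  have h := le_of_hasDerivAt_nonpos (h := fun x => V x * Real.exp (-C * x)) hab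
    (hc.mul (by fun_prop)) (fun x hx => (hd x hx).mul (hE x)) (fun x hx => by
      have := hn x hx
      have := Real.exp_pos (-C * x)
      nlinarith)
  calc V b = V b * Real.exp (-C * b) * Real.exp (C * b) := by
        rw [mul_assoc, ← Real.exp_add]; simp
    _ ≤ V a * Real.exp (-C * a) * Real.exp (C * b) := by gcongr
    _ = _ := by rw [mul_assoc, ← Real.exp_add]; congr 2; ring

/-- Grönwall's inequality, backward in time. -/
theorem le_mul_exp_of_le_deriv {V V' : ℝ → ℝ} {a b C : ℝ} (hab : a ≤ b)
    (hc : ContinuousOn V (Icc a b)) (hd : ∀ x ∈ Ioo a b, HasDerivAt V (V' x) x)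
    (hn : ∀ x ∈ Ioo a b, -(C * V x) ≤ V' x) : V a ≤ V b * Real.exp (C * (b - a)) := by
  have hE : ∀ x, HasDerivAt (fun x => Real.exp (C * x)) (Real.exp (C * x) * C) x := fun x =>
    by simpa using ((hasDerivAt_id x).const_mul C).exp
  have h := le_of_hasDerivAt_nonneg (h := fun x => V x * Real.exp (C * x)) hab
    (hc.mul (by fun_prop)) (fun x hx => (hd x hx).mul (hE x)) (fun x hx => by
      have := hn x hx
      have := Real.exp_pos (C * x)
      nlinarith)
  calc V a = V a * Real.exp (C * a) * Real.exp (-C * a) := by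
        rw [mul_assoc, ← Real.exp_add]; simp
    _ ≤ V b * Real.exp (C * b) * Real.exp (-C * a) := by gcongr
    _ = _ := by rw [mul_assoc, ← Real.exp_add]; congr 2; ring

/-- A function that increases wherever it takes the value `c` takes it only once. -/
theorem lt_of_upcrossing {h h' : ℝ → ℝ} {a b c : ℝ} (hab : a < b)
    (hc : ContinuousOn h (Icc a b)) (hd : ∀ x ∈ Icc a b, HasDerivWithinAt h (h' x) (Icc a b) x)
    (hpos : ∀ x ∈ Icc a b, h x = c → 0 < h' x) (ha : c ≤ h a) : c < h b := by
  have h1 : ∀ ⦃x⦄, x ∈ Icc a b → -h x ≤ -c := by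
    refine image_le_of_deriv_right_lt_deriv_boundary (f' := fun x => -h' x) (B := fun _ => -c)
      (B' := fun _ => 0) hc.neg ?_ (neg_le_neg ha) (fun x => hasDerivAt_const x _) ?_
    · intro x hx
      have h2 := (hd x ⟨hx.1, hx.2.le⟩).neg
      refine HasDerivWithinAt.mono_of_mem_nhdsWithin h2 ?_
      exact mem_of_superset (Icc_mem_nhdsGE hx.2) (Icc_subset_Icc_left hx.1)
    · intro x hx hxc
      have := hpos x ⟨hx.1, hx.2.le⟩ (neg_injective hxc)
      linarith
  -- Equality at `b` is impossible: a positive derivative there would force values below `c` just to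
  -- the left of `b`.
  refine lt_of_le_of_ne (neg_le_neg_iff.1 (h1 (right_mem_Icc.2 hab.le))) fun hbc => ?_
  have hp := hpos b (right_mem_Icc.2 hab.le) hbc.symm
  have hb := hd b (right_mem_Icc.2 hab.le)
  have hs := (hasDerivWithinAt_iff_tendsto_slope.1 hb).eventually (lt_mem_nhds hp)
  rw [Icc_sdiff_right] at hs
  have : (𝓝[Ico a b] b).NeBot := by
    rw [nhdsWithin_Ico_eq_nhdsLT hab]; infer_instance
  obtain ⟨x, hx1, hx2⟩ := (hs.and self_mem_nhdsWithin).exists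
  have h3 := h1 (Ico_subset_Icc_self hx2)
  rw [slope_def_field] at hx1
  have h4 : x - b < 0 := by linarith [hx2.2]
  have h5 : h x - h b < 0 := by
    by_contra hcon
    exact absurd hx1 (not_lt.2 (div_nonpos_of_nonneg_of_nonpos (not_lt.1 hcon) h4.le))
  linarith

/-- The angular velocity of `(a, -b)` when `a' = b` and `b' = d`. -/
def angleRate (a b d : ℝ) : ℝ := (b ^ 2 - a * d) / (a ^ 2 + b ^ 2)

/-- The polar angle of `(a, -b)`, with value `Θ₀` at `s₀`, when `a' = b` and `b' = d`. -/
def angle (a b d : ℝ → ℝ) (s₀ Θ₀ s : ℝ) : ℝ :=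
  Θ₀ + ∫ σ in s₀..s, angleRate (a σ) (b σ) (d σ)

/-- `(a, b)` is a nonvanishing `C¹` curve on `[s₀, ∞)` with `a' = b` and `b' = d`, and `(a, -b)` has
the polar angle `Θ₀` at `s₀`. -/
structure PhaseCurve (a b d : ℝ → ℝ) (s₀ Θ₀ : ℝ) : Prop where
  deriv_a : ∀ s ≥ s₀, HasDerivAt a (b s) s
  deriv_b : ∀ s ≥ s₀, HasDerivAt b (d s) s
  cont_d : ContinuousOn d (Ici s₀)
  ne : ∀ s ≥ s₀, a s ^ 2 + b s ^ 2 ≠ 0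
  init : ∃ ρ > 0, a s₀ = ρ * Real.cos Θ₀ ∧ b s₀ = -(ρ * Real.sin Θ₀)

namespace PhaseCurve

variable {a b d : ℝ → ℝ} {s₀ Θ₀ : ℝ}

theorem cont_a (h : PhaseCurve a b d s₀ Θ₀) : ContinuousOn a (Ici s₀) := fun s hs =>
  (h.deriv_a s hs).continuousAt.continuousWithinAt

theorem cont_b (h : PhaseCurve a b d s₀ Θ₀) : ContinuousOn b (Ici s₀) := fun s hs =>
  (h.deriv_b s hs).continuousAt.continuousWithinAt

theorem cont_rate (h : PhaseCurve a b d s₀ Θ₀) :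
    ContinuousOn (fun s => angleRate (a s) (b s) (d s)) (Ici s₀) := by
  have := h.cont_a
  have := h.cont_b
  have := h.cont_d
  unfold angleRate
  exact ContinuousOn.div (by fun_prop) (by fun_prop) h.ne

theorem rate_intervalIntegrable (h : PhaseCurve a b d s₀ Θ₀) {x y : ℝ} (hx : s₀ ≤ x)
    (hy : s₀ ≤ y) :
    IntervalIntegrable (fun s => angleRate (a s) (b s) (d s)) volume x y :=
  (h.cont_rate.mono fun z hz => by
    rcases mem_uIcc.1 hz with hz | hz
    · exact hx.trans hz.1
    · exact hy.trans hz.1).intervalIntegrable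

theorem angle_self : angle a b d s₀ Θ₀ s₀ = Θ₀ := by simp [angle]

theorem angle_eq_add (h : PhaseCurve a b d s₀ Θ₀) {s t : ℝ} (hs : s₀ ≤ s) (ht : s₀ ≤ t) :
    angle a b d s₀ Θ₀ t = angle a b d s₀ Θ₀ s + ∫ σ in s..t, angleRate (a σ) (b σ) (d σ) := by
  rw [angle, angle, add_assoc, intervalIntegral.integral_add_adjacent_intervals]
  · exact h.rate_intervalIntegrable le_rfl hs
  · exact h.rate_intervalIntegrable hs ht

theorem hasDerivAt_angle (h : PhaseCurve a b d s₀ Θ₀) {s : ℝ} (hs : s₀ < s) :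
    HasDerivAt (angle a b d s₀ Θ₀) (angleRate (a s) (b s) (d s)) s := by
  have hm : Ici s₀ ∈ 𝓝 s := Ici_mem_nhds hs
  refine (intervalIntegral.integral_hasDerivAt_right
    (h.rate_intervalIntegrable le_rfl hs.le) ?_ (h.cont_rate.continuousAt hm)).const_add Θ₀
  exact ContinuousOn.stronglyMeasurableAtFilter isOpen_Ioi
    (h.cont_rate.mono Ioi_subset_Ici_self) s hs

theorem hasDerivWithinAt_angle (h : PhaseCurve a b d s₀ Θ₀) {s : ℝ} (hs : s₀ ≤ s) :
    HasDerivWithinAt (angle a b d s₀ Θ₀) (angleRate (a s) (b s) (d s)) (Ici s₀) s := by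
  rcases hs.eq_or_lt with rfl | hs
  · refine HasDerivWithinAt.const_add Θ₀ ?_
    exact intervalIntegral.integral_hasDerivWithinAt_right
      (h.rate_intervalIntegrable le_rfl le_rfl)
      (ContinuousOn.stronglyMeasurableAtFilter_nhdsWithin h.cont_rate measurableSet_Ici _ |>.filter_mono
        (nhdsWithin_mono _ Ioi_subset_Ici_self))
      (h.cont_rate _ self_mem_Ici |>.mono Ioi_subset_Ici_self)
  · exact (h.hasDerivAt_angle hs).hasDerivWithinAt

theorem continuousOn_angle (h : PhaseCurve a b d s₀ Θ₀) :
    ContinuousOn (angle a b d s₀ Θ₀) (Ici s₀) := fun _ hs =>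
  (h.hasDerivWithinAt_angle hs).continuousWithinAt

/-- Rotate the curve back by its angle. The transversal component `e` solves a linear homogeneous
equation and vanishes at `s₀`, hence everywhere. The remaining component `c` satisfies `c² = a² + b²
≠ 0` and starts positive, so it is the radius. -/
theorem polar (h : PhaseCurve a b d s₀ Θ₀) {s : ℝ} (hs : s₀ ≤ s) :
    ∃ ρ > 0, a s = ρ * Real.cos (angle a b d s₀ Θ₀ s) ∧
      b s = -(ρ * Real.sin (angle a b d s₀ Θ₀ s)) := by
  set Θ := angle a b d s₀ Θ₀ with hΘ
  have ca := h.cont_a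
  have cb := h.cont_b
  have cd := h.cont_d
  have cΘ := h.continuousOn_angle
  rw [← hΘ] at cΘ
  set e : ℝ → ℝ := fun s => a s * Real.sin (Θ s) + b s * Real.cos (Θ s) with he
  set c : ℝ → ℝ := fun s => a s * Real.cos (Θ s) - b s * Real.sin (Θ s) with hc
  have cc : ContinuousOn c (Ici s₀) :=
    (ca.mul (Real.continuous_cos.comp_continuousOn cΘ)).sub
      (cb.mul (Real.continuous_sin.comp_continuousOn cΘ))
  have ce : ContinuousOn e (Ici s₀) :=
    (ca.mul (Real.continuous_sin.comp_continuousOn cΘ)).add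
      (cb.mul (Real.continuous_cos.comp_continuousOn cΘ))
  set k : ℝ → ℝ := fun s => (a s * b s + b s * d s) / (a s ^ 2 + b s ^ 2) with hk
  have ck : ContinuousOn k (Ici s₀) := ContinuousOn.div (by fun_prop) (by fun_prop) h.ne
  have hde : ∀ x, s₀ < x → HasDerivAt e (k x * e x) x := fun x hx => by
    have h1 := h.hasDerivAt_angle hx
    refine (((h.deriv_a x hx.le).mul h1.sin).add ((h.deriv_b x hx.le).mul h1.cos)).congr_deriv ?_
    have := h.ne x hx.le
    simp only [hk, he, hΘ, angleRate]
    field_simp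
    ring
  obtain ⟨ρ₀, hρ₀, ha0, hb0⟩ := h.init
  have hΘ0 : Θ s₀ = Θ₀ := angle_self
  have he0 : ∀ x, s₀ ≤ x → e x = 0 := fun x hx => by
    obtain ⟨C, hC⟩ := (isCompact_Icc (a := s₀) (b := x)).exists_bound_of_continuousOn
      (ck.mono Icc_subset_Ici_self)
    have h1 := le_mul_exp_of_deriv_le (V := fun x => e x ^ 2)
      (V' := fun x => 2 * e x * (k x * e x)) (C := 2 * C) hx
      ((ce.mono Icc_subset_Ici_self).pow 2) (fun y hy => by
        have := (hde y hy.1).fun_pow 2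
        simpa using this) (fun y hy => by
        have := (le_abs_self _).trans (hC y (Ioo_subset_Icc_self hy))
        have := mul_le_mul_of_nonneg_right this (sq_nonneg (e y))
        nlinarith)
    have h2 : e s₀ = 0 := by simp only [he, hΘ0, ha0, hb0]; ring
    simp only [h2] at h1
    have h3 : e x ^ 2 ≤ 0 := by simpa using h1
    exact pow_eq_zero_iff (two_ne_zero) |>.1 (le_antisymm h3 (sq_nonneg _))
  have hq : ∀ x, c x ^ 2 + e x ^ 2 = a x ^ 2 + b x ^ 2 := fun x => by
    have := Real.sin_sq_add_cos_sq (Θ x)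
    simp only [hc, he]
    calc _ = (a x ^ 2 + b x ^ 2) * (Real.sin (Θ x) ^ 2 + Real.cos (Θ x) ^ 2) := by ring
      _ = _ := by rw [this, mul_one]
  have hc0 : ∀ x, s₀ ≤ x → c x ≠ 0 := fun x hx hcx => by
    have := hq x
    rw [he0 x hx, hcx] at this
    exact h.ne x hx (by rw [← this]; ring)
  have hcpos : 0 < c s := by
    by_contra hneg
    have h1 : c s₀ = ρ₀ := by
      simp only [hc, hΘ0, ha0, hb0]
      calc _ = ρ₀ * (Real.sin Θ₀ ^ 2 + Real.cos Θ₀ ^ 2) := by ring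
        _ = _ := by rw [Real.sin_sq_add_cos_sq, mul_one]
    obtain ⟨x, hx, hx0⟩ := intermediate_value_Icc' hs (cc.mono Icc_subset_Ici_self)
      (show (0 : ℝ) ∈ Icc (c s) (c s₀) from ⟨not_lt.1 hneg, by rw [h1]; exact hρ₀.le⟩)
    exact hc0 x hx.1 hx0
  refine ⟨c s, hcpos, ?_, ?_⟩
  · have h1 := he0 s hs
    have h2 := Real.sin_sq_add_cos_sq (Θ s)
    calc a s = a s * (Real.sin (Θ s) ^ 2 + Real.cos (Θ s) ^ 2) := by rw [h2, mul_one]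
      _ = c s * Real.cos (Θ s) + e s * Real.sin (Θ s) := by simp only [hc, he]; ring
      _ = _ := by rw [h1]; ring
  · have h1 := he0 s hs
    have h2 := Real.sin_sq_add_cos_sq (Θ s)
    calc b s = b s * (Real.sin (Θ s) ^ 2 + Real.cos (Θ s) ^ 2) := by rw [h2, mul_one]
      _ = -(c s * Real.sin (Θ s)) + e s * Real.cos (Θ s) := by simp only [hc, he]; ring
      _ = _ := by rw [h1]; ring

/-- A level at which the angular velocity is positive is crossed only once. -/
theorem angle_lt (h : PhaseCurve a b d s₀ Θ₀) {c s t : ℝ}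
    (hc : ∀ s ≥ s₀, angle a b d s₀ Θ₀ s = c → 0 < angleRate (a s) (b s) (d s))
    (hs : s₀ ≤ s) (hst : s < t) (hcs : c ≤ angle a b d s₀ Θ₀ s) : c < angle a b d s₀ Θ₀ t :=
  lt_of_upcrossing hst (h.continuousOn_angle.mono fun _ hx => hs.trans hx.1)
    (fun _ hx => (h.hasDerivWithinAt_angle (hs.trans hx.1)).mono fun _ hy => hs.trans hy.1)
    (fun x hx => hc x (hs.trans hx.1)) hcs

/-- While `a > 0` the cosine of the angle cannot vanish, so the angle never leaves `(-π/2, π/2)`. It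
is then determined by the endpoint alone, which gives bounds and limits that do not depend on the
length of the interval. -/
theorem angle_eq_arctan (h : PhaseCurve a b d s₀ Θ₀) {s : ℝ} (hs : s₀ ≤ s)
    (hpos : ∀ x ∈ Icc s₀ s, 0 < a x) (hΘ : Θ₀ ∈ Ioo (-(Real.pi / 2)) (Real.pi / 2)) :
    angle a b d s₀ Θ₀ s = Real.arctan (-(b s / a s)) := by
  have hcos : ∀ x ∈ Icc s₀ s, Real.cos (angle a b d s₀ Θ₀ x) ≠ 0 := fun x hx h0 => by
    obtain ⟨ρ, _, h1, _⟩ := h.polar hx.1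
    have := hpos x hx
    rw [h1, h0] at this
    simp at this
  have hcont := h.continuousOn_angle.mono (Icc_subset_Ici_self : Icc s₀ s ⊆ Ici s₀)
  have hmem : angle a b d s₀ Θ₀ s ∈ Ioo (-(Real.pi / 2)) (Real.pi / 2) := by
    constructor
    · by_contra hcon
      obtain ⟨x, hx, hx0⟩ := intermediate_value_Icc' hs hcont
        (show -(Real.pi / 2) ∈ Icc _ _ from ⟨not_lt.1 hcon, by rw [angle_self]; exact hΘ.1.le⟩)
      exact hcos x hx (by rw [hx0]; simp)
    · by_contra hcon
      obtain ⟨x, hx, hx0⟩ := intermediate_value_Icc hs hcont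
        (show Real.pi / 2 ∈ Icc _ _ from ⟨by rw [angle_self]; exact hΘ.2.le, not_lt.1 hcon⟩)
      exact hcos x hx (by rw [hx0]; simp)
  obtain ⟨ρ, hρ, h1, h2⟩ := h.polar hs
  have h3 := hcos s (right_mem_Icc.2 hs)
  have : -(b s / a s) = Real.tan (angle a b d s₀ Θ₀ s) := by
    rw [h1, h2, Real.tan_eq_sin_div_cos]
    field_simp
  rw [this, Real.arctan_tan hmem.1 hmem.2]

end PhaseCurve

/-- On a compact set, an inequality that holds where `φ ≤ 0` holds where `φ` is small. -/
theorem exists_pos_of_isCompact {K : Set ℝ} (hK : IsCompact K) {φ ψ : ℝ → ℝ} {δ : ℝ}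
    (hφ : ContinuousOn φ K) (hψ : ContinuousOn ψ K) (h : ∀ x ∈ K, φ x ≤ 0 → ψ x < δ) :
    ∃ ε > 0, ∀ x ∈ K, φ x ≤ ε → ψ x < δ := by
  -- On the compact set where the conclusion fails `φ` is positive, so it has a positive minimum
  -- there; half of it serves as `ε`.
  have hK' : IsCompact (K ∩ ψ ⁻¹' Ici δ) := by
    obtain ⟨C, hC, hCK⟩ := continuousOn_iff_isClosed.1 hψ (Ici δ) isClosed_Ici
    rw [inter_comm, hCK, inter_comm]
    exact hK.inter_right hC
  rcases (K ∩ ψ ⁻¹' Ici δ).eq_empty_or_nonempty with he | hne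
  · refine ⟨1, one_pos, fun x hx _ => ?_⟩
    by_contra hcon
    exact (he ▸ (⟨hx, not_lt.1 hcon⟩ : x ∈ K ∩ ψ ⁻¹' Ici δ) : x ∈ (∅ : Set ℝ))
  · obtain ⟨x₀, hx₀, hmin⟩ := hK'.exists_isMinOn hne (hφ.mono inter_subset_left)
    have hpos : 0 < φ x₀ := by
      by_contra hcon
      exact absurd (h x₀ hx₀.1 (not_lt.1 hcon)) (not_lt.2 hx₀.2)
    refine ⟨φ x₀ / 2, half_pos hpos, fun x hx hxe => ?_⟩
    by_contra hcon
    have := hmin (show x ∈ K ∩ ψ ⁻¹' Ici δ from ⟨hx, not_lt.1 hcon⟩)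
    simp only [mem_ofPred_eq] at this
    linarith

/-- The divided difference of a `C¹` function is jointly continuous. -/
theorem continuousOn_dslope_of_contDiffOn {g : ℝ → ℝ} {S : Set ℝ} (hS : IsOpen S)
    (hg : ContDiffOn ℝ 1 g S) :
    ContinuousOn (fun q : ℝ × ℝ => dslope g q.2 q.1) (S ×ˢ S) := by
  have hd : ContinuousOn (deriv g) S := hg.continuousOn_deriv_of_isOpen hS le_rfl
  rintro ⟨x, y⟩ ⟨hx, hy⟩
  refine ContinuousAt.continuousWithinAt ?_
  have hgx : ContinuousAt g x := hg.continuousOn.continuousAt (hS.mem_nhds hx)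
  have hgy : ContinuousAt g y := hg.continuousOn.continuousAt (hS.mem_nhds hy)
  rcases eq_or_ne x y with rfl | hxy
  -- On the diagonal joint continuity is strict differentiability.
  · have hst : HasStrictDerivAt g (deriv g x) x :=
      (hg.contDiffAt (hS.mem_nhds hx)).hasStrictDerivAt one_ne_zero
    have hdx : ContinuousAt (deriv g) x := hd.continuousAt (hS.mem_nhds hx)
    rw [Metric.continuousAt_iff']
    intro ε hε
    have h1 := (hasStrictDerivAt_iff_hasStrictFDerivAt.1 hst).isLittleO.def (half_pos hε)
    have h2 : ∀ᶠ q : ℝ × ℝ in 𝓝 (x, x), |deriv g q.1 - deriv g x| < ε :=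
      (hdx.tendsto.comp (continuous_fst.continuousAt.tendsto
        : Tendsto Prod.fst (𝓝 (x, x)) (𝓝 x))).eventually (Metric.ball_mem_nhds _ hε)
    filter_upwards [h1, h2] with q hq1 hq2
    rcases eq_or_ne q.1 q.2 with hq | hq
    · rw [Real.dist_eq]
      simp only [← hq, dslope_same]
      exact hq2
    · simp only [dslope_same]
      rw [dslope_of_ne _ hq, slope_def_field, Real.dist_eq]
      have h3 : 0 < |q.1 - q.2| := abs_pos.2 (sub_ne_zero.2 hq)
      have h4 : (g q.1 - g q.2) / (q.1 - q.2) - deriv g x =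
          (g q.1 - g q.2 - (q.1 - q.2) * deriv g x) / (q.1 - q.2) := by
        have := sub_ne_zero.2 hq
        field_simp
      rw [h4, abs_div, div_lt_iff₀ h3]
      simp only [ContinuousLinearMap.toSpanSingleton_apply, smul_eq_mul, Real.norm_eq_abs] at hq1
      nlinarith
  · have hopen : ∀ᶠ q : ℝ × ℝ in 𝓝 (x, y), q.1 ≠ q.2 :=
      (isOpen_ne_fun continuous_fst continuous_snd).mem_nhds hxy
    have h1 : ContinuousAt (fun q : ℝ × ℝ => (g q.1 - g q.2) / (q.1 - q.2)) (x, y) := by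
      refine ContinuousAt.div ?_ (by fun_prop) (sub_ne_zero.2 hxy)
      exact (ContinuousAt.comp (g := g) (f := Prod.fst) hgx continuousAt_fst).sub
        (ContinuousAt.comp (g := g) (f := Prod.snd) hgy continuousAt_snd)
    refine h1.congr ?_
    filter_upwards [hopen] with q hq
    rw [dslope_of_ne _ hq, slope_def_field]

end SupercriticalNeumann

end

/-! ### The nonlinearity, its slope at `1` and its primitive -/

open Set Filter Topology MeasureTheory

noncomputable section

namespace SupercriticalNeumann

/-- The slope `f(x)/(x-1)` of the nonlinearity, with the value `f'(1)` at `x = 1`. -/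
def fSlope (p x : ℝ) : ℝ := dslope (f p) 1 x

/-- The primitive `F(u) = -u²/2 + u^(p+1)/(p+1)` of the nonlinearity. -/
def fPrim (p u : ℝ) : ℝ := -u ^ 2 / 2 + u ^ (p + 1) / (p + 1)

/-- The positive zero of the primitive, the maximum of the ground state. -/
def peak (p : ℝ) : ℝ := ((p + 1) / 2) ^ (1 / (p - 1))

theorem f_one (p : ℝ) : f p 1 = 0 := by simp [f]

variable {p : ℝ}

theorem f_zero (hp : 1 < p) : f p 0 = 0 := by
  simp [f, Real.zero_rpow (by linarith : p ≠ 0)]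

theorem hasDerivAt_f (hp : 1 < p) (x : ℝ) : HasDerivAt (f p) (f' p x) x := by
  have := (hasDerivAt_id x).fun_neg.fun_add (Real.hasDerivAt_rpow_const (x := x) (p := p) (Or.inr hp.le))
  exact this

theorem continuous_f (hp : 1 < p) : Continuous (f p) :=
  continuous_iff_continuousAt.2 fun x => (hasDerivAt_f hp x).continuousAt

theorem f_eq_fSlope_mul (p x : ℝ) : f p x = fSlope p x * (x - 1) := by
  have := sub_smul_dslope (f p) 1 x
  rw [f_one, sub_zero, smul_eq_mul] at this
  rw [← this, fSlope, mul_comm]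

theorem fSlope_one (hp : 1 < p) : fSlope p 1 = p - 1 := by
  rw [fSlope, dslope_same, (hasDerivAt_f hp 1).deriv, f']
  simp
  ring

theorem continuous_fSlope (hp : 1 < p) : Continuous (fSlope p) := by
  have h := (continuousOn_dslope (f := f p) (a := (1 : ℝ)) (s := univ) univ_mem).2
    ⟨(continuous_f hp).continuousOn, (hasDerivAt_f hp 1).differentiableAt⟩
  exact continuousOn_univ.1 h

theorem f_eq_mul {x : ℝ} (hx : 0 < x) : f p x = x * (x ^ (p - 1) - 1) := by
  rw [f, Real.rpow_sub_one hx.ne']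
  field_simp
  ring

theorem f_pos (hp : 1 < p) {x : ℝ} (hx : 1 < x) : 0 < f p x := by
  rw [f_eq_mul (by linarith)]
  have := Real.one_lt_rpow hx (by linarith : 0 < p - 1)
  exact mul_pos (by linarith) (by linarith)

theorem f_neg (hp : 1 < p) {x : ℝ} (hx0 : 0 < x) (hx : x < 1) : f p x < 0 := by
  rw [f_eq_mul hx0]
  have := Real.rpow_lt_one hx0.le hx (by linarith : 0 < p - 1)
  exact mul_neg_of_pos_of_neg hx0 (by linarith)

theorem fSlope_pos (hp : 1 < p) {x : ℝ} (hx : 0 < x) : 0 < fSlope p x := by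
  have h := f_eq_fSlope_mul p x
  rcases lt_trichotomy x 1 with h1 | rfl | h1
  · have := f_neg hp hx h1
    by_contra hcon
    have := mul_nonneg_of_nonpos_of_nonpos (not_lt.1 hcon) (by linarith : x - 1 ≤ 0)
    linarith
  · rw [fSlope_one hp]; linarith
  · have := f_pos hp h1
    exact pos_of_mul_pos_left (h ▸ this) (by linarith)

theorem f'_mono (hp : 1 < p) {x y : ℝ} (hx : 0 ≤ x) (hxy : x ≤ y) : f' p x ≤ f' p y := by
  unfold f'
  have := Real.rpow_le_rpow hx hxy (by linarith : 0 ≤ p - 1)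
  nlinarith

/-- The slope is a value of the derivative. -/
theorem exists_fSlope_eq (hp : 1 < p) {x : ℝ} (hx : 0 ≤ x) :
    ∃ ξ ∈ Icc (min x 1) (max x 1), fSlope p x = f' p ξ := by
  rcases lt_trichotomy x 1 with h1 | rfl | h1
  · obtain ⟨ξ, hξ, h⟩ := exists_hasDerivAt_eq_slope (f p) (f' p) h1
      (continuous_f hp).continuousOn (fun y _ => hasDerivAt_f hp y)
    refine ⟨ξ, by rw [min_eq_left h1.le, max_eq_right h1.le]; exact Ioo_subset_Icc_self hξ, ?_⟩
    rw [h, f_one, f_eq_fSlope_mul]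
    have : 1 - x ≠ 0 := by linarith
    field_simp
    ring
  · refine ⟨1, by simp, ?_⟩
    rw [fSlope_one hp]; simp [f']; ring
  · obtain ⟨ξ, hξ, h⟩ := exists_hasDerivAt_eq_slope (f p) (f' p) h1
      (continuous_f hp).continuousOn (fun y _ => hasDerivAt_f hp y)
    refine ⟨ξ, by rw [min_eq_right h1.le, max_eq_left h1.le]; exact Ioo_subset_Icc_self hξ, ?_⟩
    rw [h, f_one, f_eq_fSlope_mul]
    have : x - 1 ≠ 0 := by linarith
    field_simp
    ring

theorem fSlope_le (hp : 1 < p) {x M : ℝ} (hx : 0 ≤ x) (hxM : x ≤ M) (hM : 1 ≤ M) :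
    fSlope p x ≤ p * M ^ (p - 1) := by
  obtain ⟨ξ, hξ, h⟩ := exists_fSlope_eq hp hx
  rw [h]
  have h1 : 0 ≤ ξ := (le_min hx zero_le_one).trans hξ.1
  have := f'_mono hp h1 (hξ.2.trans (max_le hxM hM))
  have h2 : f' p M = -1 + p * M ^ (p - 1) := rfl
  linarith

theorem fSlope_nonneg (hp : 1 < p) {x : ℝ} (hx : 0 ≤ x) : 0 ≤ fSlope p x := by
  rcases hx.eq_or_lt with rfl | hx
  · have := f_eq_fSlope_mul p 0
    rw [f_zero hp] at this
    linarith
  · exact (fSlope_pos hp hx).le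

/-- On `[m,1]` this is compactness; beyond `1` the slope is a value of the increasing function `f'`
on `[1,∞)`, hence at least `f'(1) = p - 1`. A solution bounded away from zero therefore rotates
around `1` at a definite speed. -/
theorem exists_fSlope_ge (hp : 1 < p) {m : ℝ} (hm : 0 < m) :
    ∃ c > 0, ∀ x ≥ m, c ≤ fSlope p x := by
  rcases le_or_gt m 1 with h1 | h1
  · obtain ⟨x₀, hx₀, hmin⟩ := (isCompact_Icc (a := m) (b := 1)).exists_isMinOn
      (nonempty_Icc.2 h1) (continuous_fSlope hp).continuousOn
    refine ⟨min (fSlope p x₀) (p - 1), lt_min (fSlope_pos hp (hm.trans_le hx₀.1)) (by linarith),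
      fun x hx => ?_⟩
    rcases le_or_gt x 1 with hx1 | hx1
    · exact (min_le_left _ _).trans (hmin ⟨hx, hx1⟩)
    · obtain ⟨ξ, hξ, h⟩ := exists_fSlope_eq hp (by linarith : 0 ≤ x)
      rw [h]
      have := f'_mono hp zero_le_one (by rw [min_eq_right hx1.le] at hξ; exact hξ.1 : 1 ≤ ξ)
      refine (min_le_right _ _).trans (le_trans (le_of_eq ?_) this)
      simp [f']; ring
  · refine ⟨p - 1, by linarith, fun x hx => ?_⟩
    obtain ⟨ξ, hξ, h⟩ := exists_fSlope_eq hp (by linarith : 0 ≤ x)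
    rw [h]
    have := f'_mono hp zero_le_one (by
      rw [min_eq_right (by linarith : 1 ≤ x)] at hξ; exact hξ.1 : 1 ≤ ξ)
    refine le_trans (le_of_eq ?_) this
    simp [f']; ring

/-- The power `u^p` is analytic for `u > 0`, and dividing `f` by its simple factor `u - 1` preserves
analyticity. The bound `C¹` at the point `1` itself is what the divided differences in the parameter
need. -/
theorem contDiffOn_fSlope (p : ℝ) : ContDiffOn ℝ 1 (fSlope p) (Ioi 0) := by
  have hf : ∀ x : ℝ, 0 < x → AnalyticAt ℝ (f p) x := fun x hx => by
    have h1 : AnalyticAt ℝ (fun u : ℝ => u ^ p) x := by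
      have h2 : AnalyticAt ℝ (fun u : ℝ => Real.exp (Real.log u * p)) x :=
        (((analyticAt_log hx).mul analyticAt_const)).rexp
      refine h2.congr ?_
      filter_upwards [lt_mem_nhds hx] with u hu
      rw [Real.rpow_def_of_pos hu]
    exact analyticAt_id.neg.add h1
  intro x hx
  rcases eq_or_ne x 1 with rfl | h1
  · obtain ⟨q, hq⟩ := hf 1 one_pos
    exact (hq.has_fpower_series_dslope_fslope.analyticAt).contDiffAt.contDiffWithinAt
  · have h2 : AnalyticAt ℝ (fun u => (f p u - f p 1) / (u - 1)) x :=
      ((hf x hx).sub analyticAt_const).div (analyticAt_id.sub analyticAt_const)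
        (sub_ne_zero.2 h1)
    refine (h2.congr ?_).contDiffAt.contDiffWithinAt
    filter_upwards [isOpen_ne.mem_nhds h1] with u hu
    rw [fSlope, dslope_of_ne _ hu, slope_def_field]

theorem hasDerivAt_fPrim (hp : 1 < p) (x : ℝ) : HasDerivAt (fPrim p) (f p x) x := by
  have h1 := (Real.hasDerivAt_rpow_const (x := x) (p := p + 1) (Or.inr (by linarith))).div_const (p + 1)
  have h2 := ((hasDerivAt_pow 2 x).fun_neg.div_const 2).fun_add h1
  refine h2.congr_deriv ?_
  have : p + 1 ≠ 0 := by linarith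
  rw [f]
  field_simp
  norm_num
  ring

theorem continuous_fPrim (hp : 1 < p) : Continuous (fPrim p) :=
  continuous_iff_continuousAt.2 fun x => (hasDerivAt_fPrim hp x).continuousAt

theorem fPrim_eq_mul {x : ℝ} (hp : 1 < p) (hx : 0 ≤ x) :
    fPrim p x = x ^ 2 / (p + 1) * (x ^ (p - 1) - (p + 1) / 2) := by
  have : p + 1 ≠ 0 := by linarith
  have h : x ^ (p + 1) = x ^ (p - 1) * x ^ 2 := by
    rw [show p + 1 = (p - 1) + (2 : ℕ) by push_cast; ring,
      Real.rpow_add_natCast' hx (by push_cast; linarith)]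
  rw [fPrim, h]
  field_simp
  ring

theorem peak_pow (hp : 1 < p) : peak p ^ (p - 1) = (p + 1) / 2 := by
  rw [peak, ← Real.rpow_mul (by linarith), one_div, inv_mul_cancel₀ (by linarith), Real.rpow_one]

theorem one_lt_peak (hp : 1 < p) : 1 < peak p :=
  Real.one_lt_rpow (by linarith) (by apply one_div_pos.2; linarith)

theorem fPrim_neg_iff (hp : 1 < p) {x : ℝ} (hx : 0 < x) : fPrim p x < 0 ↔ x < peak p := by
  have h0 := one_lt_peak hp
  have h1 : 0 < x ^ 2 / (p + 1) := by have : 0 < p + 1 := by linarith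
                                      positivity
  rw [fPrim_eq_mul hp hx.le, ← peak_pow hp, ← smul_eq_mul, smul_neg_iff_of_pos_left h1, sub_neg,
    Real.rpow_lt_rpow_iff hx.le (by linarith) (by linarith)]

theorem fPrim_nonpos_iff (hp : 1 < p) {x : ℝ} (hx : 0 < x) : fPrim p x ≤ 0 ↔ x ≤ peak p := by
  have h0 := one_lt_peak hp
  have h1 : 0 < x ^ 2 / (p + 1) := by have : 0 < p + 1 := by linarith
                                      positivity
  rw [fPrim_eq_mul hp hx.le, ← peak_pow hp, ← smul_eq_mul, ← not_lt, smul_pos_iff_of_pos_left h1, sub_pos,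
    Real.rpow_lt_rpow_iff (by linarith) hx.le (by linarith), not_lt]

theorem fPrim_lt_of_lt (hp : 1 < p) {x y : ℝ} (hx : 1 ≤ x) (hxy : x < y) :
    fPrim p x < fPrim p y :=
  lt_of_hasDerivAt_pos hxy (continuous_fPrim hp).continuousOn
    (fun z _ => hasDerivAt_fPrim hp z) (fun z hz => f_pos hp (by linarith [hz.1]))

/-- The truncation of `x` to `[0, M]`. -/
def clamp (M x : ℝ) : ℝ := max 0 (min x M)

theorem clamp_of_mem {M x : ℝ} (h0 : 0 ≤ x) (hM : x ≤ M) : clamp M x = x := by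
  rw [clamp, min_eq_left hM, max_eq_right h0]

theorem clamp_nonneg (M x : ℝ) : 0 ≤ clamp M x := le_max_left _ _

theorem clamp_le {M : ℝ} (hM : 0 ≤ M) (x : ℝ) : clamp M x ≤ M := max_le hM (min_le_right _ _)

theorem abs_clamp_sub_le (M x y : ℝ) : |clamp M x - clamp M y| ≤ |x - y| := by
  unfold clamp
  refine (abs_max_sub_max_le_max _ _ _ _).trans ?_
  rw [sub_self, abs_zero, max_eq_right (abs_nonneg _)]
  refine (abs_min_sub_min_le_max _ _ _ _).trans ?_
  rw [sub_self, abs_zero, max_eq_left (abs_nonneg _)]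

theorem abs_rpow_sub_rpow_le (hp : 1 < p) {M x y : ℝ} (hx : x ∈ Icc 0 M) (hy : y ∈ Icc 0 M) :
    |x ^ p - y ^ p| ≤ p * M ^ (p - 1) * |x - y| := by
  have := Convex.norm_image_sub_le_of_norm_hasDerivWithin_le (f := fun x : ℝ => x ^ p)
    (f' := fun x => p * x ^ (p - 1)) (s := Icc 0 M) (C := p * M ^ (p - 1)) (x := y) (y := x)
    (fun z _ => (Real.hasDerivAt_rpow_const (Or.inr hp.le)).hasDerivWithinAt)
    (fun z hz => by
      rw [Real.norm_eq_abs, abs_of_nonneg (by have := hz.1; positivity)]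
      have := Real.rpow_le_rpow hz.1 hz.2 (by linarith : 0 ≤ p - 1)
      gcongr) (convex_Icc 0 M) hy hx
  simpa [Real.norm_eq_abs] using this

theorem abs_f_sub_f_le (hp : 1 < p) {M x y : ℝ} (hx : x ∈ Icc 0 M) (hy : y ∈ Icc 0 M) :
    |f p x - f p y| ≤ (1 + p * M ^ (p - 1)) * |x - y| := by
  have h1 := abs_rpow_sub_rpow_le hp hx hy
  have h2 : f p x - f p y = -(x - y) + (x ^ p - y ^ p) := by simp only [f]; ring
  rw [h2]
  refine (abs_add_le _ _).trans ?_
  rw [abs_neg]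
  linarith

end SupercriticalNeumann

end

/-! ### Energy and the Pohozaev functional -/

open Set Filter Topology MeasureTheory

noncomputable section

namespace SupercriticalNeumann

/-- `α = N - 2 - 2θ`. -/
def alpha (N : ℕ) (p : ℝ) : ℝ := (N : ℝ) - 2 - 2 * theta p

/-- `B = θ (N - 2 - θ)`, so that `A = B ^ (1/(p-1))`. -/
def coeffB (N : ℕ) (p : ℝ) : ℝ := theta p * ((N : ℝ) - 2 - theta p)

section Constants

variable {N : ℕ} {p : ℝ}

theorem one_lt_of_pS_lt (hN : 3 ≤ N) (hp : pS N < p) : 1 < p := by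
  refine lt_trans ?_ hp
  have : (3 : ℝ) ≤ N := by exact_mod_cast hN
  rw [pS, lt_div_iff₀ (by linarith)]
  linarith

theorem theta_pos (hp : 1 < p) : 0 < theta p := div_pos two_pos (by linarith)

theorem theta_mul (hp : 1 < p) : theta p * (p - 1) = 2 :=
  div_mul_cancel₀ _ (by linarith)

/-- Supercriticality in its useful form: `p > p_S` is equivalent to `2θ < N - 2`. The number `α` is
the friction coefficient in the Emden-Fowler variables. -/
theorem alpha_pos (hN : 3 ≤ N) (hp : pS N < p) : 0 < alpha N p := by
  have h1 := one_lt_of_pS_lt hN hp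
  have h3 : (3 : ℝ) ≤ N := by exact_mod_cast hN
  rw [pS, div_lt_iff₀ (by linarith)] at hp
  have : theta p * 2 < N - 2 := by
    rw [theta, div_mul_eq_mul_div, div_lt_iff₀ (by linarith)]
    nlinarith
  rw [alpha]
  linarith

theorem coeffB_eq (N : ℕ) (p : ℝ) : coeffB N p = theta p ^ 2 + theta p * alpha N p := by
  rw [coeffB, alpha]; ring

theorem coeffB_pos (hN : 3 ≤ N) (hp : pS N < p) : 0 < coeffB N p := by
  have := theta_pos (one_lt_of_pS_lt hN hp)
  have := alpha_pos hN hp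
  rw [coeffB_eq]
  positivity

end Constants

/-- `u` is a positive solution of `u'' + ((N-1)/s) u' + f(u) = 0` on `S ⊆ (0,∞)`, with `u' = w`. -/
structure RadialSol (N : ℕ) (p : ℝ) (u w : ℝ → ℝ) (S : Set ℝ) : Prop where
  subset : S ⊆ Ioi 0
  deriv_u : ∀ s ∈ S, HasDerivAt u (w s) s
  deriv_w : ∀ s ∈ S, HasDerivAt w (-(((N : ℝ) - 1) / s * w s) - f p (u s)) s
  pos : ∀ s ∈ S, 0 < u s

/-- The energy `u'²/2 + F(u)`. -/
def energy (p u w : ℝ) : ℝ := w ^ 2 / 2 + fPrim p u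

/-- The Pohozaev functional, the energy in the Emden-Fowler variables. -/
def pohozaev (N : ℕ) (p s u w : ℝ) : ℝ :=
  s ^ (2 * theta p) *
    ((theta p * u + s * w) ^ 2 / 2 - coeffB N p * u ^ 2 / 2 + s ^ 2 * fPrim p u)

namespace RadialSol

variable {N : ℕ} {p : ℝ} {u w : ℝ → ℝ} {S : Set ℝ}

theorem mono (h : RadialSol N p u w S) {S' : Set ℝ} (hS : S' ⊆ S) : RadialSol N p u w S' :=
  ⟨hS.trans h.subset, fun s hs => h.deriv_u s (hS hs), fun s hs => h.deriv_w s (hS hs),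
    fun s hs => h.pos s (hS hs)⟩

theorem hasDerivAt_energy (hp : 1 < p) (h : RadialSol N p u w S) {s : ℝ} (hs : s ∈ S) :
    HasDerivAt (fun s => energy p (u s) (w s)) (-(((N : ℝ) - 1) / s * w s ^ 2)) s := by
  have h1 := (((h.deriv_w s hs).fun_pow 2).div_const 2).fun_add
    ((hasDerivAt_fPrim hp (u s)).comp s (h.deriv_u s hs))
  refine h1.congr_deriv ?_
  simp
  ring

/-- The terms with `u^{p+1}` cancel because `θ(p+1) = 2(θ+1)`. What remains is minus a sum of
squares with coefficients `α` and `1`, so the functional decreases in the supercritical case. -/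
theorem hasDerivAt_pohozaev (hp : 1 < p) (h : RadialSol N p u w S) {s : ℝ} (hs : s ∈ S) :
    HasDerivAt (fun s => pohozaev N p s (u s) (w s))
      (-(s ^ (2 * theta p - 1) * (alpha N p * (theta p * u s + s * w s) ^ 2 + s ^ 2 * u s ^ 2)))
      s := by
  have hs0 : 0 < s := h.subset hs
  have hu := h.deriv_u s hs
  have hw := h.deriv_w s hs
  have hF := (hasDerivAt_fPrim hp (u s)).comp s hu
  have h1 := (Real.hasDerivAt_rpow_const (x := s) (p := 2 * theta p) (Or.inl hs0.ne'))
  have hid := hasDerivAt_id s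
  have h2 := ((((hu.const_mul (theta p)).fun_add (hid.fun_mul hw)).fun_pow 2).div_const 2).fun_sub
    (((hu.fun_pow 2).const_mul (coeffB N p)).div_const 2) |>.fun_add ((hid.fun_pow 2).fun_mul hF)
  refine (h1.fun_mul h2).congr_deriv ?_
  have hrp : s ^ (2 * theta p) = s ^ (2 * theta p - 1) * s := by
    rw [← Real.rpow_add_one hs0.ne']; ring_nf
  have hup : u s ^ (p + 1) = u s ^ p * u s := Real.rpow_add_one (h.pos s hs).ne' p
  have hth : theta p * (p + 1) = 2 * (theta p + 1) := by have := theta_mul hp; linarith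
  have hp1 : p + 1 ≠ 0 := by linarith
  rw [hrp]
  have hdiv : u s ^ p * u s / (p + 1) * (2 * (theta p + 1)) = theta p * (u s ^ p * u s) := by
    rw [← hth]; field_simp
  simp only [id, fPrim, hup, f, coeffB_eq, Function.comp_def]
  have hNa : (N : ℝ) = alpha N p + 2 + 2 * theta p := by rw [alpha]; ring
  rw [hNa]
  push_cast
  simp only [pow_one, mul_one, one_mul]
  have hsw : s * (-((alpha N p + 2 + 2 * theta p - 1) / s * w s) - (-u s + u s ^ p)) =
      -((alpha N p + 2 + 2 * theta p - 1) * w s) - s * (-u s + u s ^ p) := by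
    field_simp
  rw [hsw]
  generalize s ^ (2 * theta p - 1) = R at *
  generalize u s ^ p = Q at *
  linear_combination R * s ^ 2 * hdiv

end RadialSol

end SupercriticalNeumann

end

/-! ### The family of regular solutions and its normalized differences -/

open Set Filter Topology MeasureTheory

noncomputable section

namespace SupercriticalNeumann

/-- The regular solutions `u(·,γ)` of `u'' + ((N-1)/s) u' + f(u) = 0`, `u(0,γ) = γ`, with
`u' = -s m`, together with the normalized differences `v = (u - 1)/(γ - 1)`, with `v' = -s k`, the
solutions of `v'' + ((N-1)/s) v' + (f(u)/(u-1)) v = 0`, `v(0,γ) = 1`. -/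
structure RegularFamily (N : ℕ) (p : ℝ) (u m h v k a : ℝ → ℝ → ℝ) : Prop where
  cont_u : Continuous fun q : ℝ × ℝ => u q.1 q.2
  cont_m : Continuous fun q : ℝ × ℝ => m q.1 q.2
  cont_h : Continuous fun q : ℝ × ℝ => h q.1 q.2
  u_zero : ∀ γ, u 0 γ = γ
  deriv_u : ∀ γ s, HasDerivAt (fun s => u s γ) (-(s * m s γ)) s
  deriv_m : ∀ γ s, HasDerivAt (fun s => s * m s γ) (h s γ - ((N : ℝ) - 1) * m s γ) s
  h_eq : ∀ γ > 0, ∀ s ≥ 0, h s γ = f p (u s γ)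
  u_pos : ∀ γ > 0, ∀ s ≥ 0, 0 < u s γ
  u_le : ∀ γ > 0, ∀ s ≥ 0, u s γ ≤ max γ (peak p)
  cont_v : Continuous fun q : ℝ × ℝ => v q.1 q.2
  cont_k : Continuous fun q : ℝ × ℝ => k q.1 q.2
  cont_a : Continuous fun q : ℝ × ℝ => a q.1 q.2
  v_zero : ∀ γ, v 0 γ = 1
  deriv_v : ∀ γ s, HasDerivAt (fun s => v s γ) (-(s * k s γ)) s
  deriv_k : ∀ γ s, HasDerivAt (fun s => s * k s γ) (a s γ * v s γ - ((N : ℝ) - 1) * k s γ) s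
  a_eq : ∀ γ > 0, ∀ s ≥ 0, a s γ = fSlope p (u s γ)
  v_eq : ∀ γ > 0, ∀ s ≥ 0, u s γ - 1 = (γ - 1) * v s γ

/-- Uniqueness for the initial value problem at the singular point `s = 0`. -/
theorem eq_zero_of_radial_ineq {n L R : ℝ} (hn : 0 ≤ n) (hL : 0 ≤ L) {y z d : ℝ → ℝ}
    (hy : ContinuousOn y (Icc 0 R)) (hz : ContinuousOn z (Icc 0 R)) (hy0 : y 0 = 0) (hz0 : z 0 = 0)
    (hdy : ∀ s ∈ Ioo 0 R, HasDerivAt y (z s) s)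
    (hdz : ∀ s ∈ Ioo 0 R, HasDerivAt z (-(n / s * z s) - d s) s)
    (hd : ∀ s ∈ Ioo 0 R, |d s| ≤ L * |y s|) :
    ∀ s ∈ Icc 0 R, y s = 0 ∧ z s = 0 := by
  intro s hs
  have hsub : Icc 0 s ⊆ Icc 0 R := Icc_subset_Icc_right hs.2
  have hsub' : Ioo 0 s ⊆ Ioo 0 R := Ioo_subset_Ioo_right hs.2
  -- Grönwall for `y² + z²`: the singular friction enters as `-2(n/s) z²`, which has the favorable
  -- sign, so the singularity at `0` costs nothing.
  have h := le_mul_exp_of_deriv_le (V := fun s => y s ^ 2 + z s ^ 2)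
    (V' := fun s => 2 * y s * z s + 2 * z s * (-(n / s * z s) - d s)) (C := 1 + L) hs.1
    (((hy.mono hsub).pow 2).add ((hz.mono hsub).pow 2)) (fun x hx => by
      have h1 := (hdy x (hsub' hx)).fun_pow 2
      have h2 := (hdz x (hsub' hx)).fun_pow 2
      simpa using h1.fun_add h2) (fun x hx => by
      have h1 := hd x (hsub' hx)
      have h2 : 0 ≤ n / x * z x ^ 2 := mul_nonneg (div_nonneg hn hx.1.le) (sq_nonneg _)
      have h3 : -(z x * d x) ≤ |z x| * (L * |y x|) := by
        refine (neg_le_abs _).trans ?_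
        rw [abs_mul]
        gcongr
      have h4 : y x * z x ≤ |z x| * |y x| := by
        refine (le_abs_self _).trans ?_
        rw [abs_mul, mul_comm]
      have h5 : 2 * (|z x| * |y x|) ≤ y x ^ 2 + z x ^ 2 := by
        have := sq_nonneg (|z x| - |y x|)
        have e1 := sq_abs (z x)
        have e2 := sq_abs (y x)
        nlinarith
      have h6 : L * (2 * (|z x| * |y x|)) ≤ L * (y x ^ 2 + z x ^ 2) :=
        mul_le_mul_of_nonneg_left h5 hL
      nlinarith)
  simp only [hy0, hz0] at h
  have h0 : y s ^ 2 + z s ^ 2 ≤ 0 := by simpa using h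
  exact ⟨pow_eq_zero_iff two_ne_zero |>.1 (by nlinarith [sq_nonneg (y s), sq_nonneg (z s)]),
    pow_eq_zero_iff two_ne_zero |>.1 (by nlinarith [sq_nonneg (y s), sq_nonneg (z s)])⟩

theorem energy_le_of_radialSol {N : ℕ} (hN : 3 ≤ N) {p : ℝ} (hp : 1 < p) {u w : ℝ → ℝ} {a b : ℝ}
    (hab : a ≤ b) (h : RadialSol N p u w (Ioo a b)) (hu : ContinuousOn u (Icc a b))
    (hw : ContinuousOn w (Icc a b)) : energy p (u b) (w b) ≤ energy p (u a) (w a) := by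
  have h3 : (3 : ℝ) ≤ N := by exact_mod_cast hN
  refine le_of_hasDerivAt_nonpos (h := fun s => energy p (u s) (w s)) hab ?_
    (fun x hx => h.hasDerivAt_energy hp hx) (fun x hx => ?_)
  · exact ((hw.pow 2).div_const 2).add ((continuous_fPrim hp).comp_continuousOn hu)
  · have hx0 : 0 < x := h.subset hx
    have : 0 ≤ ((N : ℝ) - 1) / x * w x ^ 2 :=
      mul_nonneg (div_nonneg (by linarith) hx0.le) (sq_nonneg _)
    linarith

theorem continuousOn_pohozaev {N : ℕ} {p : ℝ} (hp : 1 < p) {u w : ℝ → ℝ} {S : Set ℝ}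
    (hu : ContinuousOn u S) (hw : ContinuousOn w S) :
    ContinuousOn (fun s => pohozaev N p s (u s) (w s)) S := by
  have h1 : Continuous fun s : ℝ => s ^ (2 * theta p) :=
    Real.continuous_rpow_const (by have := theta_pos hp; linarith)
  have h2 := (continuous_fPrim hp).comp_continuousOn hu
  unfold pohozaev
  refine h1.continuousOn.mul ?_
  have h3 : ContinuousOn (fun s => fPrim p (u s)) S := h2
  fun_prop

theorem pohozaev_lt_of_radialSol {N : ℕ} (hN : 3 ≤ N) {p : ℝ} (hp : pS N < p) {u w : ℝ → ℝ}
    {a b : ℝ} (hab : a < b) (h : RadialSol N p u w (Ioo a b)) (hu : ContinuousOn u (Icc a b))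
    (hw : ContinuousOn w (Icc a b)) :
    pohozaev N p b (u b) (w b) < pohozaev N p a (u a) (w a) := by
  have hp1 := one_lt_of_pS_lt hN hp
  have hc := continuousOn_pohozaev (N := N) hp1 hu hw
  have := lt_of_hasDerivAt_pos (h := fun s => -pohozaev N p s (u s) (w s)) hab hc.neg
    (fun x hx => (h.hasDerivAt_pohozaev hp1 hx).neg) (fun x hx => by
      have hx0 : 0 < x := h.subset hx
      have h1 := alpha_pos hN hp
      have h2 := h.pos x hx
      rw [neg_neg]
      positivity)
  linarith

theorem pohozaev_zero {N : ℕ} {p u w : ℝ} (hp : 1 < p) : pohozaev N p 0 u w = 0 := by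
  rw [pohozaev, Real.zero_rpow (by have := theta_pos hp; linarith), zero_mul]

/-- In the supercritical case a solution that starts in `(0, M)` stays there. -/
theorem mem_Ioo_of_truncated {N : ℕ} (hN : 3 ≤ N) {p : ℝ} (hp : pS N < p) {u w : ℝ → ℝ} {γ M : ℝ}
    (hγ : 0 < γ) (hM : max γ (peak p) < M) (hu0 : u 0 = γ) (hw0 : w 0 = 0)
    (hu : Continuous u) (hw : Continuous w)
    (hdu : ∀ s > 0, HasDerivAt u (w s) s)
    (hdw : ∀ s > 0, u s ∈ Ioo 0 M → HasDerivAt w (-(((N : ℝ) - 1) / s * w s) - f p (u s)) s) :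
    ∀ s ≥ 0, u s ∈ Ioc 0 (max γ (peak p)) := by
  have hp1 := one_lt_of_pS_lt hN hp
  have hpk := one_lt_peak hp1
  have hMp : peak p < M := (le_max_right _ _).trans_lt hM
  -- as long as the solution is in `(0, M)` it satisfies the better bounds
  have key : ∀ s > 0, (∀ x ∈ Ioo 0 s, u x ∈ Ioo 0 M) → 0 ≤ u s →
      u s ∈ Ioc 0 (max γ (peak p)) := by
    intro s hs hx hus
    have hsol : RadialSol N p u w (Ioo 0 s) :=
      ⟨fun x hx => hx.1, fun x hx => hdu x hx.1, fun x hx' => hdw x hx'.1 (hx x hx'),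
        fun x hx' => (hx x hx').1⟩
    have hE := energy_le_of_radialSol hN hp1 hs.le hsol hu.continuousOn hw.continuousOn
    have hJ := pohozaev_lt_of_radialSol hN hp hs hsol hu.continuousOn hw.continuousOn
    rw [pohozaev_zero hp1] at hJ
    -- At a zero of `u` the Pohozaev functional reduces to `s^{2θ} (s w)²/2 ≥ 0`, but it has
    -- decreased strictly from its value `0` at the origin.
    have hpos : 0 < u s := by
      rcases hus.eq_or_lt with h0 | h0
      · rw [pohozaev, ← h0] at hJ
        have hF : fPrim p 0 = 0 := by
          simp [fPrim, Real.zero_rpow (by linarith : p + 1 ≠ 0)]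
        rw [hF] at hJ
        have : 0 ≤ s ^ (2 * theta p) *
            ((theta p * 0 + s * w s) ^ 2 / 2 - coeffB N p * 0 ^ 2 / 2 + s ^ 2 * 0) := by
          have : 0 ≤ s ^ (2 * theta p) := Real.rpow_nonneg hs.le _
          refine mul_nonneg this ?_
          nlinarith [sq_nonneg (s * w s)]
        linarith
      · exact h0
    refine ⟨hpos, ?_⟩
    -- The energy decreases from `F(γ)`. If `γ ≤ peak` this keeps `F(u) ≤ 0`, that is `u ≤ peak`;
    -- otherwise `F` increases beyond `1` and `u ≤ γ`.
    have hF : fPrim p (u s) ≤ fPrim p γ := by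
      rw [energy, energy, hu0, hw0] at hE
      nlinarith [sq_nonneg (w s)]
    by_contra hcon
    rw [not_le, max_lt_iff] at hcon
    rcases le_or_gt γ (peak p) with h1 | h1
    · have h2 := (fPrim_nonpos_iff hp1 hγ).2 h1
      exact absurd ((fPrim_nonpos_iff hp1 hpos).1 (hF.trans h2)) (not_le.2 hcon.2)
    · exact absurd hF (not_le.2 (fPrim_lt_of_lt hp1 (by linarith) hcon.1))
  have hall : ∀ s ≥ 0, u s ∈ Ioo 0 M := by
    by_contra hcon
    push Not at hcon
    obtain ⟨s₁, hs₁, hbad⟩ := hcon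
    -- At the first exit time from `(0,M)` the improved bounds still hold and contradict the exit.
    set T : Set ℝ := Ici 0 ∩ u ⁻¹' (Ioo 0 M)ᶜ with hT
    have hTc : IsClosed T := isClosed_Ici.inter (isOpen_Ioo.isClosed_compl.preimage hu)
    have hTne : T.Nonempty := ⟨s₁, hs₁, hbad⟩
    have hTb : BddBelow T := ⟨0, fun x hx => hx.1⟩
    have hmem := hTc.csInf_mem hTne hTb
    set σ := sInf T with hσ
    have hσ0 : 0 < σ := by
      refine lt_of_le_of_ne hmem.1 fun h0 => hmem.2 ?_
      rw [← h0, hu0]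
      exact ⟨hγ, (le_max_left _ _).trans_lt hM⟩
    have hbefore : ∀ x ∈ Ioo 0 σ, u x ∈ Ioo 0 M := fun x hx => by
      by_contra hxb
      exact absurd (csInf_le hTb (show x ∈ T from ⟨hx.1.le, hxb⟩)) (not_le.2 hx.2)
    have hnn : 0 ≤ u σ := by
      have hcl : σ ∈ closure (Ioo 0 σ) := by
        rw [closure_Ioo hσ0.ne]; exact right_mem_Icc.2 hσ0.le
      exact closure_minimal (fun x hx => (hbefore x hx).1.le)
        (isClosed_Ici.preimage hu) hcl
    have := key σ hσ0 hbefore hnn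
    exact hmem.2 ⟨this.1, this.2.trans_lt hM⟩
  intro s hs
  rcases hs.eq_or_lt with rfl | hs
  · rw [hu0]; exact ⟨hγ, le_max_left _ _⟩
  · exact key s hs (fun x hx => hall x hx.1.le) (hall s hs.le).1.le

/-- The power is truncated at a level above the a priori bound so that the equation becomes globally
Lipschitz; the truncation is then never active for `γ > 0` and `s ≥ 0`. The function `v` is
constructed from its linear equation, not as a quotient, so that it is available and continuous at
`γ = 1`. -/
theorem exists_regularFamily {N : ℕ} (hN : 3 ≤ N) {p : ℝ} (hp : pS N < p) :
    ∃ u m h v k a : ℝ → ℝ → ℝ, RegularFamily N p u m h v k a := by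
  have hp1 := one_lt_of_pS_lt hN hp
  have hpk := one_lt_peak hp1
  have h3 : (3 : ℝ) ≤ N := by exact_mod_cast hN
  have hNc : ((N - 1 : ℕ) : ℝ) = (N : ℝ) - 1 := by
    rw [Nat.cast_sub (by omega)]; simp
  set M : ℝ → ℝ := fun γ => max γ (peak p) + 1 with hM
  have hM1 : ∀ γ, 1 ≤ M γ := fun γ => by
    have := le_max_right γ (peak p); simp only [hM]; linarith
  have hMc : Continuous M := by fun_prop
  have hrc : Continuous fun x : ℝ => x ^ p := Real.continuous_rpow_const (by linarith)
  have hrc1 : Continuous fun x : ℝ => x ^ (p - 1) := Real.continuous_rpow_const (by linarith)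
  have hcl : Continuous fun q : ℝ × ℝ => clamp (M q.1) q.2 := by unfold clamp; fun_prop
  obtain ⟨u, m, hu, hm, hum⟩ := exists_radial_solution (P := ℝ) (N - 1)
    (F := fun _ γ x => -x + clamp (M γ) x ^ p) (L := fun γ => 1 + p * M γ ^ (p - 1))
    (B := fun _ => 0) (c := fun γ => γ)
    (by
      have : Continuous fun q : ℝ × ℝ × ℝ => clamp (M q.2.1) q.2.2 ^ p :=
        hrc.comp (hcl.comp continuous_snd)
      fun_prop)
    (by fun_prop) continuous_const continuous_id
    (fun _ γ x y => by
      have hM0 : 0 ≤ M γ := zero_le_one.trans (hM1 γ)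
      have h1 := abs_rpow_sub_rpow_le hp1
        (⟨clamp_nonneg (M γ) x, clamp_le hM0 x⟩ : clamp (M γ) x ∈ Icc 0 (M γ))
        (⟨clamp_nonneg (M γ) y, clamp_le hM0 y⟩ : clamp (M γ) y ∈ Icc 0 (M γ))
      have h2 := abs_clamp_sub_le (M γ) x y
      have h3 : -x + clamp (M γ) x ^ p - (-y + clamp (M γ) y ^ p) =
        -(x - y) + (clamp (M γ) x ^ p - clamp (M γ) y ^ p) := by ring
      rw [h3]
      refine (abs_add_le _ _).trans ?_
      rw [abs_neg]
      have h4 : 0 ≤ p * M γ ^ (p - 1) := by positivity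
      have h5 := mul_le_mul_of_nonneg_left h2 h4
      linarith)
    (fun _ γ => by
      have : clamp (M γ) 0 = 0 := clamp_of_mem le_rfl (zero_le_one.trans (hM1 γ))
      simp [this, Real.zero_rpow (by linarith : p ≠ 0)])
  set h : ℝ → ℝ → ℝ := fun s γ => -u s γ + clamp (M γ) (u s γ) ^ p with hh
  have hhc : Continuous fun q : ℝ × ℝ => h q.1 q.2 := by
    have : Continuous fun q : ℝ × ℝ => clamp (M q.2) (u q.1 q.2) :=
      hcl.comp (continuous_snd.prodMk hu)
    exact hu.neg.add (hrc.comp this)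
  have husl : ∀ γ, Continuous fun s => u s γ := fun γ =>
    hu.comp (f := fun s : ℝ => (s, γ)) (by fun_prop)
  have hmsl : ∀ γ, Continuous fun s => m s γ := fun γ =>
    hm.comp (f := fun s : ℝ => (s, γ)) (by fun_prop)
  have hbounds : ∀ γ > 0, ∀ s ≥ 0, u s γ ∈ Ioc 0 (max γ (peak p)) := fun γ hγ =>
    mem_Ioo_of_truncated hN hp (w := fun s => -(s * m s γ)) (M := M γ) hγ
      (by simp only [hM]; linarith) (hum γ).1 (by simp) (husl γ)
      (continuous_id.mul (hmsl γ)).neg (fun s _ => ((hum γ).2 s).1) (fun s hs hus => by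
        refine ((hum γ).2 s).2.fun_neg.congr_deriv ?_
        rw [clamp_of_mem hus.1.le hus.2.le, f, hNc]
        field_simp
        ring)
  have hheq : ∀ γ > 0, ∀ s ≥ 0, h s γ = f p (u s γ) := fun γ hγ s hs => by
    have := hbounds γ hγ s hs
    simp only [hh, f]
    rw [clamp_of_mem this.1.le (by simp only [hM]; linarith [this.2])]
  set a : ℝ → ℝ → ℝ := fun s γ => fSlope p (clamp (M γ) (u s γ)) with ha
  have hac : Continuous fun q : ℝ × ℝ => a q.1 q.2 := by
    have : Continuous fun q : ℝ × ℝ => clamp (M q.2) (u q.1 q.2) :=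
      hcl.comp (continuous_snd.prodMk hu)
    exact (continuous_fSlope hp1).comp this
  have haeq : ∀ γ > 0, ∀ s ≥ 0, a s γ = fSlope p (u s γ) := fun γ hγ s hs => by
    have := hbounds γ hγ s hs
    simp only [ha]
    rw [clamp_of_mem this.1.le (by simp only [hM]; linarith [this.2])]
  have habd : ∀ s γ, |a s γ| ≤ p * M γ ^ (p - 1) := fun s γ => by
    have h0 := clamp_nonneg (M γ) (u s γ)
    simp only [ha]
    rw [abs_of_nonneg (fSlope_nonneg hp1 h0)]
    exact fSlope_le hp1 h0 (clamp_le (zero_le_one.trans (hM1 γ)) _) (hM1 γ)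
  obtain ⟨v, k, hv, hk, hvk⟩ := exists_radial_solution (P := ℝ) (N - 1)
    (F := fun s γ x => a s γ * x) (L := fun γ => p * M γ ^ (p - 1))
    (B := fun _ => 0) (c := fun _ => 1)
    (by
      have : Continuous fun q : ℝ × ℝ × ℝ => a q.1 q.2.1 :=
        hac.comp (f := fun q : ℝ × ℝ × ℝ => (q.1, q.2.1)) (by fun_prop)
      fun_prop)
    (by fun_prop) continuous_const continuous_const
    (fun s γ x y => by
      rw [← mul_sub, abs_mul]
      exact mul_le_mul_of_nonneg_right (habd s γ) (abs_nonneg _))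
    (fun _ γ => by simp)
  have hvsl : ∀ γ, Continuous fun s => v s γ := fun γ =>
    hv.comp (f := fun s : ℝ => (s, γ)) (by fun_prop)
  have hksl : ∀ γ, Continuous fun s => k s γ := fun γ =>
    hk.comp (f := fun s : ℝ => (s, γ)) (by fun_prop)
  refine ⟨u, m, h, v, k, a, hu, hm, hhc, fun γ => (hum γ).1, fun γ s => ((hum γ).2 s).1,
    fun γ s => by rw [← hNc]; exact ((hum γ).2 s).2, hheq, fun γ hγ s hs => (hbounds γ hγ s hs).1,
    fun γ hγ s hs => (hbounds γ hγ s hs).2, hv, hk, hac, fun γ => (hvk γ).1,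
    fun γ s => ((hvk γ).2 s).1, fun γ s => by rw [← hNc]; exact ((hvk γ).2 s).2, haeq,
    fun γ hγ s hs => ?_⟩
  have c1 := husl γ
  have c2 := hmsl γ
  have c3 := hvsl γ
  have c4 := hksl γ
  -- Both `u - 1` and `(γ-1) v` solve the linear equation with coefficient `a` and start from `γ -
  -- 1` with zero slope.
  have := eq_zero_of_radial_ineq (n := (N : ℝ) - 1) (L := p * M γ ^ (p - 1)) (R := s)
    (y := fun s => u s γ - 1 - (γ - 1) * v s γ)
    (z := fun s => -(s * m s γ) - (γ - 1) * (-(s * k s γ)))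
    (d := fun s => a s γ * (u s γ - 1 - (γ - 1) * v s γ))
    (by linarith) (by have := hM1 γ; positivity) (by fun_prop) (by fun_prop)
    (by rw [(hum γ).1, (hvk γ).1]; ring) (by simp)
    (fun s _ => (((hum γ).2 s).1.sub_const 1).fun_sub (((hvk γ).2 s).1.const_mul (γ - 1)))
    (fun s hs => by
      refine (((hum γ).2 s).2.fun_neg.fun_sub
        (((hvk γ).2 s).2.fun_neg.const_mul (γ - 1))).congr_deriv ?_
      have e1 := hheq γ hγ s hs.1.le
      simp only [hh] at e1
      rw [e1, f_eq_fSlope_mul, ← haeq γ hγ s hs.1.le, hNc]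
      have := hs.1.ne'
      field_simp
      ring)
    (fun s _ => by
      rw [abs_mul]
      exact mul_le_mul_of_nonneg_right (habd s γ) (abs_nonneg _)) s (right_mem_Icc.2 hs)
  linarith [this.1]

end SupercriticalNeumann

end

/-! ### Lower bounds at infinity and divergence of the angle -/

open Set Filter Topology MeasureTheory

noncomputable section

namespace SupercriticalNeumann

/-- The first point after `a` at which a function that is negative at `a` vanishes. -/
theorem exists_first_zero {w : ℝ → ℝ} {a b : ℝ} (hab : a ≤ b) (hw : ContinuousOn w (Icc a b))
    (ha : w a < 0) (hb : 0 ≤ w b) :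
    ∃ σ ∈ Ioc a b, w σ = 0 ∧ ∀ x ∈ Ico a σ, w x < 0 := by
  set T : Set ℝ := Icc a b ∩ w ⁻¹' {0} with hT
  have hTc : IsClosed T := hw.preimage_isClosed_of_isClosed isClosed_Icc isClosed_singleton
  have hTne : T.Nonempty := by
    obtain ⟨x, hx, hx0⟩ := intermediate_value_Icc hab hw (⟨ha.le, hb⟩ : (0 : ℝ) ∈ Icc _ _)
    exact ⟨x, hx, hx0⟩
  have hTb : BddBelow T := ⟨a, fun x hx => hx.1.1⟩
  have hmem := hTc.csInf_mem hTne hTb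
  have h0 : w (sInf T) = 0 := hmem.2
  refine ⟨sInf T, ⟨lt_of_le_of_ne hmem.1.1 fun h => ?_, hmem.1.2⟩, h0, fun x hx => ?_⟩
  · rw [← h] at h0; linarith
  · by_contra hcon
    obtain ⟨y, hy, hy0⟩ := intermediate_value_Icc hx.1
      (hw.mono (Icc_subset_Icc_right (hx.2.le.trans hmem.1.2)))
      (⟨ha.le, not_lt.1 hcon⟩ : (0 : ℝ) ∈ Icc _ _)
    exact absurd (csInf_le hTb (show y ∈ T from ⟨⟨hy.1, hy.2.trans (hx.2.le.trans hmem.1.2)⟩, hy0⟩))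
      (not_le.2 (hy.2.trans_lt hx.2))

/-- The last point before `b` at which a function that is positive at `b` vanishes. -/
theorem exists_last_zero {w : ℝ → ℝ} {a b : ℝ} (hab : a ≤ b) (hw : ContinuousOn w (Icc a b))
    (ha : w a ≤ 0) (hb : 0 < w b) :
    ∃ σ ∈ Ico a b, w σ = 0 ∧ ∀ x ∈ Ioc σ b, 0 < w x := by
  have hcont : ContinuousOn (fun x => -w (-x)) (Icc (-b) (-a)) :=
    (hw.comp continuousOn_neg fun x hx => ⟨by linarith [hx.2], by linarith [hx.1]⟩).neg
  obtain ⟨σ, hσ, h0, h1⟩ := exists_first_zero (w := fun x => -w (-x)) (neg_le_neg hab) hcont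
    (by simpa using hb) (by simpa using ha)
  refine ⟨-σ, ⟨by linarith [hσ.2], by linarith [hσ.1]⟩, neg_eq_zero.1 h0, fun x hx => ?_⟩
  have := h1 (-x) ⟨by linarith [hx.2], by linarith [hx.1]⟩
  rw [neg_neg] at this
  linarith

theorem neg_sq_div_two_le_fPrim {p x : ℝ} (hp : 1 < p) (hx : 0 ≤ x) : -(x ^ 2) / 2 ≤ fPrim p x := by
  have : 0 ≤ x ^ (p + 1) / (p + 1) := by positivity
  rw [fPrim]
  linarith

theorem fPrim_le_of_le_one {p x : ℝ} (hp : 1 < p) (hx : 0 < x) (hx1 : x ≤ 1) :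
    2 * fPrim p x ≤ -((p - 1) / (p + 1) * x ^ 2) := by
  rw [fPrim_eq_mul hp hx.le]
  have h1 := Real.rpow_le_one hx.le hx1 (by linarith : 0 ≤ p - 1)
  have h2 : 0 ≤ x ^ 2 / (p + 1) := by positivity
  have h3 : (p - 1) / (p + 1) * x ^ 2 = x ^ 2 / (p + 1) * (p - 1) := by ring
  rw [h3]
  nlinarith

/-- A lower bound for `u` in terms of the Pohozaev functional. -/
theorem le_of_pohozaev_le {N : ℕ} {p s u w c : ℝ} (hp : 1 < p) (hs : 0 < s) (hu : 0 < u)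
    (h : pohozaev N p s u w ≤ -c) :
    2 * c ≤ u ^ 2 * (s ^ (2 * theta p) * (coeffB N p + s ^ 2)) := by
  have h1 := neg_sq_div_two_le_fPrim hp hu.le
  have h2 : 0 < s ^ (2 * theta p) := Real.rpow_pos_of_pos hs _
  have h3 : s ^ 2 * (-(u ^ 2) / 2) ≤ s ^ 2 * fPrim p u := by gcongr
  have h4 : s ^ (2 * theta p) * (-(coeffB N p * u ^ 2 / 2) - s ^ 2 * u ^ 2 / 2) ≤ -c := by
    refine le_trans ?_ h
    rw [pohozaev]
    gcongr
    nlinarith [sq_nonneg (theta p * u + s * w)]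
  nlinarith

/-- Solutions stay away from zero at infinity. -/
theorem RadialSol.exists_lower_bound {N : ℕ} (hN : 3 ≤ N) {p : ℝ} (hp : 1 < p) {u w : ℝ → ℝ}
    (h : RadialSol N p u w (Ioi 0)) {c s₀ : ℝ} (hc : 0 < c)
    (hJ : ∀ s ≥ s₀, pohozaev N p s (u s) (w s) ≤ -c)
    (h0 : (∃ s > 0, energy p (u s) (w s) < 0) ∨ ∃ᶠ s in 𝓝[>] 0, 1 ≤ u s) :
    ∃ m > 0, ∃ s₁ > 0, ∀ s ≥ s₁, m ≤ u s := by
  have hcu : ContinuousOn u (Ioi 0) := fun s hs => (h.deriv_u s hs).continuousAt.continuousWithinAt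
  have hcw : ContinuousOn w (Ioi 0) := fun s hs => (h.deriv_w s hs).continuousAt.continuousWithinAt
  have hIcc : ∀ {a b : ℝ}, 0 < a → Icc a b ⊆ Ioi 0 := fun ha x hx => ha.trans_le hx.1
  -- Once the energy is negative it stays below `-e`, and `F(u) ≥ -u²/2` bounds `u` from below.
  by_cases hE : ∃ s > 0, energy p (u s) (w s) < 0
  · obtain ⟨s₂, hs₂, hE2⟩ := hE
    set e := -energy p (u s₂) (w s₂) with he
    have he0 : 0 < e := by linarith
    refine ⟨√(2 * e), Real.sqrt_pos.2 (by linarith), s₂, hs₂, fun s hs => ?_⟩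
    have h1 := energy_le_of_radialSol hN hp hs
      (h.mono (Ioo_subset_Icc_self.trans (hIcc hs₂)))
      (hcu.mono (hIcc hs₂)) (hcw.mono (hIcc hs₂))
    have hus := h.pos s (hs₂.trans_le hs)
    have h2 := neg_sq_div_two_le_fPrim hp hus.le
    rw [Real.sqrt_le_left hus.le]
    have h3 : energy p (u s) (w s) = w s ^ 2 / 2 + fPrim p (u s) := rfl
    nlinarith [sq_nonneg (w s)]
  · push Not at hE
    have hfreq : ∃ᶠ s in 𝓝[>] 0, 1 ≤ u s := h0.resolve_left (by push Not; exact hE)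
    by_cases hall : ∀ s > 0, 1 ≤ u s
    · exact ⟨1, one_pos, 1, one_pos, fun s hs => hall s (by linarith)⟩
    push Not at hall
    obtain ⟨s₁, hs₁, hus₁⟩ := hall
    exfalso
    -- If the energy is never negative, then `w² ≥ -2F(u) ≥ κ² u²` wherever `u ≤ 1`, so `w` cannot
    -- change sign there.
    set κ := √((p - 1) / (p + 1)) with hκ
    have hκ2 : κ ^ 2 = (p - 1) / (p + 1) := Real.sq_sqrt (by
      apply div_nonneg <;> linarith)
    have hκ0 : 0 < κ := Real.sqrt_pos.2 (div_pos (by linarith) (by linarith))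
    have hwu : ∀ s > 0, u s ≤ 1 → (κ * u s) ^ 2 ≤ w s ^ 2 := fun s hs hu1 => by
      have h1 := hE s hs
      have h2 := fPrim_le_of_le_one hp (h.pos s hs) hu1
      rw [energy] at h1
      rw [mul_pow, hκ2]
      linarith
    have hw0 : ∀ s > 0, u s ≤ 1 → w s ≠ 0 := fun s hs hu1 hws => by
      have h1 := hwu s hs hu1
      have h2 := mul_pos hκ0 (h.pos s hs)
      rw [hws] at h1
      nlinarith
    -- A decreasing `u` would stay below `1` and decay exponentially, too fast for the Pohozaev
    -- bound, under which `u` can decay only like a power of `s`.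
    rcases lt_or_gt_of_ne (hw0 s₁ hs₁ hus₁.le) with hneg | hpos
    · have hdec : ∀ s ≥ s₁, (∀ x ∈ Ioo s₁ s, w x ≤ 0) → u s ≤ u s₁ := fun s hs hx =>
        le_of_hasDerivAt_nonpos hs (hcu.mono (hIcc hs₁))
          (fun x hx' => h.deriv_u x (hs₁.trans hx'.1)) hx
      have hwneg : ∀ s ≥ s₁, w s < 0 := by
        intro s hs
        by_contra hcon
        obtain ⟨σ, hσ, hσ0, hσ1⟩ := exists_first_zero hs (hcw.mono (hIcc hs₁)) hneg (not_lt.1 hcon)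
        have := hdec σ hσ.1.le fun x hx => (hσ1 x (Ioo_subset_Ico_self hx)).le
        exact hw0 σ (hs₁.trans hσ.1) (this.trans hus₁.le) hσ0
      have hu1 : ∀ s ≥ s₁, u s ≤ 1 := fun s hs =>
        (hdec s hs fun x hx => (hwneg x hx.1.le).le).trans hus₁.le
      have hwk : ∀ s ≥ s₁, w s ≤ -κ * u s := fun s hs => by
        have h1 := hwu s (hs₁.trans_le hs) (hu1 s hs)
        have h2 := hwneg s hs
        have h3 : κ * u s ≤ -w s := by
          rw [← neg_sq (w s)] at h1
          exact (pow_le_pow_iff_left₀ (mul_pos hκ0 (h.pos s (hs₁.trans_le hs))).le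
            (by linarith) two_ne_zero).1 h1
        linarith
      have hexp : ∀ s ≥ s₁, u s ≤ Real.exp (-κ * (s - s₁)) := fun s hs => by
        have := le_mul_exp_of_deriv_le (C := -κ) hs (hcu.mono (hIcc hs₁))
          (fun x hx' => h.deriv_u x (hs₁.trans hx'.1)) (fun x hx => hwk x hx.1.le)
        exact this.trans (mul_le_of_le_one_left (Real.exp_pos _).le hus₁.le)
      have hlim : Tendsto (fun s : ℝ => Real.exp (2 * κ * s₁) *
          (coeffB N p * (s ^ (2 * theta p) * Real.exp (-(2 * κ) * s)) +
            s ^ (2 * theta p + 2) * Real.exp (-(2 * κ) * s))) atTop (𝓝 0) := by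
        have h1 := tendsto_rpow_mul_exp_neg_mul_atTop_nhds_zero (2 * theta p) (2 * κ) (by linarith)
        have h2 := tendsto_rpow_mul_exp_neg_mul_atTop_nhds_zero (2 * theta p + 2) (2 * κ)
          (by linarith)
        simpa using ((h1.const_mul (coeffB N p)).add h2).const_mul (Real.exp (2 * κ * s₁))
      obtain ⟨s, hs1, hs2, hs3, hsl⟩ := ((eventually_ge_atTop s₁).and
        ((eventually_ge_atTop s₀).and ((eventually_ge_atTop 1).and
          (hlim.eventually (gt_mem_nhds (by linarith : (0 : ℝ) < 2 * c)))))).exists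
      have hsp : 0 < s := by linarith
      have h1 := le_of_pohozaev_le hp hsp (h.pos s hsp) (hJ s hs2)
      have h2 : u s ^ 2 ≤ Real.exp (-κ * (s - s₁)) ^ 2 :=
        pow_le_pow_left₀ (h.pos s hsp).le (hexp s hs1) 2
      rcases le_or_gt (coeffB N p + s ^ 2) 0 with hB | hB
      · have : u s ^ 2 * (s ^ (2 * theta p) * (coeffB N p + s ^ 2)) ≤ 0 :=
          mul_nonpos_of_nonneg_of_nonpos (sq_nonneg _)
            (mul_nonpos_of_nonneg_of_nonpos (Real.rpow_nonneg hsp.le _) hB)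
        linarith
      · have h3 : 0 ≤ s ^ (2 * theta p) * (coeffB N p + s ^ 2) :=
          mul_nonneg (Real.rpow_nonneg hsp.le _) hB.le
        have h4 := mul_le_mul_of_nonneg_right h2 h3
        have h5 : Real.exp (-κ * (s - s₁)) ^ 2 =
            Real.exp (2 * κ * s₁) * Real.exp (-(2 * κ) * s) := by
          rw [← Real.exp_nat_mul, ← Real.exp_add]
          congr 1
          push_cast
          ring
        have h6 : s ^ (2 * theta p + 2) = s ^ (2 * theta p) * s ^ 2 := by
          rw [Real.rpow_add hsp]; norm_num
        rw [h5] at h4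
        rw [h6] at hsl
        nlinarith
    -- An increasing `u` below `1` must have been increasing all the way from the origin, so `u < 1`
    -- near `0`, against the assumption there.
    · have hwpos : ∀ s ∈ Ioc 0 s₁, 0 < w s := by
        intro s hs
        by_contra hcon
        obtain ⟨σ, hσ, hσ0, hσ1⟩ := exists_last_zero hs.2 (hcw.mono (hIcc hs.1)) (not_lt.1 hcon)
          hpos
        have hσp : 0 < σ := hs.1.trans_le hσ.1
        have := le_of_hasDerivAt_nonneg hσ.2.le (hcu.mono (hIcc hσp))
          (fun x hx' => h.deriv_u x (hσp.trans hx'.1)) fun x hx => (hσ1 x (Ioo_subset_Ioc_self hx)).le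
        exact hw0 σ hσp (this.trans hus₁.le) hσ0
      have hev : ∀ᶠ s in 𝓝[>] (0 : ℝ), u s < 1 := by
        filter_upwards [Ioc_mem_nhdsGT hs₁] with s hs
        have := le_of_hasDerivAt_nonneg hs.2 (hcu.mono (hIcc hs.1))
          (fun x hx' => h.deriv_u x (hs.1.trans hx'.1)) fun x hx =>
            (hwpos x ⟨hs.1.trans hx.1, hx.2.le⟩).le
        linarith
      obtain ⟨s, hs1, hs2⟩ := (hfreq.and_eventually hev).exists
      linarith

/-- The numerator is `b² + (n/s) ab + g a²`, and the mixed term is at least `-(n/(2s))(a² + b²)`. -/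
theorem angleRate_ge {a b g n s c : ℝ} (hs : 0 < s) (hn : 0 ≤ n) (hg : c ≤ g) (hc : c ≤ 1)
    (hne : a ^ 2 + b ^ 2 ≠ 0) : c - n / (2 * s) ≤ angleRate a b (-(n / s * b) - g * a) := by
  have hpos : 0 < a ^ 2 + b ^ 2 := lt_of_le_of_ne (by positivity) hne.symm
  rw [angleRate, le_div_iff₀ hpos]
  have h1 : 0 ≤ n / (2 * s) := by positivity
  have h2 : n / s = 2 * (n / (2 * s)) := by field_simp
  rw [h2]
  nlinarith [mul_nonneg h1 (sq_nonneg (a + b)), mul_nonneg (sub_nonneg.2 hg) (sq_nonneg a),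
    mul_nonneg (sub_nonneg.2 hc) (sq_nonneg b)]

/-- The angle tends to infinity if the coefficient is bounded below. -/
theorem PhaseCurve.tendsto_angle {a b d g : ℝ → ℝ} {s₀ Θ₀ n c s₁ : ℝ} (h : PhaseCurve a b d s₀ Θ₀)
    (hn : 0 ≤ n) (hc : 0 < c) (hs₁ : 0 < s₁) (hg : ∀ s ≥ s₁, c ≤ g s)
    (hd : ∀ s ≥ s₁, d s = -(n / s * b s) - g s * a s) :
    Tendsto (angle a b d s₀ Θ₀) atTop atTop := by
  set c' := min c 1 with hc'
  have hc'0 : 0 < c' := lt_min hc one_pos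
  -- From here on `n/(2s) ≤ c'/2`, so the friction takes at most half of the angular speed.
  set s₂ := max (max s₀ s₁) (n / c') with hs₂
  have hle : ∀ s ≥ s₂, angle a b d s₀ Θ₀ s₂ + c' / 2 * (s - s₂) ≤ angle a b d s₀ Θ₀ s := by
    intro s hs
    have h0 : s₀ ≤ s₂ := (le_max_left _ _).trans (le_max_left _ _)
    have := le_of_hasDerivAt_nonneg (h := fun s => angle a b d s₀ Θ₀ s - c' / 2 * s) hs
      ((h.continuousOn_angle.mono fun x hx => h0.trans hx.1).sub (by fun_prop))
      (fun x hx => (h.hasDerivAt_angle (h0.trans_lt hx.1)).fun_sub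
        ((hasDerivAt_id x).const_mul (c' / 2))) (fun x hx => by
        have hx1 : s₁ ≤ x := ((le_max_right _ _).trans (le_max_left _ _)).trans hx.1.le
        have hx0 : 0 < x := hs₁.trans_le hx1
        rw [hd x hx1]
        have hne := h.ne x (h0.trans hx.1.le)
        have h1 := angleRate_ge hx0 hn ((min_le_left c 1).trans (hg x hx1)) (min_le_right c 1) hne
        have h2 : n / (2 * x) ≤ c' / 2 := by
          rw [div_le_div_iff₀ (by positivity) two_pos]
          have : n / c' ≤ x := (le_max_right _ _).trans hx.1.le
          rw [div_le_iff₀ hc'0] at this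
          linarith
        linarith)
    linarith
  refine tendsto_atTop_mono' atTop ((eventually_ge_atTop s₂).mono fun s hs => hle s hs) ?_
  refine tendsto_atTop_add_const_left _ _ ?_
  exact (tendsto_atTop_add_const_right _ _ tendsto_id).const_mul_atTop (by positivity)

end SupercriticalNeumann

end

/-! ### The phase of the normalized difference and the critical points -/

open Set Filter Topology MeasureTheory

noncomputable section

namespace SupercriticalNeumann

theorem two_abs_mul_abs_le (x y : ℝ) : 2 * (|x| * |y|) ≤ x ^ 2 + y ^ 2 := by
  have := sq_nonneg (|x| - |y|)
  have e1 := sq_abs x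
  have e2 := sq_abs y
  nlinarith

/-- A nontrivial solution of a linear radial equation has only simple zeros. -/
theorem radial_sq_add_sq_ne_zero {n L R : ℝ} (hn : 0 ≤ n) (hL : 0 ≤ L) {y z d : ℝ → ℝ}
    (hy : ContinuousOn y (Icc 0 R)) (hz : ContinuousOn z (Icc 0 R)) (hy0 : y 0 ≠ 0)
    (hdy : ∀ s ∈ Ioo 0 R, HasDerivAt y (z s) s)
    (hdz : ∀ s ∈ Ioo 0 R, HasDerivAt z (-(n / s * z s) - d s) s)
    (hd : ∀ s ∈ Ioo 0 R, |d s| ≤ L * |y s|) :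
    ∀ s ∈ Icc 0 R, y s ^ 2 + z s ^ 2 ≠ 0 := by
  intro s hs h0
  rcases hs.1.eq_or_lt with rfl | hs0
  · exact hy0 (pow_eq_zero_iff two_ne_zero |>.1 (by nlinarith [sq_nonneg (y 0), sq_nonneg (z 0)]))
  -- A double zero at `s` propagates backward by Grönwall on `[x,s]`, where the friction is at most
  -- `n/x`. Continuity then carries the zero to the origin, where `y 0 ≠ 0`.
  have hzero : ∀ x ∈ Ioo 0 s, y x = 0 := fun x hx => by
    have hsub : Icc x s ⊆ Icc 0 R := Icc_subset_Icc hx.1.le hs.2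
    have hsub' : Ioo x s ⊆ Ioo 0 R := Ioo_subset_Ioo hx.1.le hs.2
    have h := le_mul_exp_of_le_deriv (V := fun s => y s ^ 2 + z s ^ 2)
      (V' := fun s => 2 * y s * z s + 2 * z s * (-(n / s * z s) - d s))
      (C := 1 + L + 2 * (n / x)) hx.2.le
      (((hy.mono hsub).pow 2).add ((hz.mono hsub).pow 2)) (fun t ht => by
        have h1 := (hdy t (hsub' ht)).fun_pow 2
        have h2 := (hdz t (hsub' ht)).fun_pow 2
        simpa using h1.fun_add h2) (fun t ht => by
        have h1 := hd t (hsub' ht)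
        have h2 : n / t * z t ^ 2 ≤ n / x * z t ^ 2 := by
          have := hx.1
          have := ht.1
          gcongr
        have h2' : n / x * z t ^ 2 ≤ n / x * (y t ^ 2 + z t ^ 2) := by
          have : 0 ≤ n / x := div_nonneg hn hx.1.le
          nlinarith [sq_nonneg (y t)]
        have h3 : z t * d t ≤ |z t| * (L * |y t|) := by
          refine (le_abs_self _).trans ?_
          rw [abs_mul]
          gcongr
        have h4 : -(y t * z t) ≤ |z t| * |y t| := by
          refine (neg_le_abs _).trans ?_
          rw [abs_mul, mul_comm]
        have h5 := two_abs_mul_abs_le (z t) (y t)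
        have h6 := mul_le_mul_of_nonneg_left h5 hL
        nlinarith)
    simp only [h0, zero_mul] at h
    exact pow_eq_zero_iff two_ne_zero |>.1 (by nlinarith [sq_nonneg (y x), sq_nonneg (z x)])
  refine hy0 ?_
  have hcl : (0 : ℝ) ∈ closure (Ioo 0 s) := by
    rw [closure_Ioo hs0.ne]; exact left_mem_Icc.2 hs0.le
  have hc : ContinuousOn y (closure (Ioo 0 s)) := by
    rw [closure_Ioo hs0.ne]; exact hy.mono (Icc_subset_Icc_right hs.2)
  have := hc.image_closure ⟨0, hcl, rfl⟩
  have h2 : y '' Ioo 0 s ⊆ {0} := by rintro _ ⟨x, hx, rfl⟩; exact hzero x hx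
  have h3 := closure_mono h2 this
  rw [closure_singleton] at h3
  exact h3

/-- The polar angle of `(v, v')` along a regular family. -/
def phase (N : ℕ) (v k a : ℝ → ℝ → ℝ) (s γ : ℝ) : ℝ :=
  angle (fun s => v s γ) (fun s => -(s * k s γ))
    (fun s => -(a s γ * v s γ - ((N : ℝ) - 1) * k s γ)) 0 0 s

namespace RegularFamily

variable {N : ℕ} {p : ℝ} {u m h v k a : ℝ → ℝ → ℝ}

theorem slice {F : ℝ → ℝ → ℝ} (hF : Continuous fun q : ℝ × ℝ => F q.1 q.2) (γ : ℝ) :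
    Continuous fun s => F s γ := hF.comp (f := fun s : ℝ => (s, γ)) (by fun_prop)

theorem radialSol (R : RegularFamily N p u m h v k a) {γ : ℝ} (hγ : 0 < γ) :
    RadialSol N p (fun s => u s γ) (fun s => -(s * m s γ)) (Ioi 0) where
  subset := Subset.rfl
  deriv_u s _ := R.deriv_u γ s
  deriv_w s hs := by
    refine (R.deriv_m γ s).fun_neg.congr_deriv ?_
    have : s ≠ 0 := (mem_Ioi.1 hs).ne'
    rw [R.h_eq γ hγ s (mem_Ioi.1 hs).le]
    field_simp
    ring
  pos s hs := R.u_pos γ hγ s (mem_Ioi.1 hs).le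

theorem v_ne (hN : 3 ≤ N) (R : RegularFamily N p u m h v k a) (γ : ℝ) {s : ℝ} (hs : 0 ≤ s) :
    v s γ ^ 2 + (-(s * k s γ)) ^ 2 ≠ 0 := by
  have h3 : (3 : ℝ) ≤ N := by exact_mod_cast hN
  have c1 := slice R.cont_v γ
  have c2 := slice R.cont_k γ
  have c3 := slice R.cont_a γ
  obtain ⟨L, hL⟩ := (isCompact_Icc (a := 0) (b := s)).exists_bound_of_continuousOn
    c3.continuousOn
  have hL0 : 0 ≤ L := (norm_nonneg _).trans (hL 0 (left_mem_Icc.2 hs))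
  exact radial_sq_add_sq_ne_zero (n := (N : ℝ) - 1) (L := L) (R := s) (by linarith) hL0
    (y := fun s => v s γ) (z := fun s => -(s * k s γ)) (d := fun s => a s γ * v s γ)
    (by fun_prop) (by fun_prop) (by rw [R.v_zero]; exact one_ne_zero)
    (fun s _ => R.deriv_v γ s) (fun s hs => by
      refine (R.deriv_k γ s).fun_neg.congr_deriv ?_
      have := hs.1.ne'
      field_simp
      ring)
    (fun s hs => by
      rw [abs_mul]
      exact mul_le_mul_of_nonneg_right (hL s (Ioo_subset_Icc_self hs)) (abs_nonneg _))
    s (right_mem_Icc.2 hs)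

theorem phaseCurve (hN : 3 ≤ N) (R : RegularFamily N p u m h v k a) (γ : ℝ) :
    PhaseCurve (fun s => v s γ) (fun s => -(s * k s γ))
      (fun s => -(a s γ * v s γ - ((N : ℝ) - 1) * k s γ)) 0 0 where
  deriv_a s _ := R.deriv_v γ s
  deriv_b s _ := (R.deriv_k γ s).fun_neg
  cont_d := by
    have c1 := slice R.cont_v γ
    have c2 := slice R.cont_k γ
    have c3 := slice R.cont_a γ
    fun_prop
  ne s hs := R.v_ne hN γ hs
  init := ⟨1, one_pos, by simp [R.v_zero], by simp⟩

/-- At the origin the angle starts exactly on the level `0`, so its speed there is needed. The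
equation leaves `1/N` of the coefficient, since `N - 1` parts go to the friction. -/
theorem k_zero (hN : 3 ≤ N) (R : RegularFamily N p u m h v k a) (γ : ℝ) :
    k 0 γ = a 0 γ / N := by
  have h3 : (3 : ℝ) ≤ N := by exact_mod_cast hN
  have h1 := R.deriv_k γ 0
  have h2 : HasDerivAt (fun s => s * k s γ) (k 0 γ) 0 := by
    rw [hasDerivAt_iff_tendsto_slope]
    refine ((slice R.cont_k γ).continuousAt.tendsto.mono_left nhdsWithin_le_nhds).congr' ?_
    filter_upwards [self_mem_nhdsWithin] with x hx
    have : x ≠ 0 := hx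
    simp [slope_def_field]
    field_simp
  have := h1.unique h2
  rw [R.v_zero] at this
  rw [eq_div_iff (by linarith)]
  linarith

theorem continuousOn_phase (hN : 3 ≤ N) (R : RegularFamily N p u m h v k a) :
    ContinuousOn (fun q : ℝ × ℝ => phase N v k a q.1 q.2) (Ici 0 ×ˢ univ) := by
  -- The curve is known not to vanish only for `s ≥ 0`; the reflection `|s|` makes the integrand
  -- continuous on the whole line.
  have habs : Continuous fun q : ℝ × ℝ => (|q.2|, q.1) := by fun_prop
  have c1 : Continuous fun q : ℝ × ℝ => v |q.2| q.1 := R.cont_v.comp habs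
  have c2 : Continuous fun q : ℝ × ℝ => k |q.2| q.1 := R.cont_k.comp habs
  have c3 : Continuous fun q : ℝ × ℝ => a |q.2| q.1 := R.cont_a.comp habs
  have hc : Continuous fun q : ℝ × ℝ => angleRate (v |q.2| q.1) (-(|q.2| * k |q.2| q.1))
      (-(a |q.2| q.1 * v |q.2| q.1 - ((N : ℝ) - 1) * k |q.2| q.1)) := by
    unfold angleRate
    have cs : Continuous fun q : ℝ × ℝ => |q.2| := by fun_prop
    exact Continuous.div (((cs.mul c2).neg.pow 2).sub
      (c1.mul ((c3.mul c1).sub (continuous_const.mul c2)).neg))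
      ((c1.pow 2).add ((cs.mul c2).neg.pow 2)) fun q => R.v_ne hN q.1 (abs_nonneg _)
  have hI := intervalIntegral.continuous_parametric_intervalIntegral_of_continuous (μ := volume)
    (a₀ := 0) (X := ℝ × ℝ)
    (f := fun q s => angleRate (v |s| q.2) (-(|s| * k |s| q.2))
      (-(a |s| q.2 * v |s| q.2 - ((N : ℝ) - 1) * k |s| q.2)))
    (hc.comp (f := fun q : (ℝ × ℝ) × ℝ => (q.1.2, q.2)) (by fun_prop)) continuous_fst
  refine hI.continuousOn.congr fun q hq => ?_
  simp only [phase, angle, zero_add]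
  refine intervalIntegral.integral_congr fun s hs => ?_
  rw [uIcc_of_le hq.1] at hs
  simp only [abs_of_nonneg hs.1]

theorem phase_zero (γ : ℝ) : phase N v k a 0 γ = 0 := by
  rw [phase]; exact PhaseCurve.angle_self

/-- At a critical point of `v` the angular velocity equals the coefficient `f(u)/(u-1) > 0` for `s >
0`, and this value divided by `N` at the origin. Hence each level `nπ` is crossed only upward, and
so at most once. -/
theorem rate_pos (hN : 3 ≤ N) (hp : 1 < p) (R : RegularFamily N p u m h v k a) {γ : ℝ} (hγ : 0 < γ)
    {s : ℝ} (hs : 0 ≤ s) (hk : s * k s γ = 0) :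
    0 < angleRate (v s γ) (-(s * k s γ)) (-(a s γ * v s γ - ((N : ℝ) - 1) * k s γ)) := by
  have h3 : (3 : ℝ) ≤ N := by exact_mod_cast hN
  have hne := R.v_ne hN γ hs
  have ha : 0 < a s γ := by rw [R.a_eq γ hγ s hs]; exact fSlope_pos hp (R.u_pos γ hγ s hs)
  rw [hk] at hne ⊢
  have hv : v s γ ≠ 0 := fun h0 => hne (by rw [h0]; ring)
  have hv2 : 0 < v s γ ^ 2 := by positivity
  rcases hs.eq_or_lt with rfl | hs
  · rw [angleRate, R.v_zero, R.k_zero hN]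
    have : a 0 γ - ((N : ℝ) - 1) * (a 0 γ / N) = a 0 γ / N := by field_simp; ring
    rw [mul_one, this]
    have : 0 < a 0 γ / N := by positivity
    norm_num
    exact this
  · have : k s γ = 0 := (mul_eq_zero.1 hk).resolve_left hs.ne'
    rw [angleRate, this]
    apply div_pos
    · nlinarith [mul_pos ha hv2]
    · nlinarith

theorem rate_pos_of_phase (hN : 3 ≤ N) (hp : 1 < p) (R : RegularFamily N p u m h v k a) {γ : ℝ}
    (hγ : 0 < γ) (n : ℕ) : ∀ s ≥ 0, phase N v k a s γ = n * Real.pi →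
      0 < angleRate (v s γ) (-(s * k s γ)) (-(a s γ * v s γ - ((N : ℝ) - 1) * k s γ)) := by
  intro s hs h
  refine R.rate_pos hN hp hγ hs ?_
  obtain ⟨ρ, _, _, h2⟩ := (R.phaseCurve hN γ).polar hs
  rw [← phase, h, Real.sin_nat_mul_pi] at h2
  simpa using h2

theorem phase_lt (hN : 3 ≤ N) (hp : 1 < p) (R : RegularFamily N p u m h v k a) {γ : ℝ}
    (hγ : 0 < γ) (n : ℕ) {s t : ℝ} (hs : 0 ≤ s) (hst : s < t) (h : n * Real.pi ≤ phase N v k a s γ) :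
    n * Real.pi < phase N v k a t γ :=
  (R.phaseCurve hN γ).angle_lt (R.rate_pos_of_phase hN hp hγ n) hs hst h

theorem phase_pos (hN : 3 ≤ N) (hp : 1 < p) (R : RegularFamily N p u m h v k a) {γ : ℝ}
    (hγ : 0 < γ) {s : ℝ} (hs : 0 < s) : 0 < phase N v k a s γ := by
  simpa using R.phase_lt hN hp hγ 0 le_rfl hs (by simp [phase_zero])

theorem pohozaev_neg (hN : 3 ≤ N) (hp : pS N < p) (R : RegularFamily N p u m h v k a) {γ : ℝ}
    (hγ : 0 < γ) {s : ℝ} (hs : 0 < s) : pohozaev N p s (u s γ) (-(s * m s γ)) < 0 := by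
  have c1 := slice R.cont_u γ
  have c2 := slice R.cont_m γ
  have := pohozaev_lt_of_radialSol hN hp hs ((R.radialSol hγ).mono fun x hx => hx.1)
    (by fun_prop) (by fun_prop)
  rwa [pohozaev_zero (one_lt_of_pS_lt hN hp)] at this

theorem pohozaev_le (hN : 3 ≤ N) (hp : pS N < p) (R : RegularFamily N p u m h v k a) {γ : ℝ}
    (hγ : 0 < γ) {s t : ℝ} (hs : 0 ≤ s) (hst : s ≤ t) :
    pohozaev N p t (u t γ) (-(t * m t γ)) ≤ pohozaev N p s (u s γ) (-(s * m s γ)) := by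
  rcases hst.eq_or_lt with rfl | hst
  · rfl
  have c1 := slice R.cont_u γ
  have c2 := slice R.cont_m γ
  exact (pohozaev_lt_of_radialSol hN hp hst ((R.radialSol hγ).mono fun x hx => hs.trans_lt hx.1)
    (by fun_prop) (by fun_prop)).le

theorem energy_le (hN : 3 ≤ N) (hp : 1 < p) (R : RegularFamily N p u m h v k a) {γ : ℝ}
    (hγ : 0 < γ) {s t : ℝ} (hs : 0 ≤ s) (hst : s ≤ t) :
    energy p (u t γ) (-(t * m t γ)) ≤ energy p (u s γ) (-(s * m s γ)) := by
  have c1 := slice R.cont_u γ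
  have c2 := slice R.cont_m γ
  exact energy_le_of_radialSol hN hp hst ((R.radialSol hγ).mono fun x hx => hs.trans_lt hx.1)
    (by fun_prop) (by fun_prop)

theorem tendsto_phase (hN : 3 ≤ N) (hp : pS N < p) (R : RegularFamily N p u m h v k a) {γ : ℝ}
    (hγ : 0 < γ) : Tendsto (fun s => phase N v k a s γ) atTop atTop := by
  have hp1 := one_lt_of_pS_lt hN hp
  have h3 : (3 : ℝ) ≤ N := by exact_mod_cast hN
  have c1 := slice R.cont_u γ
  obtain ⟨b, hb, s₁, hs₁, hlow⟩ := (R.radialSol hγ).exists_lower_bound hN hp1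
    (c := -pohozaev N p 1 (u 1 γ) (-(1 * m 1 γ))) (s₀ := 1)
    (neg_pos.2 (R.pohozaev_neg hN hp hγ one_pos))
    (fun s hs => by rw [neg_neg]; exact R.pohozaev_le hN hp hγ zero_le_one hs) (by
      -- Below the peak the initial energy `F(γ)` is negative; at or above it the solution starts
      -- above `1`. These are the two alternatives for the lower bound.
      rcases lt_or_ge γ (peak p) with h1 | h1
      · left
        refine ⟨1, one_pos, (R.energy_le hN hp1 hγ le_rfl zero_le_one).trans_lt ?_⟩
        rw [energy, R.u_zero]
        have := (fPrim_neg_iff hp1 hγ).2 h1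
        simpa using this
      · right
        have h2 : ∀ᶠ s in 𝓝 (0 : ℝ), 1 < u s γ := by
          refine c1.continuousAt.eventually (lt_mem_nhds ?_)
          change 1 < u 0 γ
          rw [R.u_zero]
          exact (one_lt_peak hp1).trans_le h1
        exact ((h2.filter_mono nhdsWithin_le_nhds).mono fun s hs => hs.le).frequently)
  obtain ⟨c, hc, hcg⟩ := exists_fSlope_ge hp1 hb
  refine (R.phaseCurve hN γ).tendsto_angle (n := (N : ℝ) - 1) (g := fun s => a s γ) (c := c)
    (s₁ := s₁) (by linarith) hc hs₁ (fun s hs => ?_) (fun s hs => ?_)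
  · rw [R.a_eq γ hγ s (hs₁.le.trans hs)]
    exact hcg _ (hlow s hs)
  · have : s ≠ 0 := (hs₁.trans_le hs).ne'
    field_simp
    ring

theorem exists_phase_eq (hN : 3 ≤ N) (hp : pS N < p) (R : RegularFamily N p u m h v k a) {γ : ℝ}
    (hγ : 0 < γ) (n : ℕ) : ∃ s ≥ 0, phase N v k a s γ = n * Real.pi := by
  obtain ⟨b, hb0, hb⟩ := ((eventually_ge_atTop 0).and
    ((R.tendsto_phase hN hp hγ).eventually (eventually_ge_atTop (n * Real.pi)))).exists
  have hcont : ContinuousOn (fun s => phase N v k a s γ) (Icc 0 b) :=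
    (R.phaseCurve hN γ).continuousOn_angle.mono Icc_subset_Ici_self
  obtain ⟨s, hs, hs0⟩ := intermediate_value_Icc hb0 hcont
    (⟨by rw [phase_zero]; have := Real.pi_pos; positivity, hb⟩ : (n * Real.pi) ∈ Icc _ _)
  exact ⟨s, hs.1, hs0⟩

end RegularFamily

open Classical in
/-- The `n`-th critical point of the regular solution. -/
def critPoint (N : ℕ) (v k a : ℝ → ℝ → ℝ) (n : ℕ) (γ : ℝ) : ℝ :=
  if h : ∃ s ≥ 0, phase N v k a s γ = n * Real.pi then h.choose else 0

namespace RegularFamily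

variable {N : ℕ} {p : ℝ} {u m h v k a : ℝ → ℝ → ℝ}

theorem critPoint_spec (hN : 3 ≤ N) (hp : pS N < p) (R : RegularFamily N p u m h v k a) {γ : ℝ}
    (hγ : 0 < γ) (n : ℕ) :
    0 ≤ critPoint N v k a n γ ∧ phase N v k a (critPoint N v k a n γ) γ = n * Real.pi := by
  have h := R.exists_phase_eq hN hp hγ n
  rw [critPoint, dif_pos h]
  exact h.choose_spec

theorem phase_lt_of_lt_critPoint (hN : 3 ≤ N) (hp : pS N < p) (R : RegularFamily N p u m h v k a)
    {γ : ℝ} (hγ : 0 < γ) (n : ℕ) {s : ℝ} (hs : 0 ≤ s) (hsn : s < critPoint N v k a n γ) :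
    phase N v k a s γ < n * Real.pi := by
  by_contra hcon
  have := R.phase_lt hN (one_lt_of_pS_lt hN hp) hγ n hs hsn (not_lt.1 hcon)
  rw [(R.critPoint_spec hN hp hγ n).2] at this
  exact lt_irrefl _ this

theorem lt_phase_of_critPoint_lt (hN : 3 ≤ N) (hp : pS N < p) (R : RegularFamily N p u m h v k a)
    {γ : ℝ} (hγ : 0 < γ) (n : ℕ) {s : ℝ} (hsn : critPoint N v k a n γ < s) :
    n * Real.pi < phase N v k a s γ :=
  R.phase_lt hN (one_lt_of_pS_lt hN hp) hγ n (R.critPoint_spec hN hp hγ n).1 hsn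
    (R.critPoint_spec hN hp hγ n).2.ge

theorem lt_critPoint_iff (hN : 3 ≤ N) (hp : pS N < p) (R : RegularFamily N p u m h v k a)
    {γ : ℝ} (hγ : 0 < γ) (n : ℕ) {s : ℝ} (hs : 0 ≤ s) :
    s < critPoint N v k a n γ ↔ phase N v k a s γ < n * Real.pi := by
  refine ⟨R.phase_lt_of_lt_critPoint hN hp hγ n hs, fun h1 => ?_⟩
  by_contra hcon
  rcases (not_lt.1 hcon).eq_or_lt with h2 | h2
  · rw [← h2, (R.critPoint_spec hN hp hγ n).2] at h1
    exact lt_irrefl _ h1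
  · exact lt_asymm h1 (R.lt_phase_of_critPoint_lt hN hp hγ n h2)

theorem critPoint_lt_iff (hN : 3 ≤ N) (hp : pS N < p) (R : RegularFamily N p u m h v k a)
    {γ : ℝ} (hγ : 0 < γ) (n : ℕ) {s : ℝ} (hs : 0 ≤ s) :
    critPoint N v k a n γ < s ↔ n * Real.pi < phase N v k a s γ := by
  refine ⟨R.lt_phase_of_critPoint_lt hN hp hγ n, fun h1 => ?_⟩
  by_contra hcon
  rcases (not_lt.1 hcon).eq_or_lt with h2 | h2
  · rw [h2, (R.critPoint_spec hN hp hγ n).2] at h1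
    exact lt_irrefl _ h1
  · exact lt_asymm h1 (R.phase_lt_of_lt_critPoint hN hp hγ n hs h2)

theorem critPoint_eq_iff (hN : 3 ≤ N) (hp : pS N < p) (R : RegularFamily N p u m h v k a)
    {γ : ℝ} (hγ : 0 < γ) (n : ℕ) {s : ℝ} (hs : 0 ≤ s) :
    critPoint N v k a n γ = s ↔ phase N v k a s γ = n * Real.pi := by
  have h1 := R.lt_critPoint_iff hN hp hγ n hs
  have h2 := R.critPoint_lt_iff hN hp hγ n hs
  constructor
  · rintro rfl
    exact (R.critPoint_spec hN hp hγ n).2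
  · intro h3
    refine le_antisymm (not_lt.1 fun h4 => ?_) (not_lt.1 fun h4 => ?_)
    · exact absurd (h1.1 h4) (by rw [h3]; exact lt_irrefl _)
    · exact absurd (h2.1 h4) (by rw [h3]; exact lt_irrefl _)

theorem critPoint_zero (hN : 3 ≤ N) (hp : pS N < p) (R : RegularFamily N p u m h v k a)
    {γ : ℝ} (hγ : 0 < γ) : critPoint N v k a 0 γ = 0 :=
  (R.critPoint_eq_iff hN hp hγ 0 le_rfl).2 (by simp [phase_zero])

theorem critPoint_strictMono (hN : 3 ≤ N) (hp : pS N < p) (R : RegularFamily N p u m h v k a)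
    {γ : ℝ} (hγ : 0 < γ) : StrictMono fun n => critPoint N v k a n γ := fun n n' hnn => by
  have h1 := R.critPoint_spec hN hp hγ n
  rw [R.lt_critPoint_iff hN hp hγ n' h1.1, h1.2]
  have : (n : ℝ) < n' := by exact_mod_cast hnn
  exact mul_lt_mul_of_pos_right this Real.pi_pos

theorem critPoint_pos (hN : 3 ≤ N) (hp : pS N < p) (R : RegularFamily N p u m h v k a)
    {γ : ℝ} (hγ : 0 < γ) {n : ℕ} (hn : 1 ≤ n) : 0 < critPoint N v k a n γ := by
  have := R.critPoint_strictMono hN hp hγ (show 0 < n from hn)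
  simpa [R.critPoint_zero hN hp hγ] using this

/-- A zero of `v'` is a zero of the sine of the phase, hence a phase `jπ`. Since the phase is
positive for `s > 0`, `j` is positive, and the `j`-th critical point is the only point with that
phase. -/
theorem k_eq_zero_iff (hN : 3 ≤ N) (hp : pS N < p) (R : RegularFamily N p u m h v k a)
    {γ : ℝ} (hγ : 0 < γ) {s : ℝ} (hs : 0 < s) :
    k s γ = 0 ↔ ∃ n ≥ 1, critPoint N v k a n γ = s := by
  obtain ⟨ρ, hρ, h1, h2⟩ := (R.phaseCurve hN γ).polar hs.le
  rw [← phase] at h1 h2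
  constructor
  · intro h0
    rw [h0, mul_zero, neg_zero, eq_comm, neg_eq_zero] at h2
    obtain ⟨j, hj⟩ := Real.sin_eq_zero_iff.1 ((mul_eq_zero.1 h2).resolve_left hρ.ne')
    have hpos := R.phase_pos hN (one_lt_of_pS_lt hN hp) hγ hs
    rw [← hj] at hpos
    have hj0 : 0 < j := by exact_mod_cast pos_of_mul_pos_left hpos Real.pi_pos.le
    obtain ⟨n, rfl⟩ := Int.eq_ofNat_of_zero_le hj0.le
    refine ⟨n, by exact_mod_cast hj0, (R.critPoint_eq_iff hN hp hγ n hs.le).2 ?_⟩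
    rw [← hj]
    push_cast
    rfl
  · rintro ⟨n, _, hn⟩
    have := (R.critPoint_eq_iff hN hp hγ n hs.le).1 hn
    rw [this, Real.sin_nat_mul_pi, mul_zero, neg_zero, neg_eq_zero] at h2
    exact (mul_eq_zero.1 h2).resolve_left hs.ne'

/-- The order characterizations `lt_critPoint_iff` and `critPoint_lt_iff` turn the inequalities
defining a limit into strict inequalities for the phase at a fixed point, which persist under small
changes of `γ`. -/
theorem continuousOn_critPoint (hN : 3 ≤ N) (hp : pS N < p) (R : RegularFamily N p u m h v k a)
    (n : ℕ) : ContinuousOn (critPoint N v k a n) (Ioi 0) := by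
  intro γ hγ
  refine ContinuousAt.continuousWithinAt ?_
  have hc : ∀ s ≥ 0, ContinuousAt (fun γ => phase N v k a s γ) γ := fun s hs => by
    have := (R.continuousOn_phase hN).comp_continuous (f := fun γ : ℝ => (s, γ))
      (by fun_prop) (fun x => ⟨hs, mem_univ _⟩)
    exact this.continuousAt
  refine tendsto_order.2 ⟨fun b hb => ?_, fun b hb => ?_⟩
  · rcases lt_or_ge b 0 with hb0 | hb0
    · filter_upwards [lt_mem_nhds (mem_Ioi.1 hγ)] with x hx
      exact hb0.trans_le (R.critPoint_spec hN hp hx n).1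
    · filter_upwards [lt_mem_nhds (mem_Ioi.1 hγ), (hc b hb0).eventually
        (gt_mem_nhds ((R.lt_critPoint_iff hN hp hγ n hb0).1 hb))] with x hx hx2
      exact (R.lt_critPoint_iff hN hp hx n hb0).2 hx2
  · have hb0 : 0 ≤ b := (R.critPoint_spec hN hp hγ n).1.trans hb.le
    filter_upwards [lt_mem_nhds (mem_Ioi.1 hγ), (hc b hb0).eventually
      (lt_mem_nhds ((R.critPoint_lt_iff hN hp hγ n hb0).1 hb))] with x hx hx2
    exact (R.critPoint_lt_iff hN hp hx n hb0).2 hx2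

end RegularFamily

end SupercriticalNeumann

end

/-! ### Differentiability of the critical points in the parameter -/

open Set Filter Topology MeasureTheory

noncomputable section

namespace SupercriticalNeumann

namespace RegularFamily

variable {N : ℕ} {p : ℝ} {u m h v k a : ℝ → ℝ → ℝ}

/-- The divided difference of `k` with respect to the parameter is jointly continuous. -/
theorem exists_divided_difference (hN : 3 ≤ N) (hp : 1 < p) (R : RegularFamily N p u m h v k a)
    {γa γb T : ℝ} (hγa : 0 < γa) (hab : γa ≤ γb) (hT : 0 ≤ T) :
    ∃ D : ℝ → ℝ × ℝ → ℝ, Continuous (fun q : ℝ × ℝ × ℝ => D q.1 q.2) ∧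
      ∀ s ∈ Ioc 0 T, ∀ γ₁ ∈ Icc γa γb, ∀ γ₂ ∈ Icc γa γb,
        k s γ₁ - k s γ₂ = (γ₁ - γ₂) * D s (γ₁, γ₂) := by
  have h3 : (3 : ℝ) ≤ N := by exact_mod_cast hN
  have hNc : ((N - 1 : ℕ) : ℝ) = (N : ℝ) - 1 := by
    rw [Nat.cast_sub (by omega)]; simp
  -- Projecting onto a compact box makes the coefficients bounded and continuous everywhere without
  -- changing them on the box.
  set P : ℝ × ℝ × ℝ → ℝ × ℝ × ℝ := fun q =>
    ((projIcc 0 T hT q.1 : ℝ), (projIcc γa γb hab q.2.1 : ℝ), (projIcc γa γb hab q.2.2 : ℝ)) with hP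
  have hPc : Continuous P := by fun_prop
  set K : Set (ℝ × ℝ × ℝ) := Icc 0 T ×ˢ Icc γa γb ×ˢ Icc γa γb with hK
  have hKc : IsCompact K := isCompact_Icc.prod (isCompact_Icc.prod isCompact_Icc)
  have hPK : ∀ q, P q ∈ K := fun q => ⟨Subtype.coe_prop _, Subtype.coe_prop _, Subtype.coe_prop _⟩
  have hPid : ∀ q ∈ K, P q = q := by
    rintro ⟨s, γ₁, γ₂⟩ ⟨h1, h2, h3⟩
    simp only [hP]
    rw [projIcc_of_mem _ h1, projIcc_of_mem _ h2, projIcc_of_mem _ h3]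
  have cu1 : Continuous fun q : ℝ × ℝ × ℝ => u q.1 q.2.1 :=
    R.cont_u.comp (f := fun q : ℝ × ℝ × ℝ => (q.1, q.2.1)) (by fun_prop)
  have cu2 : Continuous fun q : ℝ × ℝ × ℝ => u q.1 q.2.2 :=
    R.cont_u.comp (f := fun q : ℝ × ℝ × ℝ => (q.1, q.2.2)) (by fun_prop)
  have cv2 : Continuous fun q : ℝ × ℝ × ℝ => v q.1 q.2.2 :=
    R.cont_v.comp (f := fun q : ℝ × ℝ × ℝ => (q.1, q.2.2)) (by fun_prop)
  set G : ℝ × ℝ × ℝ → ℝ := fun q => dslope (fSlope p) (u q.1 q.2.2) (u q.1 q.2.1) with hG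
  have cG : ContinuousOn G K :=
    (continuousOn_dslope_of_contDiffOn isOpen_Ioi (contDiffOn_fSlope p)).comp
      (f := fun q : ℝ × ℝ × ℝ => (u q.1 q.2.1, u q.1 q.2.2)) (cu1.prodMk cu2).continuousOn
      (fun q hq => ⟨R.u_pos _ (hγa.trans_le hq.2.1.1) _ hq.1.1,
        R.u_pos _ (hγa.trans_le hq.2.2.1) _ hq.1.1⟩)
  -- With `G` the divided difference of the slope, `a₁v₁ - a₂v₂ = a₁(v₁-v₂) + G(u₁-u₂)v₂` and `u₁-u₂
  -- = (γ₁-1)(v₁-v₂) + (γ₁-γ₂)v₂`. So `(v₁-v₂)/(γ₁-γ₂)` solves a linear equation with coefficient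
  -- `A₀` and source `B₀`, which remains meaningful for `γ₁ = γ₂`.
  set A₀ : ℝ × ℝ × ℝ → ℝ := fun q =>
    fSlope p (u q.1 q.2.1) + v q.1 q.2.2 * G q * (q.2.1 - 1) with hA₀
  have cA : ContinuousOn A₀ K := by
    have := ((continuous_fSlope hp).comp cu1).continuousOn (s := K)
    exact this.add ((cv2.continuousOn.mul cG).mul (by fun_prop))
  set B₀ : ℝ × ℝ × ℝ → ℝ := fun q => G q * v q.1 q.2.2 ^ 2 with hB₀
  have cB : ContinuousOn B₀ K := cG.mul (cv2.pow 2).continuousOn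
  obtain ⟨L, hL⟩ := hKc.exists_bound_of_continuousOn cA
  obtain ⟨C, hC⟩ := hKc.exists_bound_of_continuousOn cB
  have cAP : Continuous fun q => A₀ (P q) := cA.comp_continuous hPc hPK
  have cBP : Continuous fun q => B₀ (P q) := cB.comp_continuous hPc hPK
  have hL0 : 0 ≤ L := (norm_nonneg _).trans (hL _ (hPK (0, 0, 0)))
  obtain ⟨z, D, _, hD, hzD⟩ := exists_radial_solution (P := ℝ × ℝ) (N - 1)
    (F := fun s π x => A₀ (P (s, π)) * x + B₀ (P (s, π))) (L := fun _ => L) (B := fun _ => C)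
    (c := fun _ => 0)
    (by
      have h1 : Continuous fun q : ℝ × (ℝ × ℝ) × ℝ => A₀ (P (q.1, q.2.1)) :=
        cAP.comp (f := fun q : ℝ × (ℝ × ℝ) × ℝ => (q.1, q.2.1)) (by fun_prop)
      have h2 : Continuous fun q : ℝ × (ℝ × ℝ) × ℝ => B₀ (P (q.1, q.2.1)) :=
        cBP.comp (f := fun q : ℝ × (ℝ × ℝ) × ℝ => (q.1, q.2.1)) (by fun_prop)
      exact (h1.mul (continuous_snd.comp continuous_snd)).add h2) continuous_const continuous_const continuous_const
    (fun s π x y => by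
      rw [show A₀ (P (s, π)) * x + B₀ (P (s, π)) - (A₀ (P (s, π)) * y + B₀ (P (s, π))) =
        A₀ (P (s, π)) * (x - y) by ring, abs_mul]
      exact mul_le_mul_of_nonneg_right (hL _ (hPK _)) (abs_nonneg _))
    (fun s π => by rw [mul_zero, zero_add]; exact hC _ (hPK _))
  refine ⟨D, hD, fun s hs γ₁ hγ₁ γ₂ hγ₂ => ?_⟩
  have c1 := slice R.cont_v γ₁
  have c2 := slice R.cont_v γ₂
  have c3 := slice R.cont_k γ₁
  have c4 := slice R.cont_k γ₂
  have hzc : Continuous fun s => z s (γ₁, γ₂) := continuous_iff_continuousAt.2 fun s =>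
    ((hzD (γ₁, γ₂)).2 s).1.continuousAt
  have hDc : Continuous fun s => D s (γ₁, γ₂) :=
    hD.comp (f := fun s : ℝ => (s, γ₁, γ₂)) (by fun_prop)
  have key := eq_zero_of_radial_ineq (n := (N : ℝ) - 1) (L := L) (R := T)
    (y := fun s => v s γ₁ - v s γ₂ - (γ₁ - γ₂) * z s (γ₁, γ₂))
    (z := fun s => -(s * k s γ₁) - -(s * k s γ₂) - (γ₁ - γ₂) * -(s * D s (γ₁, γ₂)))
    (d := fun s => A₀ (s, γ₁, γ₂) * (v s γ₁ - v s γ₂ - (γ₁ - γ₂) * z s (γ₁, γ₂)))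
    (by linarith) hL0 (by fun_prop) (by fun_prop)
    (by rw [R.v_zero, R.v_zero, (hzD _).1]; ring) (by simp)
    (fun s _ => ((R.deriv_v γ₁ s).fun_sub (R.deriv_v γ₂ s)).fun_sub
      (((hzD (γ₁, γ₂)).2 s).1.const_mul (γ₁ - γ₂)))
    (fun s hs => by
      refine (((R.deriv_k γ₁ s).fun_neg.fun_sub (R.deriv_k γ₂ s).fun_neg).fun_sub
        (((hzD (γ₁, γ₂)).2 s).2.fun_neg.const_mul (γ₁ - γ₂))).congr_deriv ?_
      have hγ₁0 : 0 < γ₁ := hγa.trans_le hγ₁.1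
      have hγ₂0 : 0 < γ₂ := hγa.trans_le hγ₂.1
      have e0 : P (s, γ₁, γ₂) = (s, γ₁, γ₂) := hPid _ ⟨Ioo_subset_Icc_self hs, hγ₁, hγ₂⟩
      have e1 := R.v_eq γ₁ hγ₁0 s hs.1.le
      have e2 := R.v_eq γ₂ hγ₂0 s hs.1.le
      have e3 : (u s γ₁ - u s γ₂) * G (s, γ₁, γ₂) = fSlope p (u s γ₁) - fSlope p (u s γ₂) := by
        have := sub_smul_dslope (fSlope p) (u s γ₂) (u s γ₁)
        simpa using this
      rw [R.a_eq γ₁ hγ₁0 s hs.1.le, R.a_eq γ₂ hγ₂0 s hs.1.le, hNc, e0]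
      simp only [hA₀, hB₀]
      have hs0 := hs.1.ne'
      have e4 : fSlope p (u s γ₂) = fSlope p (u s γ₁) -
          ((γ₁ - 1) * v s γ₁ - (γ₂ - 1) * v s γ₂) * G (s, γ₁, γ₂) := by
        rw [← e1, ← e2]; linarith
      rw [e4]
      field_simp
      ring)
    (fun s hs => by
      rw [abs_mul]
      exact mul_le_mul_of_nonneg_right (hL _ ⟨Ioo_subset_Icc_self hs, hγ₁, hγ₂⟩) (abs_nonneg _))
    s ⟨hs.1.le, hs.2⟩
  have h2 := key.2
  have h4 : s * (k s γ₁ - k s γ₂ - (γ₁ - γ₂) * D s (γ₁, γ₂)) = 0 := by linarith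
  have := (mul_eq_zero.1 h4).resolve_left hs.1.ne'
  linarith

/-- An implicit function argument by divided differences. Writing `0 = k(c(x),x)` as `k(c(x),γ) +
(x-γ)D` expresses the difference quotient of `c` as `-c(x) D` over a divided difference of `s
k(s,γ)` in `s`. The denominator tends to `a v`, which is nonzero at a critical point because zeros
of `v` are simple. The limit is continuous in `γ`. -/
theorem contDiffOn_critPoint (hN : 3 ≤ N) (hp : pS N < p) (R : RegularFamily N p u m h v k a)
    {n : ℕ} (hn : 1 ≤ n) : ContDiffOn ℝ 1 (critPoint N v k a n) (Ioi 0) := by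
  have hp1 := one_lt_of_pS_lt hN hp
  set c := critPoint N v k a n with hc
  have hcc : ∀ γ > 0, ContinuousAt c γ := fun γ hγ =>
    (R.continuousOn_critPoint hN hp n).continuousAt (Ioi_mem_nhds hγ)
  have hcpos : ∀ γ > 0, 0 < c γ := fun γ hγ => R.critPoint_pos hN hp hγ hn
  have hk0 : ∀ γ > 0, k (c γ) γ = 0 := fun γ hγ =>
    (R.k_eq_zero_iff hN hp hγ (hcpos γ hγ)).2 ⟨n, hn, rfl⟩
  set e : ℝ → ℝ := fun γ => a (c γ) γ * v (c γ) γ with he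
  have he0 : ∀ γ > 0, e γ ≠ 0 := fun γ hγ h0 => by
    have ha : 0 < a (c γ) γ := by
      rw [R.a_eq γ hγ _ (hcpos γ hγ).le]
      exact fSlope_pos hp1 (R.u_pos γ hγ _ (hcpos γ hγ).le)
    have hv := (mul_eq_zero.1 h0).resolve_left ha.ne'
    have := R.v_ne hN γ (hcpos γ hγ).le
    rw [hv, hk0 γ hγ] at this
    exact this (by ring)
  have hec : ∀ γ > 0, ContinuousAt e γ := fun γ hγ => by
    have h1 : ContinuousAt (fun γ => (c γ, γ)) γ := (hcc γ hγ).prodMk continuousAt_id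
    exact (R.cont_a.continuousAt.comp h1).mul (R.cont_v.continuousAt.comp h1)
  have hloc : ∀ γ₀ > 0, ∃ F : ℝ → ℝ, ContinuousAt F γ₀ ∧ ∀ᶠ γ in 𝓝 γ₀, HasDerivAt c (F γ) γ := by
    intro γ₀ hγ₀
    obtain ⟨D, hD, hkD⟩ := R.exists_divided_difference hN hp1 (γa := γ₀ / 2) (γb := 2 * γ₀)
      (T := c γ₀ + 1) (by linarith) (by linarith) (by linarith [hcpos γ₀ hγ₀])
    refine ⟨fun γ => -(c γ * D (c γ) (γ, γ)) / e γ, ?_, ?_⟩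
    · have h1 : ContinuousAt (fun γ => (c γ, γ, γ)) γ₀ :=
        (hcc γ₀ hγ₀).prodMk (continuousAt_id.prodMk continuousAt_id)
      have h2 : ContinuousAt (fun γ => D (c γ) (γ, γ)) γ₀ := hD.continuousAt.comp h1
      exact (((hcc γ₀ hγ₀).mul h2).neg).div (hec γ₀ hγ₀) (he0 γ₀ hγ₀)
    · filter_upwards [Ioo_mem_nhds (by linarith : γ₀ / 2 < γ₀) (by linarith : γ₀ < 2 * γ₀),
        (hcc γ₀ hγ₀).eventually (gt_mem_nhds (by linarith : c γ₀ < c γ₀ + 1))] with γ hγ hcγ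
      have hγ0 : 0 < γ := by linarith [hγ.1]
      rw [hasDerivAt_iff_tendsto_slope]
      set W : ℝ → ℝ := fun s => s * k s γ with hW
      have hWd : HasDerivAt W (e γ) (c γ) := by
        refine (R.deriv_k γ (c γ)).congr_deriv ?_
        rw [hk0 γ hγ0]
        simp [he]
      have hS : Tendsto (fun x => dslope W (c γ) (c x)) (𝓝 γ) (𝓝 (e γ)) := by
        have h1 : ContinuousAt (dslope W (c γ)) (c γ) :=
          continuousAt_dslope_same.2 hWd.differentiableAt
        have h2 := h1.tendsto.comp (hcc γ hγ0)
        rwa [dslope_same, hWd.deriv] at h2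
      have hDt : Tendsto (fun x => D (c x) (x, γ)) (𝓝 γ) (𝓝 (D (c γ) (γ, γ))) := by
        have h1 : ContinuousAt (fun x => (c x, x, γ)) γ :=
          (hcc γ hγ0).prodMk (continuousAt_id.prodMk continuousAt_const)
        exact (hD.continuousAt.comp h1).tendsto
      have hlim : Tendsto (fun x => -(c x * D (c x) (x, γ)) / dslope W (c γ) (c x)) (𝓝 γ)
          (𝓝 (-(c γ * D (c γ) (γ, γ)) / e γ)) :=
        (((hcc γ hγ0).tendsto.mul hDt).neg).div hS (he0 γ hγ0)
      refine (hlim.mono_left nhdsWithin_le_nhds).congr' ?_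
      have hne : ∀ᶠ x in 𝓝 γ, dslope W (c γ) (c x) ≠ 0 :=
        hS.eventually (isOpen_ne.mem_nhds (he0 γ hγ0))
      filter_upwards [self_mem_nhdsWithin, nhdsWithin_le_nhds hne,
        nhdsWithin_le_nhds (Ioo_mem_nhds hγ.1 hγ.2),
        nhdsWithin_le_nhds ((hcc γ hγ0).eventually (gt_mem_nhds hcγ))] with x hx hx1 hx2 hx3
      have hxγ : x - γ ≠ 0 := sub_ne_zero.2 hx
      have hx0 : 0 < x := by linarith [hx2.1]
      have h1 := hkD (c x) ⟨hcpos x hx0, hx3.le⟩ x (Ioo_subset_Icc_self hx2) γ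
        (Ioo_subset_Icc_self hγ)
      rw [hk0 x hx0] at h1
      have h2 := sub_smul_dslope W (c γ) (c x)
      simp only [smul_eq_mul] at h2
      have h3 : W (c γ) = 0 := by simp only [hW]; rw [hk0 γ hγ0, mul_zero]
      have h4 : W (c x) = c x * k (c x) γ := rfl
      rw [h3, h4, sub_zero] at h2
      rw [slope_def_field, div_eq_div_iff hx1 hxγ, h2]
      linear_combination c x * h1
  refine (contDiffOn_succ_iff_deriv_of_isOpen (n := 0) isOpen_Ioi).2 ⟨?_, by simp, ?_⟩
  · intro γ hγ
    obtain ⟨F, _, hF⟩ := hloc γ hγ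
    exact hF.self_of_nhds.differentiableAt.differentiableWithinAt
  · rw [contDiffOn_zero]
    intro γ hγ
    obtain ⟨F, hFc, hF⟩ := hloc γ hγ
    refine ContinuousAt.continuousWithinAt (hFc.congr ?_)
    filter_upwards [hF] with x hx
    exact hx.deriv.symm

end RegularFamily

end SupercriticalNeumann

end

/-! ### Regular solutions and eigenvalues in terms of the family -/

open Set Filter Topology MeasureTheory

noncomputable section

namespace SupercriticalNeumann

theorem contDiff_two_of_hasDerivAt {U U' U'' : ℝ → ℝ} (h1 : ∀ r, HasDerivAt U (U' r) r)
    (h2 : ∀ r, HasDerivAt U' (U'' r) r) (hc : Continuous U'') : ContDiff ℝ 2 U := by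
  have e1 : deriv U = U' := funext fun r => (h1 r).deriv
  have e2 : deriv U' = U'' := funext fun r => (h2 r).deriv
  have h3 : ContDiff ℝ 1 U' := contDiff_one_iff_deriv.2
    ⟨fun r => (h2 r).differentiableAt, by rw [e2]; exact hc⟩
  have := (contDiff_succ_iff_deriv (n := 1) (f := U)).2
    ⟨fun r => (h1 r).differentiableAt, by simp, by rw [e1]; exact h3⟩
  exact this

theorem isRadialNeumann_of_hasDerivAt {U U' U'' : ℝ → ℝ} (h1 : ∀ r, HasDerivAt U (U' r) r)
    (h2 : ∀ r, HasDerivAt U' (U'' r) r) (hc : Continuous U'') (h0 : U' 0 = 0) (h01 : U' 1 = 0) :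
    IsRadialNeumann U where
  contDiffOn := (contDiff_two_of_hasDerivAt h1 h2 hc).contDiffOn
  deriv_zero := by
    rw [(h1 0).hasDerivWithinAt.derivWithin (uniqueDiffOn_Icc zero_lt_one 0 (by simp)), h0]
  deriv_one := by
    rw [(h1 1).hasDerivWithinAt.derivWithin (uniqueDiffOn_Icc zero_lt_one 1 (by simp)), h01]

theorem IsRadialNeumann.congr {U V : ℝ → ℝ} (h : IsRadialNeumann U)
    (hUV : ∀ r ∈ Icc (0 : ℝ) 1, V r = U r) : IsRadialNeumann V where
  contDiffOn := h.contDiffOn.congr hUV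
  deriv_zero := by
    rw [derivWithin_congr hUV (hUV 0 (by simp))]; exact h.deriv_zero
  deriv_one := by
    rw [derivWithin_congr hUV (hUV 1 (by simp))]; exact h.deriv_one

theorem IsRadialNeumann.exists_deriv (N : ℕ) {U : ℝ → ℝ} (h : IsRadialNeumann U) :
    ∃ w : ℝ → ℝ, ContinuousOn w (Icc 0 1) ∧ w 0 = 0 ∧ w 1 = 0 ∧ ∀ r ∈ Ioo (0 : ℝ) 1,
      HasDerivAt U (w r) r ∧
        HasDerivAt w (-(((N : ℝ) - 1) / r * w r) + radialLaplacian N U r) r := by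
  refine ⟨derivWithin U (Icc 0 1), ?_, h.deriv_zero, h.deriv_one, fun r hr => ?_⟩
  · exact h.contDiffOn.continuousOn_derivWithin (uniqueDiffOn_Icc zero_lt_one) (by norm_num)
  have heq : ∀ x ∈ Ioo (0 : ℝ) 1, derivWithin U (Icc 0 1) x = deriv U x := fun x hx =>
    derivWithin_of_mem_nhds (Icc_mem_nhds hx.1 hx.2)
  have hC : ContDiffOn ℝ 2 U (Ioo 0 1) := h.contDiffOn.mono Ioo_subset_Icc_self
  have hd : DifferentiableOn ℝ U (Ioo 0 1) := hC.differentiableOn (by norm_num)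
  have hd2 : DifferentiableOn ℝ (deriv U) (Ioo 0 1) :=
    ((contDiffOn_succ_iff_deriv_of_isOpen (n := 1) isOpen_Ioo).1 hC).2.2.differentiableOn
      (by norm_num)
  have hm := isOpen_Ioo.mem_nhds hr
  constructor
  · rw [heq r hr]
    exact (hd.differentiableAt hm).hasDerivAt
  · have h2 := (hd2.differentiableAt hm).hasDerivAt
    have h3 : derivWithin U (Icc 0 1) =ᶠ[𝓝 r] deriv U := by
      filter_upwards [hm] with x hx using heq x hx
    refine (h2.congr_of_eventuallyEq h3).congr_deriv ?_
    rw [radialLaplacian, heq r hr]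
    ring

theorem radialLaplacian_congr {N : ℕ} {U V : ℝ → ℝ} {r : ℝ} (h : U =ᶠ[𝓝 r] V) :
    radialLaplacian N U r = radialLaplacian N V r := by
  rw [radialLaplacian, radialLaplacian, h.deriv.deriv_eq, h.deriv_eq]

theorem radialLaplacian_of_hasDerivAt {N : ℕ} {U U' : ℝ → ℝ} {U'' r : ℝ}
    (h1 : ∀ᶠ x in 𝓝 r, HasDerivAt U (U' x) x) (h2 : HasDerivAt U' U'' r) :
    radialLaplacian N U r = U'' + ((N : ℝ) - 1) / r * U' r := by
  have e1 : deriv U =ᶠ[𝓝 r] U' := by filter_upwards [h1] with x hx using hx.deriv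
  rw [radialLaplacian, e1.deriv_eq, h2.deriv, e1.self_of_nhds]

theorem ext_apply_of_mem (U : C(unitInterval, ℝ)) {r : ℝ} (hr : r ∈ Icc (0 : ℝ) 1) :
    ext U r = U ⟨r, hr⟩ := by
  rw [ext, IccExtend_of_mem _ _ hr]

theorem ext_eventuallyEq (U : C(unitInterval, ℝ)) {V : ℝ → ℝ} (h : ∀ r : unitInterval, U r = V r)
    {r : ℝ} (hr : r ∈ Ioo (0 : ℝ) 1) : ext U =ᶠ[𝓝 r] V := by
  filter_upwards [isOpen_Ioo.mem_nhds hr] with x hx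
  rw [ext_apply_of_mem U (Ioo_subset_Icc_self hx), h]

namespace RegularFamily

variable {N : ℕ} {p : ℝ} {u m h v k a : ℝ → ℝ → ℝ}

theorem m_eq (R : RegularFamily N p u m h v k a) {γ : ℝ} (hγ : 0 < γ) {s : ℝ} (hs : 0 < s) :
    m s γ = (γ - 1) * k s γ := by
  have h1 := R.deriv_u γ s
  have h2 := ((R.deriv_v γ s).const_mul (γ - 1)).const_add 1
  have h3 : (fun s => u s γ) =ᶠ[𝓝 s] fun s => 1 + (γ - 1) * v s γ := by
    filter_upwards [lt_mem_nhds hs] with x hx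
    have := R.v_eq γ hγ x hx.le
    linarith
  have h4 := h1.unique (h2.congr_of_eventuallyEq h3)
  have h5 : s * (m s γ - (γ - 1) * k s γ) = 0 := by linarith
  have := (mul_eq_zero.1 h5).resolve_left hs.ne'
  linarith

/-- The rescaled solution `r ↦ u(c r, γ)` on `[0,1]`. -/
def profile (R : RegularFamily N p u m h v k a) (c γ : ℝ) : C(unitInterval, ℝ) :=
  ⟨fun r => u (c * r) γ, by
    have := slice R.cont_u γ
    exact this.comp (by fun_prop)⟩

theorem profile_apply (R : RegularFamily N p u m h v k a) (c γ : ℝ) (r : unitInterval) :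
    R.profile c γ r = u (c * r) γ := rfl

theorem profile_zero (R : RegularFamily N p u m h v k a) (c γ : ℝ) : R.profile c γ 0 = γ := by
  rw [profile_apply]; simp [R.u_zero]

theorem continuous_profile (R : RegularFamily N p u m h v k a) :
    Continuous fun q : ℝ × ℝ => R.profile q.1 q.2 := by
  refine ContinuousMap.continuous_of_continuous_uncurry _ ?_
  exact R.cont_u.comp (f := fun x : (ℝ × ℝ) × unitInterval => (x.1.1 * (x.2 : ℝ), x.1.2))
    (by fun_prop)

theorem hasDerivAt_scaled (R : RegularFamily N p u m h v k a) (c γ r : ℝ) :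
    HasDerivAt (fun r => u (c * r) γ) (c * -(c * r * m (c * r) γ)) r ∧
    HasDerivAt (fun r => c * -(c * r * m (c * r) γ))
      (c * (-(h (c * r) γ - ((N : ℝ) - 1) * m (c * r) γ) * c)) r := by
  have hc : HasDerivAt (fun r => c * r) c r := by simpa using (hasDerivAt_id r).const_mul c
  constructor
  · have := (R.deriv_u γ (c * r)).comp r hc
    exact this.congr_deriv (by ring)
  · have := (R.deriv_m γ (c * r)).fun_neg.comp r hc
    exact this.const_mul c

theorem mem_regularSolutions (R : RegularFamily N p u m h v k a) {γ c : ℝ} (hγ : 0 < γ) (hc : 0 < c)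
    (hm : m c γ = 0) : (c ^ 2, R.profile c γ) ∈ regularSolutions N p := by
  have cm := slice R.cont_m γ
  have ch := slice R.cont_h γ
  refine ⟨by positivity, ?_, fun r => R.u_pos γ hγ _ (mul_nonneg hc.le r.2.1), fun r hr => ?_⟩
  · refine (isRadialNeumann_of_hasDerivAt (fun r => (R.hasDerivAt_scaled c γ r).1)
      (fun r => (R.hasDerivAt_scaled c γ r).2) (by fun_prop) (by simp) (by simp [hm])).congr ?_
    exact fun r hr => ext_apply_of_mem _ hr
  · simp only
    rw [radialLaplacian_congr (ext_eventuallyEq (R.profile c γ) (V := fun r => u (c * r) γ)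
      (fun r => rfl) hr), radialLaplacian_of_hasDerivAt
        (Eventually.of_forall fun r => (R.hasDerivAt_scaled c γ r).1)
        (R.hasDerivAt_scaled c γ r).2, ext_apply_of_mem _ (Ioo_subset_Icc_self hr), profile_apply,
        R.h_eq γ hγ _ (mul_nonneg hc.le hr.1.le)]
    have := hr.1.ne'
    simp only
    field_simp
    ring

/-- Uniqueness of the singular initial value problem: after rescaling by `√λ`, a regular solution is
the member of the family with the same value at the center. The boundary condition then says that
`√λ` is a critical point. -/
theorem eq_profile_of_mem (hN : 3 ≤ N) (hp : 1 < p) (R : RegularFamily N p u m h v k a)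
    {q : ℝ × C(unitInterval, ℝ)} (hq : q ∈ regularSolutions N p) :
    0 < q.2 0 ∧ q.2 = R.profile √q.1 (q.2 0) ∧ m √q.1 (q.2 0) = 0 := by
  obtain ⟨l, U⟩ := q
  obtain ⟨hl, hneu, hpos, heq⟩ := hq
  simp only at hl hneu hpos heq ⊢
  set γ := U 0 with hγ
  have hγ0 : 0 < γ := hpos 0
  have h3 : (3 : ℝ) ≤ N := by exact_mod_cast hN
  set c := √l with hc
  have hc0 : 0 < c := Real.sqrt_pos.2 hl
  have hc2 : c ^ 2 = l := Real.sq_sqrt hl.le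
  obtain ⟨w, hwc, hw0, hw1, hw⟩ := hneu.exists_deriv N
  have cu := slice R.cont_u γ
  have cm := slice R.cont_m γ
  have hUc : ContinuousOn (ext U) (Icc 0 1) := hneu.contDiffOn.continuousOn
  obtain ⟨M₁, hM₁⟩ := isCompact_Icc.exists_bound_of_continuousOn hUc
  set M := max M₁ (max γ (peak p)) with hM
  have hUmem : ∀ r ∈ Icc (0 : ℝ) 1, ext U r ∈ Icc 0 M := fun r hr =>
    ⟨by rw [ext_apply_of_mem _ hr]; exact (hpos _).le,
      ((le_abs_self _).trans (hM₁ r hr)).trans (le_max_left _ _)⟩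
  have humem : ∀ r ∈ Icc (0 : ℝ) 1, u (c * r) γ ∈ Icc 0 M := fun r hr =>
    ⟨(R.u_pos γ hγ0 _ (mul_nonneg hc0.le hr.1)).le,
      (R.u_le γ hγ0 _ (mul_nonneg hc0.le hr.1)).trans (le_max_right _ _)⟩
  have hM0 : 0 ≤ M := (hUmem 0 (by simp)).1.trans (hUmem 0 (by simp)).2
  have key := eq_zero_of_radial_ineq (n := (N : ℝ) - 1) (L := l * (1 + p * M ^ (p - 1))) (R := 1)
    (y := fun r => ext U r - u (c * r) γ)
    (z := fun r => w r - c * -(c * r * m (c * r) γ))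
    (d := fun r => l * (f p (ext U r) - f p (u (c * r) γ)))
    (by linarith) (by positivity) (hUc.sub (by fun_prop)) (hwc.sub (by fun_prop))
    (by
      rw [ext_apply_of_mem U (by simp : (0 : ℝ) ∈ Icc (0 : ℝ) 1), mul_zero, R.u_zero]
      exact sub_self _)
    (by simp [hw0])
    (fun r hr => (hw r hr).1.fun_sub (R.hasDerivAt_scaled c γ r).1)
    (fun r hr => by
      refine ((hw r hr).2.fun_sub (R.hasDerivAt_scaled c γ r).2).congr_deriv ?_
      have h1 : radialLaplacian N (ext U) r = -(l * f p (ext U r)) := by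
        linarith [heq r hr]
      rw [h1, R.h_eq γ hγ0 _ (mul_nonneg hc0.le hr.1.le), ← hc2]
      have := hr.1.ne'
      field_simp
      ring)
    (fun r hr => by
      rw [abs_mul, abs_of_pos hl, mul_assoc]
      exact mul_le_mul_of_nonneg_left (abs_f_sub_f_le hp (hUmem r (Ioo_subset_Icc_self hr))
        (humem r (Ioo_subset_Icc_self hr))) hl.le)
  refine ⟨hγ0, ?_, ?_⟩
  · refine ContinuousMap.ext fun r => ?_
    have := (key r r.2).1
    simp only [ext_apply_of_mem U r.2] at this
    rw [profile_apply]
    exact sub_eq_zero.1 this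
  · have := (key 1 (by simp)).2
    simp only [hw1, mul_one] at this
    have h2 : c * (c * m c γ) = 0 := by linarith
    exact (mul_eq_zero.1 ((mul_eq_zero.1 h2).resolve_left hc0.ne')).resolve_left hc0.ne'

theorem u_one (R : RegularFamily N p u m h v k a) {s : ℝ} (hs : 0 ≤ s) : u s 1 = 1 := by
  have := R.v_eq 1 one_pos s hs
  linarith

theorem profile_one (R : RegularFamily N p u m h v k a) {c : ℝ} (hc : 0 ≤ c) :
    R.profile c 1 = 1 := by
  refine ContinuousMap.ext fun r => ?_
  rw [profile_apply, R.u_one (mul_nonneg hc r.2.1)]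
  rfl

/-- The radial Neumann eigenvalues in terms of the critical points of the linearization at `1`. -/
theorem range_eigenvalues (hN : 3 ≤ N) (hp : pS N < p) (R : RegularFamily N p u m h v k a) :
    range (fun n => (p - 1) * critPoint N v k a n 1 ^ 2) = radialNeumannEigenvalues N := by
  have hp1 := one_lt_of_pS_lt hN hp
  have h3 : (3 : ℝ) ≤ N := by exact_mod_cast hN
  have cv := slice R.cont_v 1
  have ck := slice R.cont_k 1
  have ca := slice R.cont_a 1
  have ha : ∀ s ≥ 0, a s 1 = p - 1 := fun s hs => by
    rw [R.a_eq 1 one_pos s hs, R.u_one hs, fSlope_one hp1]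
  have hsc : ∀ c r : ℝ, HasDerivAt (fun r => v (c * r) 1) (c * -(c * r * k (c * r) 1)) r ∧
      HasDerivAt (fun r => c * -(c * r * k (c * r) 1))
        (c * (-(a (c * r) 1 * v (c * r) 1 - ((N : ℝ) - 1) * k (c * r) 1) * c)) r := by
    intro c r
    have hc : HasDerivAt (fun r => c * r) c r := by simpa using (hasDerivAt_id r).const_mul c
    constructor
    · have := (R.deriv_v 1 (c * r)).comp r hc
      exact this.congr_deriv (by ring)
    · have := (R.deriv_k 1 (c * r)).fun_neg.comp r hc
      exact this.const_mul c
  apply Subset.antisymm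
  · rintro _ ⟨n, rfl⟩
    set c := critPoint N v k a n 1 with hc
    have hc0 : 0 ≤ c := (R.critPoint_spec hN hp one_pos n).1
    have hck : c * k c 1 = 0 := by
      rcases hc0.eq_or_lt with h0 | h0
      · rw [← h0, zero_mul]
      · have hn : 1 ≤ n := by
          rcases Nat.eq_zero_or_pos n with rfl | hn
          · rw [hc, R.critPoint_zero hN hp one_pos] at h0
            exact absurd h0 (lt_irrefl _)
          · exact hn
        rw [(R.k_eq_zero_iff hN hp one_pos h0).2 ⟨n, hn, rfl⟩, mul_zero]
    refine ⟨fun r => v (c * r) 1, isRadialNeumann_of_hasDerivAt (fun r => (hsc c r).1)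
      (fun r => (hsc c r).2) (by fun_prop) (by simp) (by simp [hck]), ⟨0, by simp, ?_⟩,
      fun r hr => ?_⟩
    · simp [R.v_zero]
    · rw [radialLaplacian_of_hasDerivAt (Eventually.of_forall fun r => (hsc c r).1) (hsc c r).2,
        ha _ (mul_nonneg hc0 hr.1.le)]
      have := hr.1.ne'
      field_simp
      ring
  · rintro μ ⟨φ, hneu, ⟨r₀, hr₀, hφ⟩, heq⟩
    obtain ⟨w, hwc, hw0, hw1, hw⟩ := hneu.exists_deriv N
    have hφc := hneu.contDiffOn.continuousOn
    have hLap : ∀ r ∈ Ioo (0 : ℝ) 1, radialLaplacian N φ r = -(μ * φ r) := fun r hr => by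
      linarith [heq r hr]
    rcases lt_trichotomy μ 0 with hμ | rfl | hμ
    -- No negative eigenvalues: `r^{N-1} φ φ'` vanishes at both ends, and its derivative
    -- `r^{N-1}(φ'² - μ φ²)` is nonnegative. Hence this function is constant and `φ = 0`.
    · exfalso
      have hN1 : N - 1 = (N - 2) + 1 := by omega
      have hNc : ((N - 1 : ℕ) : ℝ) = (N : ℝ) - 1 := by
        rw [Nat.cast_sub (by omega)]; simp
      have hcQ : ContinuousOn (fun r => r ^ (N - 1) * (φ r * w r)) (Icc 0 1) := by fun_prop
      have hQd : ∀ r ∈ Ioo (0 : ℝ) 1, HasDerivAt (fun r => r ^ (N - 1) * (φ r * w r))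
          (r ^ (N - 1) * (w r ^ 2 + (-μ) * φ r ^ 2)) r := fun r hr => by
        refine ((hasDerivAt_pow (N - 1) r).fun_mul
          ((hw r hr).1.fun_mul (hw r hr).2)).congr_deriv ?_
        rw [hLap r hr, hNc, hN1, Nat.add_sub_cancel, pow_succ]
        have := hr.1.ne'
        field_simp
        ring
      have hQnn : ∀ r ∈ Ioo (0 : ℝ) 1, 0 ≤ r ^ (N - 1) * (w r ^ 2 + (-μ) * φ r ^ 2) :=
        fun r hr => mul_nonneg (pow_nonneg hr.1.le _)
          (add_nonneg (sq_nonneg _) (mul_nonneg (by linarith) (sq_nonneg _)))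
      have hQ0 : ∀ r ∈ Icc (0 : ℝ) 1, r ^ (N - 1) * (φ r * w r) = 0 := fun r hr => by
        have h1 := le_of_hasDerivAt_nonneg hr.1 (hcQ.mono (Icc_subset_Icc_right hr.2))
          (fun x hx => hQd x ⟨hx.1, hx.2.trans_le hr.2⟩)
          (fun x hx => hQnn x ⟨hx.1, hx.2.trans_le hr.2⟩)
        have h2 := le_of_hasDerivAt_nonneg hr.2 (hcQ.mono (Icc_subset_Icc_left hr.1))
          (fun x hx => hQd x ⟨hr.1.trans_lt hx.1, hx.2⟩)
          (fun x hx => hQnn x ⟨hr.1.trans_lt hx.1, hx.2⟩)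
        rw [hw0] at h1
        rw [hw1] at h2
        simp only [mul_zero] at h1 h2
        exact le_antisymm h2 h1
      have hφ0 : ∀ r ∈ Ioo (0 : ℝ) 1, φ r = 0 := fun r hr => by
        have h1 : HasDerivAt (fun r => r ^ (N - 1) * (φ r * w r)) 0 r := by
          refine (hasDerivAt_const r (0 : ℝ)).congr_of_eventuallyEq ?_
          filter_upwards [isOpen_Ioo.mem_nhds hr] with x hx using hQ0 x (Ioo_subset_Icc_self hx)
        have h2 := (hQd r hr).unique h1
        have h4 := (mul_eq_zero.1 h2).resolve_left (pow_ne_zero _ hr.1.ne')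
        have h5 : (-μ) * φ r ^ 2 = 0 := by
          have := mul_nonneg (by linarith : 0 ≤ -μ) (sq_nonneg (φ r))
          nlinarith [sq_nonneg (w r)]
        exact pow_eq_zero_iff two_ne_zero |>.1 ((mul_eq_zero.1 h5).resolve_left (by linarith))
      have hcl : closure (Ioo (0 : ℝ) 1) = Icc 0 1 := closure_Ioo zero_ne_one
      have h1 := (hcl ▸ hφc : ContinuousOn φ (closure (Ioo 0 1))).image_closure
        ⟨r₀, by rw [hcl]; exact hr₀, rfl⟩
      have h2 : φ '' Ioo 0 1 ⊆ {0} := by rintro _ ⟨x, hx, rfl⟩; exact hφ0 x hx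
      have h4 := closure_mono h2 h1
      rw [closure_singleton] at h4
      exact hφ h4
    · exact ⟨0, by simp [R.critPoint_zero hN hp one_pos]⟩
    -- For `γ = 1` the coefficient of the equation for `v` is `f'(1) = p - 1`, so `r ↦ v(cr,1)` has
    -- the eigenvalue `(p-1)c²`.
    · set c := √(μ / (p - 1)) with hc
      have hμp : 0 < μ / (p - 1) := div_pos hμ (by linarith)
      have hc0 : 0 < c := Real.sqrt_pos.2 hμp
      have hc2 : (p - 1) * c ^ 2 = μ := by
        rw [hc, Real.sq_sqrt hμp.le, mul_div_cancel₀ _ (by linarith)]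
      have key := eq_zero_of_radial_ineq (n := (N : ℝ) - 1) (L := μ) (R := 1)
        (y := fun r => φ r - φ 0 * v (c * r) 1)
        (z := fun r => w r - φ 0 * (c * -(c * r * k (c * r) 1)))
        (d := fun r => μ * (φ r - φ 0 * v (c * r) 1))
        (by linarith) hμ.le (hφc.sub (by fun_prop)) (hwc.sub (by fun_prop))
        (by simp [R.v_zero]) (by simp [hw0])
        (fun r hr => (hw r hr).1.fun_sub ((hsc c r).1.const_mul _))
        (fun r hr => by
          refine ((hw r hr).2.fun_sub ((hsc c r).2.const_mul (φ 0))).congr_deriv ?_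
          rw [hLap r hr, ha _ (mul_nonneg hc0.le hr.1.le), ← hc2]
          have := hr.1.ne'
          field_simp
          ring)
        (fun r _ => by rw [abs_mul, abs_of_pos hμ])
      have hφ0 : φ 0 ≠ 0 := fun h0 => hφ (by simpa [h0] using (key r₀ hr₀).1)
      have h1 := (key 1 (by simp)).2
      simp only [hw1, mul_one] at h1
      have h2 : φ 0 * (c * (c * k c 1)) = 0 := by linarith
      have h4 : k c 1 = 0 := by
        simpa [hφ0, hc0.ne'] using h2
      obtain ⟨n, _, hn⟩ := (R.k_eq_zero_iff hN hp one_pos hc0).1 h4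
      exact ⟨n, by simp only [hn]; exact hc2⟩

end RegularFamily

end SupercriticalNeumann

end

/-! ### Small `γ`, the solution curves and the branches -/

open Set Filter Topology MeasureTheory

noncomputable section

namespace SupercriticalNeumann

namespace RegularFamily

variable {N : ℕ} {p : ℝ} {u m h v k a : ℝ → ℝ → ℝ}

theorem k_pos_of_lt_critPoint_one (hN : 3 ≤ N) (hp : pS N < p) (R : RegularFamily N p u m h v k a)
    {γ : ℝ} (hγ : 0 < γ) {s : ℝ} (hs : 0 < s) (hs1 : s < critPoint N v k a 1 γ) : 0 < k s γ := by
  obtain ⟨ρ, hρ, _, h2⟩ := (R.phaseCurve hN γ).polar hs.le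
  rw [← phase] at h2
  have h3 := R.phase_pos hN (one_lt_of_pS_lt hN hp) hγ hs
  have h4 := R.phase_lt_of_lt_critPoint hN hp hγ 1 hs.le hs1
  rw [Nat.cast_one, one_mul] at h4
  have h5 := mul_pos hρ (Real.sin_pos_of_pos_of_lt_pi h3 h4)
  rw [← neg_inj.1 h2] at h5
  exact pos_of_mul_pos_right h5 hs.le

theorem deriv_pos_of_lt_critPoint_one (hN : 3 ≤ N) (hp : pS N < p)
    (R : RegularFamily N p u m h v k a) {γ : ℝ} (hγ : 0 < γ) (hγ1 : γ < 1) {s : ℝ} (hs : 0 < s)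
    (hs1 : s < critPoint N v k a 1 γ) : 0 < -(s * m s γ) := by
  have h1 := R.k_pos_of_lt_critPoint_one hN hp hγ hs hs1
  rw [R.m_eq hγ hs]
  have := mul_pos (mul_pos hs h1) (sub_pos.2 hγ1)
  linarith

theorem one_lt_u_critPoint_one (hN : 3 ≤ N) (hp : pS N < p)
    (R : RegularFamily N p u m h v k a) {γ : ℝ} (hγ : 0 < γ) (hγ1 : γ < 1) :
    1 < u (critPoint N v k a 1 γ) γ := by
  have hc := R.critPoint_spec hN hp hγ 1
  obtain ⟨ρ, hρ, h1, _⟩ := (R.phaseCurve hN γ).polar hc.1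
  rw [← phase, hc.2, Nat.cast_one, one_mul, Real.cos_pi] at h1
  have h2 := R.v_eq γ hγ _ hc.1
  rw [h1] at h2
  nlinarith [mul_pos hρ (sub_pos.2 hγ1)]

/-- Where `u' > 0` both the friction and the term `-u^p` only decrease `u² + u'²`; the linear part
gives `(u²+u'²)' ≤ 4uu' ≤ 2(u²+u'²)`. -/
theorem u_le_mul_exp (hN : 3 ≤ N) (hp : pS N < p) (R : RegularFamily N p u m h v k a) {γ : ℝ}
    (hγ : 0 < γ) (hγ1 : γ < 1) {s : ℝ} (hs : 0 ≤ s) (hs1 : s ≤ critPoint N v k a 1 γ) :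
    u s γ ≤ γ * Real.exp s := by
  have hp1 := one_lt_of_pS_lt hN hp
  have h3 : (3 : ℝ) ≤ N := by exact_mod_cast hN
  have cu := slice R.cont_u γ
  have cm := slice R.cont_m γ
  have hsol := R.radialSol hγ
  have key := le_mul_exp_of_deriv_le (V := fun s => u s γ ^ 2 + (-(s * m s γ)) ^ 2) (C := 2) hs
    (V' := fun s => 2 * u s γ * -(s * m s γ) + 2 * (-(s * m s γ)) *
      (-(((N : ℝ) - 1) / s * -(s * m s γ)) - f p (u s γ)))
    (by fun_prop)
    (fun x hx => by
      have h1 := (hsol.deriv_u x hx.1).fun_pow 2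
      have h2 := (hsol.deriv_w x hx.1).fun_pow 2
      simpa using h1.fun_add h2)
    (fun x hx => by
      have hw := R.deriv_pos_of_lt_critPoint_one hN hp hγ hγ1 hx.1 (hx.2.trans_le hs1)
      have hu := R.u_pos γ hγ x hx.1.le
      set w := -(x * m x γ)
      have h1 : 0 ≤ ((N : ℝ) - 1) / x * w ^ 2 :=
        mul_nonneg (div_nonneg (by linarith) hx.1.le) (sq_nonneg _)
      have h2 : 0 ≤ w * u x γ ^ p := by positivity
      have h4 := sq_nonneg (u x γ - w)
      simp only [f]
      nlinarith)
  simp only [R.u_zero, zero_mul, neg_zero, sub_zero] at key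
  have h4 : u s γ ^ 2 ≤ (γ * Real.exp s) ^ 2 := by
    have : (γ * Real.exp s) ^ 2 = γ ^ 2 * Real.exp (2 * s) := by
      rw [mul_pow, ← Real.exp_nat_mul]; norm_num
    rw [this]
    nlinarith [sq_nonneg (-(s * m s γ))]
  exact (pow_le_pow_iff_left₀ (R.u_pos γ hγ s hs).le (by positivity) two_ne_zero).1 h4

/-- At the first critical point `v < 0`, so `u > 1` when `γ < 1`; reaching `1` under the bound `γ
e^s` takes a time greater than `-log γ`. -/
theorem tendsto_critPoint_one (hN : 3 ≤ N) (hp : pS N < p) (R : RegularFamily N p u m h v k a) :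
    Tendsto (critPoint N v k a 1) (𝓝[>] 0) atTop := by
  have h1 : Tendsto (fun γ : ℝ => -Real.log γ) (𝓝[>] 0) atTop :=
    tendsto_neg_atBot_atTop.comp Real.tendsto_log_nhdsGT_zero
  refine tendsto_atTop_mono' _ ?_ h1
  filter_upwards [Ioo_mem_nhdsGT (zero_lt_one (α := ℝ))] with γ hγ
  have hc := (R.critPoint_spec hN hp hγ.1 1).1
  have h2 := R.u_le_mul_exp hN hp hγ.1 hγ.2 hc le_rfl
  have h3 := R.one_lt_u_critPoint_one hN hp hγ.1 hγ.2
  have h4 : Real.log 1 < Real.log (γ * Real.exp (critPoint N v k a 1 γ)) :=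
    Real.log_lt_log one_pos (h3.trans_le h2)
  rw [Real.log_one, Real.log_mul hγ.1.ne' (Real.exp_pos _).ne', Real.log_exp] at h4
  linarith

theorem critPoint_mono (hN : 3 ≤ N) (hp : pS N < p) (R : RegularFamily N p u m h v k a) {γ : ℝ}
    (hγ : 0 < γ) {i j : ℕ} (hij : i ≤ j) : critPoint N v k a i γ ≤ critPoint N v k a j γ :=
  (R.critPoint_strictMono hN hp hγ).monotone hij

theorem tendsto_critPoint (hN : 3 ≤ N) (hp : pS N < p) (R : RegularFamily N p u m h v k a) {n : ℕ}
    (hn : 1 ≤ n) : Tendsto (critPoint N v k a n) (𝓝[>] 0) atTop := by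
  refine tendsto_atTop_mono' _ ?_ (R.tendsto_critPoint_one hN hp)
  filter_upwards [self_mem_nhdsWithin] with γ hγ
  exact R.critPoint_mono hN hp hγ hn

/-- The curve of the solutions `(λ, U)` for which `√λ` is the `n`-th critical point. -/
def curve (R : RegularFamily N p u m h v k a) (n : ℕ) (γ : ℝ) : ℝ × C(unitInterval, ℝ) :=
  (critPoint N v k a n γ ^ 2, R.profile (critPoint N v k a n γ) γ)

theorem curve_snd_zero (R : RegularFamily N p u m h v k a) (n : ℕ) (γ : ℝ) :
    (R.curve n γ).2 0 = γ := R.profile_zero _ _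

theorem continuousOn_profile_critPoint (hN : 3 ≤ N) (hp : pS N < p)
    (R : RegularFamily N p u m h v k a) (n : ℕ) :
    ContinuousOn (fun γ => R.profile (critPoint N v k a n γ) γ) (Ioi 0) :=
  R.continuous_profile.comp_continuousOn
    ((R.continuousOn_critPoint hN hp n).prodMk continuousOn_id)

theorem continuousOn_curve (hN : 3 ≤ N) (hp : pS N < p) (R : RegularFamily N p u m h v k a)
    (n : ℕ) : ContinuousOn (R.curve n) (Ioi 0) :=
  ((R.continuousOn_critPoint hN hp n).pow 2).prodMk (R.continuousOn_profile_critPoint hN hp n)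

theorem curve_mem_regularSolutions (hN : 3 ≤ N) (hp : pS N < p)
    (R : RegularFamily N p u m h v k a) {n : ℕ} (hn : 1 ≤ n) {γ : ℝ} (hγ : 0 < γ) :
    R.curve n γ ∈ regularSolutions N p := by
  have hc := R.critPoint_pos hN hp hγ hn
  refine R.mem_regularSolutions hγ hc ?_
  rw [R.m_eq hγ hc, (R.k_eq_zero_iff hN hp hγ hc).2 ⟨n, hn, rfl⟩, mul_zero]

theorem curve_one (hN : 3 ≤ N) (hp : pS N < p) (R : RegularFamily N p u m h v k a) (n : ℕ) :
    R.curve n 1 = (critPoint N v k a n 1 ^ 2, 1) := by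
  rw [curve, R.profile_one (R.critPoint_spec hN hp one_pos n).1]

theorem mem_trivialBranch_or_curve (hN : 3 ≤ N) (hp : pS N < p)
    (R : RegularFamily N p u m h v k a) {q : ℝ × C(unitInterval, ℝ)}
    (hq : q ∈ regularSolutions N p) :
    (q.2 0 = 1 ∧ q ∈ trivialBranch) ∨ (q.2 0 ≠ 1 ∧ ∃ n ≥ 1, q = R.curve n (q.2 0)) := by
  obtain ⟨hγ, h1, h2⟩ := R.eq_profile_of_mem hN (one_lt_of_pS_lt hN hp) hq
  have hl : 0 < q.1 := hq.1
  have hs := Real.sqrt_pos.2 hl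
  by_cases h3 : q.2 0 = 1
  · refine Or.inl ⟨h3, hl, ?_⟩
    rw [h1, h3, R.profile_one hs.le]
  · refine Or.inr ⟨h3, ?_⟩
    rw [R.m_eq hγ hs] at h2
    have h4 := (mul_eq_zero.1 h2).resolve_left (sub_ne_zero.2 h3)
    obtain ⟨n, hn, h5⟩ := (R.k_eq_zero_iff hN hp hγ hs).1 h4
    refine ⟨n, hn, ?_⟩
    rw [curve, h5, ← h1, Real.sq_sqrt hl.le]

theorem exists_lt_critPoint (hN : 3 ≤ N) (hp : pS N < p) (R : RegularFamily N p u m h v k a)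
    {γ : ℝ} (hγ : 0 < γ) {S : ℝ} (hS : 0 ≤ S) : ∃ n ≥ 1, S < critPoint N v k a n γ := by
  obtain ⟨n, hn⟩ := exists_nat_gt (phase N v k a S γ / Real.pi)
  refine ⟨n + 1, by omega, (R.lt_critPoint_iff hN hp hγ _ hS).2 ?_⟩
  rw [div_lt_iff₀ Real.pi_pos] at hn
  push_cast
  linarith [Real.pi_pos]

/-- The union of the curves is already closed, and removing the points with `γ = 1` does not change
the closure. Bounded `λ` forces `γ` away from `0` and, near a given `γ`, admits only finitely many
`n`. -/
theorem closure_nontrivial (hN : 3 ≤ N) (hp : pS N < p) (R : RegularFamily N p u m h v k a) :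
    closure (regularSolutions N p \ trivialBranch) = ⋃ n ≥ 1, R.curve n '' Ioi 0 := by
  set Z : Set (ℝ × C(unitInterval, ℝ)) := ⋃ n ≥ 1, R.curve n '' Ioi 0 with hZ
  have heval : Continuous fun x : ℝ × C(unitInterval, ℝ) => x.2 0 :=
    (continuous_eval_const (0 : unitInterval)).comp continuous_snd
  have hmemZ : ∀ {x}, x ∈ Z ↔ ∃ n ≥ 1, ∃ γ > 0, R.curve n γ = x := by
    intro x
    simp only [hZ, mem_iUnion, mem_image, mem_Ioi, exists_prop]
  apply Subset.antisymm
  · have hsub : regularSolutions N p \ trivialBranch ⊆ Z := by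
      rintro q ⟨hq, hq'⟩
      rcases R.mem_trivialBranch_or_curve hN hp hq with h1 | ⟨_, n, hn, h2⟩
      · exact absurd h1.2 hq'
      · exact hmemZ.2 ⟨n, hn, q.2 0, (R.eq_profile_of_mem hN (one_lt_of_pS_lt hN hp) hq).1, h2.symm⟩
    refine closure_minimal hsub ?_
    refine isClosed_of_closure_subset fun q hq => ?_
    have hfr : ∃ᶠ x in 𝓝 q, x ∈ Z := mem_closure_iff_frequently.1 hq
    have hev0 : Tendsto (fun x : ℝ × C(unitInterval, ℝ) => x.2 0) (𝓝 q) (𝓝 (q.2 0)) :=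
      heval.continuousAt
    have hev1 : Tendsto (fun x : ℝ × C(unitInterval, ℝ) => x.1) (𝓝 q) (𝓝 q.1) :=
      continuous_fst.continuousAt
    have hle : ∀ᶠ x in 𝓝 q, x.1 < q.1 + 1 := hev1.eventually (gt_mem_nhds (by linarith))
    -- If `γ → 0`, already the lowest curve has `λ → ∞`.
    have hq0 : 0 < q.2 0 := by
      by_contra hneg
      have h1 := (R.tendsto_critPoint_one hN hp).eventually (eventually_gt_atTop (|q.1| + 1))
      rw [eventually_nhdsWithin_iff] at h1
      obtain ⟨δ, hδ, h2⟩ := Metric.eventually_nhds_iff.1 h1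
      have h3 : ∀ᶠ x in 𝓝 q, x.2 0 < δ := hev0.eventually (gt_mem_nhds (by linarith))
      obtain ⟨x, hx, hx1, hx2⟩ := (hfr.and_eventually (hle.and h3)).exists
      obtain ⟨n, hn, γ, hγ, rfl⟩ := hmemZ.1 hx
      rw [curve_snd_zero] at hx2
      have h4 := h2 (by rw [Real.dist_eq, sub_zero, abs_of_pos hγ]; exact hx2) hγ
      have h5 := h4.trans_le (R.critPoint_mono hN hp hγ hn)
      have h6 : critPoint N v k a n γ ^ 2 < q.1 + 1 := hx1
      have h7 := le_abs_self q.1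
      have h8 := abs_nonneg q.1
      nlinarith
    obtain ⟨n₀, hn₀, h1⟩ := R.exists_lt_critPoint hN hp hq0 (S := √(|q.1| + 1)) (Real.sqrt_nonneg _)
    have hcc : ContinuousAt (critPoint N v k a n₀) (q.2 0) :=
      (R.continuousOn_critPoint hN hp n₀).continuousAt (Ioi_mem_nhds hq0)
    have h2 : ∀ᶠ x in 𝓝 q, √(|q.1| + 1) < critPoint N v k a n₀ (x.2 0) :=
      (hcc.tendsto.comp hev0).eventually (lt_mem_nhds h1)
    -- Near `q` only the curves with `n < n₀` have small enough `λ`. For a finite union closure and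
    -- union commute, and a single index can be fixed.
    have h3 : ∃ᶠ x in 𝓝 q, x ∈ ⋃ n ∈ Finset.Ico 1 n₀, R.curve n '' Ioi 0 := by
      refine (hfr.and_eventually (hle.and h2)).mono ?_
      rintro x ⟨hx, hx1, hx2⟩
      obtain ⟨n, hn, γ, hγ, rfl⟩ := hmemZ.1 hx
      rw [curve_snd_zero] at hx2
      have hnn : n < n₀ := by
        by_contra hcon
        have h4 := hx2.trans_le (R.critPoint_mono hN hp hγ (not_lt.1 hcon))
        have h6 : critPoint N v k a n γ ^ 2 < q.1 + 1 := hx1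
        have h7 := le_abs_self q.1
        have h8 := Real.sq_sqrt (by positivity : 0 ≤ |q.1| + 1)
        have h9 := Real.sqrt_nonneg (|q.1| + 1)
        nlinarith
      exact mem_biUnion (Finset.mem_coe.2 (Finset.mem_Ico.2 ⟨hn, hnn⟩)) ⟨γ, hγ, rfl⟩
    have h4 := mem_closure_iff_frequently.2 h3
    rw [Finset.closure_biUnion] at h4
    simp only [mem_iUnion] at h4
    obtain ⟨n, hn, h5⟩ := h4
    obtain ⟨x, hx, hxq⟩ := mem_closure_iff_seq_limit.1 h5
    choose γ hγ hγx using hx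
    have h6 : Tendsto γ atTop (𝓝 (q.2 0)) := by
      have := hev0.comp hxq
      refine this.congr fun j => ?_
      simp only [Function.comp]
      rw [← hγx j, curve_snd_zero]
    have h7 : ContinuousAt (R.curve n) (q.2 0) :=
      (R.continuousOn_curve hN hp n).continuousAt (Ioi_mem_nhds hq0)
    have h8 : Tendsto x atTop (𝓝 (R.curve n (q.2 0))) :=
      (h7.tendsto.comp h6).congr fun j => hγx j
    exact hmemZ.2 ⟨n, (Finset.mem_Ico.1 hn).1, q.2 0, hq0, tendsto_nhds_unique h8 hxq⟩
  · intro x hx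
    obtain ⟨n, hn, γ, hγ, rfl⟩ := hmemZ.1 hx
    have hmem : ∀ γ > 0, γ ≠ 1 → R.curve n γ ∈ regularSolutions N p \ trivialBranch :=
      fun γ hγ hγ1 => ⟨R.curve_mem_regularSolutions hN hp hn hγ, fun ht => hγ1 (by
        have := R.curve_snd_zero n γ
        rw [ht.2] at this
        exact this.symm)⟩
    -- The punctured limit is needed for `γ = 1`, where the curve meets the trivial branch but is a
    -- limit of nontrivial solutions.
    have h1 : Tendsto (R.curve n) (𝓝[≠] γ) (𝓝 (R.curve n γ)) :=
      ((R.continuousOn_curve hN hp n).continuousAt (Ioi_mem_nhds hγ)).tendsto.mono_left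
        nhdsWithin_le_nhds
    refine mem_closure_of_tendsto h1 ?_
    rcases eq_or_ne γ 1 with rfl | hγ1
    · filter_upwards [self_mem_nhdsWithin, nhdsWithin_le_nhds (lt_mem_nhds hγ)] with x hx hx0
      exact hmem x hx0 hx
    · filter_upwards [nhdsWithin_le_nhds (isOpen_ne.mem_nhds hγ1),
        nhdsWithin_le_nhds (lt_mem_nhds hγ)] with x hx hx0
      exact hmem x hx0 hx

/-- Each curve is connected and passes through its bifurcation point, so it lies in the component.
Conversely, at every `γ` there is a gap between consecutive values of `λ`, and a connected set
cannot cross the continuous graph placed in the gap. -/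
theorem branch_eq (hN : 3 ≤ N) (hp : pS N < p) (R : RegularFamily N p u m h v k a) {n : ℕ}
    (hn : 1 ≤ n) : branch N p (critPoint N v k a n 1 ^ 2) = R.curve n '' Ioi 0 := by
  have hmemZ : ∀ {x}, x ∈ closure (regularSolutions N p \ trivialBranch) ↔
      ∃ n ≥ 1, ∃ γ > 0, R.curve n γ = x := by
    intro x
    rw [R.closure_nontrivial hN hp]
    simp only [mem_iUnion, mem_image, mem_Ioi, exists_prop]
  have hbase : (critPoint N v k a n 1 ^ 2, (1 : C(unitInterval, ℝ))) ∈ R.curve n '' Ioi 0 :=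
    ⟨1, mem_Ioi.2 one_pos, R.curve_one hN hp n⟩
  apply Subset.antisymm
  · set P := branch N p (critPoint N v k a n 1 ^ 2) with hP
    have hpre : IsPreconnected P := isPreconnected_connectedComponentIn
    have hPZ : P ⊆ closure (regularSolutions N p \ trivialBranch) :=
      connectedComponentIn_subset _ _
    have hbP : (critPoint N v k a n 1 ^ 2, (1 : C(unitInterval, ℝ))) ∈ P := by
      refine mem_connectedComponentIn (hmemZ.2 ⟨n, hn, 1, one_pos, R.curve_one hN hp n⟩)
    -- the branches are separated by the graphs of the means of consecutive values
    have hsep : ∀ j : ℕ, ∀ x ∈ P, ∀ y ∈ P,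
        x.1 ≤ (critPoint N v k a j (x.2 0) ^ 2 + critPoint N v k a (j + 1) (x.2 0) ^ 2) / 2 →
        y.1 ≤ (critPoint N v k a j (y.2 0) ^ 2 + critPoint N v k a (j + 1) (y.2 0) ^ 2) / 2 := by
      intro j x hx y hy hxle
      by_contra hylt
      push Not at hylt
      have hcont : ContinuousOn (fun x : ℝ × C(unitInterval, ℝ) => x.1 -
          (critPoint N v k a j (x.2 0) ^ 2 + critPoint N v k a (j + 1) (x.2 0) ^ 2) / 2) P := by
        have heval : ContinuousOn (fun x : ℝ × C(unitInterval, ℝ) => x.2 0) P :=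
          ((continuous_eval_const (0 : unitInterval)).comp continuous_snd).continuousOn
        have hmaps : MapsTo (fun x : ℝ × C(unitInterval, ℝ) => x.2 0) P (Ioi 0) := by
          intro x hx
          obtain ⟨i, _, γ, hγ, rfl⟩ := hmemZ.1 (hPZ hx)
          simp only [curve_snd_zero]
          exact hγ
        have c1 := (R.continuousOn_critPoint hN hp j).comp heval hmaps
        have c2 := (R.continuousOn_critPoint hN hp (j + 1)).comp heval hmaps
        exact continuous_fst.continuousOn.sub (((c1.pow 2).add (c2.pow 2)).div_const 2)
      obtain ⟨z, hz, hz0⟩ := hpre.intermediate_value hx hy hcont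
        (show (0 : ℝ) ∈ Icc _ _ from ⟨by linarith, by linarith⟩)
      obtain ⟨i, _, γ, hγ, rfl⟩ := hmemZ.1 (hPZ hz)
      simp only [curve_snd_zero] at hz0
      have hz1 : critPoint N v k a i γ ^ 2 =
        (critPoint N v k a j γ ^ 2 + critPoint N v k a (j + 1) γ ^ 2) / 2 := by
        have : (R.curve i γ).1 = critPoint N v k a i γ ^ 2 := rfl
        linarith
      have h1 := (R.critPoint_spec hN hp hγ j).1
      have h2 := R.critPoint_strictMono hN hp hγ (Nat.lt_succ_self j)
      simp only [Nat.succ_eq_add_one] at h2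
      have h3 := (R.critPoint_spec hN hp hγ i).1
      rcases Nat.lt_or_ge j i with hij | hij
      · have h4 := R.critPoint_mono hN hp hγ (Nat.succ_le_of_lt hij)
        simp only [Nat.succ_eq_add_one] at h4
        nlinarith
      · have h4 := R.critPoint_mono hN hp hγ hij
        nlinarith
    intro x hx
    obtain ⟨i, hi, γ, hγ, rfl⟩ := hmemZ.1 (hPZ hx)
    have hmean : ∀ (i j : ℕ) (γ : ℝ), 0 < γ →
        (critPoint N v k a i γ ^ 2 ≤
          (critPoint N v k a j γ ^ 2 + critPoint N v k a (j + 1) γ ^ 2) / 2 ↔ i ≤ j) := by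
      intro i j γ hγ
      have h1 := (R.critPoint_spec hN hp hγ j).1
      have h2 := R.critPoint_strictMono hN hp hγ (Nat.lt_succ_self j)
      simp only [Nat.succ_eq_add_one] at h2
      have h3 := (R.critPoint_spec hN hp hγ i).1
      constructor
      · intro h5
        by_contra hij
        have h4 := R.critPoint_mono hN hp hγ (Nat.succ_le_of_lt (not_le.1 hij))
        simp only [Nat.succ_eq_add_one] at h4
        nlinarith
      · intro hij
        have h4 := R.critPoint_mono hN hp hγ hij
        nlinarith
    -- All points of the component lie on the same side of each separating graph as the base point,
    -- so the two indices have the same upper bounds.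
    have hin : ∀ j, i ≤ j ↔ n ≤ j := by
      intro j
      have e1 := hmean i j γ hγ
      have e2 := hmean n j 1 one_pos
      have s1 := hsep j _ hx _ hbP
      have s2 := hsep j _ hbP _ hx
      simp only [curve_snd_zero] at s1 s2
      have e3 : (R.curve i γ).1 = critPoint N v k a i γ ^ 2 := rfl
      rw [e3] at s1 s2
      simp only [ContinuousMap.one_apply] at s1 s2
      rw [← e1, ← e2]
      exact ⟨s1, s2⟩
    have : i = n := le_antisymm ((hin n).2 le_rfl) ((hin i).1 le_rfl)
    exact ⟨γ, hγ, by rw [this]⟩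
  · have hpre : IsPreconnected (R.curve n '' Ioi 0) :=
      isPreconnected_Ioi.image _ (R.continuousOn_curve hN hp n)
    refine hpre.subset_connectedComponentIn hbase ?_
    rintro _ ⟨γ, hγ, rfl⟩
    exact hmemZ.2 ⟨n, hn, γ, hγ, rfl⟩

theorem regularSolutions_eq (hN : 3 ≤ N) (hp : pS N < p) (R : RegularFamily N p u m h v k a) :
    regularSolutions N p = trivialBranch ∪ ⋃ n ≥ 1,
      (branchPlus N p (critPoint N v k a n 1 ^ 2) ∪ branchMinus N p (critPoint N v k a n 1 ^ 2)) := by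
  have h0 : ∀ q, q ∈ (⋃ n ≥ 1, (branchPlus N p (critPoint N v k a n 1 ^ 2) ∪
      branchMinus N p (critPoint N v k a n 1 ^ 2))) ↔
      ∃ n ≥ 1, ∃ γ > 0, γ ≠ 1 ∧ R.curve n γ = q := by
    intro q
    simp only [mem_iUnion, exists_prop]
    refine exists_congr fun n => and_congr_right fun hn => ?_
    rw [branchPlus, branchMinus, ← inter_union_distrib_left, R.branch_eq hN hp hn]
    constructor
    · rintro ⟨⟨γ, hγ, rfl⟩, h1⟩
      refine ⟨γ, hγ, ?_, rfl⟩
      simp only [mem_union, mem_ofPred_eq, curve_snd_zero] at h1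
      rcases h1 with h1 | h1
      · exact h1.ne'
      · exact h1.ne
    · rintro ⟨γ, hγ, hγ1, rfl⟩
      refine ⟨⟨γ, hγ, rfl⟩, ?_⟩
      simp only [mem_union, mem_ofPred_eq, curve_snd_zero]
      exact (lt_or_gt_of_ne hγ1).symm
  ext q
  rw [mem_union, h0]
  constructor
  · intro hq
    rcases R.mem_trivialBranch_or_curve hN hp hq with h1 | ⟨h1, n, hn, h2⟩
    · exact Or.inl h1.2
    · exact Or.inr ⟨n, hn, q.2 0, (R.eq_profile_of_mem hN (one_lt_of_pS_lt hN hp) hq).1, h1,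
        h2.symm⟩
  · rintro (hq | ⟨n, hn, γ, hγ, _, rfl⟩)
    · obtain ⟨l, U⟩ := q
      obtain ⟨hl, hU⟩ := hq
      simp only at hl hU
      have hs := Real.sqrt_pos.2 hl
      have hm : m √l 1 = 0 := by rw [R.m_eq one_pos hs]; ring
      have := R.mem_regularSolutions one_pos hs hm
      rw [R.profile_one hs.le, Real.sq_sqrt hl.le] at this
      rw [hU]
      exact this
    · exact R.curve_mem_regularSolutions hN hp hn hγ

end RegularFamily

end SupercriticalNeumann

end

/-! ### Emden-Fowler variables: energy decrease toward the equilibrium -/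

open Set Filter Topology MeasureTheory

noncomputable section

namespace SupercriticalNeumann

/-- `x(t) = e^{θt} u(e^t)`. -/
def efX (p : ℝ) (u : ℝ → ℝ) (t : ℝ) : ℝ := Real.exp (theta p * t) * u (Real.exp t)

/-- The derivative of `x(t) = e^{θt} u(e^t)` when `u' = w`. -/
def efY (p : ℝ) (u w : ℝ → ℝ) (t : ℝ) : ℝ :=
  Real.exp (theta p * t) * (theta p * u (Real.exp t) + Real.exp t * w (Real.exp t))

/-- The force `B x - x^p` of the Emden-Fowler equation. -/
def efForce (N : ℕ) (p x : ℝ) : ℝ := coeffB N p * x - x ^ p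

/-- The potential of the Emden-Fowler equation, a primitive of `-(B x - x^p)`. -/
def efPot (N : ℕ) (p x : ℝ) : ℝ := x ^ (p + 1) / (p + 1) - coeffB N p * x ^ 2 / 2

/-- The energy in the Emden-Fowler variables. -/
def efEnergy (N : ℕ) (p t x y : ℝ) : ℝ :=
  y ^ 2 / 2 + efPot N p x - Real.exp (2 * t) * x ^ 2 / 2

/-- A positive solution of `x'' + α x' - B x + x^p - e^{2t} x = 0` on `S`, with `x' = y`. -/
structure EFSol (N : ℕ) (p : ℝ) (x y : ℝ → ℝ) (S : Set ℝ) : Prop where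
  deriv_x : ∀ t ∈ S, HasDerivAt x (y t) t
  deriv_y : ∀ t ∈ S, HasDerivAt y
    (-(alpha N p * y t) + efForce N p (x t) + Real.exp (2 * t) * x t) t
  pos : ∀ t ∈ S, 0 < x t

section

variable {N : ℕ} {p : ℝ} {u w x y : ℝ → ℝ} {S : Set ℝ}

theorem exp_theta_mul_p (hp : 1 < p) (t : ℝ) : Real.exp (theta p * t) ^ p =
    Real.exp (theta p * t) * Real.exp (2 * t) := by
  rw [← Real.exp_mul, ← Real.exp_add]
  congr 1
  linear_combination t * theta_mul hp

theorem RadialSol.efSol (hp : 1 < p) (h : RadialSol N p u w S) :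
    EFSol N p (efX p u) (efY p u w) (Real.exp ⁻¹' S) where
  deriv_x t ht := by
    have h1 := (h.deriv_u _ ht).comp t (Real.hasDerivAt_exp t)
    have h2 := ((hasDerivAt_id t).const_mul (theta p)).exp
    refine (h2.fun_mul h1).congr_deriv ?_
    simp only [efY, id, mul_one, Function.comp]
    ring
  deriv_y t ht := by
    have h1 := (h.deriv_u _ ht).comp t (Real.hasDerivAt_exp t)
    have h3 := (h.deriv_w _ ht).comp t (Real.hasDerivAt_exp t)
    have h2 := ((hasDerivAt_id t).const_mul (theta p)).exp
    refine (h2.fun_mul ((h1.const_mul (theta p)).fun_add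
      ((Real.hasDerivAt_exp t).fun_mul h3))).congr_deriv ?_
    have hup := (h.pos _ ht).le
    have hx : efX p u t ^ p = Real.exp (theta p * t) * Real.exp (2 * t) * u (Real.exp t) ^ p := by
      rw [efX, Real.mul_rpow (Real.exp_pos _).le hup, exp_theta_mul_p hp]
    rw [efForce, hx]
    have he : Real.exp (2 * t) = Real.exp t ^ 2 := by rw [← Real.exp_nat_mul]; norm_num
    simp only [efX, efY, id, mul_one, Function.comp, f, he, coeffB, alpha]
    have := (Real.exp_pos t).ne'
    field_simp
    ring
  pos t ht := mul_pos (Real.exp_pos _) (h.pos _ ht)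

theorem pohozaev_eq_efEnergy (hp : 1 < p) {t : ℝ} (hu : 0 ≤ u (Real.exp t)) :
    pohozaev N p (Real.exp t) (u (Real.exp t)) (w (Real.exp t)) =
      efEnergy N p t (efX p u t) (efY p u w t) := by
  have hE2 : Real.exp t ^ (2 * theta p) = Real.exp (theta p * t) ^ 2 := by
    rw [← Real.exp_mul, ← Real.exp_nat_mul]; congr 1; push_cast; ring
  have hx : efX p u t ^ (p + 1) = Real.exp (theta p * t) ^ 2 * Real.exp t ^ 2 *
      u (Real.exp t) ^ (p + 1) := by
    rw [efX, Real.mul_rpow (Real.exp_pos _).le hu, Real.rpow_add_one (Real.exp_pos _).ne',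
      exp_theta_mul_p hp]
    have he : Real.exp (2 * t) = Real.exp t ^ 2 := by rw [← Real.exp_nat_mul]; norm_num
    rw [he]; ring
  have he : Real.exp (2 * t) = Real.exp t ^ 2 := by rw [← Real.exp_nat_mul]; norm_num
  rw [pohozaev, efEnergy, efPot, hx, hE2, fPrim, he]
  simp only [efX, efY]
  ring

theorem hasDerivAt_efPot (hp : 1 < p) (x : ℝ) : HasDerivAt (efPot N p) (-efForce N p x) x := by
  have h1 := (Real.hasDerivAt_rpow_const (x := x) (p := p + 1) (Or.inr (by linarith))).div_const
    (p + 1)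
  have h2 := h1.fun_sub (((hasDerivAt_pow 2 x).const_mul (coeffB N p)).div_const 2)
  refine h2.congr_deriv ?_
  have : p + 1 ≠ 0 := by linarith
  rw [efForce]
  field_simp
  norm_num
  ring

theorem continuous_efPot (hp : 1 < p) : Continuous (efPot N p) :=
  continuous_iff_continuousAt.2 fun x => (hasDerivAt_efPot hp x).continuousAt

theorem hasDerivAt_efForce (hp : 1 < p) (x : ℝ) :
    HasDerivAt (efForce N p) (coeffB N p - p * x ^ (p - 1)) x := by
  have := ((hasDerivAt_id x).const_mul (coeffB N p)).fun_sub
    (Real.hasDerivAt_rpow_const (x := x) (p := p) (Or.inr hp.le))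
  exact this.congr_deriv (by simp)

theorem continuous_efForce (hp : 1 < p) : Continuous (efForce N p) :=
  continuous_iff_continuousAt.2 fun x => (hasDerivAt_efForce hp x).continuousAt

theorem EFSol.hasDerivAt_energy (hp : 1 < p) (h : EFSol N p x y S) {t : ℝ} (ht : t ∈ S) :
    HasDerivAt (fun t => efEnergy N p t (x t) (y t))
      (-(alpha N p * y t ^ 2) - Real.exp (2 * t) * x t ^ 2) t := by
  have hx := h.deriv_x t ht
  have h1 := ((h.deriv_y t ht).fun_pow 2).div_const 2
  have h2 := (hasDerivAt_efPot (N := N) hp (x t)).comp t hx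
  have h3 := (((hasDerivAt_id t).const_mul 2).exp.fun_mul (hx.fun_pow 2)).div_const 2
  refine ((h1.fun_add h2).fun_sub h3).congr_deriv ?_
  simp
  ring

theorem A_pos (hN : 3 ≤ N) (hp : pS N < p) : 0 < A N p :=
  Real.rpow_pos_of_pos (coeffB_pos hN hp) _

theorem A_pow (hN : 3 ≤ N) (hp : pS N < p) : A N p ^ (p - 1) = coeffB N p := by
  have h1 := one_lt_of_pS_lt hN hp
  have : A N p = coeffB N p ^ (1 / (p - 1)) := rfl
  rw [this, ← Real.rpow_mul (coeffB_pos hN hp).le, one_div, inv_mul_cancel₀ (by linarith),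
    Real.rpow_one]

theorem efForce_eq_mul {x : ℝ} (hx : 0 < x) :
    efForce N p x = x * (coeffB N p - x ^ (p - 1)) := by
  rw [efForce, Real.rpow_sub_one hx.ne']
  field_simp

theorem efForce_pos (hN : 3 ≤ N) (hp : pS N < p) {x : ℝ} (hx : 0 < x) (hxA : x < A N p) :
    0 < efForce N p x := by
  have h1 := one_lt_of_pS_lt hN hp
  rw [efForce_eq_mul hx, ← A_pow hN hp]
  have := Real.rpow_lt_rpow hx.le hxA (by linarith : 0 < p - 1)
  exact mul_pos hx (by linarith)

theorem efForce_neg (hN : 3 ≤ N) (hp : pS N < p) {x : ℝ} (hxA : A N p < x) :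
    efForce N p x < 0 := by
  have h1 := one_lt_of_pS_lt hN hp
  have h0 := A_pos hN hp
  rw [efForce_eq_mul (h0.trans hxA), ← A_pow hN hp]
  have := Real.rpow_lt_rpow h0.le hxA (by linarith : 0 < p - 1)
  exact mul_neg_of_pos_of_neg (h0.trans hxA) (by linarith)

theorem efPot_lt (hN : 3 ≤ N) (hp : pS N < p) {x : ℝ} (hx : 0 < x) (hxA : x ≠ A N p) :
    efPot N p (A N p) < efPot N p x := by
  have h1 := one_lt_of_pS_lt hN hp
  rcases lt_or_gt_of_ne hxA with h | h
  · have := lt_of_hasDerivAt_pos (h := fun x => -efPot N p x) h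
      (continuous_efPot h1).neg.continuousOn
      (fun z _ => (hasDerivAt_efPot h1 z).neg) (fun z hz => by
        rw [neg_neg]; exact efForce_pos hN hp (hx.trans hz.1) hz.2)
    linarith
  · exact lt_of_hasDerivAt_pos h (continuous_efPot h1).continuousOn
      (fun z _ => hasDerivAt_efPot h1 z) (fun z hz => by
        have := efForce_neg hN hp hz.1; linarith)

/-- The a priori bound for `x(t)`. -/
def efBound (N : ℕ) (p t : ℝ) : ℝ :=
  ((p + 1) / 2 * (coeffB N p + Real.exp (2 * t))) ^ (1 / (p - 1))

theorem efBound_pos (hN : 3 ≤ N) (hp : pS N < p) (t : ℝ) : 0 < efBound N p t := by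
  have h1 := one_lt_of_pS_lt hN hp
  have := coeffB_pos hN hp
  exact Real.rpow_pos_of_pos (by positivity) _

theorem efBound_mono (hN : 3 ≤ N) (hp : pS N < p) {s t : ℝ} (hst : s ≤ t) :
    efBound N p s ≤ efBound N p t := by
  have h1 := one_lt_of_pS_lt hN hp
  have := coeffB_pos hN hp
  refine Real.rpow_le_rpow (by positivity) ?_ (by apply one_div_nonneg.2; linarith)
  gcongr

/-- With nonpositive energy the term `x^{p+1}/(p+1)` is dominated by the quadratic terms; dividing
by `x²` bounds `x^{p-1}`. -/
theorem le_efBound_of_efEnergy_nonpos (hN : 3 ≤ N) (hp : pS N < p) {t x y : ℝ} (hx : 0 < x)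
    (h : efEnergy N p t x y ≤ 0) : x ≤ efBound N p t := by
  have h1 := one_lt_of_pS_lt hN hp
  have hB := coeffB_pos hN hp
  have h2 : x ^ (p + 1) = x ^ (p - 1) * x ^ 2 := by
    rw [show p + 1 = (p - 1) + (2 : ℕ) by push_cast; ring, Real.rpow_add_natCast hx.ne']
  rw [efEnergy, efPot, h2] at h
  have h3 : x ^ (p - 1) ≤ (p + 1) / 2 * (coeffB N p + Real.exp (2 * t)) := by
    have hp1 : 0 < p + 1 := by linarith
    have h4 : x ^ 2 * (x ^ (p - 1) / (p + 1) - (coeffB N p + Real.exp (2 * t)) / 2) ≤ 0 := by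
      have e : x ^ (p - 1) * x ^ 2 / (p + 1) = x ^ 2 * (x ^ (p - 1) / (p + 1)) := by ring
      rw [e] at h
      nlinarith [sq_nonneg y]
    have h5 : x ^ (p - 1) / (p + 1) - (coeffB N p + Real.exp (2 * t)) / 2 ≤ 0 := by
      by_contra hcon
      have := mul_pos (pow_pos hx 2) (not_le.1 hcon)
      linarith
    have h6 : x ^ (p - 1) / (p + 1) ≤ (coeffB N p + Real.exp (2 * t)) / 2 := by linarith
    rw [div_le_iff₀ hp1] at h6
    linarith
  have h7 := Real.rpow_le_rpow (by positivity) h3 (by apply one_div_nonneg.2; linarith :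
    0 ≤ 1 / (p - 1))
  rwa [← Real.rpow_mul hx.le, mul_one_div_cancel (by linarith : p - 1 ≠ 0), Real.rpow_one] at h7

theorem sq_le_of_efEnergy_nonpos (hp : 1 < p) {t x y : ℝ} (hx : 0 < x)
    (h : efEnergy N p t x y ≤ 0) : y ^ 2 ≤ (coeffB N p + Real.exp (2 * t)) * x ^ 2 := by
  rw [efEnergy, efPot] at h
  have : 0 ≤ x ^ (p + 1) / (p + 1) := by positivity
  nlinarith

/-- The energy alone dissipates `y²` but not the force `F`. Subtracting the small multiple `η y F`
from the energy makes `F²` appear with a negative sign; the mixed terms are absorbed by Young's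
inequality, using that `η` is small and `E ≤ 1`. -/
theorem weighted_rate_le {α η κ b P Q E F x y : ℝ} (hη0 : 0 ≤ η) (hη1 : η ≤ 1)
    (hη2 : η * (α ^ 2 + P) ≤ α / 2) (hb : 0 ≤ b) (hQ : Q ≤ P) (hE0 : 0 ≤ E) (hE1 : E ≤ 1)
    (hκ1 : κ ≤ α / 2) (hκ2 : κ ≤ η / 2) :
    -(α * y ^ 2) - E * x ^ 2 - η * ((-(α * y) + F + E * x) * F + y * ((b - Q) * y)) ≤
      -(κ * (y ^ 2 + F ^ 2)) := by
  have h3 : α * y * F ≤ α ^ 2 * y ^ 2 + F ^ 2 / 4 := by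
    nlinarith [sq_nonneg (α * y - F / 2)]
  have h4 : -(E * x * F) ≤ F ^ 2 / 4 + E ^ 2 * x ^ 2 := by
    nlinarith [sq_nonneg (E * x + F / 2)]
  have h5 : η * (E ^ 2 * x ^ 2) ≤ E * x ^ 2 := by
    have e1 : E ^ 2 ≤ E := by nlinarith
    have e2 := mul_le_mul_of_nonneg_right e1 (sq_nonneg x)
    have e3 : 0 ≤ E ^ 2 * x ^ 2 := by positivity
    nlinarith
  have h6 : -(y * ((b - Q) * y)) ≤ P * y ^ 2 := by
    have := mul_le_mul_of_nonneg_right hQ (sq_nonneg y)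
    nlinarith [mul_nonneg hb (sq_nonneg y)]
  have h7 := mul_le_mul_of_nonneg_left (add_le_add (add_le_add h3 h4) h6) hη0
  have h8 := mul_le_mul_of_nonneg_right hη2 (sq_nonneg y)
  have h9 := mul_le_mul_of_nonneg_right hκ1 (sq_nonneg y)
  have h10 := mul_le_mul_of_nonneg_right hκ2 (sq_nonneg F)
  linarith

set_option maxHeartbeats 800000 in
/-- A solution with small energy decrease comes close to the equilibrium. -/
theorem exists_efEnergy_le (hN : 3 ≤ N) (hp : pS N < p) {c ε : ℝ} (hc : 0 < c) (hε : 0 < ε) :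
    ∃ n > 0, ∀ (x y : ℝ → ℝ) (b : ℝ), b + n ≤ 0 → EFSol N p x y (Icc b (b + n)) →
      (∀ t ∈ Icc b (b + n), efEnergy N p t (x t) (y t) ≤ -c) →
      ∃ t ∈ Icc b (b + n), efEnergy N p t (x t) (y t) ≤ efPot N p (A N p) + ε := by
  have hp1 := one_lt_of_pS_lt hN hp
  have hα := alpha_pos hN hp
  have hB := coeffB_pos hN hp
  set X := efBound N p 0 with hX
  have hX0 : 0 < X := efBound_pos hN hp 0
  -- Energy at most `-c` together with `e^{2t} ≤ 1` forces `(B+1) x²/2 ≥ c`. This excludes the other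
  -- zero `x = 0` of the force.
  set x₀ := √(2 * c / (coeffB N p + 1)) with hx₀
  have hx₀0 : 0 < x₀ := Real.sqrt_pos.2 (by positivity)
  set P := p * X ^ (p - 1) with hP
  have hP0 : 0 ≤ P := by positivity
  set η := min 1 (alpha N p / (2 * (alpha N p ^ 2 + P))) with hη
  have hη0 : 0 < η := lt_min one_pos (by positivity)
  have hη1 : η ≤ 1 := min_le_left _ _
  have hη2 : η * (alpha N p ^ 2 + P) ≤ alpha N p / 2 := by
    have h1 : η ≤ alpha N p / (2 * (alpha N p ^ 2 + P)) := min_le_right _ _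
    calc η * (alpha N p ^ 2 + P) ≤ alpha N p / (2 * (alpha N p ^ 2 + P)) *
          (alpha N p ^ 2 + P) := by gcongr
      _ = _ := by field_simp
  set κ := min (alpha N p / 2) (η / 2) with hκ
  have hκ0 : 0 < κ := lt_min (by positivity) (by positivity)
  set Y2 := (coeffB N p + 1) * X ^ 2 with hY2
  -- the set where the solution lives
  obtain ⟨ε₁, hε₁, hforce⟩ := exists_pos_of_isCompact (isCompact_Icc (a := x₀) (b := X))
    (φ := fun x => efForce N p x ^ 2) (ψ := efPot N p) (δ := efPot N p (A N p) + ε / 2)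
    ((continuous_efForce hp1).pow 2).continuousOn (continuous_efPot hp1).continuousOn
    (fun x hx h0 => by
      have hx0 : 0 < x := hx₀0.trans_le hx.1
      have hf0 : efForce N p x = 0 := pow_eq_zero_iff two_ne_zero |>.1 (le_antisymm h0 (sq_nonneg _))
      have hxA : x = A N p := by
        rcases lt_trichotomy x (A N p) with h | h | h
        · exact absurd hf0 (efForce_pos hN hp hx0 h).ne'
        · exact h
        · exact absurd hf0 (efForce_neg hN hp h).ne
      rw [hxA]; linarith)
  obtain ⟨F₁, hF₁⟩ := (isCompact_Icc (a := 0) (b := X)).exists_bound_of_continuousOn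
    (continuous_efForce (N := N) hp1).continuousOn
  obtain ⟨G₁, hG₁⟩ := (isCompact_Icc (a := 0) (b := X)).exists_bound_of_continuousOn
    (continuous_efPot (N := N) hp1).continuousOn
  have hF₁0 : 0 ≤ F₁ := (norm_nonneg _).trans (hF₁ 0 ⟨le_rfl, hX0.le⟩)
  set K := Y2 / 2 + G₁ + X ^ 2 / 2 + (Y2 + F₁ ^ 2) with hK
  -- Over this length a function bounded by `K` has somewhere a slope at least `-2K/n`, which makes
  -- `y² + F² ≤ min ε₁ ε`.
  set n := 2 * K / (κ * min ε₁ ε) + 1 with hn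
  have hG₁0 : 0 ≤ G₁ := (norm_nonneg _).trans (hG₁ 0 ⟨le_rfl, hX0.le⟩)
  have hK0 : 0 ≤ K := by positivity
  have hmin0 : 0 < min ε₁ ε := lt_min hε₁ hε
  have hn0 : 0 < n := by positivity
  clear_value K η
  refine ⟨n, hn0, fun x y b hb hsol hJ => ?_⟩
  have hexp : ∀ t ∈ Icc b (b + n), Real.exp (2 * t) ≤ 1 := fun t ht =>
    Real.exp_le_one_iff.2 (by linarith [ht.2])
  have hxX : ∀ t ∈ Icc b (b + n), x t ∈ Icc x₀ X := fun t ht => by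
    have hJt := hJ t ht
    have hxt := hsol.pos t ht
    constructor
    · rw [hx₀]
      refine Real.sqrt_le_iff.2 ⟨hxt.le, ?_⟩
      rw [div_le_iff₀ (by positivity)]
      rw [efEnergy, efPot] at hJt
      have h1 : 0 ≤ x t ^ (p + 1) / (p + 1) := by positivity
      have h2 := hexp t ht
      have h3 := mul_le_mul_of_nonneg_right h2 (sq_nonneg (x t))
      nlinarith [sq_nonneg (y t)]
    · exact (le_efBound_of_efEnergy_nonpos hN hp hxt (by linarith)).trans
        (efBound_mono hN hp (by linarith [ht.2]))
  have hyY : ∀ t ∈ Icc b (b + n), y t ^ 2 ≤ Y2 := fun t ht => by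
    have h1 := sq_le_of_efEnergy_nonpos hp1 (hsol.pos t ht) (by linarith [hJ t ht] :
      efEnergy N p t (x t) (y t) ≤ 0)
    refine h1.trans ?_
    have h2 := hexp t ht
    have h3 := (hxX t ht).2
    have h4 := (hsol.pos t ht).le
    rw [hY2]
    gcongr
  set W : ℝ → ℝ := fun t => efEnergy N p t (x t) (y t) - η * (y t * efForce N p (x t)) with hW
  have hWd : ∀ t ∈ Icc b (b + n), HasDerivAt W (-(alpha N p * y t ^ 2) - Real.exp (2 * t) * x t ^ 2 -
      η * ((-(alpha N p * y t) + efForce N p (x t) + Real.exp (2 * t) * x t) * efForce N p (x t) +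
        y t * ((coeffB N p - p * x t ^ (p - 1)) * y t))) t := fun t ht =>
    (hsol.hasDerivAt_energy hp1 ht).fun_sub (((hsol.deriv_y t ht).fun_mul
      ((hasDerivAt_efForce hp1 (x t)).comp t (hsol.deriv_x t ht))).const_mul η)
  have hWle : ∀ t ∈ Icc b (b + n), -(alpha N p * y t ^ 2) - Real.exp (2 * t) * x t ^ 2 -
      η * ((-(alpha N p * y t) + efForce N p (x t) + Real.exp (2 * t) * x t) * efForce N p (x t) +
        y t * ((coeffB N p - p * x t ^ (p - 1)) * y t)) ≤
      -(κ * (y t ^ 2 + efForce N p (x t) ^ 2)) := fun t ht => by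
    have hx1 := hxX t ht
    have hxt := hsol.pos t ht
    have h1 : p * x t ^ (p - 1) ≤ P := by
      have := Real.rpow_le_rpow hxt.le hx1.2 (by linarith : 0 ≤ p - 1)
      rw [hP]; gcongr
    have h2 := hexp t ht
    exact weighted_rate_le hη0.le hη1 hη2 hB.le h1 (Real.exp_pos _).le h2
      (min_le_left _ _) (min_le_right _ _)
  have hWb : ∀ t ∈ Icc b (b + n), |W t| ≤ K := fun t ht => by
    have hxt := hsol.pos t ht
    have hxm : x t ∈ Icc 0 X := ⟨hxt.le, (hxX t ht).2⟩
    have h1 := hF₁ _ hxm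
    have h2 := hG₁ _ hxm
    have h3 := hyY t ht
    have h4 := hexp t ht
    have h5 : Real.exp (2 * t) * x t ^ 2 ≤ X ^ 2 := by
      have : x t ^ 2 ≤ X ^ 2 := pow_le_pow_left₀ hxt.le hxm.2 2
      calc _ ≤ 1 * X ^ 2 := by gcongr
        _ = _ := one_mul _
    have h50 : 0 ≤ Real.exp (2 * t) * x t ^ 2 := by positivity
    rw [Real.norm_eq_abs] at h1 h2
    have h6 : |y t * efForce N p (x t)| ≤ Y2 + F₁ ^ 2 := by
      have e1 := two_abs_mul_abs_le (y t) (efForce N p (x t))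
      have e2 : efForce N p (x t) ^ 2 ≤ F₁ ^ 2 := sq_le_sq' (by linarith [neg_abs_le (efForce N p (x t))]) (by linarith [le_abs_self (efForce N p (x t))])
      rw [abs_mul]
      have e3 : 0 ≤ |y t| * |efForce N p (x t)| := by positivity
      linarith
    have h7 : |η * (y t * efForce N p (x t))| ≤ Y2 + F₁ ^ 2 := by
      rw [abs_mul, abs_of_pos hη0]
      exact (mul_le_of_le_one_left (abs_nonneg _) hη1).trans h6
    simp only [hW, efEnergy]
    rw [abs_le] at h2 h7 ⊢
    have := sq_nonneg (y t)
    constructor <;> linarith [h2.1, h2.2, h7.1, h7.2]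
  -- At the point given by the mean value theorem both `y` and the force are small; a small force
  -- puts `x` near `A`, where the potential is minimal.
  obtain ⟨t, ht, hslope⟩ := exists_hasDerivAt_eq_slope W _ (by linarith : b < b + n)
    (fun t ht => (hWd t ht).continuousAt.continuousWithinAt)
    (fun t ht => hWd t (Ioo_subset_Icc_self ht))
  have ht' := Ioo_subset_Icc_self ht
  refine ⟨t, ht', ?_⟩
  have h1 := hWle t ht'
  rw [hslope] at h1
  have h2 := hWb b ⟨le_rfl, by linarith⟩
  have h3 := hWb (b + n) ⟨by linarith, le_rfl⟩
  rw [abs_le] at h2 h3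
  have h4 : -(2 * K) / n ≤ (W (b + n) - W b) / (b + n - b) := by
    rw [add_sub_cancel_left]
    gcongr
    linarith
  have h5 : κ * (y t ^ 2 + efForce N p (x t) ^ 2) ≤ 2 * K / n := by
    have : -(2 * K) / n = -(2 * K / n) := neg_div _ _
    linarith
  have h6 : 2 * K / n ≤ κ * min ε₁ ε := by
    have h : κ * min ε₁ ε * n = 2 * K + κ * min ε₁ ε := by
      rw [hn, mul_add, mul_one, mul_div_cancel₀ (2 * K) (mul_pos hκ0 hmin0).ne']
    have : 0 ≤ κ * min ε₁ ε := by positivity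
    rw [div_le_iff₀ hn0, h]
    linarith
  have h7 : y t ^ 2 + efForce N p (x t) ^ 2 ≤ min ε₁ ε := le_of_mul_le_mul_left (h5.trans h6) hκ0
  have h8 := hforce (x t) (hxX t ht') (by
    have := min_le_left ε₁ ε
    nlinarith [sq_nonneg (y t)])
  rw [efEnergy]
  have h9 : 0 ≤ Real.exp (2 * t) * x t ^ 2 / 2 := by positivity
  have := min_le_right ε₁ ε
  nlinarith [sq_nonneg (efForce N p (x t))]

/-- A solution whose energy is close to the minimum stays close to the equilibrium. -/
theorem exists_efEnergy_trap (hN : 3 ≤ N) (hp : pS N < p) {c δ : ℝ} (hc : 0 < c) (hδ : 0 < δ) :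
    ∃ ε > 0, ∃ T ≤ 0, ∀ t x y : ℝ, t ≤ T → 0 < x → efEnergy N p t x y ≤ -c →
      efEnergy N p t x y ≤ efPot N p (A N p) + ε → |x - A N p| < δ ∧ |y| < δ := by
  have hp1 := one_lt_of_pS_lt hN hp
  have hB := coeffB_pos hN hp
  set X := efBound N p 0 with hX
  have hX0 : 0 < X := efBound_pos hN hp 0
  set x₀ := √(2 * c / (coeffB N p + 1)) with hx₀
  have hx₀0 : 0 < x₀ := Real.sqrt_pos.2 (by positivity)
  -- Away from `0` the potential has its strict minimum at `A`, so values close to the minimum occur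
  -- only near `A`.
  obtain ⟨ε₁, hε₁, htrap⟩ := exists_pos_of_isCompact (isCompact_Icc (a := x₀) (b := X))
    (φ := fun x => efPot N p x - efPot N p (A N p)) (ψ := fun x => |x - A N p|) (δ := δ)
    ((continuous_efPot hp1).sub continuous_const).continuousOn (by fun_prop)
    (fun x hx h0 => by
      have hxA : x = A N p := by
        by_contra hne
        have := efPot_lt hN hp (hx₀0.trans_le hx.1) hne
        linarith
      rw [hxA, sub_self, abs_zero]; exact hδ)
  -- One `ε` is spent on the excess energy and one on the term `e^{2t} x²/2`, which is small for `t
  -- ≤ T`.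
  set ε := min (ε₁ / 2) (δ ^ 2 / 4) / 2 with hε
  have hε0 : 0 < ε := by positivity
  have hlim : Tendsto (fun t : ℝ => Real.exp (2 * t) * X ^ 2 / 2) atBot (𝓝 0) := by
    have h1 : Tendsto (fun t : ℝ => 2 * t) atBot atBot := tendsto_id.const_mul_atBot two_pos
    have := ((Real.tendsto_exp_atBot.comp h1).mul_const (X ^ 2)).div_const 2
    simpa using this
  obtain ⟨T, hT1, hT0⟩ := ((hlim.eventually (gt_mem_nhds hε0)).and (eventually_le_atBot 0)).exists
  refine ⟨ε, hε0, T, hT0, fun t x y ht hx hJc hJ => ?_⟩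
  have hexp : Real.exp (2 * t) ≤ Real.exp (2 * T) := Real.exp_le_exp.2 (by linarith)
  have hexp1 : Real.exp (2 * t) ≤ 1 := Real.exp_le_one_iff.2 (by linarith)
  have hxX : x ≤ X := (le_efBound_of_efEnergy_nonpos hN hp hx (by linarith)).trans
    (efBound_mono hN hp (ht.trans hT0))
  have hxx₀ : x₀ ≤ x := by
    rw [hx₀]
    refine Real.sqrt_le_iff.2 ⟨hx.le, ?_⟩
    rw [div_le_iff₀ (by positivity)]
    rw [efEnergy, efPot] at hJc
    have h1 : 0 ≤ x ^ (p + 1) / (p + 1) := by positivity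
    have h3 := mul_le_mul_of_nonneg_right hexp1 (sq_nonneg x)
    nlinarith [sq_nonneg y]
  have h1 : Real.exp (2 * t) * x ^ 2 / 2 < ε := by
    refine lt_of_le_of_lt ?_ hT1
    have : x ^ 2 ≤ X ^ 2 := pow_le_pow_left₀ hx.le hxX 2
    gcongr
  rw [efEnergy] at hJ
  have hmin : efPot N p (A N p) ≤ efPot N p x := by
    by_cases h : x = A N p
    · rw [h]
    · exact (efPot_lt hN hp hx h).le
  have h2 : y ^ 2 / 2 + (efPot N p x - efPot N p (A N p)) < min (ε₁ / 2) (δ ^ 2 / 4) := by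
    linarith
  have h3 := min_le_left (ε₁ / 2) (δ ^ 2 / 4)
  have h4 := min_le_right (ε₁ / 2) (δ ^ 2 / 4)
  refine ⟨htrap x ⟨hxx₀, hxX⟩ (by nlinarith [sq_nonneg y]), ?_⟩
  refine abs_lt_of_sq_lt_sq ?_ hδ.le
  nlinarith

end

end SupercriticalNeumann

end

/-! ### The core region and closeness to the equilibrium for large `γ` -/

open Set Filter Topology MeasureTheory

noncomputable section

namespace SupercriticalNeumann

theorem EFSol.mono {N : ℕ} {p : ℝ} {x y : ℝ → ℝ} {S S' : Set ℝ} (h : EFSol N p x y S)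
    (hS : S' ⊆ S) : EFSol N p x y S' :=
  ⟨fun t ht => h.deriv_x t (hS ht), fun t ht => h.deriv_y t (hS ht), fun t ht => h.pos t (hS ht)⟩

theorem EFSol.energy_le {N : ℕ} {p : ℝ} (hN : 3 ≤ N) (hp : pS N < p) {x y : ℝ → ℝ}
    (h : EFSol N p x y univ) {s t : ℝ} (hst : s ≤ t) :
    efEnergy N p t (x t) (y t) ≤ efEnergy N p s (x s) (y s) :=
  le_of_hasDerivAt_nonpos hst
    (fun τ _ => (h.hasDerivAt_energy (one_lt_of_pS_lt hN hp)
      (mem_univ τ)).continuousAt.continuousWithinAt)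
    (fun τ _ => h.hasDerivAt_energy (one_lt_of_pS_lt hN hp) (mem_univ τ)) (fun τ _ => by
      have h1 := mul_nonneg (alpha_pos hN hp).le (sq_nonneg (y τ))
      have h2 := mul_nonneg (Real.exp_pos (2 * τ)).le (sq_nonneg (x τ))
      linarith)

namespace RegularFamily

variable {N : ℕ} {p : ℝ} {u m h v k a : ℝ → ℝ → ℝ}

theorem hasDerivAt_pow_mul (hN : 3 ≤ N) (R : RegularFamily N p u m h v k a) (γ s : ℝ) :
    HasDerivAt (fun s => s ^ (N - 1) * (s * m s γ)) (s ^ (N - 1) * h s γ) s := by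
  refine ((hasDerivAt_pow (N - 1) s).fun_mul (R.deriv_m γ s)).congr_deriv ?_
  obtain ⟨n, rfl⟩ : ∃ n, N = n + 2 := ⟨N - 2, by omega⟩
  simp only [Nat.add_succ_sub_one]
  push_cast
  ring

/-- While `u ≤ γ`, the derivative is controlled by `γ^p s`. -/
theorem mul_m_le (hN : 3 ≤ N) (R : RegularFamily N p u m h v k a) {γ : ℝ} (hγ : 0 < γ)
    (hp : 1 < p) (hγ1 : peak p ≤ γ) {s : ℝ} (hs : 0 ≤ s) : s * m s γ ≤ γ ^ p * s := by
  have hd := fun t : ℝ => ((hasDerivAt_pow N t).const_mul (γ ^ p)).fun_sub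
    (R.hasDerivAt_pow_mul hN γ t)
  have hγp : 0 < γ ^ p := Real.rpow_pos_of_pos hγ p
  have h1 := le_of_hasDerivAt_nonneg hs (fun t _ => (hd t).continuousAt.continuousWithinAt)
    (fun t _ => hd t) (fun t ht => by
      have hu := R.u_pos γ hγ t ht.1.le
      have hle : u t γ ≤ γ := (R.u_le γ hγ t ht.1.le).trans (max_le le_rfl hγ1)
      have hh : h t γ ≤ γ ^ p := by
        rw [R.h_eq γ hγ t ht.1.le, f]
        have := Real.rpow_le_rpow hu.le hle (by linarith : 0 ≤ p)
        linarith
      have hN1 : (1 : ℝ) ≤ N := by exact_mod_cast (by omega : 1 ≤ N)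
      have h2 : 0 < t ^ (N - 1) := pow_pos ht.1 _
      have h3 : t ^ (N - 1) * h t γ ≤ t ^ (N - 1) * γ ^ p := by gcongr
      have h4 : 1 * (t ^ (N - 1) * γ ^ p) ≤ N * (t ^ (N - 1) * γ ^ p) := by gcongr
      linarith)
  rcases hs.eq_or_lt with rfl | hs
  · simp
  · have hs' : 0 < s ^ (N - 1) := pow_pos hs _
    have e : s ^ N = s ^ (N - 1) * s := by rw [← pow_succ]; congr 1; omega
    have hN0 : N ≠ 0 := by omega
    simp only [zero_pow hN0, mul_zero, zero_mul, sub_zero, e] at h1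
    refine le_of_mul_le_mul_left ?_ hs'
    linarith

theorem m_nonneg_of_one_le (hN : 3 ≤ N) (R : RegularFamily N p u m h v k a) {γ : ℝ} (hγ : 0 < γ)
    (hp : 1 < p) {s : ℝ} (hs : 0 ≤ s) (h1 : ∀ t ∈ Icc 0 s, 1 ≤ u t γ) : 0 ≤ s * m s γ := by
  have h2 := le_of_hasDerivAt_nonneg hs
    (fun t _ => (R.hasDerivAt_pow_mul hN γ t).continuousAt.continuousWithinAt)
    (fun t _ => R.hasDerivAt_pow_mul hN γ t) (fun t ht => by
      rw [R.h_eq γ hγ t ht.1.le]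
      refine mul_nonneg (pow_nonneg ht.1.le _) ?_
      rcases (h1 t (Ioo_subset_Icc_self ht)).eq_or_lt with h | h
      · rw [← h, f_one]
      · exact (f_pos hp h).le)
  rcases hs.eq_or_lt with rfl | hs
  · simp
  · simp only [zero_mul, mul_zero] at h2
    exact nonneg_of_mul_nonneg_right h2 (pow_pos hs _)

/-- In the core `s ≤ s₀ γ^{-1/θ}` the solution stays comparable to `γ`, and outside of the core
the Pohozaev functional is negative, uniformly in `γ`. -/
theorem exists_core (hN : 3 ≤ N) (hp : pS N < p) (R : RegularFamily N p u m h v k a) :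
    ∃ c > 0, ∃ S : ℝ → ℝ, Tendsto S atTop (𝓝 0) ∧ ∀ᶠ γ in atTop, 0 < S γ ∧
      (∀ s ∈ Icc 0 (S γ), γ / 2 ≤ u s γ) ∧
      ∀ s ≥ S γ, pohozaev N p s (u s γ) (-(s * m s γ)) ≤ -c := by
  have hp1 := one_lt_of_pS_lt hN hp
  have hθ := theta_pos hp1
  have hα := alpha_pos hN hp
  -- The three bounds serve in turn to keep `u ≥ γ/2` in the core, to keep `θu + su'` between `0`
  -- and `θu` at its edge, and to bound the potential there by `θα u²/4`.
  set σ := min 1 (min (theta p / 2) (theta p * alpha N p / 2)) with hσ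
  have hσ0 : 0 < σ := lt_min one_pos (lt_min (by positivity) (by positivity))
  have hσ1 : σ ≤ 1 := min_le_left _ _
  have hσ2 : σ ≤ theta p / 2 := (min_le_right _ _).trans (min_le_left _ _)
  have hσ3 : σ ≤ theta p * alpha N p / 2 := (min_le_right _ _).trans (min_le_right _ _)
  refine ⟨σ ^ theta p * (theta p * alpha N p) / 16, by positivity,
    fun γ => √σ * γ ^ (-((p - 1) / 2)), ?_, ?_⟩
  · simpa using (tendsto_rpow_neg_atTop (by linarith : 0 < (p - 1) / 2)).const_mul √σ
  filter_upwards [eventually_ge_atTop (max 2 (peak p))] with γ hγ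
  have hγ2 : 2 ≤ γ := (le_max_left _ _).trans hγ
  have hγp : peak p ≤ γ := (le_max_right _ _).trans hγ
  have hγ0 : 0 < γ := by linarith
  -- The natural length of the core, normalized so that `γ^{p-1} S² = σ`.
  set S := √σ * γ ^ (-((p - 1) / 2)) with hS
  have hS0 : 0 < S := by positivity
  have hS2 : γ ^ (p - 1) * S ^ 2 = σ := by
    rw [hS, mul_pow, Real.sq_sqrt hσ0.le, ← Real.rpow_natCast, ← Real.rpow_mul hγ0.le,
      mul_left_comm, ← Real.rpow_add hγ0]
    rw [show p - 1 + -((p - 1) / 2) * ((2 : ℕ) : ℝ) = 0 by push_cast; ring, Real.rpow_zero, mul_one]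
  clear_value S σ
  have hSθ : S ^ (2 * theta p) * γ ^ 2 = σ ^ theta p := by
    have e1 : (γ ^ (p - 1)) ^ theta p = γ ^ 2 := by
      rw [← Real.rpow_mul hγ0.le, mul_comm, theta_mul hp1]; norm_num
    rw [← hS2, Real.mul_rpow (by positivity) (by positivity), e1, ← Real.rpow_natCast S 2,
      ← Real.rpow_mul hS0.le]
    push_cast
    ring
  have hγpp : γ ^ p = γ ^ (p - 1) * γ := by
    rw [← Real.rpow_add_one hγ0.ne']; congr 1; ring
  have hlow : ∀ s ∈ Icc 0 S, γ / 2 ≤ u s γ := fun s hs => by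
    have hd := fun t : ℝ => (R.deriv_u γ t).fun_add
      (((hasDerivAt_pow 2 t).const_mul (γ ^ p / 2)))
    have h1 := le_of_hasDerivAt_nonneg hs.1 (fun t _ => (hd t).continuousAt.continuousWithinAt)
      (fun t _ => hd t) (fun t ht => by
        have := R.mul_m_le hN hγ0 hp1 hγp ht.1.le
        norm_num
        linarith)
    rw [R.u_zero] at h1
    have h2 : s ^ 2 ≤ S ^ 2 := pow_le_pow_left₀ hs.1 hs.2 2
    have h3 : γ ^ p * s ^ 2 ≤ γ := by
      calc γ ^ p * s ^ 2 ≤ γ ^ p * S ^ 2 := by gcongr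
        _ = σ * γ := by rw [hγpp, ← hS2]; ring
        _ ≤ 1 * γ := by gcongr
        _ = γ := one_mul _
    norm_num at h1
    linarith
  refine ⟨hS0, hlow, fun s hs => (R.pohozaev_le hN hp hγ0 hS0.le hs).trans ?_⟩
  have hu := hlow S ⟨hS0.le, le_rfl⟩
  have hule : u S γ ≤ γ := (R.u_le γ hγ0 S hS0.le).trans (max_le le_rfl hγp)
  have hm0 := R.m_nonneg_of_one_le hN hγ0 hp1 hS0.le (fun t ht => by linarith [hlow t ht])
  have hm1 := R.mul_m_le hN hγ0 hp1 hγp hS0.le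
  set z := u S γ
  set q := S * m S γ
  have hz0 : 0 < z := by linarith
  have hSq : S * q ≤ σ * γ := by
    calc S * q ≤ S * (γ ^ p * S) := by gcongr
      _ = σ * γ := by rw [hγpp, ← hS2]; ring
  have hSq' : σ * γ ≤ theta p * z := by
    calc σ * γ ≤ theta p / 2 * γ := by gcongr
      _ = theta p * (γ / 2) := by ring
      _ ≤ _ := by gcongr
  have h1 : (theta p * z + S * -q) ^ 2 ≤ (theta p * z) ^ 2 := by
    have e1 : 0 ≤ S * q := by positivity
    refine pow_le_pow_left₀ (by linarith) (by linarith) 2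
  have hzp : z ^ (p + 1) ≤ γ ^ (p - 1) * z ^ 2 := by
    have e : z ^ (p + 1) = z ^ (p - 1) * z ^ 2 := by
      rw [show p + 1 = (p - 1) + (2 : ℕ) by push_cast; ring, Real.rpow_add_natCast hz0.ne']
    rw [e]
    have := Real.rpow_le_rpow hz0.le hule (by linarith : 0 ≤ p - 1)
    gcongr
  have h2 : S ^ 2 * fPrim p z ≤ theta p * alpha N p / 4 * z ^ 2 := by
    rw [fPrim]
    have e1 : z ^ (p + 1) / (p + 1) ≤ γ ^ (p - 1) * z ^ 2 / 2 := by
      have : 0 ≤ γ ^ (p - 1) * z ^ 2 := by positivity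
      exact div_le_div₀ this hzp two_pos (by linarith)
    calc S ^ 2 * (-z ^ 2 / 2 + z ^ (p + 1) / (p + 1)) ≤ S ^ 2 * (γ ^ (p - 1) * z ^ 2 / 2) := by
          gcongr; linarith [sq_nonneg z]
      _ = σ * z ^ 2 / 2 := by rw [← hS2]; ring
      _ ≤ theta p * alpha N p / 2 * z ^ 2 / 2 := by gcongr
      _ = _ := by ring
  have h3 : (theta p * z + S * -q) ^ 2 / 2 - coeffB N p * z ^ 2 / 2 + S ^ 2 * fPrim p z ≤
      -(theta p * alpha N p / 16 * γ ^ 2) := by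
    -- Since `B = θ² + θα`, the square `(θu)²` cancels and `-θα u²/2 + θα u²/4` remains; with `u ≥
    -- γ/2` this is at most `-θα γ²/16`.
    rw [coeffB_eq]
    have e1 : (γ / 2) ^ 2 ≤ z ^ 2 := pow_le_pow_left₀ (by linarith) hu 2
    have e2 : theta p * alpha N p * (γ / 2) ^ 2 ≤ theta p * alpha N p * z ^ 2 := by gcongr
    linarith
  calc pohozaev N p S z (-q) ≤ S ^ (2 * theta p) * -(theta p * alpha N p / 16 * γ ^ 2) := by
        rw [pohozaev]; gcongr
    _ = _ := by rw [← hSθ]; ring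

/-- The regular solutions in the Emden-Fowler variables. -/
theorem efSol (hp : 1 < p) (R : RegularFamily N p u m h v k a) {γ : ℝ} (hγ : 0 < γ) :
    EFSol N p (efX p fun s => u s γ) (efY p (fun s => u s γ) fun s => -(s * m s γ)) univ :=
  ((R.radialSol hγ).efSol hp).mono fun t _ => Real.exp_pos t

/-- The core shrinks to the origin as `γ → ∞`, so the uniform bound on the energy holds from any
given time on, however early. -/
theorem exists_efEnergy_core (hN : 3 ≤ N) (hp : pS N < p) (R : RegularFamily N p u m h v k a) :
    ∃ c > 0, ∀ τ : ℝ, ∀ᶠ γ in atTop, ∀ t ≥ τ,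
      efEnergy N p t (efX p (fun s => u s γ) t)
        (efY p (fun s => u s γ) (fun s => -(s * m s γ)) t) ≤ -c := by
  obtain ⟨c, hc, S, hS, hcore⟩ := R.exists_core hN hp
  refine ⟨c, hc, fun τ => ?_⟩
  filter_upwards [hcore, hS.eventually (gt_mem_nhds (Real.exp_pos τ)), eventually_gt_atTop 0]
    with γ h1 h2 hγ t ht
  rw [← pohozaev_eq_efEnergy (one_lt_of_pS_lt hN hp) (R.u_pos γ hγ _ (Real.exp_pos t).le).le]
  exact h1.2.2 _ (h2.le.trans (Real.exp_le_exp.2 ht))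

/-- For large `γ` the solutions are close to the equilibrium on `[τ, T]`. -/
theorem exists_near_equilibrium (hN : 3 ≤ N) (hp : pS N < p) (R : RegularFamily N p u m h v k a)
    {δ : ℝ} (hδ : 0 < δ) : ∃ T ≤ 0, ∀ τ : ℝ, ∀ᶠ γ in atTop, ∀ t ∈ Icc τ T,
      |efX p (fun s => u s γ) t - A N p| < δ ∧
        |efY p (fun s => u s γ) (fun s => -(s * m s γ)) t| < δ := by
  have hp1 := one_lt_of_pS_lt hN hp
  obtain ⟨c, hc, hcore⟩ := R.exists_efEnergy_core hN hp
  obtain ⟨ε, hε, T, hT, htrap⟩ := exists_efEnergy_trap hN hp hc hδ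
  obtain ⟨n, hn, hentry⟩ := exists_efEnergy_le hN hp hc hε
  refine ⟨T, hT, fun τ => ?_⟩
  -- The time `n` before `τ` is used to come close to the equilibrium; energy decrease and the trap
  -- keep the solution there up to `T`, which does not depend on `τ`.
  filter_upwards [hcore (τ - n), eventually_gt_atTop 0] with γ h1 hγ t ht
  have hsol := R.efSol hp1 hγ
  obtain ⟨t₀, ht₀, hle⟩ := hentry _ _ (τ - n) (by linarith [ht.1, ht.2])
    (hsol.mono (subset_univ _)) (fun t ht => h1 t ht.1)
  have ht0t : t₀ ≤ t := by linarith [ht₀.2, ht.1]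
  exact htrap t _ _ ht.2 (hsol.pos t (mem_univ t)) (h1 t (by linarith [ht₀.1]))
    ((hsol.energy_le hN hp ht0t).trans hle)

end RegularFamily

end SupercriticalNeumann

end

/-! ### Attraction of solutions near the equilibrium -/

open Set Filter Topology MeasureTheory

noncomputable section

namespace SupercriticalNeumann

/-- The derivative of `y²/2 + β z²/2 + κ z y` along `z' = y`, `y' = -αy - βz + e`. Friction damps
only `y`; the cross term brings in `-κβ z²`, and the perturbation `e` is absorbed because `ν` is
small. -/
theorem lyapunov_rate_le {α β κ ν z y e : ℝ} (hβ : 0 < β) (hν : 0 ≤ ν) (hκ0 : 0 ≤ κ)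
    (hκ1 : κ ≤ 1 / 2) (hκα : κ * (1 + α ^ 2 / (2 * β)) ≤ α / 4)
    (hνα : ν ≤ α / 2) (hνκ : ν ≤ κ * β / 4) (he : |e| ≤ ν * |z|) :
    y * (-(α * y) - β * z + e) + β * (z * y) + κ * (y * y + z * (-(α * y) - β * z + e)) ≤
      -(α / 2 * y ^ 2) - κ * β / 4 * z ^ 2 := by
  have h1 : y * e ≤ ν * (y ^ 2 + z ^ 2) / 2 := by
    have e1 : y * e ≤ |y| * (ν * |z|) := by
      refine (le_abs_self _).trans ?_
      rw [abs_mul]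
      gcongr
    have e2 := mul_le_mul_of_nonneg_left (two_abs_mul_abs_le y z) hν
    linarith
  have h2 : κ * (z * e) ≤ ν * z ^ 2 / 2 := by
    have e1 : z * e ≤ ν * z ^ 2 := by
      calc z * e ≤ |z| * |e| := by rw [← abs_mul]; exact le_abs_self _
        _ ≤ |z| * (ν * |z|) := by gcongr
        _ = ν * z ^ 2 := by rw [← sq_abs z]; ring
    have e2 : 0 ≤ ν * z ^ 2 := by positivity
    have e3 := mul_le_mul_of_nonneg_left e1 hκ0
    have e4 := mul_le_mul_of_nonneg_right hκ1 e2
    linarith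
  have h3 : -(z * (α * y)) ≤ β / 2 * z ^ 2 + α ^ 2 / (2 * β) * y ^ 2 := by
    have e : β / 2 * z ^ 2 + α ^ 2 / (2 * β) * y ^ 2 + z * (α * y) =
        1 / (2 * β) * (β * z + α * y) ^ 2 := by field_simp; ring
    have : 0 ≤ 1 / (2 * β) * (β * z + α * y) ^ 2 := by positivity
    linarith
  have h4 := mul_le_mul_of_nonneg_left h3 hκ0
  have h5 := mul_le_mul_of_nonneg_right hκα (sq_nonneg y)
  have h6 := mul_le_mul_of_nonneg_right hνα (sq_nonneg y)
  have h7 := mul_le_mul_of_nonneg_right hνκ (sq_nonneg z)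
  linarith

/-- Exponential decay for `z'' + α z' + (β + o(1)) z = 0`. -/
theorem exists_linear_decay {α β : ℝ} (hα : 0 < α) (hβ : 0 < β) :
    ∃ ν > 0, ∃ C > 0, ∃ c > 0, ∀ (z y e : ℝ → ℝ) (τ T : ℝ), τ ≤ T →
      (∀ t ∈ Icc τ T, HasDerivAt z (y t) t) →
      (∀ t ∈ Icc τ T, HasDerivAt y (-(α * y t) - β * z t + e t) t) →
      (∀ t ∈ Icc τ T, |e t| ≤ ν * |z t|) →
      z T ^ 2 + y T ^ 2 ≤ (z τ ^ 2 + y τ ^ 2) * (C * Real.exp (-(c * (T - τ)))) := by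
  -- The first two bounds make the Lyapunov function comparable to `z² + y²`; the third lets the
  -- friction absorb the cross term.
  obtain ⟨κ, hκ0, hκ1, hκ2, hκ3⟩ : ∃ κ > 0, κ ≤ 1 / 2 ∧ κ ≤ β / 2 ∧
      κ * (1 + α ^ 2 / (2 * β)) ≤ α / 4 := by
    refine ⟨min (min (1 / 2) (β / 2)) (α / 4 / (1 + α ^ 2 / (2 * β))),
      lt_min (lt_min (by norm_num) (by positivity)) (by positivity),
      (min_le_left _ _).trans (min_le_left _ _), (min_le_left _ _).trans (min_le_right _ _), ?_⟩
    rw [← le_div_iff₀ (by positivity)]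
    exact min_le_right _ _
  set ν := min (α / 2) (κ * β / 4) with hν
  have hν0 : 0 < ν := lt_min (by positivity) (by positivity)
  set c := min (2 * α / 3) (κ / 3) with hc
  have hc0 : 0 < c := lt_min (by positivity) (by positivity)
  set b := min 1 β with hb
  have hb0 : 0 < b := lt_min one_pos hβ
  refine ⟨ν, hν0, 3 * (1 + β) / b, by positivity, c, hc0,
    fun z y e τ T hτT hz hy he => ?_⟩
  set V : ℝ → ℝ := fun t => y t ^ 2 / 2 + β * (z t ^ 2 / 2) + κ * (z t * y t) with hV
  have hVd : ∀ t ∈ Icc τ T, HasDerivAt V (y t * (-(α * y t) - β * z t + e t) + β * (z t * y t) +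
      κ * (y t * y t + z t * (-(α * y t) - β * z t + e t))) t := fun t ht => by
    refine ((((hy t ht).fun_pow 2).div_const 2).fun_add
      ((((hz t ht).fun_pow 2).div_const 2).const_mul β) |>.fun_add
      (((hz t ht).fun_mul (hy t ht)).const_mul κ)).congr_deriv ?_
    norm_num
    ring
  have hzy : ∀ t, |κ * (z t * y t)| ≤ β / 4 * z t ^ 2 + 1 / 4 * y t ^ 2 := fun t => by
    have e1 := two_abs_mul_abs_le (z t) (y t)
    rw [abs_mul, abs_of_pos hκ0, abs_mul]
    have e2 := mul_le_mul_of_nonneg_left e1 hκ0.le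
    have e3 := mul_le_mul_of_nonneg_right hκ1 (sq_nonneg (y t))
    have e4 := mul_le_mul_of_nonneg_right hκ2 (sq_nonneg (z t))
    linarith
  have hlow : ∀ t, b / 4 * (z t ^ 2 + y t ^ 2) ≤ V t := fun t => by
    have e1 := neg_le_of_abs_le (hzy t)
    have e2 := mul_le_mul_of_nonneg_right (min_le_left 1 β) (sq_nonneg (y t))
    have e3 := mul_le_mul_of_nonneg_right (min_le_right 1 β) (sq_nonneg (z t))
    simp only [hV]
    linarith
  have hup' : ∀ t, V t ≤ 3 / 4 * (y t ^ 2 + β * z t ^ 2) := fun t => by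
    have e1 := le_of_abs_le (hzy t)
    simp only [hV]
    linarith
  have hup : ∀ t, V t ≤ 3 / 4 * (1 + β) * (z t ^ 2 + y t ^ 2) := fun t => by
    have e1 := hup' t
    have e2 := mul_nonneg hβ.le (sq_nonneg (y t))
    have e3 := sq_nonneg (z t)
    linarith
  have hdec := le_mul_exp_of_deriv_le (C := -c) hτT
    (fun t ht => (hVd t ht).continuousAt.continuousWithinAt)
    (fun t ht => hVd t (Ioo_subset_Icc_self ht)) (fun t ht => by
      have h1 := lyapunov_rate_le (y := y t) hβ hν0.le hκ0.le hκ1 hκ3 (min_le_left _ _)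
        (min_le_right _ _) (he t (Ioo_subset_Icc_self ht))
      refine h1.trans ?_
      have h2 := mul_le_mul_of_nonneg_left (hup' t) hc0.le
      have h3 := mul_le_mul_of_nonneg_right (min_le_left (2 * α / 3) (κ / 3)) (sq_nonneg (y t))
      have h4 := mul_le_mul_of_nonneg_right (min_le_right (2 * α / 3) (κ / 3))
        (mul_nonneg hβ.le (sq_nonneg (z t)))
      linarith)
  have h1 := (hlow T).trans hdec
  have h2 := mul_le_mul_of_nonneg_right (hup τ) (Real.exp_pos (-c * (T - τ))).le
  have h3 := h1.trans h2
  rw [neg_mul] at h3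
  calc z T ^ 2 + y T ^ 2 = 4 / b * (b / 4 * (z T ^ 2 + y T ^ 2)) := by field_simp
    _ ≤ 4 / b * (3 / 4 * (1 + β) * (z τ ^ 2 + y τ ^ 2) * Real.exp (-(c * (T - τ)))) := by gcongr
    _ = _ := by ring

variable {N : ℕ} {p : ℝ}

theorem exists_efForce_sub_eq (hp : 1 < p) (x₁ x₂ : ℝ) :
    ∃ ξ ∈ uIcc x₁ x₂, efForce N p x₁ - efForce N p x₂ =
      (coeffB N p - p * ξ ^ (p - 1)) * (x₁ - x₂) := by
  wlog h : x₁ < x₂ generalizing x₁ x₂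
  · rcases (not_lt.1 h).eq_or_lt with rfl | h
    · exact ⟨x₂, left_mem_uIcc, by ring⟩
    · obtain ⟨ξ, hξ, e⟩ := this x₂ x₁ h
      exact ⟨ξ, uIcc_comm x₁ x₂ ▸ hξ, by linarith⟩
  obtain ⟨ξ, hξ, e⟩ := exists_hasDerivAt_eq_slope (efForce N p) _ h
    (continuous_efForce hp).continuousOn (fun x _ => hasDerivAt_efForce hp x)
  refine ⟨ξ, Ioo_subset_Icc_self.trans Icc_subset_uIcc hξ, ?_⟩
  rw [eq_div_iff (by linarith)] at e
  linarith

theorem EFSol.sub_deriv {x₁ y₁ x₂ y₂ : ℝ → ℝ} {S : Set ℝ} (h₁ : EFSol N p x₁ y₁ S)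
    (h₂ : EFSol N p x₂ y₂ S) {t : ℝ} (ht : t ∈ S) :
    HasDerivAt (fun t => x₁ t - x₂ t) (y₁ t - y₂ t) t ∧
    HasDerivAt (fun t => y₁ t - y₂ t) (-(alpha N p * (y₁ t - y₂ t)) +
      (efForce N p (x₁ t) - efForce N p (x₂ t)) + Real.exp (2 * t) * (x₁ t - x₂ t)) t :=
  ⟨(h₁.deriv_x t ht).fun_sub (h₂.deriv_x t ht),
    ((h₁.deriv_y t ht).fun_sub (h₂.deriv_y t ht)).congr_deriv (by ring)⟩

/-- The linearization rate `β = (p-1) B` at the equilibrium. -/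
def efBeta (N : ℕ) (p : ℝ) : ℝ := (p - 1) * coeffB N p

theorem efBeta_pos (hN : 3 ≤ N) (hp : pS N < p) : 0 < efBeta N p :=
  mul_pos (by linarith [one_lt_of_pS_lt hN hp]) (coeffB_pos hN hp)

/-- Near the equilibrium, the difference of two solutions satisfies an equation that is close
to the linearization. -/
theorem exists_efForce_sub_near (hN : 3 ≤ N) (hp : pS N < p) {ν : ℝ} (hν : 0 < ν) :
    ∃ δ > 0, ∃ T₀ ≤ 0, ∀ t ≤ T₀, ∀ x₁ x₂, |x₁ - A N p| < δ → |x₂ - A N p| < δ →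
      |efForce N p x₁ - efForce N p x₂ + Real.exp (2 * t) * (x₁ - x₂) + efBeta N p * (x₁ - x₂)| ≤
        ν * |x₁ - x₂| := by
  have hp1 := one_lt_of_pS_lt hN hp
  have hc : Continuous fun ξ : ℝ => coeffB N p - p * ξ ^ (p - 1) := by
    have : Continuous fun ξ : ℝ => ξ ^ (p - 1) := Real.continuous_rpow_const (by linarith)
    fun_prop
  have hA : coeffB N p - p * A N p ^ (p - 1) = -efBeta N p := by
    rw [A_pow hN hp, efBeta]; ring
  obtain ⟨δ, hδ, hd⟩ := Metric.continuous_iff.1 hc (A N p) (ν / 2) (by positivity)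
  have hlim : Tendsto (fun t : ℝ => Real.exp (2 * t)) atBot (𝓝 0) :=
    Real.tendsto_exp_atBot.comp (tendsto_id.const_mul_atBot two_pos)
  obtain ⟨T, hT1, hT0⟩ := ((hlim.eventually (gt_mem_nhds (by positivity : 0 < ν / 2))).and
    (eventually_le_atBot 0)).exists
  refine ⟨δ, hδ, T, hT0, fun t ht x₁ x₂ h₁ h₂ => ?_⟩
  obtain ⟨ξ, hξ, e⟩ := exists_efForce_sub_eq (N := N) hp1 x₁ x₂
  have hξA : dist ξ (A N p) < δ := by
    have h1 : x₁ ∈ Metric.ball (A N p) δ := h₁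
    have h2 : x₂ ∈ Metric.ball (A N p) δ := h₂
    exact (convex_ball (A N p) δ).ordConnected.uIcc_subset h1 h2 hξ
  have h3 := hd ξ hξA
  rw [hA, Real.dist_eq] at h3
  have h4 : Real.exp (2 * t) < ν / 2 := (Real.exp_le_exp.2 (by linarith)).trans_lt hT1
  rw [e, ← add_mul, ← add_mul, abs_mul]
  gcongr
  have := Real.exp_pos (2 * t)
  rw [abs_lt] at h3
  rw [abs_le]
  constructor <;> linarith [h3.1, h3.2]

/-- Solutions near the equilibrium attract each other. -/
theorem exists_efSol_decay (hN : 3 ≤ N) (hp : pS N < p) :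
    ∃ δ > 0, ∃ T₀ ≤ 0, ∃ C > 0, ∃ c > 0, ∀ (x₁ y₁ x₂ y₂ : ℝ → ℝ) (τ T : ℝ), τ ≤ T → T ≤ T₀ →
      EFSol N p x₁ y₁ (Icc τ T) → EFSol N p x₂ y₂ (Icc τ T) →
      (∀ t ∈ Icc τ T, |x₁ t - A N p| < δ) → (∀ t ∈ Icc τ T, |x₂ t - A N p| < δ) →
      (x₁ T - x₂ T) ^ 2 + (y₁ T - y₂ T) ^ 2 ≤
        ((x₁ τ - x₂ τ) ^ 2 + (y₁ τ - y₂ τ) ^ 2) * (C * Real.exp (-(c * (T - τ)))) := by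
  obtain ⟨ν, hν, C, hC, c, hc, hdec⟩ := exists_linear_decay (alpha_pos hN hp) (efBeta_pos hN hp)
  obtain ⟨δ, hδ, T₀, hT₀, hnear⟩ := exists_efForce_sub_near hN hp hν
  refine ⟨δ, hδ, T₀, hT₀, C, hC, c, hc, fun x₁ y₁ x₂ y₂ τ T hτ hT h₁ h₂ hx₁ hx₂ => ?_⟩
  exact hdec (fun t => x₁ t - x₂ t) (fun t => y₁ t - y₂ t)
    (fun t => efForce N p (x₁ t) - efForce N p (x₂ t) + Real.exp (2 * t) * (x₁ t - x₂ t) +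
      efBeta N p * (x₁ t - x₂ t)) τ T hτ (fun t ht => (h₁.sub_deriv h₂ ht).1)
    (fun t ht => ((h₁.sub_deriv h₂ ht).2).congr_deriv (by ring))
    (fun t ht => hnear t (ht.2.trans hT) _ _ (hx₁ t ht) (hx₂ t ht))

/-- Two-sided Grönwall estimate for the difference of two solutions. -/
theorem EFSol.gronwall (hN : 3 ≤ N) (hp : pS N < p) {x₁ y₁ x₂ y₂ : ℝ → ℝ} {s t M : ℝ} (hst : s ≤ t)
    (h₁ : EFSol N p x₁ y₁ (Icc s t)) (h₂ : EFSol N p x₂ y₂ (Icc s t))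
    (hx₁ : ∀ r ∈ Icc s t, x₁ r ≤ M) (hx₂ : ∀ r ∈ Icc s t, x₂ r ≤ M) :
    (x₁ t - x₂ t) ^ 2 + (y₁ t - y₂ t) ^ 2 ≤ ((x₁ s - x₂ s) ^ 2 + (y₁ s - y₂ s) ^ 2) *
      Real.exp ((1 + coeffB N p + p * M ^ (p - 1) + Real.exp (2 * t) + 2 * alpha N p) * (t - s)) ∧
    (x₁ s - x₂ s) ^ 2 + (y₁ s - y₂ s) ^ 2 ≤ ((x₁ t - x₂ t) ^ 2 + (y₁ t - y₂ t) ^ 2) *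
      Real.exp ((1 + coeffB N p + p * M ^ (p - 1) + Real.exp (2 * t) + 2 * alpha N p) *
        (t - s)) := by
  have hp1 := one_lt_of_pS_lt hN hp
  have hα := alpha_pos hN hp
  have hB := coeffB_pos hN hp
  set K := 1 + coeffB N p + p * M ^ (p - 1) + Real.exp (2 * t) + 2 * alpha N p
  -- The squared phase distance has a logarithmic derivative bounded on both sides, since the force
  -- is Lipschitz where both solutions lie in `[0,M]`.
  have hd : ∀ r ∈ Icc s t, HasDerivAt (fun t => (x₁ t - x₂ t) ^ 2 + (y₁ t - y₂ t) ^ 2)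
      (2 * (x₁ r - x₂ r) * (y₁ r - y₂ r) + 2 * (y₁ r - y₂ r) * (-(alpha N p * (y₁ r - y₂ r)) +
      (efForce N p (x₁ r) - efForce N p (x₂ r)) + Real.exp (2 * r) * (x₁ r - x₂ r))) r :=
    fun r hr => by
      refine (((h₁.sub_deriv h₂ hr).1.fun_pow 2).fun_add
        ((h₁.sub_deriv h₂ hr).2.fun_pow 2)).congr_deriv ?_
      norm_num
  have hbd : ∀ r ∈ Icc s t, |2 * (x₁ r - x₂ r) * (y₁ r - y₂ r) + 2 * (y₁ r - y₂ r) *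
      (-(alpha N p * (y₁ r - y₂ r)) + (efForce N p (x₁ r) - efForce N p (x₂ r)) +
      Real.exp (2 * r) * (x₁ r - x₂ r))| ≤ K * ((x₁ r - x₂ r) ^ 2 + (y₁ r - y₂ r) ^ 2) :=
    fun r hr => by
      obtain ⟨ξ, hξ, e⟩ := exists_efForce_sub_eq (N := N) hp1 (x₁ r) (x₂ r)
      have hξ' : ξ ∈ Icc 0 M := (ordConnected_Icc.uIcc_subset
        ⟨(h₁.pos r hr).le, hx₁ r hr⟩ ⟨(h₂.pos r hr).le, hx₂ r hr⟩) hξ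
      rw [e]
      set z := x₁ r - x₂ r
      set y := y₁ r - y₂ r
      have h1 : |coeffB N p - p * ξ ^ (p - 1)| ≤ coeffB N p + p * M ^ (p - 1) := by
        have e1 : p * ξ ^ (p - 1) ≤ p * M ^ (p - 1) := by
          have := Real.rpow_le_rpow hξ'.1 hξ'.2 (by linarith : 0 ≤ p - 1)
          gcongr
        have e2 : 0 ≤ p * ξ ^ (p - 1) := mul_nonneg (by linarith) (Real.rpow_nonneg hξ'.1 _)
        rw [abs_le]
        constructor <;> linarith
      have h2 : Real.exp (2 * r) ≤ Real.exp (2 * t) := Real.exp_le_exp.2 (by linarith [hr.2])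
      have h3 : |1 + (coeffB N p - p * ξ ^ (p - 1)) + Real.exp (2 * r)| ≤
          1 + coeffB N p + p * M ^ (p - 1) + Real.exp (2 * t) := by
        have := Real.exp_pos (2 * r)
        rw [abs_le] at h1 ⊢
        constructor <;> linarith [h1.1, h1.2]
      have h4 := two_abs_mul_abs_le z y
      have e5 : 2 * z * y + 2 * y * (-(alpha N p * y) + (coeffB N p - p * ξ ^ (p - 1)) * z +
          Real.exp (2 * r) * z) = 2 * (z * y) *
            (1 + (coeffB N p - p * ξ ^ (p - 1)) + Real.exp (2 * r)) - 2 * alpha N p * y ^ 2 := by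
        ring
      rw [e5]
      refine (abs_sub _ _).trans ?_
      have h6 : |2 * (z * y) * (1 + (coeffB N p - p * ξ ^ (p - 1)) + Real.exp (2 * r))| ≤
          (z ^ 2 + y ^ 2) * (1 + coeffB N p + p * M ^ (p - 1) + Real.exp (2 * t)) := by
        rw [abs_mul, abs_mul, abs_mul, abs_of_pos (two_pos : (0 : ℝ) < 2)]
        gcongr
      have h7 : |2 * alpha N p * y ^ 2| ≤ 2 * alpha N p * (z ^ 2 + y ^ 2) := by
        rw [abs_of_nonneg (by positivity)]
        have := sq_nonneg z
        gcongr
        linarith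
      have : K = 1 + coeffB N p + p * M ^ (p - 1) + Real.exp (2 * t) + 2 * alpha N p := rfl
      rw [this]
      linarith
  have hcont : ContinuousOn (fun t => (x₁ t - x₂ t) ^ 2 + (y₁ t - y₂ t) ^ 2) (Icc s t) :=
    fun r hr => (hd r hr).continuousAt.continuousWithinAt
  exact ⟨le_mul_exp_of_deriv_le hst hcont (fun r hr => hd r (Ioo_subset_Icc_self hr))
      (fun r hr => le_of_abs_le (hbd r (Ioo_subset_Icc_self hr))),
    le_mul_exp_of_le_deriv hst hcont (fun r hr => hd r (Ioo_subset_Icc_self hr))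
      (fun r hr => neg_le_of_abs_le (hbd r (Ioo_subset_Icc_self hr)))⟩

end SupercriticalNeumann

end

/-! ### Convergence of the family as `γ → ∞` -/

open Set Filter Topology MeasureTheory

noncomputable section

namespace SupercriticalNeumann

variable {N : ℕ} {p : ℝ} {X Y : ℝ → ℝ → ℝ} {c : ℝ}

/-- Families that approach the equilibrium are uniformly Cauchy on compact intervals. -/
theorem exists_sq_dist_lt (hN : 3 ≤ N) (hp : pS N < p)
    (hsol : ∀ γ > 0, EFSol N p (X γ) (Y γ) univ) (hc : 0 < c)
    (hcore : ∀ τ, ∀ᶠ γ in atTop, ∀ t ≥ τ, efEnergy N p t (X γ t) (Y γ t) ≤ -c)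
    (hnear : ∀ δ > 0, ∃ T ≤ 0, ∀ τ : ℝ, ∀ᶠ γ in atTop, ∀ t ∈ Icc τ T,
      |X γ t - A N p| < δ ∧ |Y γ t| < δ) (a b : ℝ) {ε : ℝ} (hε : 0 < ε) :
    ∃ Γ : ℝ, ∀ γ₁ ≥ Γ, ∀ γ₂ ≥ Γ, ∀ t ∈ Icc a b,
      (X γ₁ t - X γ₂ t) ^ 2 + (Y γ₁ t - Y γ₂ t) ^ 2 < ε := by
  obtain ⟨δ, hδ, T₀, hT₀, C, hC, κ, hκ, hdec⟩ := exists_efSol_decay hN hp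
  obtain ⟨T₁, hT₁, hn⟩ := hnear δ hδ
  set T := min T₀ T₁ with hT
  set M := efBound N p (max b 0) with hM
  have hM0 : 0 < M := efBound_pos hN hp _
  have hp1 := one_lt_of_pS_lt hN hp
  have hα := alpha_pos hN hp
  have hB := coeffB_pos hN hp
  set K := 1 + coeffB N p + p * M ^ (p - 1) + Real.exp (2 * b) + 2 * alpha N p with hK
  have hK0 : 0 < K := by positivity
  set L := Real.exp (K * |b - T|) with hL
  -- At time `τ` both solutions are `δ`-close to the equilibrium, so their squared distance is at
  -- most `8δ²`. The exponential is the attraction from `τ` up to `min a T`, and `L` bounds the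
  -- later growth up to `b`. An early `τ` makes the product small.
  have hlim : Tendsto (fun τ : ℝ => 8 * δ ^ 2 * (C * Real.exp (-(κ * (min a T - τ)))) * L)
      atBot (𝓝 0) := by
    have h1 : Tendsto (fun τ : ℝ => -(κ * (min a T - τ))) atBot atBot := by
      have := (tendsto_id (α := ℝ)).const_mul_atBot hκ
      have := tendsto_atBot_add_const_right atBot (-(κ * min a T)) this
      refine this.congr fun τ => ?_
      simp only [id]; ring
    simpa using (((Real.tendsto_exp_atBot.comp h1).const_mul C).const_mul (8 * δ ^ 2)).mul_const L
  obtain ⟨τ, hτ1, hτ2⟩ := ((hlim.eventually (gt_mem_nhds hε)).and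
    (eventually_le_atBot (min a T))).exists
  obtain ⟨Γ, hΓ⟩ := eventually_atTop.1 (((hcore τ).and (hn τ)).and (eventually_gt_atTop 0))
  refine ⟨Γ, fun γ₁ h₁ γ₂ h₂ t ht => ?_⟩
  obtain ⟨⟨hc₁, hn₁⟩, hγ₁⟩ := hΓ γ₁ h₁
  obtain ⟨⟨hc₂, hn₂⟩, hγ₂⟩ := hΓ γ₂ h₂
  have hs₁ := hsol γ₁ hγ₁
  have hs₂ := hsol γ₂ hγ₂
  have hτT : τ ≤ T := hτ2.trans (min_le_right _ _)
  have hτt : τ ≤ t := (hτ2.trans (min_le_left _ _)).trans ht.1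
  set T' := min t T with hT'
  have hτT' : τ ≤ T' := le_min hτt hτT
  have hT'T : T' ≤ T := min_le_right _ _
  have hmem : ∀ r ∈ Icc τ T', r ∈ Icc τ T₁ := fun r hr =>
    ⟨hr.1, hr.2.trans (hT'T.trans (min_le_right _ _))⟩
  have h3 := hdec _ _ _ _ τ T' hτT' (hT'T.trans (min_le_left _ _)) (hs₁.mono (subset_univ _))
    (hs₂.mono (subset_univ _)) (fun r hr => (hn₁ r (hmem r hr)).1)
    (fun r hr => (hn₂ r (hmem r hr)).1)
  have hMr : ∀ γ, (∀ t ≥ τ, efEnergy N p t (X γ t) (Y γ t) ≤ -c) → EFSol N p (X γ) (Y γ) univ →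
      ∀ r ∈ Icc T' t, X γ r ≤ M := fun γ h hs r hr =>
    (le_efBound_of_efEnergy_nonpos hN hp (hs.pos r (mem_univ r))
      (by linarith [h r (hτT'.trans hr.1)])).trans
      (efBound_mono hN hp ((hr.2.trans ht.2).trans (le_max_left _ _)))
  have h4 := (EFSol.gronwall hN hp (min_le_left t T) (hs₁.mono (subset_univ _))
    (hs₂.mono (subset_univ _)) (hMr γ₁ hc₁ hs₁) (hMr γ₂ hc₂ hs₂)).1
  have h5 : (X γ₁ τ - X γ₂ τ) ^ 2 + (Y γ₁ τ - Y γ₂ τ) ^ 2 ≤ 8 * δ ^ 2 := by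
    have hτm : τ ∈ Icc τ T₁ := ⟨le_rfl, hτT.trans (min_le_right _ _)⟩
    have e1 := abs_lt.1 (hn₁ τ hτm).1
    have e2 := abs_lt.1 (hn₂ τ hτm).1
    have e3 := abs_lt.1 (hn₁ τ hτm).2
    have e4 := abs_lt.1 (hn₂ τ hτm).2
    have e5 : (X γ₁ τ - X γ₂ τ) ^ 2 ≤ (2 * δ) ^ 2 := sq_le_sq' (by linarith) (by linarith)
    have e6 : (Y γ₁ τ - Y γ₂ τ) ^ 2 ≤ (2 * δ) ^ 2 := sq_le_sq' (by linarith) (by linarith)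
    linarith
  have h6 : Real.exp (-(κ * (T' - τ))) ≤ Real.exp (-(κ * (min a T - τ))) := by
    have : min a T ≤ T' := min_le_min_right T ht.1
    gcongr
  have h7 : Real.exp ((1 + coeffB N p + p * M ^ (p - 1) + Real.exp (2 * t) + 2 * alpha N p) *
      (t - T')) ≤ L := by
    have e1 : t - T' ≤ |b - T| := by
      rcases le_total t T with h | h
      · rw [hT', min_eq_left h, sub_self]; exact abs_nonneg _
      · rw [hT', min_eq_right h]
        exact (by linarith [ht.2] : t - T ≤ b - T).trans (le_abs_self _)
    have e2 : 0 ≤ t - T' := sub_nonneg.2 (min_le_left _ _)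
    have e3 : Real.exp (2 * t) ≤ Real.exp (2 * b) := Real.exp_le_exp.2 (by linarith [ht.2])
    rw [hL]
    refine Real.exp_le_exp.2 (mul_le_mul ?_ e1 e2 hK0.le)
    rw [hK]
    linarith
  refine lt_of_le_of_lt ?_ hτ1
  refine h4.trans (mul_le_mul (h3.trans (mul_le_mul h5 ?_ (by positivity) (by positivity))) h7
    (Real.exp_pos _).le (by positivity))
  gcongr

/-- The limit of a family that approaches the equilibrium: the singular solution. -/
theorem exists_ef_limit (hN : 3 ≤ N) (hp : pS N < p)
    (hsol : ∀ γ > 0, EFSol N p (X γ) (Y γ) univ) (hc : 0 < c)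
    (hcore : ∀ τ, ∀ᶠ γ in atTop, ∀ t ≥ τ, efEnergy N p t (X γ t) (Y γ t) ≤ -c)
    (hnear : ∀ δ > 0, ∃ T ≤ 0, ∀ τ : ℝ, ∀ᶠ γ in atTop, ∀ t ∈ Icc τ T,
      |X γ t - A N p| < δ ∧ |Y γ t| < δ) :
    ∃ x y : ℝ → ℝ, EFSol N p x y univ ∧ (∀ t, efEnergy N p t (x t) (y t) ≤ -c) ∧
      (∀ t, Tendsto (fun γ => X γ t) atTop (𝓝 (x t))) ∧
      (∀ t, Tendsto (fun γ => Y γ t) atTop (𝓝 (y t))) ∧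
      Tendsto x atBot (𝓝 (A N p)) ∧ Tendsto y atBot (𝓝 0) := by
  have hp1 := one_lt_of_pS_lt hN hp
  have hcau := exists_sq_dist_lt hN hp hsol hc hcore hnear
  have hcx : ∀ a b, UniformCauchySeqOn X atTop (Icc a b) := fun a b => by
    rw [Metric.uniformCauchySeqOn_iff]
    intro ε hε
    obtain ⟨Γ, hΓ⟩ := hcau a b (pow_pos hε 2)
    refine ⟨Γ, fun γ₁ h₁ γ₂ h₂ t ht => ?_⟩
    have := hΓ γ₁ h₁ γ₂ h₂ t ht
    exact abs_lt_of_sq_lt_sq (by linarith [sq_nonneg (Y γ₁ t - Y γ₂ t)]) hε.le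
  have hcy : ∀ a b, UniformCauchySeqOn Y atTop (Icc a b) := fun a b => by
    rw [Metric.uniformCauchySeqOn_iff]
    intro ε hε
    obtain ⟨Γ, hΓ⟩ := hcau a b (pow_pos hε 2)
    refine ⟨Γ, fun γ₁ h₁ γ₂ h₂ t ht => ?_⟩
    have := hΓ γ₁ h₁ γ₂ h₂ t ht
    exact abs_lt_of_sq_lt_sq (by linarith [sq_nonneg (X γ₁ t - X γ₂ t)]) hε.le
  have hlx : ∀ t, ∃ l, Tendsto (fun γ => X γ t) atTop (𝓝 l) := fun t =>
    cauchySeq_tendsto_of_complete ((hcx t t).cauchySeq (left_mem_Icc.2 le_rfl))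
  have hly : ∀ t, ∃ l, Tendsto (fun γ => Y γ t) atTop (𝓝 l) := fun t =>
    cauchySeq_tendsto_of_complete ((hcy t t).cauchySeq (left_mem_Icc.2 le_rfl))
  choose x hx using hlx
  choose y hy using hly
  have hXc : ∀ γ > 0, Continuous (X γ) := fun γ hγ => continuous_iff_continuousAt.2 fun t =>
    ((hsol γ hγ).deriv_x t (mem_univ t)).continuousAt
  have hYc : ∀ γ > 0, Continuous (Y γ) := fun γ hγ => continuous_iff_continuousAt.2 fun t =>
    ((hsol γ hγ).deriv_y t (mem_univ t)).continuousAt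
  have hux := fun a b => (hcx a b).tendstoUniformlyOn_of_tendsto fun t _ => hx t
  have huy := fun a b => (hcy a b).tendstoUniformlyOn_of_tendsto fun t _ => hy t
  have hcontx : Continuous x := continuous_iff_continuousAt.2 fun t =>
    ((hux (t - 1) (t + 1)).continuousOn ((eventually_gt_atTop 0).mono fun γ hγ =>
      (hXc γ hγ).continuousOn).frequently).continuousAt (Icc_mem_nhds (by linarith) (by linarith))
  have hconty : Continuous y := continuous_iff_continuousAt.2 fun t =>
    ((huy (t - 1) (t + 1)).continuousOn ((eventually_gt_atTop 0).mono fun γ hγ =>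
      (hYc γ hγ).continuousOn).frequently).continuousAt (Icc_mem_nhds (by linarith) (by linarith))
  have hE : ∀ t, efEnergy N p t (x t) (y t) ≤ -c := fun t => by
    have hcon : Continuous fun q : ℝ × ℝ => efEnergy N p t q.1 q.2 := by
      have := continuous_efPot (N := N) hp1
      unfold efEnergy
      fun_prop
    have h1 := (hcon.tendsto (x t, y t)).comp ((hx t).prodMk_nhds (hy t))
    exact le_of_tendsto h1 ((hcore t).mono fun γ h => h t le_rfl)
  have hx0 : ∀ t, 0 ≤ x t := fun t => ge_of_tendsto (hx t)
    ((eventually_gt_atTop 0).mono fun γ hγ => ((hsol γ hγ).pos t (mem_univ t)).le)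
  -- The energy at `x = 0` is `y²/2 ≥ 0`, so the uniform bound `-c` prevents the limit from
  -- degenerating.
  have hxpos : ∀ t, 0 < x t := fun t => by
    refine lt_of_le_of_ne (hx0 t) fun h0 => ?_
    have h1 := hE t
    rw [efEnergy, efPot, ← h0, Real.zero_rpow (by linarith)] at h1
    have := sq_nonneg (y t)
    norm_num at h1
    linarith
  set F : ℝ → ℝ → ℝ → ℝ := fun t x y => -(alpha N p * y) + efForce N p x + Real.exp (2 * t) * x
    with hF
  have hFc : Continuous fun q : ℝ × ℝ × ℝ => F q.1 q.2.1 q.2.2 := by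
    have := continuous_efForce (N := N) hp1
    simp only [hF]
    fun_prop
  have hbdd : ∀ a b, ∃ K, ∀ᶠ γ in atTop, ∀ t ∈ Icc a b, |X γ t| ≤ K ∧ |Y γ t| ≤ K :=
    fun a b => by
      obtain ⟨K₁, hK₁⟩ := isCompact_Icc.exists_bound_of_continuousOn (s := Icc a b)
        hcontx.continuousOn
      obtain ⟨K₂, hK₂⟩ := isCompact_Icc.exists_bound_of_continuousOn (s := Icc a b)
        hconty.continuousOn
      refine ⟨max K₁ K₂ + 1, ?_⟩
      filter_upwards [Metric.tendstoUniformlyOn_iff.1 (hux a b) 1 one_pos,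
        Metric.tendstoUniformlyOn_iff.1 (huy a b) 1 one_pos] with γ h1 h2 t ht
      have e1 := h1 t ht
      have e2 := h2 t ht
      have e3 := hK₁ t ht
      have e4 := hK₂ t ht
      rw [dist_comm, Real.dist_eq] at e1 e2
      rw [Real.norm_eq_abs] at e3 e4
      have e5 := le_max_left K₁ K₂
      have e6 := le_max_right K₁ K₂
      constructor
      · linarith [abs_sub_abs_le_abs_sub (X γ t) (x t)]
      · linarith [abs_sub_abs_le_abs_sub (Y γ t) (y t)]
  -- The limit solves the system because the integral equations pass to the limit by dominated
  -- convergence.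
  have hInt : ∀ t, x t - x 0 = ∫ σ in (0 : ℝ)..t, y σ := fun t => by
    have h1 : Tendsto (fun γ => ∫ σ in (0 : ℝ)..t, Y γ σ) atTop (𝓝 (∫ σ in (0 : ℝ)..t, y σ)) := by
      obtain ⟨K, hK⟩ := hbdd (min 0 t) (max 0 t)
      refine intervalIntegral.tendsto_integral_filter_of_dominated_convergence (fun _ => K)
        ((eventually_gt_atTop 0).mono fun γ hγ => (hYc γ hγ).aestronglyMeasurable) ?_
        intervalIntegrable_const (ae_of_all _ fun σ _ => hy σ)
      filter_upwards [hK] with γ h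
      exact ae_of_all _ fun σ hσ => (h σ (Ioc_subset_Icc_self hσ)).2
    refine tendsto_nhds_unique ((hx t).sub (hx 0)) (h1.congr' ?_)
    filter_upwards [eventually_gt_atTop 0] with γ hγ
    exact intervalIntegral.integral_eq_sub_of_hasDerivAt
      (fun σ _ => (hsol γ hγ).deriv_x σ (mem_univ σ)) ((hYc γ hγ).intervalIntegrable _ _)
  have hInt' : ∀ t, y t - y 0 = ∫ σ in (0 : ℝ)..t, F σ (x σ) (y σ) := fun t => by
    have h1 : Tendsto (fun γ => ∫ σ in (0 : ℝ)..t, F σ (X γ σ) (Y γ σ)) atTop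
        (𝓝 (∫ σ in (0 : ℝ)..t, F σ (x σ) (y σ))) := by
      obtain ⟨K, hK⟩ := hbdd (min 0 t) (max 0 t)
      obtain ⟨K', hK'⟩ := ((isCompact_Icc (a := min 0 t) (b := max 0 t)).prod
        ((isCompact_Icc (a := -K) (b := K)).prod
          (isCompact_Icc (a := -K) (b := K)))).exists_bound_of_continuousOn hFc.continuousOn
      refine intervalIntegral.tendsto_integral_filter_of_dominated_convergence (fun _ => K')
        ((eventually_gt_atTop 0).mono fun γ hγ => ?_) ?_
        intervalIntegrable_const (ae_of_all _ fun σ _ => ?_)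
      · have h1 := hXc γ hγ
        have h2 := hYc γ hγ
        exact (hFc.comp (f := fun σ => (σ, X γ σ, Y γ σ)) (by fun_prop)).aestronglyMeasurable
      · filter_upwards [hK] with γ h
        refine ae_of_all _ fun σ hσ => hK' (σ, X γ σ, Y γ σ) ?_
        have hσ' : σ ∈ Icc (min 0 t) (max 0 t) := Ioc_subset_Icc_self hσ
        exact ⟨hσ', abs_le.1 (h σ hσ').1, abs_le.1 (h σ hσ').2⟩
      · exact (hFc.tendsto (σ, x σ, y σ)).comp
          (tendsto_const_nhds.prodMk_nhds ((hx σ).prodMk_nhds (hy σ)))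
    refine tendsto_nhds_unique ((hy t).sub (hy 0)) (h1.congr' ?_)
    filter_upwards [eventually_gt_atTop 0] with γ hγ
    have h1 := hXc γ hγ
    have h2 := hYc γ hγ
    exact intervalIntegral.integral_eq_sub_of_hasDerivAt
      (fun σ _ => (hsol γ hγ).deriv_y σ (mem_univ σ))
      ((hFc.comp (f := fun σ => (σ, X γ σ, Y γ σ)) (by fun_prop)).intervalIntegrable _ _)
  have hFxy : Continuous fun σ => F σ (x σ) (y σ) :=
    hFc.comp (f := fun σ => (σ, x σ, y σ)) (by fun_prop)
  refine ⟨x, y, ⟨fun t _ => ?_, fun t _ => ?_, fun t _ => hxpos t⟩, hE, hx, hy, ?_, ?_⟩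
  · have h1 := (intervalIntegral.integral_hasDerivAt_right (hconty.intervalIntegrable 0 t)
      (hconty.stronglyMeasurableAtFilter _ _) hconty.continuousAt).const_add (x 0)
    refine h1.congr_of_eventuallyEq (Eventually.of_forall fun s => ?_)
    simp only
    rw [← hInt s]; ring
  · have h1 := (intervalIntegral.integral_hasDerivAt_right (hFxy.intervalIntegrable 0 t)
      (hFxy.stronglyMeasurableAtFilter _ _) hFxy.continuousAt).const_add (y 0)
    refine h1.congr_of_eventuallyEq (Eventually.of_forall fun s => ?_)
    simp only
    rw [← hInt' s]; ring
  · refine Metric.tendsto_nhds.2 fun δ hδ => ?_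
    obtain ⟨T, -, h⟩ := hnear (δ / 2) (by positivity)
    filter_upwards [eventually_le_atBot T] with t ht
    have : |x t - A N p| ≤ δ / 2 := le_of_tendsto ((hx t).sub_const _).abs
      ((h t).mono fun γ h => (h t ⟨le_rfl, ht⟩).1.le)
    rw [Real.dist_eq]
    linarith
  · refine Metric.tendsto_nhds.2 fun δ hδ => ?_
    obtain ⟨T, -, h⟩ := hnear (δ / 2) (by positivity)
    filter_upwards [eventually_le_atBot T] with t ht
    have : |y t| ≤ δ / 2 := le_of_tendsto (hy t).abs
      ((h t).mono fun γ h => (h t ⟨le_rfl, ht⟩).2.le)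
    rw [Real.dist_eq, sub_zero]
    linarith

end SupercriticalNeumann

end

/-! ### The singular solution as a limit in the original variables -/

open Set Filter Topology MeasureTheory

noncomputable section

namespace SupercriticalNeumann

variable {N : ℕ} {p : ℝ}

theorem rpow_neg_mul_efX (p : ℝ) (u : ℝ → ℝ) {s : ℝ} (hs : 0 < s) :
    s ^ (-theta p) * efX p u (Real.log s) = u s := by
  rw [efX, Real.exp_log hs, mul_comm (theta p), Real.exp_mul, Real.exp_log hs, ← mul_assoc,
    ← Real.rpow_add hs, neg_add_cancel, Real.rpow_zero, one_mul]

theorem rpow_neg_mul_efY (p : ℝ) (u w : ℝ → ℝ) {s : ℝ} (hs : 0 < s) :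
    s ^ (-theta p) * (efY p u w (Real.log s) - theta p * efX p u (Real.log s)) / s = w s := by
  rw [mul_sub, mul_left_comm, rpow_neg_mul_efX p u hs, efY, Real.exp_log hs, mul_comm (theta p),
    Real.exp_mul, Real.exp_log hs, ← mul_assoc, ← Real.rpow_add hs, neg_add_cancel,
    Real.rpow_zero, one_mul]
  field_simp
  ring

/-- The radial function with Emden-Fowler transform `x`. -/
def ofEF (p : ℝ) (x : ℝ → ℝ) (s : ℝ) : ℝ := s ^ (-theta p) * x (Real.log s)

/-- The derivative of the radial function with Emden-Fowler transform `x`, when `x' = y`. -/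
def ofEF' (p : ℝ) (x y : ℝ → ℝ) (s : ℝ) : ℝ :=
  s ^ (-theta p) * (y (Real.log s) - theta p * x (Real.log s)) / s

theorem exp_mul_exp_rpow (p t : ℝ) : Real.exp (theta p * t) * Real.exp t ^ (-theta p) = 1 := by
  rw [← Real.exp_mul, ← Real.exp_add]
  simp; ring

theorem efX_ofEF (p : ℝ) (x : ℝ → ℝ) : efX p (ofEF p x) = x := by
  ext t
  rw [efX, ofEF, Real.log_exp, ← mul_assoc, exp_mul_exp_rpow, one_mul]

theorem efY_ofEF (p : ℝ) (x y : ℝ → ℝ) : efY p (ofEF p x) (ofEF' p x y) = y := by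
  ext t
  have h := exp_mul_exp_rpow p t
  rw [efY, ofEF, ofEF', Real.log_exp]
  have := (Real.exp_pos t).ne'
  field_simp
  linear_combination y t * h

theorem EFSol.radialSol (hp : 1 < p) {x y : ℝ → ℝ} (h : EFSol N p x y univ) :
    RadialSol N p (ofEF p x) (ofEF' p x y) (Ioi 0) where
  subset := Subset.rfl
  deriv_u s hs := by
    have hs0 : s ≠ 0 := (mem_Ioi.1 hs).ne'
    have h1 := (h.deriv_x (Real.log s) (mem_univ _)).comp s (Real.hasDerivAt_log hs0)
    have h2 := Real.hasDerivAt_rpow_const (x := s) (p := -theta p) (Or.inl hs0)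
    refine (h2.fun_mul h1).congr_deriv ?_
    rw [ofEF', Real.rpow_sub_one hs0]
    simp only [Function.comp]
    field_simp
    ring
  deriv_w s hs := by
    have hs0 : s ≠ 0 := (mem_Ioi.1 hs).ne'
    have h1 := (h.deriv_x (Real.log s) (mem_univ _)).comp s (Real.hasDerivAt_log hs0)
    have h3 := (h.deriv_y (Real.log s) (mem_univ _)).comp s (Real.hasDerivAt_log hs0)
    have h2 := Real.hasDerivAt_rpow_const (x := s) (p := -theta p) (Or.inl hs0)
    refine ((h2.fun_mul (h3.fun_sub (h1.const_mul (theta p)))).fun_div (hasDerivAt_id s)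
      hs0).congr_deriv ?_
    have hx := h.pos (Real.log s) (mem_univ _)
    have he : Real.exp (2 * Real.log s) = s ^ 2 := by
      rw [two_mul, Real.exp_add, Real.exp_log hs, sq]
    have hp' : ofEF p x s ^ p = s ^ (-theta p) * x (Real.log s) ^ p / s ^ 2 := by
      rw [ofEF, Real.mul_rpow (Real.rpow_nonneg (le_of_lt hs) _) hx.le, ← Real.rpow_mul
        (le_of_lt hs), mul_div_right_comm]
      congr 1
      rw [eq_div_iff (pow_ne_zero 2 hs0), ← Real.rpow_natCast, ← Real.rpow_add hs]
      congr 1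
      have := theta_mul hp
      push_cast
      linarith
    rw [f, hp', he, Real.rpow_sub_one hs0, efForce]
    simp only [Function.comp, id, ofEF, ofEF', coeffB, alpha]
    field_simp
    ring
  pos s hs := mul_pos (Real.rpow_pos_of_pos hs _) (h.pos _ (mem_univ _))

/-- The limit `(U, W)` of the regular solutions and their derivatives as `γ → ∞`, a singular
solution on `(0, ∞)`, decreasing and larger than `1` on `(0, s₀]`. -/
structure SingularLimit (N : ℕ) (p : ℝ) (u m : ℝ → ℝ → ℝ) (U W : ℝ → ℝ) (s₀ : ℝ) : Prop where
  sol : RadialSol N p U W (Ioi 0)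
  tendsto_u : ∀ s > 0, Tendsto (fun γ => u s γ) atTop (𝓝 (U s))
  tendsto_w : ∀ s > 0, Tendsto (fun γ => -(s * m s γ)) atTop (𝓝 (W s))
  exists_pohozaev_le : ∃ c > 0, ∀ s > 0, pohozaev N p s (U s) (W s) ≤ -c
  tendsto_x : Tendsto (efX p U) atBot (𝓝 (A N p))
  tendsto_y : Tendsto (efY p U W) atBot (𝓝 0)
  s₀_pos : 0 < s₀
  one_lt : ∀ s ∈ Ioc 0 s₀, 1 < U s
  neg : ∀ s ∈ Ioc 0 s₀, W s < 0
  eventually_one_lt : ∀ᶠ γ in atTop, ∀ s ∈ Icc 0 s₀, 1 < u s γ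
  bounded : ∀ b : ℝ, ∃ M, ∀ᶠ γ in atTop, ∀ s ∈ Icc s₀ b, u s γ ≤ M

theorem one_lt_of_lt_mul_sq {z κ c : ℝ} (hz : 0 < z) (hκ : 0 ≤ κ) (hκc : κ < 2 * c)
    (h : 2 * c ≤ z ^ 2 * κ) : 1 < z := by
  by_contra hle
  have h1 : z ^ 2 ≤ 1 := pow_le_one₀ hz.le (not_lt.1 hle)
  have := mul_le_mul_of_nonneg_right h1 hκ
  linarith

theorem RegularFamily.exists_singularLimit {u m h v k a : ℝ → ℝ → ℝ} (hN : 3 ≤ N) (hp : pS N < p)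
    (R : RegularFamily N p u m h v k a) : ∃ U W s₀, SingularLimit N p u m U W s₀ := by
  have hp1 := one_lt_of_pS_lt hN hp
  have hθ := theta_pos hp1
  have hB := coeffB_pos hN hp
  obtain ⟨c₁, hc₁, hcore⟩ := R.exists_efEnergy_core hN hp
  obtain ⟨x, y, hsol, hE, hx, hy, hxA, hy0⟩ := exists_ef_limit hN hp
    (X := fun γ => efX p (fun s => u s γ))
    (Y := fun γ => efY p (fun s => u s γ) (fun s => -(s * m s γ)))
    (fun γ hγ => R.efSol hp1 hγ) hc₁ hcore (fun δ hδ => R.exists_near_equilibrium hN hp hδ)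
  have hrad := hsol.radialSol hp1
  have hpoh : ∀ s > 0, pohozaev N p s (ofEF p x s) (ofEF' p x y s) ≤ -c₁ := fun s hs => by
    have := pohozaev_eq_efEnergy (N := N) (w := ofEF' p x y) hp1 (t := Real.log s)
      (u := ofEF p x) (hrad.pos _ (Real.exp_pos _)).le
    rw [Real.exp_log hs, efX_ofEF, efY_ofEF] at this
    rw [this]
    exact hE _
  obtain ⟨c₂, hc₂, S, hS, hcore₂⟩ := R.exists_core hN hp
  have hlim : Tendsto (fun s : ℝ => s ^ (2 * theta p) * (coeffB N p + s ^ 2)) (𝓝[>] 0) (𝓝 0) := by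
    have : Continuous fun s : ℝ => s ^ (2 * theta p) * (coeffB N p + s ^ 2) := by
      have := Real.continuous_rpow_const (by positivity : 0 ≤ 2 * theta p)
      fun_prop
    have h1 := (this.tendsto 0).mono_left (nhdsWithin_le_nhds (s := Ioi 0))
    simpa [Real.zero_rpow (by positivity : 2 * theta p ≠ 0)] using h1
  have hyx : Tendsto (fun t => y t - theta p * x t) atBot (𝓝 (0 - theta p * A N p)) :=
    hy0.sub (hxA.const_mul _)
  -- The sign of `U'` is that of `y - θx`, which tends to `-θA < 0`.
  have hneg : ∀ᶠ s in 𝓝[>] (0 : ℝ), y (Real.log s) - theta p * x (Real.log s) < 0 :=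
    (hyx.comp Real.tendsto_log_nhdsGT_zero).eventually (gt_mem_nhds (by
      have := A_pos hN hp
      nlinarith))
  -- On `(0,b]` the Pohozaev bound `2c ≤ u² s^{2θ}(B+s²)` is incompatible with `u ≤ 1`, for the
  -- limit and, outside the core, for the regular solutions; inside the core `u ≥ γ/2 > 1`.
  obtain ⟨b, hb, hbs⟩ := (mem_nhdsGT_iff_exists_Ioc_subset).1 ((hlim.eventually
    (gt_mem_nhds (by positivity : 0 < 2 * min c₁ c₂))).and hneg)
  rw [mem_Ioi] at hb
  have hκ : ∀ s ∈ Ioc 0 b, s ^ (2 * theta p) * (coeffB N p + s ^ 2) < 2 * min c₁ c₂ :=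
    fun s hs => (hbs hs).1
  refine ⟨ofEF p x, ofEF' p x y, b, hrad, fun s hs => ?_, fun s hs => ?_, ⟨c₁, hc₁, hpoh⟩, ?_, ?_,
    hb, fun s hs => ?_, fun s hs => ?_, ?_, fun b' => ?_⟩
  · refine ((hx (Real.log s)).const_mul (s ^ (-theta p))).congr fun γ => ?_
    exact rpow_neg_mul_efX p _ hs
  · refine ((((hy (Real.log s)).sub ((hx (Real.log s)).const_mul (theta p))).const_mul
      (s ^ (-theta p))).div_const s).congr fun γ => ?_
    exact rpow_neg_mul_efY p _ (fun s => -(s * m s γ)) hs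
  · rwa [efX_ofEF]
  · rwa [efY_ofEF]
  · have h1 := hκ s hs
    have h2 := min_le_left c₁ c₂
    have := hs.1
    exact one_lt_of_lt_mul_sq (hrad.pos s hs.1) (by positivity) (h1.trans_le (by linarith))
      (le_of_pohozaev_le hp1 hs.1 (hrad.pos s hs.1) (hpoh s hs.1))
  · have h1 := (hbs hs).2
    exact div_neg_of_neg_of_pos (mul_neg_of_pos_of_neg (Real.rpow_pos_of_pos hs.1 _) h1) hs.1
  · filter_upwards [hcore₂, eventually_gt_atTop 2] with γ hγ hγ2 s hs
    rcases le_total s (S γ) with h | h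
    · linarith [hγ.2.1 s ⟨hs.1, h⟩]
    · have hs0 : 0 < s := hγ.1.trans_le h
      have h1 := hκ s ⟨hs0, hs.2⟩
      have h2 := min_le_right c₁ c₂
      have hu := R.u_pos γ (by linarith) s hs.1
      exact one_lt_of_lt_mul_sq hu (by positivity) (h1.trans_le (by linarith))
        (le_of_pohozaev_le hp1 hs0 hu (hγ.2.2 s h))
  · refine ⟨b ^ (-theta p) * efBound N p (Real.log b'), ?_⟩
    filter_upwards [hcore (Real.log b), eventually_gt_atTop 0] with γ hγ hγ0 s hs
    have hs0 : 0 < s := hb.trans_le hs.1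
    rw [← rpow_neg_mul_efX p (fun s => u s γ) hs0]
    have h1 := hγ (Real.log s) (Real.log_le_log hb hs.1)
    have h2 := (le_efBound_of_efEnergy_nonpos hN hp ((R.efSol hp1 hγ0).pos _ (mem_univ _))
      (by linarith)).trans (efBound_mono hN hp (Real.log_le_log hs0 hs.2))
    have h3 := ((R.efSol hp1 hγ0).pos (Real.log s) (mem_univ _)).le
    have h4 : s ^ (-theta p) ≤ b ^ (-theta p) :=
      Real.rpow_le_rpow_of_nonpos hb hs.1 (by linarith)
    exact mul_le_mul h4 h2 h3 (by positivity)

end SupercriticalNeumann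

end

/-! ### The angle of the singular solution and convergence of critical points -/

open Set Filter Topology MeasureTheory

noncomputable section

namespace SupercriticalNeumann

variable {N : ℕ} {p : ℝ} {u m h v k a : ℝ → ℝ → ℝ} {U W : ℝ → ℝ} {s₀ : ℝ}

/-- The angle does not see a constant factor, so the phase of `v` is governed by `u - 1`, which,
unlike `v`, has a nontrivial limit as `γ → ∞`. -/
theorem angleRate_mul {c : ℝ} (hc : c ≠ 0) (a b d : ℝ) :
    angleRate (c * a) (c * b) (c * d) = angleRate a b d := by
  rw [angleRate, angleRate, show (c * b) ^ 2 - c * a * (c * d) = c ^ 2 * (b ^ 2 - a * d) by ring,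
    show (c * a) ^ 2 + (c * b) ^ 2 = c ^ 2 * (a ^ 2 + b ^ 2) by ring,
    mul_div_mul_left _ _ (pow_ne_zero 2 hc)]

theorem abs_angleRate_le {a b g n s : ℝ} (hs : 0 < s) (hn : 0 ≤ n) :
    |angleRate a b (-(n / s * b) - g * a)| ≤ 1 + n / s + |g| := by
  have hns : 0 ≤ n / s := div_nonneg hn hs.le
  rw [angleRate, abs_div, abs_of_nonneg (by positivity : 0 ≤ a ^ 2 + b ^ 2)]
  refine div_le_of_le_mul₀ (by positivity) (by positivity) ?_
  rw [show b ^ 2 - a * (-(n / s * b) - g * a) = b ^ 2 + n / s * (a * b) + g * a ^ 2 by ring]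
  have h1 := abs_add_three (b ^ 2) (n / s * (a * b)) (g * a ^ 2)
  rw [abs_of_nonneg (sq_nonneg b), abs_mul, abs_mul, abs_mul, abs_of_nonneg hns,
    abs_of_nonneg (sq_nonneg a)] at h1
  have h2 := mul_le_mul_of_nonneg_left (two_abs_mul_abs_le a b) hns
  have h3 := mul_nonneg hns (add_nonneg (sq_nonneg a) (sq_nonneg b))
  have h4 := mul_nonneg (abs_nonneg g) (sq_nonneg b)
  have h5 := sq_nonneg a
  linarith

theorem exists_polar_arctan {a b : ℝ} (ha : 0 < a) :
    ∃ ρ > 0, a = ρ * Real.cos (Real.arctan (-(b / a))) ∧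
      b = -(ρ * Real.sin (Real.arctan (-(b / a)))) := by
  set Θ := Real.arctan (-(b / a)) with hΘ
  have hcos : 0 < Real.cos Θ := Real.cos_arctan_pos _
  refine ⟨a / Real.cos Θ, by positivity, by field_simp, ?_⟩
  have h2 : Real.tan Θ = -(b / a) := Real.tan_arctan _
  rw [Real.tan_eq_sin_div_cos, div_eq_iff hcos.ne'] at h2
  rw [h2]
  field_simp

/-- Nonvanishing of solutions of linear radial equations away from the origin. -/
theorem sq_add_sq_pos_of_radial {n L s₀ s : ℝ} (hn : 0 ≤ n) (hs₀ : 0 < s₀) (hL : 0 ≤ L)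
    {y z g : ℝ → ℝ} (hs : s₀ ≤ s) (hdy : ∀ t ∈ Icc s₀ s, HasDerivAt y (z t) t)
    (hdz : ∀ t ∈ Icc s₀ s, HasDerivAt z (-(n / t * z t) - g t * y t) t)
    (hg : ∀ t ∈ Icc s₀ s, |g t| ≤ L) (h0 : 0 < y s₀ ^ 2 + z s₀ ^ 2) :
    0 < y s ^ 2 + z s ^ 2 := by
  have hd : ∀ t ∈ Icc s₀ s, HasDerivAt (fun t => y t ^ 2 + z t ^ 2)
      (2 * y t * z t + 2 * z t * (-(n / t * z t) - g t * y t)) t := fun t ht => by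
    refine (((hdy t ht).fun_pow 2).fun_add ((hdz t ht).fun_pow 2)).congr_deriv ?_
    norm_num
  have h := le_mul_exp_of_le_deriv (C := 1 + L + 2 * (n / s₀)) hs
    (fun t ht => (hd t ht).continuousAt.continuousWithinAt)
    (fun t ht => hd t (Ioo_subset_Icc_self ht)) (fun t ht => by
      have ht' := Ioo_subset_Icc_self ht
      have e1 := two_abs_mul_abs_le (y t) (z t)
      have e2 : |2 * y t * z t| ≤ y t ^ 2 + z t ^ 2 := by
        rw [abs_mul, abs_mul, abs_two]; linarith
      have e3 : |2 * z t * (g t * y t)| ≤ L * (y t ^ 2 + z t ^ 2) := by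
        rw [show 2 * z t * (g t * y t) = g t * (2 * y t * z t) by ring, abs_mul]
        exact mul_le_mul (hg t ht') e2 (abs_nonneg _) hL
      have e4 : n / t * z t ^ 2 ≤ n / s₀ * (y t ^ 2 + z t ^ 2) := by
        have : n / t ≤ n / s₀ := div_le_div_of_nonneg_left hn hs₀ ht'.1
        exact mul_le_mul this (by linarith [sq_nonneg (y t)]) (sq_nonneg _) (by positivity)
      have e5 := neg_le_of_abs_le e2
      have e6 := le_of_abs_le e3
      linarith)
  exact pos_of_mul_pos_left (h0.trans_le h) (Real.exp_pos _).le

/-- The Prüfer angle of the singular solution. -/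
def singAngle (N : ℕ) (p : ℝ) (U W : ℝ → ℝ) (s₀ s : ℝ) : ℝ :=
  angle (fun s => U s - 1) W (fun s => -(((N : ℝ) - 1) / s * W s) - fSlope p (U s) * (U s - 1)) s₀
    (Real.arctan (-(W s₀ / (U s₀ - 1)))) s

namespace SingularLimit

theorem deriv_W (L : SingularLimit N p u m U W s₀) {s : ℝ} (hs : 0 < s) :
    HasDerivAt W (-(((N : ℝ) - 1) / s * W s) - fSlope p (U s) * (U s - 1)) s := by
  rw [← f_eq_fSlope_mul]
  exact L.sol.deriv_w s hs

theorem continuousOn_U (L : SingularLimit N p u m U W s₀) : ContinuousOn U (Ioi 0) :=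
  fun s hs => (L.sol.deriv_u s hs).continuousAt.continuousWithinAt

theorem continuousOn_W (L : SingularLimit N p u m U W s₀) : ContinuousOn W (Ioi 0) :=
  fun s hs => (L.sol.deriv_w s hs).continuousAt.continuousWithinAt

theorem phaseCurve (hN : 3 ≤ N) (hp : pS N < p) (L : SingularLimit N p u m U W s₀) :
    PhaseCurve (fun s => U s - 1) W
      (fun s => -(((N : ℝ) - 1) / s * W s) - fSlope p (U s) * (U s - 1)) s₀
      (Real.arctan (-(W s₀ / (U s₀ - 1)))) where
  deriv_a s hs := (L.sol.deriv_u s (L.s₀_pos.trans_le hs)).sub_const 1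
  deriv_b s hs := L.deriv_W (L.s₀_pos.trans_le hs)
  cont_d := by
    have hsub : Ici s₀ ⊆ Ioi 0 := fun s hs => L.s₀_pos.trans_le hs
    have h1 := L.continuousOn_U.mono hsub
    have h2 := L.continuousOn_W.mono hsub
    have h3 := (continuous_fSlope (one_lt_of_pS_lt hN hp)).comp_continuousOn h1
    have h4 : ContinuousOn (fun s : ℝ => ((N : ℝ) - 1) / s) (Ici s₀) :=
      continuousOn_const.div continuousOn_id fun s hs => (hsub hs).ne'
    exact ((h4.mul h2).neg).sub (h3.mul (h1.sub continuousOn_const))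
  ne s hs := by
    have hp1 := one_lt_of_pS_lt hN hp
    have hN1 : (0 : ℝ) ≤ N - 1 := by
      have : (3 : ℝ) ≤ N := by exact_mod_cast hN
      linarith
    have hsub : Icc s₀ s ⊆ Ioi 0 := fun t ht => L.s₀_pos.trans_le ht.1
    obtain ⟨K, hK⟩ := isCompact_Icc.exists_bound_of_continuousOn (s := Icc s₀ s)
      ((continuous_fSlope hp1).comp_continuousOn (L.continuousOn_U.mono hsub))
    refine (sq_add_sq_pos_of_radial (y := fun s => U s - 1) hN1 L.s₀_pos
      ((norm_nonneg _).trans (hK s₀ ⟨le_rfl, hs⟩)) hs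
      (fun t ht => (L.sol.deriv_u t (hsub ht)).sub_const 1) (fun t ht => L.deriv_W (hsub ht))
      hK ?_).ne'
    have := L.one_lt s₀ ⟨L.s₀_pos, le_rfl⟩
    have : 0 < (U s₀ - 1) ^ 2 := pow_pos (by linarith) 2
    have := sq_nonneg (W s₀)
    linarith
  init := exists_polar_arctan (by linarith [L.one_lt s₀ ⟨L.s₀_pos, le_rfl⟩])

theorem base_mem (L : SingularLimit N p u m U W s₀) :
    Real.arctan (-(W s₀ / (U s₀ - 1))) ∈ Ioo 0 (Real.pi / 2) := by
  refine ⟨Real.arctan_pos.2 ?_, Real.arctan_lt_pi_div_two _⟩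
  have h1 : 0 < U s₀ - 1 := by linarith [L.one_lt s₀ ⟨L.s₀_pos, le_rfl⟩]
  have h2 := L.neg s₀ ⟨L.s₀_pos, le_rfl⟩
  have := div_neg_of_neg_of_pos h2 h1
  linarith

theorem exists_polar (hN : 3 ≤ N) (hp : pS N < p) (L : SingularLimit N p u m U W s₀) {s : ℝ}
    (hs : s₀ ≤ s) : ∃ ρ > 0, U s - 1 = ρ * Real.cos (singAngle N p U W s₀ s) ∧
      W s = -(ρ * Real.sin (singAngle N p U W s₀ s)) := (L.phaseCurve hN hp).polar hs

/-- At multiples of `π/2` either `U' = 0` and the speed is `f(U)/(U-1) > 0`, or `U = 1` and the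
speed is `1`. Even multiples are thus the critical points and odd ones the intersections with `1`,
each met once and in order. -/
theorem rate_pos (hN : 3 ≤ N) (hp : pS N < p) (L : SingularLimit N p u m U W s₀) (j : ℕ) :
    ∀ s ≥ s₀, singAngle N p U W s₀ s = j * (Real.pi / 2) →
      0 < angleRate (U s - 1) (W s)
        (-(((N : ℝ) - 1) / s * W s) - fSlope p (U s) * (U s - 1)) := fun s hs hj => by
  obtain ⟨ρ, hρ, h1, h2⟩ := L.exists_polar hN hp hs
  have h3 : Real.sin (singAngle N p U W s₀ s) * Real.cos (singAngle N p U W s₀ s) = 0 := by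
    have := Real.sin_two_mul (singAngle N p U W s₀ s)
    rw [show 2 * singAngle N p U W s₀ s = j * Real.pi by rw [hj]; ring, Real.sin_nat_mul_pi] at this
    linarith
  have hne := (L.phaseCurve hN hp).ne s hs
  have hpos : 0 < (U s - 1) ^ 2 + W s ^ 2 := lt_of_le_of_ne (by positivity) hne.symm
  have hg := fSlope_pos (one_lt_of_pS_lt hN hp) (L.sol.pos s (L.s₀_pos.trans_le hs))
  rw [angleRate]
  refine div_pos ?_ hpos
  rcases mul_eq_zero.1 h3 with h | h
  · have hW : W s = 0 := by rw [h2, h]; ring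
    rw [hW] at hpos ⊢
    have : 0 < fSlope p (U s) * (U s - 1) ^ 2 := mul_pos hg (by linarith)
    linarith
  · have hU : U s - 1 = 0 := by rw [h1, h]; ring
    rw [hU] at hpos ⊢
    linarith

theorem singAngle_lt (hN : 3 ≤ N) (hp : pS N < p) (L : SingularLimit N p u m U W s₀) (j : ℕ)
    {s t : ℝ} (hs : s₀ ≤ s) (hst : s < t) (h : j * (Real.pi / 2) ≤ singAngle N p U W s₀ s) :
    j * (Real.pi / 2) < singAngle N p U W s₀ t :=
  (L.phaseCurve hN hp).angle_lt (L.rate_pos hN hp j) hs hst h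

theorem singAngle_base : singAngle N p U W s₀ s₀ = Real.arctan (-(W s₀ / (U s₀ - 1))) :=
  PhaseCurve.angle_self

theorem singAngle_pos (hN : 3 ≤ N) (hp : pS N < p) (L : SingularLimit N p u m U W s₀) {s : ℝ}
    (hs : s₀ ≤ s) : 0 < singAngle N p U W s₀ s := by
  have h0 : 0 < singAngle N p U W s₀ s₀ := by rw [singAngle_base]; exact L.base_mem.1
  rcases hs.eq_or_lt with rfl | hs
  · exact h0
  · simpa using L.singAngle_lt hN hp 0 le_rfl hs (by simpa using h0.le)

theorem tendsto_singAngle (hN : 3 ≤ N) (hp : pS N < p) (L : SingularLimit N p u m U W s₀) :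
    Tendsto (singAngle N p U W s₀) atTop atTop := by
  have hp1 := one_lt_of_pS_lt hN hp
  obtain ⟨c, hc, hJ⟩ := L.exists_pohozaev_le
  have hev : ∀ᶠ s in 𝓝[>] 0, 1 ≤ U s := by
    filter_upwards [Ioc_mem_nhdsGT L.s₀_pos] with s hs using (L.one_lt s hs).le
  obtain ⟨μ, hμ, s₁, hs₁, hlow⟩ := L.sol.exists_lower_bound hN hp1 (s₀ := s₀) hc
    (fun s hs => hJ s (L.s₀_pos.trans_le hs)) (Or.inr hev.frequently)
  obtain ⟨κ, hκ, hg⟩ := exists_fSlope_ge hp1 hμ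
  have hN1 : (0 : ℝ) ≤ N - 1 := by
    have : (3 : ℝ) ≤ N := by exact_mod_cast hN
    linarith
  exact (L.phaseCurve hN hp).tendsto_angle (g := fun s => fSlope p (U s)) hN1 hκ hs₁
    (fun s hs => hg _ (hlow s hs)) (fun s hs => rfl)

theorem exists_singAngle_eq (hN : 3 ≤ N) (hp : pS N < p) (L : SingularLimit N p u m U W s₀) {j : ℕ}
    (hj : 1 ≤ j) : ∃ s > s₀, singAngle N p U W s₀ s = j * (Real.pi / 2) := by
  obtain ⟨b, hb, hs₀b⟩ := (((L.tendsto_singAngle hN hp).eventually_ge_atTop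
    (j * (Real.pi / 2))).and (eventually_gt_atTop s₀)).exists
  have hlt : singAngle N p U W s₀ s₀ < j * (Real.pi / 2) := by
    rw [singAngle_base]
    refine L.base_mem.2.trans_le ?_
    have : (1 : ℝ) ≤ j := by exact_mod_cast hj
    nlinarith [Real.pi_pos]
  obtain ⟨s, hs, he⟩ := intermediate_value_Icc hs₀b.le
    ((L.phaseCurve hN hp).continuousOn_angle.mono Icc_subset_Ici_self) ⟨hlt.le, hb⟩
  refine ⟨s, lt_of_le_of_ne hs.1 fun h => ?_, he⟩
  rw [← h] at he
  exact hlt.ne he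

end SingularLimit

open Classical in
/-- The point at which the Prüfer angle of the singular solution is `j π/2`. -/
def singPoint (N : ℕ) (p : ℝ) (U W : ℝ → ℝ) (s₀ : ℝ) (j : ℕ) : ℝ :=
  if h : ∃ s > s₀, singAngle N p U W s₀ s = j * (Real.pi / 2) then h.choose else s₀

namespace SingularLimit

theorem singPoint_spec (hN : 3 ≤ N) (hp : pS N < p) (L : SingularLimit N p u m U W s₀) {j : ℕ}
    (hj : 1 ≤ j) : s₀ < singPoint N p U W s₀ j ∧
      singAngle N p U W s₀ (singPoint N p U W s₀ j) = j * (Real.pi / 2) := by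
  have h := L.exists_singAngle_eq hN hp hj
  rw [singPoint, dif_pos h]
  exact h.choose_spec

theorem lt_singPoint_iff (hN : 3 ≤ N) (hp : pS N < p) (L : SingularLimit N p u m U W s₀) {j : ℕ}
    (hj : 1 ≤ j) {s : ℝ} (hs : s₀ ≤ s) :
    s < singPoint N p U W s₀ j ↔ singAngle N p U W s₀ s < j * (Real.pi / 2) := by
  have h := L.singPoint_spec hN hp hj
  constructor
  · intro hlt
    by_contra hle
    exact (L.singAngle_lt hN hp j hs hlt (not_lt.1 hle)).ne' h.2
  · intro hlt
    by_contra hle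
    rcases (not_lt.1 hle).eq_or_lt with h1 | h1
    · rw [← h1, h.2] at hlt; exact lt_irrefl _ hlt
    · exact (L.singAngle_lt hN hp j h.1.le h1 h.2.ge).not_gt hlt

theorem singPoint_lt_iff (hN : 3 ≤ N) (hp : pS N < p) (L : SingularLimit N p u m U W s₀) {j : ℕ}
    (hj : 1 ≤ j) {s : ℝ} (hs : s₀ ≤ s) :
    singPoint N p U W s₀ j < s ↔ j * (Real.pi / 2) < singAngle N p U W s₀ s := by
  have h := L.singPoint_spec hN hp hj
  constructor
  · exact fun hlt => L.singAngle_lt hN hp j h.1.le hlt h.2.ge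
  · intro hlt
    by_contra hle
    rcases (not_lt.1 hle).eq_or_lt with h1 | h1
    · rw [h1, h.2] at hlt; exact lt_irrefl _ hlt
    · exact ((L.lt_singPoint_iff hN hp hj hs).1 h1).not_gt hlt

theorem singPoint_eq_iff (hN : 3 ≤ N) (hp : pS N < p) (L : SingularLimit N p u m U W s₀) {j : ℕ}
    (hj : 1 ≤ j) {s : ℝ} (hs : s₀ ≤ s) :
    singPoint N p U W s₀ j = s ↔ singAngle N p U W s₀ s = j * (Real.pi / 2) := by
  constructor
  · rintro rfl; exact (L.singPoint_spec hN hp hj).2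
  · intro h
    by_contra hne
    rcases lt_or_gt_of_ne hne with h1 | h1
    · exact ((L.singPoint_lt_iff hN hp hj hs).1 h1).ne' h
    · exact ((L.lt_singPoint_iff hN hp hj hs).1 h1).ne h

theorem singPoint_lt_singPoint (hN : 3 ≤ N) (hp : pS N < p) (L : SingularLimit N p u m U W s₀)
    {i j : ℕ} (hi : 1 ≤ i) (hij : i < j) :
    singPoint N p U W s₀ i < singPoint N p U W s₀ j := by
  have h := L.singPoint_spec hN hp hi
  rw [L.lt_singPoint_iff hN hp (hi.trans hij.le) h.1.le, h.2]
  have : (i : ℝ) < j := by exact_mod_cast hij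
  have := Real.pi_pos
  gcongr

theorem W_eq_zero_iff (hN : 3 ≤ N) (hp : pS N < p) (L : SingularLimit N p u m U W s₀) {s : ℝ}
    (hs : 0 < s) : W s = 0 ↔ ∃ n ≥ 1, s = singPoint N p U W s₀ (2 * n) := by
  constructor
  · intro hW
    have hs' : s₀ ≤ s := by
      by_contra hlt
      exact (L.neg s ⟨hs, (not_le.1 hlt).le⟩).ne hW
    obtain ⟨ρ, hρ, -, h2⟩ := L.exists_polar hN hp hs'
    have hsin : Real.sin (singAngle N p U W s₀ s) = 0 := by
      rw [hW] at h2
      have : ρ * Real.sin (singAngle N p U W s₀ s) = 0 := by linarith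
      exact (mul_eq_zero.1 this).resolve_left hρ.ne'
    obtain ⟨n, hn⟩ := Real.sin_eq_zero_iff.1 hsin
    have hpos := L.singAngle_pos hN hp hs'
    have hn0 : 0 < n := by
      rw [← hn] at hpos
      exact_mod_cast pos_of_mul_pos_left hpos Real.pi_pos.le
    lift n to ℕ using hn0.le
    have hn1 : 1 ≤ n := by exact_mod_cast hn0
    refine ⟨n, hn1, ((L.singPoint_eq_iff hN hp (by omega) hs').2 ?_).symm⟩
    rw [← hn]; push_cast; ring
  · rintro ⟨n, hn, rfl⟩
    have h := L.singPoint_spec hN hp (j := 2 * n) (by omega)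
    obtain ⟨ρ, hρ, -, h2⟩ := L.exists_polar hN hp h.1.le
    rw [h2, h.2, show ((2 * n : ℕ) : ℝ) * (Real.pi / 2) = n * Real.pi by push_cast; ring,
      Real.sin_nat_mul_pi, mul_zero, neg_zero]

theorem U_eq_one_iff (hN : 3 ≤ N) (hp : pS N < p) (L : SingularLimit N p u m U W s₀) {s : ℝ}
    (hs : 0 < s) : U s = 1 ↔ ∃ i : ℕ, s = singPoint N p U W s₀ (2 * i + 1) := by
  constructor
  · intro hU
    have hs' : s₀ ≤ s := by
      by_contra hlt
      exact (L.one_lt s ⟨hs, (not_le.1 hlt).le⟩).ne' hU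
    obtain ⟨ρ, hρ, h1, -⟩ := L.exists_polar hN hp hs'
    have hcos : Real.cos (singAngle N p U W s₀ s) = 0 := by
      rw [hU, sub_self] at h1
      exact (mul_eq_zero.1 h1.symm).resolve_left hρ.ne'
    obtain ⟨n, hn⟩ := Real.cos_eq_zero_iff.1 hcos
    have hpos := L.singAngle_pos hN hp hs'
    have hn0 : 0 ≤ n := by
      rw [hn] at hpos
      have h3 : 0 < (2 * (n : ℝ) + 1) := by
        by_contra hle
        have := mul_nonneg (by linarith : 0 ≤ -(2 * (n : ℝ) + 1)) Real.pi_pos.le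
        linarith
      have h4 : 0 < 2 * n + 1 := by exact_mod_cast h3
      omega
    lift n to ℕ using hn0
    refine ⟨n, ((L.singPoint_eq_iff hN hp (by omega) hs').2 ?_).symm⟩
    rw [hn]; push_cast; ring
  · rintro ⟨n, rfl⟩
    have h := L.singPoint_spec hN hp (j := 2 * n + 1) (by omega)
    obtain ⟨ρ, hρ, h1, -⟩ := L.exists_polar hN hp h.1.le
    have : Real.cos (((2 * n + 1 : ℕ) : ℝ) * (Real.pi / 2)) = 0 :=
      Real.cos_eq_zero_iff.2 ⟨n, by push_cast; ring⟩
    rw [h.2, this, mul_zero] at h1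
    linarith

/-- The angle starts in `(0, π/2)`, so before the level `2n · π/2` exactly the odd levels `1, 3, …,
2n-1` are met. -/
theorem encard_zeros (hN : 3 ≤ N) (hp : pS N < p) (L : SingularLimit N p u m U W s₀) {n : ℕ}
    (hn : 1 ≤ n) : {s ∈ Ioc 0 (singPoint N p U W s₀ (2 * n)) | U s = 1}.encard = n := by
  have hset : {s ∈ Ioc 0 (singPoint N p U W s₀ (2 * n)) | U s = 1} =
      (fun i : ℕ => singPoint N p U W s₀ (2 * i + 1)) '' (Finset.range n : Set ℕ) := by
    ext s
    simp only [mem_ofPred_eq, mem_image, Finset.coe_range, mem_Iio]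
    constructor
    · rintro ⟨hs, hU⟩
      obtain ⟨i, rfl⟩ := (L.U_eq_one_iff hN hp hs.1).1 hU
      refine ⟨i, ?_, rfl⟩
      by_contra hle
      exact (L.singPoint_lt_singPoint hN hp (i := 2 * n) (j := 2 * i + 1) (by omega)
        (by omega)).not_ge hs.2
    · rintro ⟨i, hi, rfl⟩
      have h0 := L.s₀_pos.trans (L.singPoint_spec hN hp (j := 2 * i + 1) (by omega)).1
      exact ⟨⟨h0, (L.singPoint_lt_singPoint hN hp (by omega) (by omega)).le⟩,
        (L.U_eq_one_iff hN hp h0).2 ⟨i, rfl⟩⟩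
  rw [hset, InjOn.encard_image, Set.encard_coe_eq_coe_finsetCard, Finset.card_range]
  intro i _ j _ hij
  by_contra hne
  rcases lt_or_gt_of_ne hne with h | h
  · exact (L.singPoint_lt_singPoint hN hp (i := 2 * i + 1) (j := 2 * j + 1) (by omega)
      (by omega)).ne hij
  · exact (L.singPoint_lt_singPoint hN hp (i := 2 * j + 1) (j := 2 * i + 1) (by omega)
      (by omega)).ne' hij

/-- The Prüfer angles of the regular solutions converge to that of the singular solution. -/
theorem tendsto_phase (hN : 3 ≤ N) (hp : pS N < p) (R : RegularFamily N p u m h v k a)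
    (L : SingularLimit N p u m U W s₀) {s : ℝ} (hs : s₀ ≤ s) :
    Tendsto (fun γ => phase N v k a s γ) atTop (𝓝 (singAngle N p U W s₀ s)) := by
  have hp1 := one_lt_of_pS_lt hN hp
  have hs₀ := L.s₀_pos
  have hN1 : (0 : ℝ) ≤ N - 1 := by
    have : (3 : ℝ) ≤ N := by exact_mod_cast hN
    linarith
  have hrate : ∀ γ > 1, ∀ t > 0, angleRate (v t γ) (-(t * k t γ))
      (-(a t γ * v t γ - ((N : ℝ) - 1) * k t γ)) = angleRate (u t γ - 1) (-(t * m t γ))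
        (-(((N : ℝ) - 1) / t * -(t * m t γ)) - fSlope p (u t γ) * (u t γ - 1)) :=
    fun γ hγ t ht => by
      have hγ0 : 0 < γ := by linarith
      rw [← angleRate_mul (by linarith : γ - 1 ≠ 0), R.v_eq γ hγ0 t ht.le, R.m_eq hγ0 ht,
        R.a_eq γ hγ0 t ht.le]
      congr 1
      · ring
      · field_simp
        ring
  -- Up to `s₀` every `u(·,γ)` with `γ` large stays above `1`, so the phase there is an arctangent
  -- of endpoint values. This avoids integrating the angular velocity through the core, where it is
  -- not uniformly controlled.
  have hbase : Tendsto (fun γ => phase N v k a s₀ γ) atTop (𝓝 (singAngle N p U W s₀ s₀)) := by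
    rw [singAngle_base]
    have h1 : Tendsto (fun γ => Real.arctan (-(-(s₀ * m s₀ γ) / (u s₀ γ - 1)))) atTop
        (𝓝 (Real.arctan (-(W s₀ / (U s₀ - 1))))) :=
      (Real.continuous_arctan.tendsto _).comp (((L.tendsto_w s₀ hs₀).div
        ((L.tendsto_u s₀ hs₀).sub_const 1)
        (by linarith [L.one_lt s₀ ⟨hs₀, le_rfl⟩])).neg)
    refine h1.congr' ?_
    filter_upwards [L.eventually_one_lt, eventually_gt_atTop 1] with γ hγ hγ1
    have hγ0 : 0 < γ := by linarith
    have hγ1' : 0 < γ - 1 := by linarith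
    have hv : ∀ t ∈ Icc 0 s₀, 0 < v t γ := fun t ht => by
      have h2 := R.v_eq γ hγ0 t ht.1
      have h3 := hγ t ht
      exact pos_of_mul_pos_right (by linarith : 0 < (γ - 1) * v t γ) hγ1'.le
    rw [phase, (R.phaseCurve hN γ).angle_eq_arctan hs₀.le hv
      ⟨by linarith [Real.pi_pos], by linarith [Real.pi_pos]⟩, R.v_eq γ hγ0 s₀ hs₀.le, R.m_eq hγ0 hs₀]
    have := (hv s₀ ⟨hs₀.le, le_rfl⟩).ne'
    congr 2
    field_simp
  have hInt : Tendsto (fun γ => ∫ t in s₀..s, angleRate (u t γ - 1) (-(t * m t γ))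
        (-(((N : ℝ) - 1) / t * -(t * m t γ)) - fSlope p (u t γ) * (u t γ - 1))) atTop
      (𝓝 (∫ t in s₀..s, angleRate (U t - 1) (W t)
        (-(((N : ℝ) - 1) / t * W t) - fSlope p (U t) * (U t - 1)))) := by
    obtain ⟨M, hM⟩ := L.bounded s
    refine intervalIntegral.tendsto_integral_filter_of_dominated_convergence
      (fun _ => 1 + (N - 1) / s₀ + p * max M 1 ^ (p - 1)) ?_ ?_ intervalIntegrable_const
      (ae_of_all _ fun t ht => ?_)
    · filter_upwards [eventually_gt_atTop 1] with γ hγ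
      refine (((R.phaseCurve hN γ).rate_intervalIntegrable hs₀.le (hs₀.le.trans hs)).congr
        ?_).aestronglyMeasurable_restrict_uIoc
      intro t ht
      rw [uIoc_of_le hs] at ht
      exact hrate γ hγ t (hs₀.trans ht.1)
    · filter_upwards [hM, eventually_gt_atTop 0] with γ hγ hγ0
      refine ae_of_all _ fun t ht => ?_
      rw [uIoc_of_le hs] at ht
      have ht0 : 0 < t := hs₀.trans ht.1
      refine (abs_angleRate_le ht0 hN1).trans ?_
      have hu := (R.u_pos γ hγ0 t ht0.le).le
      have h1 : ((N : ℝ) - 1) / t ≤ (N - 1) / s₀ := div_le_div_of_nonneg_left hN1 hs₀ ht.1.le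
      have h2 := fSlope_le hp1 hu ((hγ t ⟨ht.1.le, ht.2⟩).trans (le_max_left M 1))
        (le_max_right M 1)
      rw [abs_of_nonneg (fSlope_nonneg hp1 hu)]
      linarith
    · rw [uIoc_of_le hs] at ht
      have ht0 : 0 < t := hs₀.trans ht.1
      have h1 := (L.tendsto_u t ht0).sub_const 1
      have h2 := L.tendsto_w t ht0
      have h3 := ((continuous_fSlope hp1).tendsto (U t)).comp (L.tendsto_u t ht0)
      have h4 := ((h2.const_mul (((N : ℝ) - 1) / t)).neg).sub (h3.mul h1)
      exact ((h2.pow 2).sub (h1.mul h4)).div ((h1.pow 2).add (h2.pow 2))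
        ((L.phaseCurve hN hp).ne t ht.1.le)
  have h1 := hbase.add hInt
  rw [singAngle, (L.phaseCurve hN hp).angle_eq_add le_rfl hs]
  refine h1.congr' ?_
  filter_upwards [eventually_gt_atTop 1] with γ hγ
  rw [phase, phase, (R.phaseCurve hN γ).angle_eq_add hs₀.le (hs₀.le.trans hs)]
  congr 1
  refine intervalIntegral.integral_congr fun t ht => ?_
  rw [uIcc_of_le hs] at ht
  exact (hrate γ hγ t (hs₀.trans_le ht.1)).symm

/-- The critical points of the regular solutions converge to those of the singular solution. -/
theorem tendsto_critPoint (hN : 3 ≤ N) (hp : pS N < p) (R : RegularFamily N p u m h v k a)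
    (L : SingularLimit N p u m U W s₀) {n : ℕ} (hn : 1 ≤ n) :
    Tendsto (critPoint N v k a n) atTop (𝓝 (singPoint N p U W s₀ (2 * n))) := by
  have hn2 : 1 ≤ 2 * n := by omega
  have h := L.singPoint_spec hN hp hn2
  have e : ((2 * n : ℕ) : ℝ) * (Real.pi / 2) = n * Real.pi := by push_cast; ring
  rw [tendsto_order]
  constructor
  · intro b hb
    have hb' : max b s₀ < singPoint N p U W s₀ (2 * n) := max_lt hb h.1
    have hlt := (L.lt_singPoint_iff hN hp hn2 (le_max_right b s₀)).1 hb'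
    rw [e] at hlt
    filter_upwards [(L.tendsto_phase hN hp R (le_max_right b s₀)).eventually (gt_mem_nhds hlt),
      eventually_gt_atTop 0] with γ h1 hγ
    exact (le_max_left b s₀).trans_lt ((R.lt_critPoint_iff hN hp hγ n
      (L.s₀_pos.le.trans (le_max_right b s₀))).2 h1)
  · intro b hb
    have hb' : s₀ ≤ b := h.1.le.trans hb.le
    have hlt := (L.singPoint_lt_iff hN hp hn2 hb').1 hb
    rw [e] at hlt
    filter_upwards [(L.tendsto_phase hN hp R hb').eventually (lt_mem_nhds hlt),
      eventually_gt_atTop 0] with γ h1 hγ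
    exact (R.critPoint_lt_iff hN hp hγ n (L.s₀_pos.le.trans hb')).2 h1

end SingularLimit

end SupercriticalNeumann

end

/-! ### Uniqueness and properties of the singular solutions -/

open Set Filter Topology MeasureTheory

noncomputable section

namespace SupercriticalNeumann

variable {N : ℕ} {p : ℝ} {u m h v k a : ℝ → ℝ → ℝ} {U W : ℝ → ℝ} {s₀ : ℝ}

/-- A solution that converges to the equilibrium as `t → -∞` is unique. -/
theorem EFSol.eq_of_tendsto (hN : 3 ≤ N) (hp : pS N < p) {x₁ y₁ x₂ y₂ : ℝ → ℝ} {b : ℝ}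
    (h₁ : EFSol N p x₁ y₁ (Iio b)) (h₂ : EFSol N p x₂ y₂ (Iio b))
    (hx₁ : Tendsto x₁ atBot (𝓝 (A N p))) (hx₂ : Tendsto x₂ atBot (𝓝 (A N p))) :
    ∀ t < b, x₁ t = x₂ t := by
  obtain ⟨δ, hδ, T₀, hT₀, C, hC, c, hc, hdec⟩ := exists_efSol_decay hN hp
  obtain ⟨T, hT⟩ := eventually_atBot.1 ((((Metric.tendsto_nhds.1 hx₁ δ hδ).and
    (Metric.tendsto_nhds.1 hx₂ δ hδ)).and (eventually_le_atBot T₀)).and (eventually_lt_atBot b))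
  have hz : ∀ t ≤ T, |x₁ t - x₂ t| ≤ 2 * δ := fun t ht => by
    have e1 := (hT t ht).1.1.1
    have e2 := (hT t ht).1.1.2
    rw [← Real.dist_eq]
    have := dist_triangle_right (x₁ t) (x₂ t) (A N p)
    linarith
  have hzero : ∀ t ≤ T, (x₁ t - x₂ t) ^ 2 + (y₁ t - y₂ t) ^ 2 ≤ 0 := fun t ht => by
    have hlim : Tendsto (fun τ : ℝ => 20 * δ ^ 2 * (C * Real.exp (-(c * (t - τ))))) atBot (𝓝 0) := by
      have h1 : Tendsto (fun τ : ℝ => -(c * (t - τ))) atBot atBot := by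
        have := tendsto_atBot_add_const_right atBot (-(c * t))
          ((tendsto_id (α := ℝ)).const_mul_atBot hc)
        refine this.congr fun τ => ?_
        simp only [id]; ring
      simpa using ((Real.tendsto_exp_atBot.comp h1).const_mul C).const_mul (20 * δ ^ 2)
    refine ge_of_tendsto hlim ?_
    filter_upwards [eventually_le_atBot t] with τ hτ
    have hmem : ∀ r ≤ t, r ∈ Iio b := fun r hr => (hT r (hr.trans ht)).2
    -- Only `x₁` and `x₂` are assumed to converge. The mean value theorem supplies a time in
    -- `(τ-1,τ)` at which `y₁ - y₂` is at most `4δ`; then `(2δ)² + (4δ)² = 20δ²` bounds the starting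
    -- distance for the decay estimate, and `τ → -∞` gives zero.
    obtain ⟨τ', hτ', e⟩ := exists_hasDerivAt_eq_slope (fun t => x₁ t - x₂ t)
      (fun t => y₁ t - y₂ t) (by linarith : τ - 1 < τ)
      (fun r hr => (h₁.sub_deriv h₂ (hmem r (hr.2.trans hτ))).1.continuousAt.continuousWithinAt)
      (fun r hr => (h₁.sub_deriv h₂ (hmem r (hr.2.le.trans hτ))).1)
    have hτ't : τ' ≤ t := hτ'.2.le.trans hτ
    have h3 := hdec x₁ y₁ x₂ y₂ τ' t hτ't (hT t ht).1.2
      (h₁.mono fun r hr => hmem r hr.2) (h₂.mono fun r hr => hmem r hr.2)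
      (fun r hr => (hT r (hr.2.trans ht)).1.1.1) (fun r hr => (hT r (hr.2.trans ht)).1.1.2)
    refine h3.trans (mul_le_mul ?_ ?_ (by positivity) (by positivity))
    · rw [show τ - (τ - 1) = 1 by ring, div_one] at e
      have e1 := hz τ (hτ.trans ht)
      have e2 := hz (τ - 1) (by linarith)
      have e3 := hz τ' (hτ't.trans ht)
      rw [e]
      rw [abs_le] at e1 e2 e3
      have e4 : (x₁ τ' - x₂ τ') ^ 2 ≤ (2 * δ) ^ 2 := sq_le_sq' e3.1 e3.2
      have e5 : (x₁ τ - x₂ τ - (x₁ (τ - 1) - x₂ (τ - 1))) ^ 2 ≤ (4 * δ) ^ 2 :=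
        sq_le_sq' (by linarith) (by linarith)
      linarith
    · have := hτ'.2.le
      gcongr
  intro t htb
  rcases le_total t T with ht | ht
  · have h3 := hzero t ht
    have h4 : (x₁ t - x₂ t) ^ 2 = 0 := by
      have := sq_nonneg (x₁ t - x₂ t)
      have := sq_nonneg (y₁ t - y₂ t)
      linarith
    linarith [pow_eq_zero_iff two_ne_zero |>.1 h4]
  · have hsub : Icc T t ⊆ Iio b := fun r hr => lt_of_le_of_lt hr.2 htb
    obtain ⟨M₁, hM₁⟩ := isCompact_Icc.exists_bound_of_continuousOn (s := Icc T t)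
      (fun r hr => (h₁.deriv_x r (hsub hr)).continuousAt.continuousWithinAt)
    obtain ⟨M₂, hM₂⟩ := isCompact_Icc.exists_bound_of_continuousOn (s := Icc T t)
      (fun r hr => (h₂.deriv_x r (hsub hr)).continuousAt.continuousWithinAt)
    have h3 := (EFSol.gronwall hN hp (M := max M₁ M₂) ht (h₁.mono hsub) (h₂.mono hsub)
      (fun r hr => (le_abs_self _).trans ((hM₁ r hr).trans (le_max_left _ _)))
      (fun r hr => (le_abs_self _).trans ((hM₂ r hr).trans (le_max_right _ _)))).1
    have h4 := mul_nonpos_of_nonpos_of_nonneg (hzero T le_rfl) (Real.exp_pos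
      ((1 + coeffB N p + p * max M₁ M₂ ^ (p - 1) + Real.exp (2 * t) + 2 * alpha N p) *
        (t - T))).le
    have h5 : (x₁ t - x₂ t) ^ 2 = 0 := by
      have := sq_nonneg (x₁ t - x₂ t)
      have := sq_nonneg (y₁ t - y₂ t)
      linarith
    linarith [pow_eq_zero_iff two_ne_zero |>.1 h5]

theorem RadialSol.eq_of_tendsto (hN : 3 ≤ N) (hp : pS N < p) {u₁ w₁ u₂ w₂ : ℝ → ℝ} {c : ℝ}
    (hc : 0 < c) (h₁ : RadialSol N p u₁ w₁ (Ioo 0 c)) (h₂ : RadialSol N p u₂ w₂ (Ioo 0 c))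
    (hx₁ : Tendsto (efX p u₁) atBot (𝓝 (A N p))) (hx₂ : Tendsto (efX p u₂) atBot (𝓝 (A N p))) :
    ∀ s ∈ Ioo 0 c, u₁ s = u₂ s := fun s hs => by
  have hp1 := one_lt_of_pS_lt hN hp
  have hsub : Iio (Real.log c) ⊆ Real.exp ⁻¹' Ioo 0 c := fun t ht =>
    ⟨Real.exp_pos t, (Real.lt_log_iff_exp_lt hc).1 ht⟩
  have := EFSol.eq_of_tendsto hN hp ((h₁.efSol hp1).mono hsub) ((h₂.efSol hp1).mono hsub) hx₁ hx₂
    (Real.log s) (Real.log_lt_log hs.1 hs.2)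
  rw [← rpow_neg_mul_efX p u₁ hs.1, this, rpow_neg_mul_efX p u₂ hs.1]

namespace SingularLimit

theorem hasDerivAt_scaled (L : SingularLimit N p u m U W s₀) {c r : ℝ} (hc : 0 < c) (hr : 0 < r) :
    HasDerivAt (fun r => U (c * r)) (c * W (c * r)) r ∧
    HasDerivAt (fun r => c * W (c * r))
      (-(((N : ℝ) - 1) / r * (c * W (c * r))) - c ^ 2 * f p (U (c * r))) r := by
  have hcr : 0 < c * r := mul_pos hc hr
  have h0 := (hasDerivAt_id r).const_mul c
  have h1 := (L.sol.deriv_u _ hcr).comp r h0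
  have h2 := ((L.sol.deriv_w _ hcr).comp r h0).const_mul c
  refine ⟨h1.congr_deriv (by ring), h2.congr_deriv ?_⟩
  field_simp

theorem contDiffOn_scaled (hp : 1 < p) (L : SingularLimit N p u m U W s₀) {c : ℝ} (hc : 0 < c) :
    ContDiffOn ℝ 2 (fun r => U (c * r)) (Ioi 0) := by
  have h1 := fun r (hr : r ∈ Ioi (0 : ℝ)) => (L.hasDerivAt_scaled hc hr).1
  have h2 := fun r (hr : r ∈ Ioi (0 : ℝ)) => (L.hasDerivAt_scaled hc hr).2
  have hc1 : ContinuousOn (fun r => c * W (c * r)) (Ioi 0) := fun r hr =>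
    (h2 r hr).continuousAt.continuousWithinAt
  have hc0 : ContinuousOn (fun r => U (c * r)) (Ioi 0) := fun r hr =>
    (h1 r hr).continuousAt.continuousWithinAt
  have hc2 : ContinuousOn (fun r => -(((N : ℝ) - 1) / r * (c * W (c * r))) -
      c ^ 2 * f p (U (c * r))) (Ioi 0) := by
    have h3 : ContinuousOn (fun r : ℝ => ((N : ℝ) - 1) / r) (Ioi 0) :=
      continuousOn_const.div continuousOn_id fun s hs => (mem_Ioi.1 hs).ne'
    exact (h3.mul hc1).neg.sub (continuousOn_const.mul ((continuous_f hp).comp_continuousOn hc0))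
  have hW : ContDiffOn ℝ 1 (fun r => c * W (c * r)) (Ioi 0) := by
    rw [show (1 : WithTop ℕ∞) = 0 + 1 from rfl, contDiffOn_succ_iff_deriv_of_isOpen isOpen_Ioi]
    refine ⟨fun r hr => (h2 r hr).differentiableAt.differentiableWithinAt, by simp, ?_⟩
    exact contDiffOn_zero.2 (hc2.congr fun r hr => (h2 r hr).deriv)
  rw [show (2 : WithTop ℕ∞) = 1 + 1 from rfl, contDiffOn_succ_iff_deriv_of_isOpen isOpen_Ioi]
  exact ⟨fun r hr => (h1 r hr).differentiableAt.differentiableWithinAt, by simp,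
    hW.congr fun r hr => (h1 r hr).deriv⟩

/-- Near the origin `s^θ U` and `s^{θ+1} U'` converge, by the Emden-Fowler asymptotics; on the
remaining compact interval continuity suffices. -/
theorem exists_bound (hp : 1 < p) (L : SingularLimit N p u m U W s₀) (c : ℝ) :
    ∃ K > 0, ∀ s ∈ Ioc 0 c, U s ^ 2 + s ^ 2 * W s ^ 2 ≤ K * s ^ (-(2 * theta p)) := by
  have h1 : Tendsto (fun s => efX p U (Real.log s)) (𝓝[>] 0) (𝓝 (A N p)) :=
    L.tendsto_x.comp Real.tendsto_log_nhdsGT_zero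
  have h2 : Tendsto (fun s => efY p U W (Real.log s)) (𝓝[>] 0) (𝓝 0) :=
    L.tendsto_y.comp Real.tendsto_log_nhdsGT_zero
  have h3 := (h1.pow 2).add ((h2.sub (h1.const_mul (theta p))).pow 2)
  obtain ⟨b, hb, hbs⟩ := mem_nhdsGT_iff_exists_Ioc_subset.1 (h3.eventually
    (gt_mem_nhds (lt_add_one _)))
  rw [mem_Ioi] at hb
  have hsub : Icc b c ⊆ Ioi 0 := fun s hs => hb.trans_le hs.1
  have hcont : ContinuousOn (fun s => (U s ^ 2 + s ^ 2 * W s ^ 2) * s ^ (2 * theta p)) (Icc b c) := by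
    have e1 := L.continuousOn_U.mono hsub
    have e2 := L.continuousOn_W.mono hsub
    have e3 := (Real.continuous_rpow_const (mul_pos two_pos (theta_pos hp)).le).continuousOn
      (s := Icc b c)
    exact ((e1.pow 2).add ((continuousOn_id.pow 2).mul (e2.pow 2))).mul e3
  obtain ⟨K, hK⟩ := isCompact_Icc.exists_bound_of_continuousOn hcont
  refine ⟨max (A N p ^ 2 + (0 - theta p * A N p) ^ 2 + 1) K, lt_max_of_lt_left (by positivity),
    fun s hs => ?_⟩
  have hs0 : 0 < s := hs.1
  rw [Real.rpow_neg hs0.le, ← div_eq_mul_inv, le_div_iff₀ (Real.rpow_pos_of_pos hs0 _)]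
  rcases le_total s b with h | h
  · refine le_trans ?_ (le_max_left _ _)
    refine le_of_eq_of_le ?_ (le_of_lt (hbs ⟨hs0, h⟩))
    have e1 := rpow_neg_mul_efX p U hs0
    have e2 := rpow_neg_mul_efY p U W hs0
    have e3 : s ^ (-theta p) ^ 1 * s ^ (theta p) = 1 := by
      rw [pow_one, ← Real.rpow_add hs0, neg_add_cancel, Real.rpow_zero]
    have e4 : s ^ (2 * theta p) = s ^ theta p * s ^ theta p := by
      rw [← Real.rpow_add hs0]; congr 1; ring
    rw [div_eq_iff hs0.ne'] at e2
    have e5 : U s ^ 2 + s ^ 2 * W s ^ 2 = U s ^ 2 + (W s * s) ^ 2 := by ring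
    rw [e5, ← e1, ← e2, e4]
    generalize efX p U (Real.log s) = X
    generalize efY p U W (Real.log s) = Y
    have e3' : s ^ (-theta p) * s ^ theta p = 1 := by simpa using e3
    generalize s ^ (-theta p) = P at *
    generalize s ^ theta p = Q at *
    have : (P * Q) ^ 2 = 1 := by rw [e3']; norm_num
    linear_combination (X ^ 2 + (Y - theta p * X) ^ 2) * this
  · exact ((le_abs_self _).trans (hK s ⟨h, hs.2⟩)).trans (le_max_right _ _)

theorem isSingularSolution (hN : 3 ≤ N) (hp : pS N < p) (L : SingularLimit N p u m U W s₀) {n : ℕ}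
    (hn : 1 ≤ n) : IsSingularSolution N p n (singPoint N p U W s₀ (2 * n) ^ 2)
      (fun r => U (singPoint N p U W s₀ (2 * n) * r)) := by
  have hp1 := one_lt_of_pS_lt hN hp
  have hθ := theta_pos hp1
  have hspec := L.singPoint_spec hN hp (j := 2 * n) (by omega)
  set c := singPoint N p U W s₀ (2 * n) with hcdef
  have hc : 0 < c := L.s₀_pos.trans hspec.1
  have h1 := fun r (hr : 0 < r) => (L.hasDerivAt_scaled hc hr).1
  have h2 := fun r (hr : 0 < r) => (L.hasDerivAt_scaled hc hr).2
  have hC2 := L.contDiffOn_scaled hp1 hc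
  have hWc : W c = 0 := (L.W_eq_zero_iff hN hp hc).2 ⟨n, hn, hcdef⟩
  refine ⟨by positivity, hC2.mono fun r hr => hr.1,
    (hC2.of_le (by norm_num)).mono fun r hr => hr.1, ?_, fun r hr => ?_, ?_, fun r hr => ?_, ?_, ?_⟩
  · obtain ⟨K, hK, hbd⟩ := L.exists_bound hp1 c
    -- The gradient term behaves like `r^{N-1-2θ-2} = r^{α-1}`, integrable at `0` exactly because `α
    -- > 0`.
    have hexp : -1 < alpha N p - 1 := by linarith [alpha_pos hN hp]
    have hInt := ((intervalIntegral.integrableOn_Ioo_rpow_iff one_pos).2 hexp).const_mul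
      (K * c ^ (-(2 * theta p)))
    refine hInt.mono' ?_ ?_
    · refine ContinuousOn.aestronglyMeasurable ?_ measurableSet_Ioo
      have e1 : ContinuousOn (fun r => U (c * r)) (Ioo 0 1) := fun r hr =>
        (h1 r hr.1).continuousAt.continuousWithinAt
      have e2 : ContinuousOn (deriv fun r => U (c * r)) (Ioo 0 1) :=
        ContinuousOn.congr (fun r hr => (h2 r hr.1).continuousAt.continuousWithinAt)
          (fun r hr => (h1 r hr.1).deriv)
      exact (continuousOn_pow _).mul ((e1.pow 2).add (e2.pow 2))
    · refine (ae_restrict_mem measurableSet_Ioo).mono fun r hr => ?_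
      have hr0 : 0 < r := hr.1
      have hcr : 0 < c * r := by positivity
      rw [(h1 r hr0).deriv, Real.norm_of_nonneg (by positivity)]
      have h3 := hbd (c * r) ⟨hcr, by nlinarith [hr.2]⟩
      rw [Real.mul_rpow hc.le hr0.le] at h3
      have h4 : r ^ (alpha N p - 1) = r ^ (N - 1) * (r ^ (-(2 * theta p)) / r ^ 2) := by
        rw [← Real.rpow_natCast, ← Real.rpow_natCast r 2, ← Real.rpow_sub hr0, ← Real.rpow_add hr0,
          alpha, Nat.cast_sub (by omega)]
        congr 1
        push_cast
        ring
      rw [h4]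
      have h5 : r ^ 2 * (U (c * r) ^ 2 + (c * W (c * r)) ^ 2) ≤
          U (c * r) ^ 2 + (c * r) ^ 2 * W (c * r) ^ 2 := by
        have : r ^ 2 * U (c * r) ^ 2 ≤ 1 * U (c * r) ^ 2 := by
          have : r ^ 2 ≤ 1 := pow_le_one₀ hr0.le hr.2.le
          gcongr
        linarith
      have h6 : U (c * r) ^ 2 + (c * W (c * r)) ^ 2 ≤
          K * (c ^ (-(2 * theta p)) * r ^ (-(2 * theta p))) / r ^ 2 := by
        rw [le_div_iff₀ (by positivity)]
        linarith
      calc r ^ (N - 1) * (U (c * r) ^ 2 + (c * W (c * r)) ^ 2) ≤ r ^ (N - 1) *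
          (K * (c ^ (-(2 * theta p)) * r ^ (-(2 * theta p))) / r ^ 2) := by gcongr
        _ = _ := by ring
  · rw [radialLaplacian_of_hasDerivAt ((eventually_gt_nhds hr.1).mono h1) (h2 r hr.1)]
    ring
  · rw [((h1 1 one_pos).hasDerivWithinAt).derivWithin
      ((uniqueDiffOn_Ioc 0 1) 1 ⟨one_pos, le_rfl⟩), mul_one, hWc, mul_zero]
  · exact L.sol.pos _ (mul_pos hc hr.1)
  · have h3 : Tendsto (fun r => efX p U (Real.log (c * r))) (𝓝[>] 0) (𝓝 (A N p)) := by
      refine L.tendsto_x.comp (Real.tendsto_log_nhdsGT_zero.comp ?_)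
      refine tendsto_nhdsWithin_iff.2 ⟨?_, eventually_nhdsWithin_of_forall fun r hr => mul_pos hc hr⟩
      have : Tendsto (fun r => c * r) (𝓝 0) (𝓝 (c * 0)) := (continuous_const_mul c).tendsto 0
      rw [mul_zero] at this
      exact this.mono_left nhdsWithin_le_nhds
    have h4 := h3.div_const (A N p)
    rw [div_self (A_pos hN hp).ne'] at h4
    refine h4.congr' (eventually_nhdsWithin_of_forall fun r hr => ?_)
    have hcr : 0 < c * r := mul_pos hc hr
    simp only [Real.sqrt_sq hc.le]
    rw [← rpow_neg_mul_efX p U hcr, mul_comm (A N p),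
      mul_div_mul_left _ _ (Real.rpow_pos_of_pos hcr _).ne']
  · rw [← L.encard_zeros hN hp hn, ← hcdef]
    have : {s ∈ Ioc 0 c | U s = 1} =
        (fun r => c * r) '' {r ∈ Ioc (0 : ℝ) 1 | U (c * r) - 1 = 0} := by
      ext s
      simp only [mem_ofPred_eq, mem_image, sub_eq_zero]
      constructor
      · rintro ⟨hs, hU⟩
        refine ⟨s / c, ⟨⟨div_pos hs.1 hc, (div_le_one hc).2 hs.2⟩, ?_⟩, by field_simp⟩
        rwa [mul_div_cancel₀ _ hc.ne']
      · rintro ⟨r, ⟨hr, hU⟩, rfl⟩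
        exact ⟨⟨mul_pos hc hr.1, by nlinarith [hr.2]⟩, hU⟩
    rw [this, (mul_right_injective₀ hc.ne').encard_image]

/-- The rescaled solution has the same limit in Emden-Fowler variables as `U`, so it coincides with
`U`. The Neumann condition makes `√λ` a critical point of `U`, and the number of zeros identifies
which one. -/
theorem eq_of_isSingularSolution (hN : 3 ≤ N) (hp : pS N < p) (L : SingularLimit N p u m U W s₀)
    {n : ℕ} {l : ℝ} {V : ℝ → ℝ} (hV : IsSingularSolution N p n l V) :
    l = singPoint N p U W s₀ (2 * n) ^ 2 := by
  have hp1 := one_lt_of_pS_lt hN hp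
  set c := √l with hcdef
  have hc : 0 < c := Real.sqrt_pos.2 hV.lam_pos
  have hcl : c ^ 2 = l := Real.sq_sqrt hV.lam_pos.le
  have hd1 : ∀ r ∈ Ioo (0 : ℝ) 1, HasDerivAt V (deriv V r) r := fun r hr =>
    ((hV.contDiffOn_two.differentiableOn two_ne_zero).differentiableAt
      (isOpen_Ioo.mem_nhds hr)).hasDerivAt
  have hd2 : ∀ r ∈ Ioo (0 : ℝ) 1, HasDerivAt (deriv V) (deriv (deriv V) r) r := fun r hr => by
    have h1 := hV.contDiffOn_two
    rw [show (2 : WithTop ℕ∞) = 1 + 1 from rfl,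
      contDiffOn_succ_iff_deriv_of_isOpen isOpen_Ioo] at h1
    exact ((h1.2.2.differentiableOn one_ne_zero).differentiableAt
      (isOpen_Ioo.mem_nhds hr)).hasDerivAt
  have hmem : ∀ s ∈ Ioo 0 c, s / c ∈ Ioo (0 : ℝ) 1 := fun s hs =>
    ⟨div_pos hs.1 hc, (div_lt_one hc).2 hs.2⟩
  have hrad : RadialSol N p (fun s => V (s / c)) (fun s => deriv V (s / c) / c) (Ioo 0 c) := by
    refine ⟨fun s hs => hs.1, fun s hs => ?_, fun s hs => ?_, fun s hs =>
      hV.pos _ (Ioo_subset_Ioc_self (hmem s hs))⟩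
    · exact ((hd1 _ (hmem s hs)).comp s ((hasDerivAt_id s).div_const c)).congr_deriv (by ring)
    · refine (((hd2 _ (hmem s hs)).comp s ((hasDerivAt_id s).div_const c)).div_const
        c).congr_deriv ?_
      have h1 := hV.equation _ (hmem s hs)
      rw [radialLaplacian, ← hcl] at h1
      have hs0 := hs.1.ne'
      have h2 : deriv (deriv V) (s / c) = -(((N : ℝ) - 1) / (s / c) * deriv V (s / c)) -
        c ^ 2 * f p (V (s / c)) := by linarith
      rw [h2]
      field_simp
  have hx : Tendsto (efX p fun s => V (s / c)) atBot (𝓝 (A N p)) := by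
    have h1 : Tendsto (fun t => Real.exp t / c) atBot (𝓝[>] 0) := by
      refine tendsto_nhdsWithin_iff.2 ⟨?_, Eventually.of_forall fun t => div_pos (Real.exp_pos t) hc⟩
      simpa using Real.tendsto_exp_atBot.div_const c
    have h2 := (hV.asymptotics.comp h1).const_mul (A N p)
    rw [mul_one] at h2
    refine h2.congr fun t => ?_
    have hA := (A_pos hN hp).ne'
    simp only [Function.comp]
    rw [← hcdef, mul_div_cancel₀ _ hc.ne', efX]
    have h3 := exp_mul_exp_rpow p t
    have h4 : Real.exp t ^ (-theta p) ≠ 0 := (Real.rpow_pos_of_pos (Real.exp_pos t) _).ne'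
    field_simp
    linear_combination (-V (Real.exp t / c)) * h3
  have heq := RadialSol.eq_of_tendsto hN hp hc hrad (L.sol.mono fun s hs => hs.1) hx L.tendsto_x
  have heq' : EqOn V (fun r => U (c * r)) (Ioo 0 1) := fun r hr => by
    have := heq (c * r) ⟨mul_pos hc hr.1, by nlinarith [hr.2]⟩
    rwa [mul_div_cancel_left₀ _ hc.ne'] at this
  have hcont := L.contDiffOn_scaled hp1 hc |>.continuousOn
  have hV1 : V 1 = U (c * 1) := by
    have h1 : Tendsto V (𝓝[<] 1) (𝓝 (V 1)) := by
      have := hV.contDiffOn_one.continuousOn 1 ⟨one_pos, le_rfl⟩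
      exact this.tendsto.mono_left (nhdsWithin_le_of_mem (mem_of_superset (Ioo_mem_nhdsLT one_pos)
        Ioo_subset_Ioc_self))
    have h2 : Tendsto (fun r => U (c * r)) (𝓝[<] 1) (𝓝 (U (c * 1))) :=
      ((hcont 1 (mem_Ioi.2 one_pos)).continuousAt (Ioi_mem_nhds one_pos)).tendsto.mono_left nhdsWithin_le_nhds
    refine tendsto_nhds_unique h1 (h2.congr' ?_)
    filter_upwards [Ioo_mem_nhdsLT one_pos] with r hr using (heq' hr).symm
  have heqc : EqOn V (fun r => U (c * r)) (Ioc 0 1) := fun r hr => by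
    rcases hr.2.eq_or_lt with rfl | h
    · exact hV1
    · exact heq' ⟨hr.1, h⟩
  have hW : W c = 0 := by
    have h1 := hV.neumann
    rw [derivWithin_congr heqc (heqc ⟨one_pos, le_rfl⟩),
      ((L.hasDerivAt_scaled hc one_pos).1.hasDerivWithinAt).derivWithin
      ((uniqueDiffOn_Ioc 0 1) 1 ⟨one_pos, le_rfl⟩), mul_one] at h1
    exact (mul_eq_zero.1 h1).resolve_left hc.ne'
  obtain ⟨j, hj, hcj⟩ := (L.W_eq_zero_iff hN hp hc).1 hW
  have hz := L.encard_zeros hN hp hj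
  rw [← hcj] at hz
  have : {s ∈ Ioc 0 c | U s = 1} = (fun r => c * r) '' {r ∈ Ioc (0 : ℝ) 1 | V r - 1 = 0} := by
    ext s
    simp only [mem_ofPred_eq, mem_image, sub_eq_zero]
    constructor
    · rintro ⟨hs, hU⟩
      have hm : s / c ∈ Ioc (0 : ℝ) 1 := ⟨div_pos hs.1 hc, (div_le_one hc).2 hs.2⟩
      refine ⟨s / c, ⟨hm, ?_⟩, by field_simp⟩
      rw [heqc hm]
      simp only
      rwa [mul_div_cancel₀ _ hc.ne']
    · rintro ⟨r, ⟨hr, hU⟩, rfl⟩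
      rw [heqc hr] at hU
      exact ⟨⟨mul_pos hc hr.1, by nlinarith [hr.2]⟩, hU⟩
  rw [this, (mul_right_injective₀ hc.ne').encard_image, hV.zeros] at hz
  have hnj : n = j := by exact_mod_cast hz
  rw [hnj, ← hcj, hcl]

theorem exists_isSingularSolution_iff (hN : 3 ≤ N) (hp : pS N < p)
    (L : SingularLimit N p u m U W s₀) {n : ℕ} (hn : 1 ≤ n) (l : ℝ) :
    (∃ V, IsSingularSolution N p n l V) ↔ l = singPoint N p U W s₀ (2 * n) ^ 2 :=
  ⟨fun ⟨_, hV⟩ => L.eq_of_isSingularSolution hN hp hV,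
    fun h => ⟨_, h ▸ L.isSingularSolution hN hp hn⟩⟩

end SingularLimit

end SupercriticalNeumann

end

/-! ### Oscillation below the Joseph-Lundgren exponent -/

open Set Filter Topology MeasureTheory

noncomputable section

namespace SupercriticalNeumann

variable {N : ℕ} {p : ℝ}

/-- Below the Joseph-Lundgren exponent, the linearization at the equilibrium is a spiral. -/
theorem alpha_sq_lt (hN : 3 ≤ N) (hp : pS N < p) (hJL : (p : EReal) < pJL N) :
    alpha N p ^ 2 < 4 * efBeta N p := by
  have hp1 := one_lt_of_pS_lt hN hp
  have hα := alpha_pos hN hp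
  have hN3 : (3 : ℝ) ≤ N := by exact_mod_cast hN
  have hβ : efBeta N p = 2 * ((N : ℝ) - 2 - theta p) := by
    rw [efBeta, coeffB, ← mul_assoc, mul_comm (p - 1), theta_mul hp1]
  have hθ := theta_pos hp1
  have hq : √((N : ℝ) - 1) ^ 2 = N - 1 := Real.sq_sqrt (by linarith)
  have hq0 := Real.sqrt_nonneg ((N : ℝ) - 1)
  set q := √((N : ℝ) - 1) with hqdef
  -- By `β = 2(N-2-θ)` the claim is `|2θ - (N-4)| < 2√(N-1)`. The lower bound for `2θ` is `p <
  -- p_JL`, automatic for `N ≤ 10`; the upper one follows from `2θ < N - 2`.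
  have hlow : (N : ℝ) - 4 - 2 * q < 2 * theta p := by
    by_cases h11 : 11 ≤ N
    · rw [pJL, if_pos h11, EReal.coe_lt_coe_iff, ← hqdef] at hJL
      have h11' : (11 : ℝ) ≤ N := by exact_mod_cast h11
      have hD : 0 < (N : ℝ) - 4 - 2 * q := by
        have : 2 * q < N - 4 := by
          refine lt_of_pow_lt_pow_left₀ 2 (by linarith) ?_
          rw [mul_pow, hq]
          nlinarith
        linarith
      have h1 : p - 1 < 4 / ((N : ℝ) - 4 - 2 * q) := by linarith
      rw [lt_div_iff₀ hD] at h1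
      have h2 : 2 * theta p = 4 / (p - 1) := by rw [theta]; ring
      rw [h2, lt_div_iff₀ (by linarith)]
      linarith
    · have h10 : (N : ℝ) ≤ 10 := by exact_mod_cast (by omega : N ≤ 10)
      have : (N : ℝ) - 4 ≤ 2 * q := by
        by_contra hlt
        have h1 : (2 * q) ^ 2 < ((N : ℝ) - 4) ^ 2 :=
          pow_lt_pow_left₀ (not_le.1 hlt) (by positivity) two_ne_zero
        rw [mul_pow, hq] at h1
        nlinarith
      linarith
  have hup : 2 * theta p - ((N : ℝ) - 4) < 2 * q := by
    rw [alpha] at hα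
    have : 1 ≤ q := Real.one_le_sqrt.2 (by linarith)
    linarith
  have h3 : (2 * theta p - ((N : ℝ) - 4)) ^ 2 < (2 * q) ^ 2 :=
    sq_lt_sq' (by linarith) hup
  rw [mul_pow, hq] at h3
  rw [alpha, hβ]
  nlinarith

/-- The condition on `c` makes the quadratic form `(1-c) b² + α ab + (β-c) a²` positive
semidefinite, so the unperturbed speed is at least `c`; half of it is given up to the perturbation.
-/
theorem angleRate_ge_of_spiral {α β c ν a b e : ℝ} (hc : c * (1 + β) ≤ β - α ^ 2 / 4) (hc0 : 0 < c)
    (hβ : 0 < β) (hν : ν ≤ c / 2) (he : |e| ≤ ν * |a|) (hne : a ^ 2 + b ^ 2 ≠ 0) :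
    c / 2 ≤ angleRate a b (-(α * b) - β * a + e) := by
  have hpos : 0 < a ^ 2 + b ^ 2 := lt_of_le_of_ne (by positivity) hne.symm
  rw [angleRate, le_div_iff₀ hpos]
  have hc1 : 0 < 1 - c := by
    have : c * (1 + β) ≤ β := by linarith [sq_nonneg α]
    nlinarith
  have h1 : 0 ≤ (1 - c) * b ^ 2 + α * (a * b) + (β - c) * a ^ 2 := by
    refine nonneg_of_mul_nonneg_right ?_ hc1
    have h2 : α ^ 2 / 4 ≤ (1 - c) * (β - c) := by nlinarith [sq_nonneg c]
    have h3 := mul_le_mul_of_nonneg_right h2 (sq_nonneg a)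
    nlinarith [sq_nonneg ((1 - c) * b + α * a / 2)]
  have h4 : a * e ≤ c / 2 * a ^ 2 := by
    calc a * e ≤ |a| * |e| := by rw [← abs_mul]; exact le_abs_self _
      _ ≤ |a| * (ν * |a|) := by gcongr
      _ = ν * a ^ 2 := by rw [← sq_abs a]; ring
      _ ≤ _ := by gcongr
  have h5 := mul_nonneg hc0.le (sq_nonneg b)
  linarith

/-- The phase curve of the difference of two solutions. -/
theorem EFSol.phaseCurve_sub (hN : 3 ≤ N) (hp : pS N < p) {x₁ y₁ x₂ y₂ : ℝ → ℝ} {σ : ℝ}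
    (h₁ : EFSol N p x₁ y₁ univ) (h₂ : EFSol N p x₂ y₂ univ) (hσ : x₂ σ < x₁ σ) :
    PhaseCurve (fun t => x₁ t - x₂ t) (fun t => y₁ t - y₂ t) (fun t =>
      -(alpha N p * (y₁ t - y₂ t)) + (efForce N p (x₁ t) - efForce N p (x₂ t)) +
        Real.exp (2 * t) * (x₁ t - x₂ t)) σ
      (Real.arctan (-((y₁ σ - y₂ σ) / (x₁ σ - x₂ σ)))) where
  deriv_a t _ := (h₁.sub_deriv h₂ (mem_univ t)).1
  deriv_b t _ := (h₁.sub_deriv h₂ (mem_univ t)).2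
  cont_d := by
    have e1 : Continuous x₁ := continuous_iff_continuousAt.2 fun t =>
      (h₁.deriv_x t (mem_univ t)).continuousAt
    have e2 : Continuous x₂ := continuous_iff_continuousAt.2 fun t =>
      (h₂.deriv_x t (mem_univ t)).continuousAt
    have e3 : Continuous y₁ := continuous_iff_continuousAt.2 fun t =>
      (h₁.deriv_y t (mem_univ t)).continuousAt
    have e4 : Continuous y₂ := continuous_iff_continuousAt.2 fun t =>
      (h₂.deriv_y t (mem_univ t)).continuousAt
    have e5 := continuous_efForce (N := N) (one_lt_of_pS_lt hN hp)
    fun_prop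
  ne t ht := by
    obtain ⟨M₁, hM₁⟩ := isCompact_Icc.exists_bound_of_continuousOn (s := Icc σ t)
      (fun r _ => (h₁.deriv_x r (mem_univ r)).continuousAt.continuousWithinAt)
    obtain ⟨M₂, hM₂⟩ := isCompact_Icc.exists_bound_of_continuousOn (s := Icc σ t)
      (fun r _ => (h₂.deriv_x r (mem_univ r)).continuousAt.continuousWithinAt)
    have h3 := (EFSol.gronwall hN hp (M := max M₁ M₂) ht (h₁.mono (subset_univ _))
      (h₂.mono (subset_univ _))
      (fun r hr => (le_abs_self _).trans ((hM₁ r hr).trans (le_max_left _ _)))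
      (fun r hr => (le_abs_self _).trans ((hM₂ r hr).trans (le_max_right _ _)))).2
    have h4 : 0 < (x₁ σ - x₂ σ) ^ 2 := pow_pos (by linarith) 2
    have h5 := sq_nonneg (y₁ σ - y₂ σ)
    exact (pos_of_mul_pos_left ((by linarith : _ < _).trans_le h3) (Real.exp_pos _).le).ne'
  init := exists_polar_arctan (by linarith)

/-- The angle of a phase curve crosses the vertical axis only upwards. -/
theorem PhaseCurve.angle_le_of_vertical {a b d : ℝ → ℝ} {s₀ Θ₀ : ℝ} (h : PhaseCurve a b d s₀ Θ₀)
    (k : ℤ) {s t : ℝ} (hs : s₀ ≤ s) (hst : s ≤ t)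
    (hk : (2 * k + 1) * Real.pi / 2 ≤ angle a b d s₀ Θ₀ s) :
    (2 * k + 1) * Real.pi / 2 ≤ angle a b d s₀ Θ₀ t := by
  rcases hst.eq_or_lt with rfl | hst
  · exact hk
  refine (h.angle_lt (fun r hr he => ?_) hs hst hk).le
  obtain ⟨ρ, hρ, h1, -⟩ := h.polar hr
  rw [he, Real.cos_eq_zero_iff.2 ⟨k, rfl⟩, mul_zero] at h1
  have hne := h.ne r hr
  rw [h1] at hne ⊢
  have : b r ^ 2 ≠ 0 := by simpa using hne
  have : 0 < b r ^ 2 := lt_of_le_of_ne (sq_nonneg _) this.symm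
  rw [angleRate]
  refine div_pos ?_ ?_ <;> nlinarith

/-- The Prüfer angle of the difference between the singular solution `(x, y)` and `(x₂, y₂)`,
measured from the time `σ`. -/
def gapAngle (N : ℕ) (p : ℝ) (x y x₂ y₂ : ℝ → ℝ) (σ t : ℝ) : ℝ :=
  angle (fun t => x t - x₂ t) (fun t => y t - y₂ t) (fun t =>
      -(alpha N p * (y t - y₂ t)) + (efForce N p (x t) - efForce N p (x₂ t)) +
        Real.exp (2 * t) * (x t - x₂ t)) σ (Real.arctan (-((y σ - y₂ σ) / (x σ - x₂ σ)))) t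

section

variable {X Y : ℝ → ℝ → ℝ} {x y : ℝ → ℝ}

theorem continuousOn_gapAngle (hN : 3 ≤ N) (hp : pS N < p)
    (hsol : ∀ γ > 0, EFSol N p (X γ) (Y γ) univ) (hXc : Continuous fun q : ℝ × ℝ => X q.1 q.2)
    (hYc : Continuous fun q : ℝ × ℝ => Y q.1 q.2) (hx : EFSol N p x y univ) {γ₁ γ₂ σ t : ℝ}
    (hγ₁ : 0 < γ₁) (hγ : γ₁ ≤ γ₂) (hσ : ∀ γ ∈ Icc γ₁ γ₂, X γ σ < x σ) (ht : σ ≤ t) :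
    ContinuousOn (fun γ => gapAngle N p x y (X γ) (Y γ) σ t) (Icc γ₁ γ₂) := by
  have hp1 := one_lt_of_pS_lt hN hp
  have cx : Continuous x := continuous_iff_continuousAt.2 fun t =>
    (hx.deriv_x t (mem_univ t)).continuousAt
  have cy : Continuous y := continuous_iff_continuousAt.2 fun t =>
    (hx.deriv_y t (mem_univ t)).continuousAt
  -- Clamping the parameter, and the time from below by `σ`, yields an integrand that is continuous
  -- everywhere and unchanged where it is used.
  set π : ℝ → ℝ := fun γ => max γ₁ (min γ γ₂) with hπ
  have hπc : Continuous π := by fun_prop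
  have hπm : ∀ γ, π γ ∈ Icc γ₁ γ₂ := fun γ => ⟨le_max_left _ _, max_le hγ (min_le_right _ _)⟩
  have hπe : ∀ γ ∈ Icc γ₁ γ₂, π γ = γ := fun γ h => by
    simp only [hπ, min_eq_left h.2, max_eq_right h.1]
  have c1 : Continuous fun q : ℝ × ℝ => x (max σ q.2) - X (π q.1) (max σ q.2) :=
    (cx.comp (by fun_prop)).sub (hXc.comp (f := fun q : ℝ × ℝ => (π q.1, max σ q.2)) (by fun_prop))
  have c2 : Continuous fun q : ℝ × ℝ => y (max σ q.2) - Y (π q.1) (max σ q.2) :=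
    (cy.comp (by fun_prop)).sub (hYc.comp (f := fun q : ℝ × ℝ => (π q.1, max σ q.2)) (by fun_prop))
  have cF := continuous_efForce (N := N) hp1
  have c3 : Continuous fun q : ℝ × ℝ => efForce N p (x (max σ q.2)) -
      efForce N p (X (π q.1) (max σ q.2)) :=
    (cF.comp (cx.comp (by fun_prop))).sub
      (cF.comp (hXc.comp (f := fun q : ℝ × ℝ => (π q.1, max σ q.2)) (by fun_prop)))
  have hcurve := fun γ => hx.phaseCurve_sub hN hp (hsol (π γ) (hγ₁.trans_le (hπm γ).1))
    (hσ _ (hπm γ))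
  have hc : Continuous fun q : ℝ × ℝ => angleRate (x (max σ q.2) - X (π q.1) (max σ q.2))
      (y (max σ q.2) - Y (π q.1) (max σ q.2))
      (-(alpha N p * (y (max σ q.2) - Y (π q.1) (max σ q.2))) + (efForce N p (x (max σ q.2)) -
      efForce N p (X (π q.1) (max σ q.2))) + Real.exp (2 * max σ q.2) *
      (x (max σ q.2) - X (π q.1) (max σ q.2))) := by
    have c4 : Continuous fun q : ℝ × ℝ => Real.exp (2 * max σ q.2) := by fun_prop
    unfold angleRate
    exact Continuous.div ((c2.pow 2).sub (c1.mul
      (((continuous_const.mul c2).neg.add c3).add (c4.mul c1))))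
      ((c1.pow 2).add (c2.pow 2)) fun q => (hcurve q.1).ne _ (le_max_left σ q.2)
  have hI := intervalIntegral.continuous_parametric_intervalIntegral_of_continuous (μ := volume)
    (a₀ := σ) (X := ℝ) (f := fun γ s => angleRate (x (max σ s) - X (π γ) (max σ s))
      (y (max σ s) - Y (π γ) (max σ s))
      (-(alpha N p * (y (max σ s) - Y (π γ) (max σ s))) + (efForce N p (x (max σ s)) -
      efForce N p (X (π γ) (max σ s))) + Real.exp (2 * max σ s) *
      (x (max σ s) - X (π γ) (max σ s)))) hc (continuous_const (y := t))
  have e1 : Continuous fun γ => x σ - X (π γ) σ :=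
    continuous_const.sub (hXc.comp (f := fun γ : ℝ => (π γ, σ)) (by fun_prop))
  have e2 : Continuous fun γ => y σ - Y (π γ) σ :=
    continuous_const.sub (hYc.comp (f := fun γ : ℝ => (π γ, σ)) (by fun_prop))
  have e3 : Continuous fun γ => Real.arctan (-((y σ - Y (π γ) σ) / (x σ - X (π γ) σ))) :=
    Real.continuous_arctan.comp (e2.div e1 fun γ => by linarith [hσ _ (hπm γ)]).neg
  refine (e3.add hI).continuousOn.congr fun γ hγm => ?_
  simp only [gapAngle, angle, Pi.add_apply, hπe γ hγm]
  congr 1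
  refine intervalIntegral.integral_congr fun s hs => ?_
  rw [uIcc_of_le ht] at hs
  simp only [max_eq_right hs.1]

/-- In the oscillatory regime the family crosses the singular solution, at any given time, with
equal derivative and from either side, for arbitrarily large parameters. -/
theorem exists_crossing (hN : 3 ≤ N) (hp : pS N < p) (hαβ : alpha N p ^ 2 < 4 * efBeta N p)
    (hsol : ∀ γ > 0, EFSol N p (X γ) (Y γ) univ) (hXc : Continuous fun q : ℝ × ℝ => X q.1 q.2)
    (hYc : Continuous fun q : ℝ × ℝ => Y q.1 q.2) (hx : EFSol N p x y univ)
    (hxA : Tendsto x atBot (𝓝 (A N p)))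
    (hsmall : ∀ g > 0, ∃ σ₀ : ℝ, ∀ γ ∈ Ioc 0 g, ∀ t ≤ σ₀, X γ t < x t)
    (hnear : ∀ δ > 0, ∃ T ≤ 0, ∀ τ : ℝ, ∀ᶠ γ in atTop, ∀ t ∈ Icc τ T,
      |X γ t - A N p| < δ ∧ |Y γ t| < δ) (t Γ : ℝ) :
    (∃ γ ≥ Γ, X γ t < x t ∧ Y γ t = y t) ∧ (∃ γ ≥ Γ, x t < X γ t ∧ Y γ t = y t) := by
  have hβ := efBeta_pos hN hp
  have hπ := Real.pi_pos
  obtain ⟨c, hc0, hc⟩ : ∃ c > 0, c * (1 + efBeta N p) ≤ efBeta N p - alpha N p ^ 2 / 4 :=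
    ⟨(efBeta N p - alpha N p ^ 2 / 4) / (1 + efBeta N p), div_pos (by linarith) (by linarith),
      (div_mul_cancel₀ _ (by linarith)).le⟩
  obtain ⟨δ, hδ, T₀, -, hforce⟩ := exists_efForce_sub_near hN hp (ν := c / 2) (by positivity)
  obtain ⟨T₁, -, hn⟩ := hnear δ hδ
  obtain ⟨T₂, hT₂⟩ := eventually_atBot.1 (Metric.tendsto_nhds.1 hxA δ hδ)
  set T := min (min T₀ T₁) (min T₂ t) with hT
  have hTT₀ : T ≤ T₀ := (min_le_left _ _).trans (min_le_left _ _)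
  have hTT₁ : T ≤ T₁ := (min_le_left _ _).trans (min_le_right _ _)
  have hTT₂ : T ≤ T₂ := (min_le_right _ _).trans (min_le_left _ _)
  have hTt : T ≤ t := (min_le_right _ _).trans (min_le_right _ _)
  set γ₁ := max Γ 1 with hγ₁
  have hγ₁0 : 0 < γ₁ := lt_max_of_lt_right one_pos
  obtain ⟨σ₁, hσ₁⟩ := hsmall γ₁ hγ₁0
  set σ₁' := min σ₁ t with hσ₁'
  -- A bound for the final angle at `γ₁` that does not involve the starting time `σ`, which is
  -- chosen only later.
  set K := Real.pi / 2 + ∫ s in σ₁'..t, angleRate (x s - X γ₁ s) (y s - Y γ₁ s)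
    (-(alpha N p * (y s - Y γ₁ s)) + (efForce N p (x s) - efForce N p (X γ₁ s)) +
        Real.exp (2 * s) * (x s - X γ₁ s)) with hK
  obtain ⟨j, hj⟩ := exists_nat_gt (K / (2 * Real.pi))
  rw [div_lt_iff₀ (by positivity)] at hj
  -- At speed at least `c/2` the angle gains `(2j+2)π` on `[τ,T]`.
  set τ := T - (2 * j + 2) * Real.pi / (c / 2) with hτ
  have hτT : τ ≤ T := by
    have : 0 ≤ (2 * j + 2) * Real.pi / (c / 2) := by positivity
    linarith
  obtain ⟨γ₂, hγ₂, hγ₁₂⟩ := ((hn τ).and (eventually_ge_atTop γ₁)).exists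
  have hγ₂0 : 0 < γ₂ := hγ₁0.trans_le hγ₁₂
  obtain ⟨σ₂, hσ₂⟩ := hsmall γ₂ hγ₂0
  -- A starting time at which all solutions with parameter in `[γ₁,γ₂]` lie below the singular one,
  -- so that the starting angle is an arctangent, continuous in the parameter.
  set σ := min (min σ₁' σ₂) τ with hσ
  have hσσ₁ : σ ≤ σ₁' := (min_le_left _ _).trans (min_le_left _ _)
  have hσσ₂ : σ ≤ σ₂ := (min_le_left _ _).trans (min_le_right _ _)
  have hστ : σ ≤ τ := min_le_right _ _
  have hσt : σ ≤ t := hστ.trans (hτT.trans hTt)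
  have hcurve : ∀ γ ∈ Icc γ₁ γ₂, _ := fun γ (hγ : γ ∈ Icc γ₁ γ₂) =>
    hx.phaseCurve_sub hN hp (hsol γ (hγ₁0.trans_le hγ.1))
      (hσ₂ γ ⟨hγ₁0.trans_le hγ.1, hγ.2⟩ σ hσσ₂)
  have hcont := continuousOn_gapAngle hN hp hsol hXc hYc hx hγ₁0 hγ₁₂ (σ := σ) (t := t)
    (fun γ hγ => hσ₂ γ ⟨hγ₁0.trans_le hγ.1, hγ.2⟩ σ hσσ₂) hσt
  -- Up to `σ₁'` the gap is positive, so the angle is still an arctangent below `π/2`, however early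
  -- the start.
  have hupper : gapAngle N p x y (X γ₁) (Y γ₁) σ t ≤ K := by
    have h1 := hcurve γ₁ ⟨le_rfl, hγ₁₂⟩
    rw [gapAngle, h1.angle_eq_add hσσ₁ hσt, hK]
    gcongr
    rw [h1.angle_eq_arctan hσσ₁ (fun r hr => by
      have := hσ₁ γ₁ ⟨hγ₁0, le_rfl⟩ r (hr.2.trans (min_le_left _ _))
      linarith) ⟨Real.neg_pi_div_two_lt_arctan _, Real.arctan_lt_pi_div_two _⟩]
    exact (Real.arctan_lt_pi_div_two _).le
  -- Vertical levels are never crossed downward: the angle is at least `-π/2` at `τ`, hence at least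
  -- `(4j+3)π/2` at `T` and also at `t`.
  have hlower : (2 * j + 1) * Real.pi ≤ gapAngle N p x y (X γ₂) (Y γ₂) σ t := by
    have h1 := hcurve γ₂ ⟨hγ₁₂, le_rfl⟩
    have h2 := h1.angle_le_of_vertical (-1) le_rfl hστ (by
      rw [PhaseCurve.angle_self]
      push_cast
      have := Real.neg_pi_div_two_lt_arctan (-((y σ - Y γ₂ σ) / (x σ - X γ₂ σ)))
      linarith)
    have h3 : c / 2 * (T - τ) ≤ ∫ s in τ..T, angleRate (x s - X γ₂ s) (y s - Y γ₂ s)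
      (-(alpha N p * (y s - Y γ₂ s)) + (efForce N p (x s) - efForce N p (X γ₂ s)) +
        Real.exp (2 * s) * (x s - X γ₂ s)) := by
      have e := intervalIntegral.integral_mono_on (a := τ) (b := T) (f := fun _ => c / 2) hτT
        intervalIntegrable_const (h1.rate_intervalIntegrable hστ (hστ.trans hτT)) (fun s hs => by
          have e1 := hforce s (hs.2.trans hTT₀) (x s) (X γ₂ s) (hT₂ s (hs.2.trans hTT₂))
            (hγ₂ s ⟨hs.1, hs.2.trans hTT₁⟩).1
          have e2 := angleRate_ge_of_spiral (b := y s - Y γ₂ s) hc hc0 hβ le_rfl e1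
            (h1.ne s (hστ.trans hs.1))
          refine e2.trans_eq ?_
          congr 1
          ring)
      rw [intervalIntegral.integral_const, smul_eq_mul] at e
      linarith
    have h4 : c / 2 * (T - τ) = (2 * j + 2) * Real.pi := by
      rw [hτ]; field_simp; ring
    have h5 := h1.angle_eq_add hστ (hστ.trans hτT)
    have h6 := h1.angle_le_of_vertical (2 * j + 1) (hστ.trans hτT) hTt (by
      rw [h5]
      push_cast at h2 ⊢
      linarith)
    rw [gapAngle]
    push_cast at h6
    linarith
  -- Both `2jπ` and `(2j+1)π` lie between the final angles for `γ₁` and `γ₂`. At such an angle the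
  -- derivatives agree, and the parity of the multiple is the sign of the gap.
  have hpt : ∀ i : ℕ, 2 * j ≤ i → i ≤ 2 * j + 1 → ∃ γ ≥ Γ, ∃ ρ > 0,
      x t - X γ t = ρ * Real.cos (i * Real.pi) ∧ Y γ t = y t := fun i h1 h2 => by
    have h1' : ((2 * j : ℕ) : ℝ) ≤ i := by exact_mod_cast h1
    have h2' : (i : ℝ) ≤ (2 * j + 1 : ℕ) := by exact_mod_cast h2
    push_cast at h1' h2'
    have h3 := mul_le_mul_of_nonneg_right h1' hπ.le
    have h4 := mul_le_mul_of_nonneg_right h2' hπ.le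
    obtain ⟨γ, hγ, he⟩ := intermediate_value_Icc hγ₁₂ hcont
      (show (i : ℝ) * Real.pi ∈ Icc _ _ from ⟨by linarith, by linarith⟩)
    simp only at he
    obtain ⟨ρ, hρ, e1, e2⟩ := (hcurve γ hγ).polar hσt
    rw [gapAngle] at he
    rw [he] at e1 e2
    rw [Real.sin_nat_mul_pi, mul_zero, neg_zero] at e2
    exact ⟨γ, (le_max_left _ _).trans hγ.1, ρ, hρ, e1, by linarith⟩
  constructor
  · obtain ⟨γ, hγ, ρ, hρ, h1, h2⟩ := hpt (2 * j) le_rfl (by omega)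
    refine ⟨γ, hγ, ?_, h2⟩
    rw [Real.cos_nat_mul_pi, pow_mul, neg_one_sq, one_pow, mul_one] at h1
    linarith
  · obtain ⟨γ, hγ, ρ, hρ, h1, h2⟩ := hpt (2 * j + 1) (by omega) le_rfl
    refine ⟨γ, hγ, ?_, h2⟩
    rw [Real.cos_nat_mul_pi, pow_succ, pow_mul, neg_one_sq, one_pow, one_mul] at h1
    linarith

end

variable {u m h v k a : ℝ → ℝ → ℝ} {U W : ℝ → ℝ} {s₀ : ℝ}

namespace SingularLimit

/-- At a zero of `U'`, equality of the Emden-Fowler derivatives reads `θu + su' = θU`. The sign of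
`u'` is then opposite to that of `u - U`, and crossings of both kinds exist. -/
theorem exists_deriv_sign (hN : 3 ≤ N) (hp : pS N < p) (hαβ : alpha N p ^ 2 < 4 * efBeta N p)
    (R : RegularFamily N p u m h v k a) (L : SingularLimit N p u m U W s₀) {s : ℝ} (hs : 0 < s)
    (hW : W s = 0) (Γ : ℝ) :
    (∃ γ ≥ Γ, m s γ < 0) ∧ (∃ γ ≥ Γ, 0 < m s γ) := by
  have hp1 := one_lt_of_pS_lt hN hp
  have hθ := theta_pos hp1
  have hx : EFSol N p (efX p U) (efY p U W) univ :=
    (L.sol.efSol hp1).mono fun t _ => Real.exp_pos t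
  -- For bounded `γ` the regular solutions are bounded, so their transforms tend to `0` uniformly as
  -- `t → -∞`, while that of `U` tends to `A > 0`.
  have hsmall : ∀ g > 0, ∃ σ₀ : ℝ, ∀ γ ∈ Ioc 0 g, ∀ t ≤ σ₀,
      efX p (fun s => u s γ) t < efX p U t := fun g hg => by
    have hA := A_pos hN hp
    have hlim : Tendsto (fun t : ℝ => Real.exp (theta p * t) * max g (peak p)) atBot (𝓝 0) := by
      simpa using (Real.tendsto_exp_atBot.comp (tendsto_id.const_mul_atBot hθ)).mul_const
        (max g (peak p))
    obtain ⟨σ, hσ⟩ := eventually_atBot.1 ((hlim.eventually (gt_mem_nhds (half_pos hA))).and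
      (L.tendsto_x.eventually (lt_mem_nhds (half_lt_self hA))))
    refine ⟨σ, fun γ hγ t ht => ?_⟩
    have h1 := R.u_le γ hγ.1 (Real.exp t) (Real.exp_pos t).le
    have h2 : efX p (fun s => u s γ) t ≤ Real.exp (theta p * t) * max g (peak p) := by
      rw [efX]
      exact mul_le_mul_of_nonneg_left (h1.trans (max_le_max_right _ hγ.2)) (Real.exp_pos _).le
    linarith [(hσ t ht).1, (hσ t ht).2]
  have hXc : Continuous fun q : ℝ × ℝ => efX p (fun s => u s q.1) q.2 := by
    have := R.cont_u.comp (f := fun q : ℝ × ℝ => (Real.exp q.2, q.1)) (by fun_prop)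
    exact (Real.continuous_exp.comp (continuous_const.mul continuous_snd)).mul this
  have hYc : Continuous fun q : ℝ × ℝ => efY p (fun s => u s q.1) (fun s => -(s * m s q.1)) q.2 := by
    have h1 := R.cont_u.comp (f := fun q : ℝ × ℝ => (Real.exp q.2, q.1)) (by fun_prop)
    have h2 := R.cont_m.comp (f := fun q : ℝ × ℝ => (Real.exp q.2, q.1)) (by fun_prop)
    have h3 : Continuous fun q : ℝ × ℝ => Real.exp q.2 := by fun_prop
    exact (Real.continuous_exp.comp (continuous_const.mul continuous_snd)).mul
      ((continuous_const.mul h1).add (h3.mul (h3.mul h2).neg))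
  have hcross := exists_crossing hN hp hαβ (X := fun γ => efX p fun s => u s γ)
    (Y := fun γ => efY p (fun s => u s γ) fun s => -(s * m s γ))
    (fun γ hγ => R.efSol hp1 hγ) hXc hYc hx L.tendsto_x hsmall
    (fun δ hδ => R.exists_near_equilibrium hN hp hδ) (Real.log s) Γ
  simp only [efX, efY, Real.exp_log hs, hW, mul_zero, add_zero] at hcross
  have hpos := Real.exp_pos (theta p * Real.log s)
  have key : ∀ γ, Real.exp (theta p * Real.log s) * (theta p * u s γ + s * -(s * m s γ)) =
      Real.exp (theta p * Real.log s) * (theta p * U s) →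
      s ^ 2 * m s γ = theta p * (u s γ - U s) := fun γ h => by
    have := mul_left_cancel₀ hpos.ne' h
    linarith
  constructor
  · obtain ⟨γ, hγ, h1, h2⟩ := hcross.1
    have h3 := key γ h2
    have h4 : u s γ < U s := lt_of_mul_lt_mul_left h1 hpos.le
    refine ⟨γ, hγ, ?_⟩
    by_contra hm
    have h5 := mul_nonneg (sq_nonneg s) (not_lt.1 hm)
    nlinarith
  · obtain ⟨γ, hγ, h1, h2⟩ := hcross.2
    have h3 := key γ h2
    have h4 : U s < u s γ := lt_of_mul_lt_mul_left h1 hpos.le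
    refine ⟨γ, hγ, ?_⟩
    have h5 : 0 < s ^ 2 * m s γ := by rw [h3]; exact mul_pos hθ (by linarith)
    exact pos_of_mul_pos_right h5 (sq_nonneg s)

/-- Near the critical point of the singular solution, the sign of the derivative of the regular
solution tells the position of its critical point. -/
theorem eventually_sign_iff (hN : 3 ≤ N) (hp : pS N < p) (R : RegularFamily N p u m h v k a)
    (L : SingularLimit N p u m U W s₀) {n : ℕ} (hn : 1 ≤ n) :
    ∀ᶠ γ in atTop,
      (0 < (-1) ^ n * m (singPoint N p U W s₀ (2 * n)) γ →
        critPoint N v k a n γ < singPoint N p U W s₀ (2 * n)) ∧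
      ((-1) ^ n * m (singPoint N p U W s₀ (2 * n)) γ < 0 →
        singPoint N p U W s₀ (2 * n) < critPoint N v k a n γ) := by
  have hspec := L.singPoint_spec hN hp (j := 2 * n) (by omega)
  have hπ := Real.pi_pos
  set s := singPoint N p U W s₀ (2 * n) with hs
  have hs0 : 0 < s := L.s₀_pos.trans hspec.1
  have hlim := L.tendsto_phase hN hp R hspec.1.le
  rw [hspec.2, show ((2 * n : ℕ) : ℝ) * (Real.pi / 2) = n * Real.pi by push_cast; ring] at hlim
  filter_upwards [hlim.eventually (Ioo_mem_nhds (by linarith : n * Real.pi - Real.pi < n * Real.pi)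
    (by linarith : n * Real.pi < n * Real.pi + Real.pi)), eventually_gt_atTop 1] with γ hγ hγ1
  have hγ0 : 0 < γ := by linarith
  obtain ⟨ρ, hρ, -, h2⟩ := (R.phaseCurve hN γ).polar hs0.le
  have h3 : s * m s γ = (γ - 1) * ρ * Real.sin (phase N v k a s γ) := by
    rw [R.m_eq hγ0 hs0, phase]
    linear_combination (-(γ - 1)) * h2
  set φ := phase N v k a s γ with hφ
  have h4 : (-1) ^ n * (s * m s γ) = (γ - 1) * ρ * Real.sin (φ - n * Real.pi) := by
    rw [Real.sin_sub_nat_mul_pi, h3]; ring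
  have hρ' : 0 < (γ - 1) * ρ := mul_pos (by linarith) hρ
  have h5 : (-1) ^ n * (s * m s γ) = s * ((-1) ^ n * m s γ) := by ring
  rw [h5] at h4
  constructor
  · intro hm
    rw [R.critPoint_lt_iff hN hp hγ0 n hs0.le]
    by_contra hle
    have := Real.sin_nonpos_of_nonpos_of_neg_pi_le (x := φ - n * Real.pi)
      (by linarith [not_lt.1 hle]) (by linarith [hγ.1])
    have := mul_nonpos_of_nonneg_of_nonpos hρ'.le this
    have := mul_pos hs0 hm
    linarith
  · intro hm
    rw [R.lt_critPoint_iff hN hp hγ0 n hs0.le]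
    by_contra hle
    have := Real.sin_nonneg_of_nonneg_of_le_pi (x := φ - n * Real.pi)
      (by linarith [not_lt.1 hle]) (by linarith [hγ.2])
    have := mul_nonneg hρ'.le this
    have := mul_neg_of_pos_of_neg hs0 hm
    linarith

theorem frequently_critPoint (hN : 3 ≤ N) (hp : pS N < p) (hJL : (p : EReal) < pJL N)
    (R : RegularFamily N p u m h v k a) (L : SingularLimit N p u m U W s₀) {n : ℕ} (hn : 1 ≤ n) :
    (∃ᶠ γ in atTop, singPoint N p U W s₀ (2 * n) < critPoint N v k a n γ) ∧
      (∃ᶠ γ in atTop, critPoint N v k a n γ < singPoint N p U W s₀ (2 * n)) := by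
  have hspec := L.singPoint_spec hN hp (j := 2 * n) (by omega)
  have hs0 : 0 < singPoint N p U W s₀ (2 * n) := L.s₀_pos.trans hspec.1
  have hW : W (singPoint N p U W s₀ (2 * n)) = 0 := (L.W_eq_zero_iff hN hp hs0).2 ⟨n, hn, rfl⟩
  obtain ⟨Γ₀, hΓ₀⟩ := eventually_atTop.1 (L.eventually_sign_iff hN hp R hn)
  have hsign := fun Γ => L.exists_deriv_sign hN hp (alpha_sq_lt hN hp hJL) R hs0 hW Γ
  have key : ∀ Γ, (∃ γ ≥ Γ, 0 < (-1) ^ n * m (singPoint N p U W s₀ (2 * n)) γ) ∧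
      (∃ γ ≥ Γ, (-1) ^ n * m (singPoint N p U W s₀ (2 * n)) γ < 0) := fun Γ => by
    obtain ⟨⟨γ₁, h₁, hm₁⟩, ⟨γ₂, h₂, hm₂⟩⟩ := hsign Γ
    rcases neg_one_pow_eq_or ℝ n with e | e <;> rw [e]
    · exact ⟨⟨γ₂, h₂, by linarith⟩, ⟨γ₁, h₁, by linarith⟩⟩
    · exact ⟨⟨γ₁, h₁, by linarith⟩, ⟨γ₂, h₂, by linarith⟩⟩
  constructor
  · refine frequently_atTop.2 fun Γ => ?_
    obtain ⟨γ, hγ, hm⟩ := (key (max Γ Γ₀)).2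
    exact ⟨γ, (le_max_left _ _).trans hγ, (hΓ₀ γ ((le_max_right _ _).trans hγ)).2 hm⟩
  · refine frequently_atTop.2 fun Γ => ?_
    obtain ⟨γ, hγ, hm⟩ := (key (max Γ Γ₀)).1
    exact ⟨γ, (le_max_left _ _).trans hγ, (hΓ₀ γ ((le_max_right _ _).trans hγ)).1 hm⟩

end SingularLimit

end SupercriticalNeumann

end

/-! ### The ground state and boundary concentration -/

open Set Filter Topology MeasureTheory

noncomputable section

namespace SupercriticalNeumann

section GroundState

variable {p : ℝ}

/-- The derivative of the ground state. -/
def groundSlope (p y : ℝ) : ℝ :=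
  -(groundState p y * (Real.sinh ((p - 1) / 2 * y) / Real.cosh ((p - 1) / 2 * y)))

theorem groundState_eq (p y : ℝ) :
    groundState p y = peak p * Real.cosh ((p - 1) / 2 * y) ^ (-theta p) := rfl

theorem groundState_zero (p : ℝ) : groundState p 0 = peak p := by
  rw [groundState_eq, mul_zero, Real.cosh_zero, Real.one_rpow, mul_one]

theorem groundSlope_zero (p : ℝ) : groundSlope p 0 = 0 := by simp [groundSlope]

theorem groundState_pos (hp : 1 < p) (y : ℝ) : 0 < groundState p y :=
  mul_pos (zero_lt_one.trans (one_lt_peak hp)) (Real.rpow_pos_of_pos (Real.cosh_pos _) _)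

theorem hasDerivAt_groundState (hp : 1 < p) (y : ℝ) :
    HasDerivAt (groundState p) (groundSlope p y) y := by
  have hC := Real.cosh_pos ((p - 1) / 2 * y)
  have h1 := (((hasDerivAt_id y).const_mul ((p - 1) / 2)).cosh.rpow_const (p := -theta p)
    (Or.inl hC.ne')).const_mul (peak p)
  refine h1.congr_deriv ?_
  simp only [id, mul_one]
  rw [groundSlope, groundState_eq, Real.rpow_sub_one hC.ne']
  have h2 := theta_mul hp
  field_simp
  linear_combination (-(peak p * Real.sinh ((p - 1) * y / 2))) * h2

theorem groundState_rpow (hp : 1 < p) (y : ℝ) :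
    groundState p y ^ p = groundState p y * ((p + 1) / 2 / Real.cosh ((p - 1) / 2 * y) ^ 2) := by
  have hC := Real.cosh_pos ((p - 1) / 2 * y)
  have hw := groundState_pos hp y
  have h1 : groundState p y ^ p = groundState p y * groundState p y ^ (p - 1) := by
    rw [Real.rpow_sub_one hw.ne']; field_simp
  rw [h1]
  congr 1
  rw [groundState_eq, Real.mul_rpow (by linarith [one_lt_peak hp]) (Real.rpow_nonneg hC.le _),
    peak_pow hp, ← Real.rpow_mul hC.le, neg_mul, theta_mul hp, Real.rpow_neg hC.le, div_eq_mul_inv ((p + 1) / 2),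
    Real.rpow_two]

theorem hasDerivAt_groundSlope (hp : 1 < p) (y : ℝ) :
    HasDerivAt (groundSlope p) (-f p (groundState p y)) y := by
  have hC := (Real.cosh_pos ((p - 1) / 2 * y)).ne'
  have h0 := (hasDerivAt_id y).const_mul ((p - 1) / 2)
  have h1 := ((hasDerivAt_groundState hp y).fun_mul (h0.sinh.fun_div h0.cosh hC)).fun_neg
  refine h1.congr_deriv ?_
  simp only [id, mul_one]
  rw [f, groundState_rpow hp, groundSlope]
  have hS := Real.cosh_sq ((p - 1) / 2 * y)
  simp only [id] at *
  generalize Real.cosh ((p - 1) / 2 * y) = C at *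
  generalize Real.sinh ((p - 1) / 2 * y) = S at *
  field_simp
  rw [hS]
  ring

theorem groundSlope_neg (hp : 1 < p) {y : ℝ} (hy : 0 < y) : groundSlope p y < 0 := by
  have h1 : 0 < Real.sinh ((p - 1) / 2 * y) := Real.sinh_pos_iff.2 (mul_pos (by linarith) hy)
  have h2 := Real.cosh_pos ((p - 1) / 2 * y)
  have := groundState_pos hp y
  exact neg_neg_of_pos (by positivity)

theorem continuous_groundState (hp : 1 < p) : Continuous (groundState p) :=
  continuous_iff_continuousAt.2 fun y => (hasDerivAt_groundState hp y).continuousAt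

theorem continuous_groundSlope (hp : 1 < p) : Continuous (groundSlope p) :=
  continuous_iff_continuousAt.2 fun y => (hasDerivAt_groundSlope hp y).continuousAt

theorem groundState_le (hp : 1 < p) {y z : ℝ} (hy : 0 ≤ y) (hyz : y ≤ z) :
    groundState p z ≤ groundState p y :=
  le_of_hasDerivAt_nonpos hyz (continuous_groundState hp).continuousOn
    (fun x _ => hasDerivAt_groundState hp x)
    (fun _ hx => (groundSlope_neg hp (hy.trans_lt hx.1)).le)

theorem tendsto_groundState (hp : 1 < p) : Tendsto (groundState p) atTop (𝓝 0) := by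
  have h1 : Tendsto (fun y : ℝ => (p - 1) / 2 * y) atTop atTop :=
    tendsto_id.const_mul_atTop (by linarith)
  have h2 : Tendsto Real.cosh atTop atTop := by
    refine tendsto_atTop_mono (fun x => ?_) (Real.tendsto_exp_atTop.atTop_div_const two_pos)
    rw [Real.cosh_eq]
    have := Real.exp_pos (-x)
    linarith
  have h3 := ((tendsto_rpow_neg_atTop (theta_pos hp)).comp (h2.comp h1)).const_mul (peak p)
  rw [mul_zero] at h3
  exact h3

end GroundState

namespace RegularFamily

variable {N : ℕ} {p : ℝ} {u m h v k a : ℝ → ℝ → ℝ}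

theorem m_critPoint (hN : 3 ≤ N) (hp : pS N < p) (R : RegularFamily N p u m h v k a) {n : ℕ}
    (hn : 1 ≤ n) {γ : ℝ} (hγ : 0 < γ) : m (critPoint N v k a n γ) γ = 0 := by
  have hc := R.critPoint_pos hN hp hγ hn
  rw [R.m_eq hγ hc, (R.k_eq_zero_iff hN hp hγ hc).2 ⟨n, hn, rfl⟩, mul_zero]

theorem u_le_peak (hp : 1 < p) (R : RegularFamily N p u m h v k a) {γ : ℝ} (hγ : 0 < γ)
    (hγ1 : γ < 1) {s : ℝ} (hs : 0 ≤ s) : u s γ ≤ peak p :=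
  (R.u_le γ hγ s hs).trans (max_le (by linarith [one_lt_peak hp]) le_rfl)

theorem energy_nonpos (hN : 3 ≤ N) (hp : 1 < p) (R : RegularFamily N p u m h v k a) {γ : ℝ}
    (hγ : 0 < γ) (hγ1 : γ < 1) {s : ℝ} (hs : 0 ≤ s) : energy p (u s γ) (-(s * m s γ)) ≤ 0 := by
  have h1 := R.energy_le hN hp hγ le_rfl hs
  have h2 : fPrim p γ ≤ 0 := (fPrim_nonpos_iff hp hγ).2 (by linarith [one_lt_peak hp])
  simp only [energy, R.u_zero, zero_mul, neg_zero] at h1 ⊢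
  linarith

theorem abs_mul_m_le (hN : 3 ≤ N) (hp : 1 < p) (R : RegularFamily N p u m h v k a) {γ : ℝ}
    (hγ : 0 < γ) (hγ1 : γ < 1) {s : ℝ} (hs : 0 ≤ s) : |s * m s γ| ≤ u s γ := by
  have h1 := R.energy_nonpos hN hp hγ hγ1 hs
  have h0 := R.u_pos γ hγ s hs
  have h2 := neg_sq_div_two_le_fPrim hp h0.le
  rw [energy] at h1
  refine abs_le_of_sq_le_sq ?_ h0.le
  nlinarith

theorem u_mono (hN : 3 ≤ N) (hp : pS N < p) (R : RegularFamily N p u m h v k a) {γ : ℝ}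
    (hγ : 0 < γ) (hγ1 : γ < 1) {s t : ℝ} (hs : 0 ≤ s) (hst : s ≤ t)
    (ht : t ≤ critPoint N v k a 1 γ) : u s γ ≤ u t γ :=
  le_of_hasDerivAt_nonneg hst (slice R.cont_u γ).continuousOn (fun x _ => R.deriv_u γ x)
    (fun _ hx => (R.deriv_pos_of_lt_critPoint_one hN hp hγ hγ1 (hs.trans_lt hx.1)
      (hx.2.trans_le ht)).le)

/-- The energy of the increasing part of the solution is small. -/
theorem eventually_energy_ge (hN : 3 ≤ N) (hp : pS N < p) (R : RegularFamily N p u m h v k a)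
    {ε : ℝ} (hε : 0 < ε) : ∀ᶠ γ in 𝓝[>] (0 : ℝ), ∀ s ∈ Icc 0 (critPoint N v k a 1 γ),
      -ε ≤ energy p (u s γ) (-(s * m s γ)) := by
  have hp1 := one_lt_of_pS_lt hN hp
  have hN1 : (0 : ℝ) ≤ N - 1 := by
    have : (3 : ℝ) ≤ N := by exact_mod_cast hN
    linarith
  have hpk := one_lt_peak hp1
  -- Beyond `S` the energy loss is at most `((N-1)/S) max u' ∫ u'`, and both `u'` and the increase
  -- of `u` are at most `peak`; this costs `ε/2`.
  set S := 2 * (N - 1) * peak p ^ 2 / ε + 1 with hS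
  have hS0 : 0 < S := by positivity
  have hSε : (N - 1) / S * peak p ^ 2 ≤ ε / 2 := by
    rw [div_mul_eq_mul_div, div_le_iff₀ hS0, hS]
    have : ε / 2 * (2 * (N - 1) * peak p ^ 2 / ε + 1) = (N - 1) * peak p ^ 2 + ε / 2 := by
      field_simp
    rw [this]
    linarith
  have hlim : Tendsto (fun γ : ℝ => (γ * Real.exp S) ^ 2 / 2) (𝓝[>] 0) (𝓝 0) := by
    have : Continuous fun γ : ℝ => (γ * Real.exp S) ^ 2 / 2 := by fun_prop
    simpa using (this.tendsto 0).mono_left (nhdsWithin_le_nhds (s := Ioi 0))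
  filter_upwards [hlim.eventually (gt_mem_nhds (half_pos hε)),
    (R.tendsto_critPoint_one hN hp).eventually_gt_atTop S, Ioo_mem_nhdsGT one_pos]
    with γ h1 hSc hγ s hs
  obtain ⟨hγ0, hγ1⟩ := hγ
  have hES : -(ε / 2) ≤ energy p (u S γ) (-(S * m S γ)) := by
    have e1 := R.u_le_mul_exp hN hp hγ0 hγ1 hS0.le hSc.le
    have e2 := (R.u_pos γ hγ0 S hS0.le).le
    have e3 := neg_sq_div_two_le_fPrim hp1 e2
    have e4 : u S γ ^ 2 ≤ (γ * Real.exp S) ^ 2 := pow_le_pow_left₀ e2 e1 2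
    rw [energy]
    linarith [sq_nonneg (-(S * m S γ))]
  rcases le_total s S with h | h
  · linarith [R.energy_le hN hp1 hγ0 hs.1 h]
  -- The loss estimate in differential form: adding a multiple of `u` to the energy yields a
  -- nondecreasing function. Up to `S` the solution is tiny, which accounts for the other `ε/2`.
  · have hd : ∀ t ∈ Ioi (0 : ℝ), HasDerivAt
        (fun t => energy p (u t γ) (-(t * m t γ)) + (N - 1) / S * peak p * u t γ)
        (-(((N : ℝ) - 1) / t * (-(t * m t γ)) ^ 2) + (N - 1) / S * peak p * -(t * m t γ)) t :=
      fun t ht => ((R.radialSol hγ0).hasDerivAt_energy hp1 ht).fun_add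
        ((R.deriv_u γ t).const_mul _)
    have h2 := le_of_hasDerivAt_nonneg h
      (fun t ht => (hd t (hS0.trans_le ht.1)).continuousAt.continuousWithinAt)
      (fun t ht => hd t (hS0.trans ht.1)) (fun t ht => by
        have ht0 : 0 < t := hS0.trans ht.1
        have e1 := (R.deriv_pos_of_lt_critPoint_one hN hp hγ0 hγ1 ht0 (ht.2.trans_le hs.2)).le
        have e2 : -(t * m t γ) ≤ peak p := (neg_le_abs _).trans
          ((R.abs_mul_m_le hN hp1 hγ0 hγ1 ht0.le).trans (R.u_le_peak hp1 hγ0 hγ1 ht0.le))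
        have e3 : ((N : ℝ) - 1) / t ≤ (N - 1) / S := div_le_div_of_nonneg_left hN1 hS0 ht.1.le
        have e4 : (-(t * m t γ)) ^ 2 ≤ peak p * -(t * m t γ) := by
          rw [sq]; exact mul_le_mul_of_nonneg_right e2 e1
        have e5 := mul_le_mul e3 e4 (sq_nonneg _) (by positivity)
        linarith)
    have e1 := R.u_le_peak hp1 hγ0 hγ1 hs.1
    have e2 := R.u_pos γ hγ0 S hS0.le
    have e3 : 0 ≤ (N - 1) / S * peak p := by positivity
    have e4 : (N - 1) / S * peak p * (u s γ - u S γ) ≤ (N - 1) / S * peak p ^ 2 := by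
      rw [sq, ← mul_assoc]
      exact mul_le_mul_of_nonneg_left (by linarith) e3
    linarith

/-- At the critical point the energy is `F(u)`, which is nearly `0` and at most `0`. Since `u > 1`
there, and `F` increases on `[1,∞)` with its zero at the peak, `u` is close to the peak. -/
theorem tendsto_u_critPoint_one (hN : 3 ≤ N) (hp : pS N < p) (R : RegularFamily N p u m h v k a) :
    Tendsto (fun γ => u (critPoint N v k a 1 γ) γ) (𝓝[>] 0) (𝓝 (peak p)) := by
  have hp1 := one_lt_of_pS_lt hN hp
  have hpk := one_lt_peak hp1
  rw [tendsto_order]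
  constructor
  · intro b hb
    set b' := max b 1 with hb'
    have hb'1 : 1 ≤ b' := le_max_right _ _
    have hb'pk : b' < peak p := max_lt hb hpk
    have hF : fPrim p b' < 0 := (fPrim_neg_iff hp1 (by linarith)).2 hb'pk
    filter_upwards [R.eventually_energy_ge hN hp (by linarith : 0 < -fPrim p b' / 2),
      Ioo_mem_nhdsGT one_pos] with γ h1 hγ
    have hc := R.critPoint_pos hN hp hγ.1 le_rfl
    have h2 := h1 _ ⟨hc.le, le_rfl⟩
    rw [R.m_critPoint hN hp le_rfl hγ.1, mul_zero, neg_zero, energy] at h2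
    refine (le_max_left b 1).trans_lt ?_
    by_contra hle
    have h3 := R.one_lt_u_critPoint_one hN hp hγ.1 hγ.2
    have h4 : fPrim p (u (critPoint N v k a 1 γ) γ) ≤ fPrim p b' := by
      rcases (not_lt.1 hle).eq_or_lt with h | h
      · rw [h]
      · exact (fPrim_lt_of_lt hp1 h3.le h).le
    norm_num at h2
    linarith
  · intro b hb
    filter_upwards [Ioo_mem_nhdsGT one_pos] with γ hγ
    exact (R.u_le_peak hp1 hγ.1 hγ.2 (R.critPoint_pos hN hp hγ.1 le_rfl).le).trans_lt hb

theorem gronwall_rate_le {z q d r L e : ℝ} (hL : 0 ≤ L) (hd : |d| ≤ L * |z|) (hr : |r| ≤ e) :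
    2 * z * q + 2 * q * (-d + r) ≤ (2 + L) * (z ^ 2 + q ^ 2 + e ^ 2) := by
  have h1 := two_abs_mul_abs_le z q
  have h2 : 2 * z * q ≤ z ^ 2 + q ^ 2 := by linarith [sq_nonneg (z - q)]
  have h3 : -(q * d) ≤ |q| * (L * |z|) := by
    refine (neg_le_abs _).trans ?_
    rw [abs_mul]; gcongr
  have h5 : 2 * q * r ≤ q ^ 2 + e ^ 2 := by
    have : r ^ 2 ≤ e ^ 2 := sq_le_sq' (by linarith [neg_abs_le r]) (by linarith [le_abs_self r])
    linarith [sq_nonneg (q - r)]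
  have h4 := mul_le_mul_of_nonneg_left h1 hL
  have h6 := mul_nonneg hL (sq_nonneg e)
  linarith [sq_nonneg z, sq_nonneg e]

/-- Near the boundary point the solution and its derivative are close to the ground state. -/
theorem eventually_near_groundState (hN : 3 ≤ N) (hp : pS N < p)
    (R : RegularFamily N p u m h v k a) (Y : ℝ) {ε : ℝ} (hε : 0 < ε) :
    ∀ᶠ γ in 𝓝[>] (0 : ℝ), ∀ y ∈ Icc 0 Y,
      |u (critPoint N v k a 1 γ - y) γ - groundState p y| < ε ∧
      |(critPoint N v k a 1 γ - y) * m (critPoint N v k a 1 γ - y) γ - groundSlope p y| < ε := by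
  have hp1 := one_lt_of_pS_lt hN hp
  have hN1 : (0 : ℝ) ≤ N - 1 := by
    have : (3 : ℝ) ≤ N := by exact_mod_cast hN
    linarith
  have hpk := one_lt_peak hp1
  set L := 1 + p * peak p ^ (p - 1) with hL
  have hL0 : 0 ≤ L := by positivity
  have hc := R.tendsto_critPoint_one hN hp
  have hlim : Tendsto (fun γ => ((u (critPoint N v k a 1 γ) γ - peak p) ^ 2 +
      ((N - 1) * peak p / (critPoint N v k a 1 γ - Y)) ^ 2) * Real.exp ((2 + L) * |Y|))
      (𝓝[>] 0) (𝓝 0) := by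
    have h1 := ((R.tendsto_u_critPoint_one hN hp).sub_const (peak p)).pow 2
    have h2 := ((tendsto_atTop_add_const_right _ (-Y) hc).const_div_atTop
      (((N : ℝ) - 1) * peak p)).pow 2
    have h3 := (h1.add h2).mul_const (Real.exp ((2 + L) * |Y|))
    simpa [sub_eq_add_neg] using h3
  filter_upwards [hlim.eventually (gt_mem_nhds (pow_pos hε 2)), hc.eventually_gt_atTop Y,
    Ioo_mem_nhdsGT one_pos] with γ h1 hYc hγ y hy
  obtain ⟨hγ0, hγ1⟩ := hγ
  set c := critPoint N v k a 1 γ with hcdef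
  -- A bound for the friction on `[c-Y,c]`. The constant `e²` is added to the squared distance to
  -- make the Grönwall inequality homogeneous; it vanishes as `c → ∞`.
  set e := (N - 1) * peak p / (c - Y) with he
  have hmem : ∀ t ∈ Icc 0 Y, 0 < c - t := fun t ht => by linarith [ht.2]
  have hrev : ∀ t, HasDerivAt (fun t => c - t) (-1) t := fun t => by
    simpa using (hasDerivAt_id t).const_sub c
  have hd : ∀ t ∈ Icc 0 Y, HasDerivAt (fun t => (u (c - t) γ - groundState p t) ^ 2 +
      ((c - t) * m (c - t) γ - groundSlope p t) ^ 2 + e ^ 2)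
      (2 * (u (c - t) γ - groundState p t) * ((c - t) * m (c - t) γ - groundSlope p t) +
        2 * ((c - t) * m (c - t) γ - groundSlope p t) *
        (-(f p (u (c - t) γ) - f p (groundState p t)) + (N - 1) * m (c - t) γ)) t := fun t ht => by
    have e1 := ((R.deriv_u γ (c - t)).comp t (hrev t)).fun_sub (hasDerivAt_groundState hp1 t)
    have e2 := ((R.deriv_m γ (c - t)).comp t (hrev t)).fun_sub (hasDerivAt_groundSlope hp1 t)
    refine (((e1.fun_pow 2).fun_add (e2.fun_pow 2)).add_const (e ^ 2)).congr_deriv ?_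
    rw [R.h_eq γ hγ0 _ (hmem t ht).le]
    simp only [Function.comp]
    push_cast
    ring
  have hsub : Icc 0 y ⊆ Icc 0 Y := Icc_subset_Icc_right hy.2
  have h2 := le_mul_exp_of_deriv_le (C := 2 + L) hy.1
    (fun t ht => (hd t (hsub ht)).continuousAt.continuousWithinAt)
    (fun t ht => hd t (hsub (Ioo_subset_Icc_self ht))) (fun t ht => by
      have ht' := hsub (Ioo_subset_Icc_self ht)
      have hs := hmem t ht'
      refine gronwall_rate_le hL0 (abs_f_sub_f_le hp1
        ⟨(R.u_pos γ hγ0 _ hs.le).le, R.u_le_peak hp1 hγ0 hγ1 hs.le⟩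
        ⟨(groundState_pos hp1 t).le, ?_⟩) ?_
      · rw [← groundState_zero p]
        exact groundState_le hp1 le_rfl ht'.1
      · have e1 := (R.abs_mul_m_le hN hp1 hγ0 hγ1 hs.le).trans (R.u_le_peak hp1 hγ0 hγ1 hs.le)
        rw [abs_mul, abs_of_pos hs] at e1
        rw [abs_mul, abs_of_nonneg hN1, he, le_div_iff₀ (by linarith)]
        have e2 : |m (c - t) γ| * (c - Y) ≤ (c - t) * |m (c - t) γ| := by
          rw [mul_comm]
          gcongr
          exact ht'.2
        calc (N - 1) * |m (c - t) γ| * (c - Y) = (N - 1) * (|m (c - t) γ| * (c - Y)) := by ring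
          _ ≤ (N - 1) * peak p := by gcongr; linarith)
  simp only [sub_zero] at h2
  rw [R.m_critPoint hN hp le_rfl hγ0, groundState_zero, groundSlope_zero, mul_zero, sub_zero,
    zero_pow two_ne_zero, add_zero] at h2
  have h3 : Real.exp ((2 + L) * y) ≤ Real.exp ((2 + L) * |Y|) := by
    have := hy.2.trans (le_abs_self Y)
    gcongr
  have h4 := mul_le_mul_of_nonneg_left h3 (by positivity : 0 ≤ (u c γ - peak p) ^ 2 + e ^ 2)
  have h5 := sq_nonneg e
  constructor
  · refine abs_lt_of_sq_lt_sq ?_ hε.le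
    linarith [sq_nonneg ((c - y) * m (c - y) γ - groundSlope p y)]
  · refine abs_lt_of_sq_lt_sq ?_ hε.le
    linarith [sq_nonneg (u (c - y) γ - groundState p y)]

/-- The increasing solutions concentrate at the boundary. -/
theorem isBoundaryConcentrating (hN : 3 ≤ N) (hp : pS N < p) (R : RegularFamily N p u m h v k a) :
    IsBoundaryConcentrating p (fun γ => critPoint N v k a 1 γ ^ 2)
      (fun γ => R.profile (critPoint N v k a 1 γ) γ) := by
  have hp1 := one_lt_of_pS_lt hN hp
  refine ⟨(tendsto_pow_atTop two_ne_zero).comp (R.tendsto_critPoint_one hN hp), fun δ hδ => ?_⟩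
  -- Beyond the distance `Y` from the boundary both functions are monotone and already small at `Y`,
  -- so only a bounded window needs the Grönwall estimate.
  obtain ⟨Y, hY1, hY0⟩ := (((tendsto_groundState hp1).eventually
    (gt_mem_nhds (by positivity : 0 < δ / 3))).and (eventually_ge_atTop 0)).exists
  filter_upwards [R.eventually_near_groundState hN hp Y (by positivity : 0 < δ / 3),
    (R.tendsto_critPoint_one hN hp).eventually_gt_atTop Y, Ioo_mem_nhdsGT one_pos] with γ h1 hYc hγ r
  obtain ⟨hγ0, hγ1⟩ := hγ
  rw [R.profile_apply]
  set c := critPoint N v k a 1 γ with hc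
  have hc0 : 0 < c := hY0.trans_lt hYc
  have hy0 : 0 ≤ c * (1 - (r : ℝ)) := mul_nonneg hc0.le (by linarith [r.2.2])
  rw [Real.sqrt_sq hc0.le]
  set y := c * (1 - (r : ℝ)) with hy
  have hcr : c * (r : ℝ) = c - y := by rw [hy]; ring
  have hcy : 0 ≤ c - y := by rw [← hcr]; exact mul_nonneg hc0.le r.2.1
  rw [hcr]
  rcases le_total y Y with h | h
  · have := (h1 y ⟨hy0, h⟩).1
    linarith
  · have e1 := R.u_mono hN hp hγ0 hγ1 hcy (by linarith : c - y ≤ c - Y) (by linarith)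
    have e2 := (abs_lt.1 (h1 Y ⟨hY0, le_rfl⟩).1).2
    have e3 := groundState_le hp1 hY0 h
    have e4 := groundState_pos hp1 y
    have e5 := R.u_pos γ hγ0 _ hcy
    rw [abs_lt]
    constructor <;> linarith

end RegularFamily

end SupercriticalNeumann

end

/-! ### The linearized equation and its Wronskian with `u'` -/

open Set Filter Topology MeasureTheory

noncomputable section

namespace SupercriticalNeumann

/-- `ψ` solves the linearized equation `ψ'' + ((N-1)/s) ψ' + f'(z) ψ = 0` on `(0,c)`, with `ψ' = χ`
and `χ(0) = 0`. -/
structure LinSol (N : ℕ) (p : ℝ) (z ψ χ : ℝ → ℝ) (c : ℝ) : Prop where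
  cont_ψ : ContinuousOn ψ (Icc 0 c)
  cont_χ : ContinuousOn χ (Icc 0 c)
  χ_zero : χ 0 = 0
  deriv_ψ : ∀ s ∈ Ioo 0 c, HasDerivAt ψ (χ s) s
  deriv_χ : ∀ s ∈ Ioo 0 c, HasDerivAt χ (-(((N : ℝ) - 1) / s * χ s) - f' p (z s) * ψ s) s

theorem LinSol.neg {N : ℕ} {p : ℝ} {z ψ χ : ℝ → ℝ} {c : ℝ} (h : LinSol N p z ψ χ c) :
    LinSol N p z (fun s => -ψ s) (fun s => -χ s) c where
  cont_ψ := h.cont_ψ.neg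
  cont_χ := h.cont_χ.neg
  χ_zero := by rw [h.χ_zero, neg_zero]
  deriv_ψ s hs := (h.deriv_ψ s hs).fun_neg
  deriv_χ s hs := (h.deriv_χ s hs).fun_neg.congr_deriv (by ring)

theorem abs_f'_le {p : ℝ} (hp : 1 < p) {M x : ℝ} (hx : 0 ≤ x) (hxM : x ≤ M) :
    |f' p x| ≤ 1 + p * M ^ (p - 1) := by
  have h1 := Real.rpow_le_rpow hx hxM (by linarith : 0 ≤ p - 1)
  have h2 : p * x ^ (p - 1) ≤ p * M ^ (p - 1) := by gcongr
  have h3 : 0 ≤ p * x ^ (p - 1) := mul_nonneg (by linarith) (Real.rpow_nonneg hx _)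
  rw [f', abs_le]
  constructor <;> linarith

/-- A positive initial segment either extends to the whole interval or ends at a zero. -/
theorem exists_first_zero_of_pos {ψ : ℝ → ℝ} {b : ℝ} (hψ : ContinuousOn ψ (Icc 0 b))
    (h0 : 0 < ψ 0) {x : ℝ} (hx : x ∈ Icc 0 b) (hx0 : ψ x ≤ 0) :
    ∃ σ ∈ Ioc 0 x, ψ σ = 0 ∧ ∀ t ∈ Ico 0 σ, 0 < ψ t := by
  obtain ⟨σ, hσ, e1, e2⟩ := exists_first_zero (w := fun t => -ψ t) hx.1
    (hψ.mono (Icc_subset_Icc_right hx.2)).neg (by linarith) (by linarith)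
  exact ⟨σ, hσ, by linarith, fun t ht => by linarith [e2 t ht]⟩

/-- On a short interval the mixed boundary value problem has only the trivial solution. -/
theorem eq_zero_of_short {n L δ z c : ℝ} {ψ χ g : ℝ → ℝ} (hn : 0 ≤ n) (hL : 0 ≤ L) (hδ : 0 ≤ δ)
    (hδ1 : δ * (n + L * δ) < 1) (hz : 1 ≤ z) (hzc : z ≤ c) (hcz : c - z ≤ δ)
    (hψ : ContinuousOn ψ (Icc z c)) (hχ : ContinuousOn χ (Icc z c))
    (hdψ : ∀ s ∈ Ioo z c, HasDerivAt ψ (χ s) s)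
    (hdχ : ∀ s ∈ Ioo z c, HasDerivAt χ (-(n / s * χ s) - g s * ψ s) s)
    (hg : ∀ s ∈ Ioo z c, |g s| ≤ L) (hψz : ψ z = 0) (hχc : χ c = 0) : χ z = 0 := by
  -- With `ψ(z) = 0` and `χ(c) = 0`, integrating twice bounds the maximum `P` of `|χ|` by `δ(n +
  -- Lδ)P`, so `P = 0` on a short interval.
  obtain ⟨t, ht, hmax⟩ := isCompact_Icc.exists_isMaxOn ⟨z, left_mem_Icc.2 hzc⟩ hχ.abs
  set P := |χ t| with hP
  have hP0 : 0 ≤ P := abs_nonneg _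
  have hχP : ∀ s ∈ Icc z c, |χ s| ≤ P := fun s hs => hmax hs
  have mvt : ∀ {F F' : ℝ → ℝ} {a b C : ℝ}, a ≤ b → ContinuousOn F (Icc a b) →
      (∀ x ∈ Ioo a b, HasDerivAt F (F' x) x) → (∀ x ∈ Ioo a b, |F' x| ≤ C) →
      |F b - F a| ≤ C * (b - a) := fun {F F' a b C} hab hF hd hC => by
    have h1 := le_of_hasDerivAt_nonneg (h := fun x => C * x - F x) (h' := fun x => C * 1 - F' x) hab
      ((continuousOn_const.mul continuousOn_id).sub hF)
      (fun x hx => ((hasDerivAt_id x).const_mul C).fun_sub (hd x hx))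
      (fun x hx => by linarith [le_of_abs_le (hC x hx)])
    have h2 := le_of_hasDerivAt_nonneg (h := fun x => C * x + F x) (h' := fun x => C * 1 + F' x) hab
      ((continuousOn_const.mul continuousOn_id).add hF)
      (fun x hx => ((hasDerivAt_id x).const_mul C).fun_add (hd x hx))
      (fun x hx => by linarith [neg_le_of_abs_le (hC x hx)])
    rw [abs_le]
    constructor <;> linarith
  have hψP : ∀ s ∈ Icc z c, |ψ s| ≤ P * δ := fun s hs => by
    have h1 := mvt hs.1 (hψ.mono (Icc_subset_Icc_right hs.2))
      (fun x hx => hdψ x ⟨hx.1, hx.2.trans_le hs.2⟩)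
      (fun x hx => hχP x ⟨hx.1.le, hx.2.le.trans hs.2⟩)
    rw [hψz, sub_zero] at h1
    exact h1.trans (mul_le_mul_of_nonneg_left (by linarith [hs.2]) hP0)
  have h1 := mvt ht.2 (hχ.mono (Icc_subset_Icc_left ht.1))
    (fun x hx => hdχ x ⟨ht.1.trans_lt hx.1, hx.2⟩) (C := (n + L * δ) * P) (fun x hx => by
      have hx' : x ∈ Ioo z c := ⟨ht.1.trans_lt hx.1, hx.2⟩
      have hx0 : 1 ≤ x := hz.trans hx'.1.le
      have e1 : |n / x * χ x| ≤ n * P := by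
        rw [abs_mul, abs_of_nonneg (div_nonneg hn (by linarith))]
        exact mul_le_mul (div_le_self hn hx0) (hχP x (Ioo_subset_Icc_self hx')) (abs_nonneg _) hn
      have e2 : |g x * ψ x| ≤ L * (P * δ) := by
        rw [abs_mul]
        exact mul_le_mul (hg x hx') (hψP x (Ioo_subset_Icc_self hx')) (abs_nonneg _) hL
      rw [abs_le] at e1 e2 ⊢
      constructor <;> linarith [e1.1, e1.2, e2.1, e2.2])
  rw [hχc, zero_sub, abs_neg, ← hP] at h1
  have h2 : (n + L * δ) * P * (c - t) ≤ (n + L * δ) * P * δ :=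
    mul_le_mul_of_nonneg_left (by linarith [ht.1]) (by positivity)
  have hP' : P = 0 := by
    by_contra hne
    have hpos : 0 < P := lt_of_le_of_ne hP0 (Ne.symm hne)
    have := mul_lt_mul_of_pos_right hδ1 hpos
    linarith
  have := hχP z (left_mem_Icc.2 hzc)
  rw [hP'] at this
  exact abs_nonpos_iff.1 this

namespace RegularFamily

variable {N : ℕ} {p : ℝ} {u m h v k a : ℝ → ℝ → ℝ}

/-- The second derivative of the regular solution. -/
theorem hasDerivAt_second (hp : 1 < p) (R : RegularFamily N p u m h v k a) {γ : ℝ} (hγ : 0 < γ)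
    {s : ℝ} (hs : 0 < s) :
    HasDerivAt (fun s => -(h s γ - ((N : ℝ) - 1) * m s γ))
      (((N : ℝ) - 1) / s ^ 2 * -(s * m s γ) -
        ((N : ℝ) - 1) / s * -(h s γ - ((N : ℝ) - 1) * m s γ) - f' p (u s γ) * -(s * m s γ)) s := by
  have h1 := (hasDerivAt_f hp (u s γ)).comp s (R.deriv_u γ s)
  have h2 := ((R.deriv_m γ s).fun_div (hasDerivAt_id s) hs.ne').const_mul ((N : ℝ) - 1)
  refine ((h1.fun_sub h2).fun_neg.congr_deriv ?_).congr_of_eventuallyEq ?_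
  · simp only [id]
    field_simp
    ring
  · filter_upwards [eventually_gt_nhds hs] with t ht
    simp only [Function.comp, id]
    rw [R.h_eq γ hγ t ht.le, mul_div_cancel_left₀ _ ht.ne']

/-- While `u^{p-1} ≤ 1/4` one has `-f(u) ≥ 3u/4 ≥ 3γ/4`; integrating `(s^{N-1} u')' = -s^{N-1} f(u)`
gives the bound. It is the lower bound for `u'` that matches `u ≤ γ e^s`, so that `γ` cancels in the
ratio. -/
theorem neg_mul_m_ge (hN : 3 ≤ N) (hp : pS N < p) (R : RegularFamily N p u m h v k a) {γ : ℝ}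
    (hγ : 0 < γ) (hγ1 : γ < 1) {s : ℝ} (hs : 0 < s) (hsc : s ≤ critPoint N v k a 1 γ)
    (hu : u s γ ^ (p - 1) ≤ 1 / 4) : 3 / 4 * γ * s / N ≤ -(s * m s γ) := by
  have hN0 : (0 : ℝ) < N := by exact_mod_cast (by omega : 0 < N)
  have hp1 := one_lt_of_pS_lt hN hp
  have hd := fun t : ℝ => ((R.hasDerivAt_pow_mul hN γ t).fun_neg).fun_sub
    ((hasDerivAt_pow N t).const_mul (3 / 4 * γ / N))
  have h1 := le_of_hasDerivAt_nonneg hs.le (fun t _ => (hd t).continuousAt.continuousWithinAt)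
    (fun t _ => hd t) (fun t ht => by
      have e1 := R.u_mono hN hp hγ hγ1 le_rfl ht.1.le (ht.2.le.trans hsc)
      rw [R.u_zero] at e1
      have e2 := R.u_mono hN hp hγ hγ1 ht.1.le ht.2.le hsc
      have e0 := R.u_pos γ hγ t ht.1.le
      have e3 : u t γ ^ (p - 1) ≤ 1 / 4 :=
        (Real.rpow_le_rpow e0.le e2 (by linarith)).trans hu
      have e4 : h t γ ≤ -(3 / 4 * γ) := by
        rw [R.h_eq γ hγ t ht.1.le, f_eq_mul e0]
        nlinarith
      have e5 : 0 < t ^ (N - 1) := pow_pos ht.1 _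
      have e6 := mul_le_mul_of_nonneg_left e4 e5.le
      have e7 : 3 / 4 * γ / N * (N * t ^ (N - 1)) = 3 / 4 * γ * t ^ (N - 1) := by field_simp
      rw [e7]
      linarith)
  have hs' : 0 < s ^ (N - 1) := pow_pos hs _
  have e : s ^ N = s ^ (N - 1) * s := by rw [← pow_succ]; congr 1; omega
  have hN0' : N ≠ 0 := by omega
  simp only [zero_pow hN0', mul_zero, zero_mul, sub_zero, e, neg_zero] at h1
  refine le_of_mul_le_mul_left ?_ hs'
  have : s ^ (N - 1) * (3 / 4 * γ * s / N) = 3 / 4 * γ / N * (s ^ (N - 1) * s) := by ring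
  rw [this]
  linarith

variable {ψ χ : ℝ → ℝ} {γ : ℝ}

/-- The Wronskian of `ψ` and `u'` has a sign as long as `ψ` is positive. -/
theorem wronskian_pos (hN : 3 ≤ N) (hp : pS N < p) (R : RegularFamily N p u m h v k a)
    (hγ : 0 < γ) (hγ1 : γ < 1)
    (hψ : LinSol N p (fun s => u s γ) ψ χ (critPoint N v k a 1 γ)) {b : ℝ} (hb : 0 < b)
    (hbc : b ≤ critPoint N v k a 1 γ) (hpos : ∀ t ∈ Ioo 0 b, 0 < ψ t) :
    0 < ψ b * -(h b γ - ((N : ℝ) - 1) * m b γ) - χ b * -(b * m b γ) := by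
  have hp1 := one_lt_of_pS_lt hN hp
  have hN1 : (0 : ℝ) < N - 1 := by
    have : (3 : ℝ) ≤ N := by exact_mod_cast hN
    linarith
  have cu := slice R.cont_u γ
  have cm := slice R.cont_m γ
  have ch := slice R.cont_h γ
  have hsub : Icc 0 b ⊆ Icc 0 (critPoint N v k a 1 γ) := Icc_subset_Icc_right hbc
  have cψ := hψ.cont_ψ.mono hsub
  have cχ := hψ.cont_χ.mono hsub
  -- Differentiating the equation shows that `u'` solves the linearized equation up to the term
  -- `((N-1)/s²) u'`. Hence `(s^{N-1} g)' = s^{N-1} ((N-1)/s²) ψ u' > 0` for the Wronskian `g = ψ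
  -- u'' - χ u'`.
  have h1 := lt_of_hasDerivAt_pos (h := fun s => s ^ (N - 1) *
      (ψ s * -(h s γ - ((N : ℝ) - 1) * m s γ) - χ s * -(s * m s γ)))
    (h' := fun s => s ^ (N - 1) * (((N : ℝ) - 1) / s ^ 2 * (ψ s * -(s * m s γ)))) hb (by
      refine (continuousOn_pow _).mul ((cψ.mul ?_).sub (cχ.mul ?_))
      · exact ((ch.sub (continuous_const.mul cm)).neg).continuousOn
      · exact ((continuous_id.mul cm).neg).continuousOn)
    (fun s hs => by
      have hs' : s ∈ Ioo 0 (critPoint N v k a 1 γ) := ⟨hs.1, hs.2.trans_le hbc⟩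
      refine ((hasDerivAt_pow (N - 1) s).fun_mul (((hψ.deriv_ψ s hs').fun_mul
        (R.hasDerivAt_second hp1 hγ hs.1)).fun_sub ((hψ.deriv_χ s hs').fun_mul
        (R.deriv_m γ s).fun_neg))).congr_deriv ?_
      obtain ⟨n, rfl⟩ : ∃ n, N = n + 2 := ⟨N - 2, by omega⟩
      have := hs.1.ne'
      simp only [Nat.add_succ_sub_one]
      push_cast
      field_simp
      ring)
    (fun s hs => by
      have e1 := R.deriv_pos_of_lt_critPoint_one hN hp hγ hγ1 hs.1 (hs.2.trans_le hbc)
      have e2 := hpos s hs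
      have e3 := hs.1
      positivity)
  have hN0 : N - 1 ≠ 0 := by omega
  simp only [zero_pow hN0, zero_mul] at h1
  exact pos_of_mul_pos_right h1 (pow_nonneg hb.le _)

/-- Where `f'(u) ≤ 0`, the linearized solution is positive and nondecreasing. -/
theorem linSol_pos (hN : 3 ≤ N) {z : ℝ → ℝ} {c : ℝ} (hψ : LinSol N p z ψ χ c) (h0 : 0 < ψ 0) {b : ℝ}
    (hbc : b ≤ c) (hf : ∀ s ∈ Ioo 0 b, f' p (z s) ≤ 0) : ∀ s ∈ Icc 0 b, 0 < ψ s ∧ 0 ≤ χ s := by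
  have hsub : Icc 0 b ⊆ Icc 0 c := Icc_subset_Icc_right hbc
  have hχ : ∀ s ∈ Icc 0 b, (∀ t ∈ Ioo 0 s, 0 < ψ t) → 0 ≤ χ s := fun s hs hpos => by
    have hsub' : Icc 0 s ⊆ Icc 0 c := (Icc_subset_Icc_right hs.2).trans hsub
    have h1 := le_of_hasDerivAt_nonneg (h := fun s => s ^ (N - 1) * χ s)
      (h' := fun s => s ^ (N - 1) * (-f' p (z s) * ψ s)) hs.1
      ((continuousOn_pow _).mul (hψ.cont_χ.mono hsub')) (fun t ht => by
        refine ((hasDerivAt_pow (N - 1) t).fun_mul (hψ.deriv_χ t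
          ⟨ht.1, ht.2.trans_le (hs.2.trans hbc)⟩)).congr_deriv ?_
        obtain ⟨n, rfl⟩ : ∃ n, N = n + 2 := ⟨N - 2, by omega⟩
        have := ht.1.ne'
        simp only [Nat.add_succ_sub_one]
        push_cast
        field_simp
        ring)
      (fun t ht => mul_nonneg (pow_nonneg ht.1.le _) (mul_nonneg
        (by linarith [hf t ⟨ht.1, ht.2.trans_le hs.2⟩]) (hpos t ht).le))
    rcases hs.1.eq_or_lt with e | e
    · rw [← e, hψ.χ_zero]
    · simp only [hψ.χ_zero, mul_zero] at h1
      exact nonneg_of_mul_nonneg_right h1 (pow_pos e _)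
  have hpos : ∀ s ∈ Icc 0 b, 0 < ψ s := fun s hs => by
    by_contra hle
    obtain ⟨σ, hσ, e1, e2⟩ := exists_first_zero_of_pos (hψ.cont_ψ.mono hsub) h0 hs (not_lt.1 hle)
    have hσb : σ ≤ b := hσ.2.trans hs.2
    have h1 := le_of_hasDerivAt_nonneg hσ.1.le
      (hψ.cont_ψ.mono ((Icc_subset_Icc_right hσb).trans hsub))
      (fun t ht => hψ.deriv_ψ t ⟨ht.1, ht.2.trans_le (hσb.trans hbc)⟩)
      (fun t ht => hχ t ⟨ht.1.le, ht.2.le.trans hσb⟩ fun r hr => e2 r ⟨hr.1.le, hr.2.trans ht.2⟩)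
    linarith
  exact fun s hs => ⟨hpos s hs, hχ s hs fun t ht => hpos t ⟨ht.1.le, ht.2.le.trans hs.2⟩⟩

/-- While `u` is small, `ψ` becomes almost parallel to `u'`. -/
theorem wronskian_le (hN : 3 ≤ N) (hp : pS N < p) (R : RegularFamily N p u m h v k a)
    (hγ : 0 < γ) (hγ1 : γ < 1)
    (hψ : LinSol N p (fun s => u s γ) ψ χ (critPoint N v k a 1 γ)) (h0 : 0 < ψ 0) {s₁ b : ℝ}
    (hs₁ : 4 * ((N : ℝ) - 1) ≤ s₁) (hs₁b : s₁ ≤ b) (hbc : b < critPoint N v k a 1 γ)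
    (hu : p * u b γ ^ (p - 1) ≤ 1 / 4) :
    ψ b * -(h b γ - ((N : ℝ) - 1) * m b γ) - χ b * -(b * m b γ) ≤
      (2 * (N - 1) / s₁ ^ 2 + 4 * N * Real.exp s₁ / (3 * s₁) * Real.exp (-(1 / 2 * (b - s₁)))) *
        (ψ b * -(b * m b γ)) := by
  have hp1 := one_lt_of_pS_lt hN hp
  have hN3 : (3 : ℝ) ≤ N := by exact_mod_cast hN
  have hN1 : (0 : ℝ) < N - 1 := by linarith
  have hs₁0 : 0 < s₁ := by linarith
  set c := critPoint N v k a 1 γ with hc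
  have hupow : ∀ s ∈ Icc 0 b, p * u s γ ^ (p - 1) ≤ 1 / 4 := fun s hs => by
    have e1 := R.u_mono hN hp hγ hγ1 hs.1 hs.2 hbc.le
    have e2 := Real.rpow_le_rpow (R.u_pos γ hγ s hs.1).le e1 (by linarith : 0 ≤ p - 1)
    have e3 : p * u s γ ^ (p - 1) ≤ p * u b γ ^ (p - 1) := by gcongr
    linarith
  have hupow' : ∀ s ∈ Icc 0 b, u s γ ^ (p - 1) ≤ 1 / 4 := fun s hs => by
    have e1 := hupow s hs
    have e2 := Real.rpow_nonneg (R.u_pos γ hγ s hs.1).le (p - 1)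
    nlinarith
  have hpos := linSol_pos hN hψ h0 hbc.le (fun s hs => by
    have := hupow s (Ioo_subset_Icc_self hs)
    rw [f']
    linarith)
  have hw : ∀ s ∈ Icc s₁ b, 0 < -(s * m s γ) := fun s hs =>
    R.deriv_pos_of_lt_critPoint_one hN hp hγ hγ1 (hs₁0.trans_le hs.1) (hs.2.trans_lt hbc)
  have hmem : ∀ s ∈ Icc s₁ b, s ∈ Icc 0 b := fun s hs => ⟨hs₁0.le.trans hs.1, hs.2⟩
  -- The difference `u''/u' - χ/ψ` of logarithmic derivatives is the Wronskian over `ψ u'`. It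
  -- solves a scalar linear equation with source `(N-1)/s²` and damping at least `1/2`, hence decays
  -- to the order `1/s₁²`.
  set E : ℝ → ℝ := fun s => -(h s γ - ((N : ℝ) - 1) * m s γ) / -(s * m s γ) - χ s / ψ s with hE
  have hd : ∀ s ∈ Icc s₁ b, HasDerivAt (fun s => E s - 2 * (N - 1) / s₁ ^ 2)
      ((N - 1) / s ^ 2 - ((N - 1) / s + -(h s γ - ((N : ℝ) - 1) * m s γ) / -(s * m s γ) +
        χ s / ψ s) * E s) s := fun s hs => by
    have hs0 : 0 < s := hs₁0.trans_le hs.1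
    have hsc : s ∈ Ioo 0 c := ⟨hs0, hs.2.trans_lt hbc⟩
    have hw' := (hw s hs).ne'
    have hψ' := (hpos s (hmem s hs)).1.ne'
    refine ((((R.hasDerivAt_second hp1 hγ hs0).fun_div (R.deriv_m γ s).fun_neg hw').fun_sub
      ((hψ.deriv_χ s hsc).fun_div (hψ.deriv_ψ s hsc) hψ')).sub_const _).congr_deriv ?_
    simp only [hE]
    generalize f' p (u s γ) = F
    generalize -(h s γ - ((N : ℝ) - 1) * m s γ) = D
    generalize -(s * m s γ) = w at *
    field_simp
    ring
  -- While `u` is small, `u'' = -f(u) - ((N-1)/s) u' ≥ 3u/4 - u'/4`, and `u' ≤ u` by the energy; the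
  -- condition `s ≥ 4(N-1)` bounds the friction.
  have hRu : ∀ s ∈ Icc s₁ b, 1 / 2 ≤ -(h s γ - ((N : ℝ) - 1) * m s γ) / -(s * m s γ) := fun s hs => by
    have hs0 : 0 < s := hs₁0.trans_le hs.1
    have hw' := hw s hs
    have hu0 := R.u_pos γ hγ s hs0.le
    have e1 := hupow' s (hmem s hs)
    have e2 : -(s * m s γ) ≤ u s γ := (neg_le_abs _).trans (R.abs_mul_m_le hN hp1 hγ hγ1 hs0.le)
    have e3 : h s γ ≤ -(3 / 4 * u s γ) := by
      rw [R.h_eq γ hγ s hs0.le, f_eq_mul hu0]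
      have := mul_le_mul_of_nonneg_left e1 hu0.le
      linarith
    have e4 : -(((N : ℝ) - 1) * m s γ) ≤ 1 / 4 * -(s * m s γ) := by
      have hm : 0 ≤ -m s γ := by
        by_contra hneg
        have := mul_neg_of_pos_of_neg hs0 (not_le.1 hneg)
        linarith
      have := mul_le_mul_of_nonneg_right (hs₁.trans hs.1) hm
      linarith
    rw [le_div_iff₀ hw']
    linarith
  have hE0 : ∀ s ∈ Icc s₁ b, 0 ≤ E s := fun s hs => by
    have hs0 : 0 < s := hs₁0.trans_le hs.1
    have e1 := R.wronskian_pos hN hp hγ hγ1 hψ hs0 (hs.2.trans hbc.le)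
      (fun t ht => (hpos t ⟨ht.1.le, ht.2.le.trans hs.2⟩).1)
    have e2 := hw s hs
    have e3 := (hpos s (hmem s hs)).1
    simp only [hE]
    rw [div_sub_div _ _ e2.ne' e3.ne']
    refine div_nonneg ?_ (by positivity)
    linarith
  have hdec := le_mul_exp_of_deriv_le (C := -(1 / 2)) hs₁b
    (fun s hs => (hd s hs).continuousAt.continuousWithinAt)
    (fun s hs => hd s (Ioo_subset_Icc_self hs)) (fun s hs => by
      have hs' := Ioo_subset_Icc_self hs
      have hs0 : 0 < s := hs₁0.trans hs.1
      have e1 := hRu s hs'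
      have e2 := hE0 s hs'
      have e3 : 0 ≤ χ s / ψ s := div_nonneg (hpos s (hmem s hs')).2 (hpos s (hmem s hs')).1.le
      have e4 : (0 : ℝ) ≤ (N - 1) / s := by positivity
      have e5 : ((N : ℝ) - 1) / s ^ 2 ≤ (N - 1) / s₁ ^ 2 := by
        have := hs.1.le
        gcongr
      have e6 : 1 / 2 * E s ≤ ((N - 1) / s + -(h s γ - ((N : ℝ) - 1) * m s γ) / -(s * m s γ) +
        χ s / ψ s) * E s := mul_le_mul_of_nonneg_right (by linarith) e2
      have e7 : -(1 / 2) * (E s - 2 * (N - 1) / s₁ ^ 2) = (N - 1) / s₁ ^ 2 - 1 / 2 * E s := by ring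
      rw [e7]
      linarith)
  have hs₁m : s₁ ∈ Icc s₁ b := ⟨le_rfl, hs₁b⟩
  have hbm : b ∈ Icc s₁ b := ⟨hs₁b, le_rfl⟩
  -- The initial value is bounded independently of `γ`: numerator and denominator of `u''/u'` are
  -- both of order `γ`.
  have hEs : E s₁ ≤ 4 * N * Real.exp s₁ / (3 * s₁) := by
    have e1 : 0 ≤ χ s₁ / ψ s₁ :=
      div_nonneg (hpos _ (hmem _ hs₁m)).2 (hpos _ (hmem _ hs₁m)).1.le
    have e2 := hw s₁ hs₁m
    have e3 := R.neg_mul_m_ge hN hp hγ hγ1 hs₁0 (hs₁b.trans hbc.le) (hupow' _ (hmem _ hs₁m))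
    have e4 := R.u_le_mul_exp hN hp hγ hγ1 hs₁0.le (hs₁b.trans hbc.le)
    have e5 : -(h s₁ γ - ((N : ℝ) - 1) * m s₁ γ) ≤ u s₁ γ := by
      rw [R.h_eq γ hγ s₁ hs₁0.le, f]
      have hm : m s₁ γ ≤ 0 := by
        by_contra hneg
        have := mul_pos hs₁0 (not_le.1 hneg)
        linarith
      have := mul_nonpos_of_nonneg_of_nonpos hN1.le hm
      have := Real.rpow_nonneg (R.u_pos γ hγ s₁ hs₁0.le).le p
      linarith
    have e6 : -(h s₁ γ - ((N : ℝ) - 1) * m s₁ γ) / -(s₁ * m s₁ γ) ≤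
        4 * N * Real.exp s₁ / (3 * s₁) := by
      rw [div_le_iff₀ e2]
      have e7 : 4 * N * Real.exp s₁ / (3 * s₁) * (3 / 4 * γ * s₁ / N) = γ * Real.exp s₁ := by
        field_simp
      have e8 := mul_le_mul_of_nonneg_left e3 (by positivity :
        0 ≤ 4 * N * Real.exp s₁ / (3 * s₁))
      linarith
    simp only [hE]
    linarith
  have hEb : E b ≤ 2 * (N - 1) / s₁ ^ 2 +
      4 * N * Real.exp s₁ / (3 * s₁) * Real.exp (-(1 / 2 * (b - s₁))) := by
    have e1 : (E s₁ - 2 * (N - 1) / s₁ ^ 2) * Real.exp (-(1 / 2) * (b - s₁)) ≤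
        4 * N * Real.exp s₁ / (3 * s₁) * Real.exp (-(1 / 2 * (b - s₁))) := by
      rw [neg_mul]
      have : 0 ≤ 2 * ((N : ℝ) - 1) / s₁ ^ 2 := by positivity
      gcongr
      linarith
    linarith
  have e2 := hw b hbm
  have e3 := (hpos b (hmem b hbm)).1
  have e4 : ψ b * -(h b γ - ((N : ℝ) - 1) * m b γ) - χ b * -(b * m b γ) =
      E b * (ψ b * -(b * m b γ)) := by
    have e2' := e2.ne'
    simp only [hE]
    generalize -(h b γ - ((N : ℝ) - 1) * m b γ) = D at *
    generalize -(b * m b γ) = w at *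
    field_simp
  rw [e4]
  exact mul_le_mul_of_nonneg_right hEb (by positivity)

end RegularFamily

end SupercriticalNeumann

end

/-! ### Nondegeneracy for small `γ` -/

open Set Filter Topology MeasureTheory

noncomputable section

namespace SupercriticalNeumann

/-- If the Wronskian `g` of `ψ` and `w` is small at `b`, then `ψ` stays positive up to `z`. -/
theorem pos_of_wronskian_le {n b z μ P ε : ℝ} {ψ w g : ℝ → ℝ} (hn : 0 ≤ n) (hb : 0 < b)
    (hbz : b ≤ z) (hμ : 0 < μ) (hε : 0 ≤ ε)
    (hρ : ∀ s ∈ Icc b z, HasDerivAt (fun s => ψ s / w s) (-(g s / w s ^ 2)) s)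
    (hg : ∀ s ∈ Icc b z, HasDerivAt g (n / s ^ 2 * (ψ s * w s) - n / s * g s) s)
    (hg0 : ∀ s ∈ Icc b z, 0 ≤ g s) (hw : ∀ s ∈ Icc b z, μ ≤ w s ∧ w s ≤ P)
    (hψ : 0 < ψ b) (hgb : g b ≤ ε * (ψ b * w b))
    (hK : P ^ 2 * (ε + n * (z - b) / b ^ 2) * (z - b) < μ ^ 2) : 0 < ψ z := by
  have hw0 : ∀ s ∈ Icc b z, 0 < w s := fun s hs => hμ.trans_le (hw s hs).1
  have hbm : b ∈ Icc b z := left_mem_Icc.2 hbz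
  have hzm : z ∈ Icc b z := right_mem_Icc.2 hbz
  set ρ := ψ b / w b with hρdef
  have hρ0 : 0 < ρ := div_pos hψ (hw0 b hbm)
  have hww : ∀ s ∈ Icc b z, w s ^ 2 ≤ P ^ 2 := fun s hs =>
    pow_le_pow_left₀ (hw0 s hs).le (hw s hs).2 2
  -- The ratio `ψ/w` decreases with speed `g/w²`, so it stays below its initial value `ρ`; this
  -- bounds the source in the equation for `g`, and then `g` itself by `ρK`.
  have hle : ∀ s ∈ Icc b z, ψ s * w s ≤ ρ * P ^ 2 := fun s hs => by
    have hsub : Icc b s ⊆ Icc b z := Icc_subset_Icc_right hs.2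
    have h1 := le_of_hasDerivAt_nonneg hs.1
      (fun t ht => (hρ t (hsub ht)).fun_neg.continuousAt.continuousWithinAt)
      (fun t ht => (hρ t (hsub (Ioo_subset_Icc_self ht))).fun_neg)
      (fun t ht => by
        rw [neg_neg]
        exact div_nonneg (hg0 t (hsub (Ioo_subset_Icc_self ht))) (sq_nonneg _))
    have h2 : ψ s / w s ≤ ρ := by linarith
    have h3 : ψ s * w s = ψ s / w s * w s ^ 2 := by
      have := (hw0 s hs).ne'
      field_simp
    rw [h3]
    exact (mul_le_mul_of_nonneg_right h2 (sq_nonneg _)).trans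
      (mul_le_mul_of_nonneg_left (hww s hs) hρ0.le)
  set K := P ^ 2 * (ε + n * (z - b) / b ^ 2) with hKdef
  have hgK : ∀ s ∈ Icc b z, g s ≤ ρ * K := fun s hs => by
    have hsub : Icc b s ⊆ Icc b z := Icc_subset_Icc_right hs.2
    have hd := fun t (ht : t ∈ Icc b s) =>
      ((hasDerivAt_id t).const_mul (n / b ^ 2 * (ρ * P ^ 2))).fun_sub (hg t (hsub ht))
    have h1 := le_of_hasDerivAt_nonneg hs.1
      (fun t ht => (hd t ht).continuousAt.continuousWithinAt)
      (fun t ht => hd t (Ioo_subset_Icc_self ht)) (fun t ht => by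
        have htm := hsub (Ioo_subset_Icc_self ht)
        have ht0 : 0 < t := hb.trans ht.1
        have e1 : 0 ≤ n / t * g t := mul_nonneg (div_nonneg hn ht0.le) (hg0 t htm)
        have e2 : n / t ^ 2 * (ψ t * w t) ≤ n / t ^ 2 * (ρ * P ^ 2) :=
          mul_le_mul_of_nonneg_left (hle t htm) (by positivity)
        have e3 : n / t ^ 2 * (ρ * P ^ 2) ≤ n / b ^ 2 * (ρ * P ^ 2) := by
          have := ht.1.le
          gcongr
        linarith)
    simp only [id] at h1
    have e1 : ε * (ψ b * w b) ≤ ε * (ρ * P ^ 2) := mul_le_mul_of_nonneg_left (hle b hbm) hε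
    have e2 : n / b ^ 2 * (ρ * P ^ 2) * (s - b) ≤ n / b ^ 2 * (ρ * P ^ 2) * (z - b) :=
      mul_le_mul_of_nonneg_left (by linarith [hs.2]) (by positivity)
    have e3 : ρ * K = ε * (ρ * P ^ 2) + n / b ^ 2 * (ρ * P ^ 2) * (z - b) := by
      rw [hKdef]; ring
    linarith
  have hd := fun t (ht : t ∈ Icc b z) =>
    ((hasDerivAt_id t).const_mul (ρ * K / μ ^ 2)).fun_add (hρ t ht)
  have h1 := le_of_hasDerivAt_nonneg hbz (fun t ht => (hd t ht).continuousAt.continuousWithinAt)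
    (fun t ht => hd t (Ioo_subset_Icc_self ht)) (fun t ht => by
      have htm := Ioo_subset_Icc_self ht
      have e1 : g t / w t ^ 2 ≤ ρ * K / μ ^ 2 :=
        div_le_div₀ ((hg0 t htm).trans (hgK t htm)) (hgK t htm) (by positivity)
          (pow_le_pow_left₀ hμ.le (hw t htm).1 2)
      linarith)
  simp only [id] at h1
  -- The total decrease of `ψ/w` is smaller than its initial value.
  have h2 : ρ * K / μ ^ 2 * (z - b) < ρ := by
    rw [div_mul_eq_mul_div, div_lt_iff₀ (by positivity), mul_assoc]
    exact mul_lt_mul_of_pos_left hK hρ0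
  have h3 : 0 < ψ z / w z := by linarith
  exact (div_pos_iff_of_pos_right (hw0 z hzm)).1 h3

namespace RegularFamily

variable {N : ℕ} {p : ℝ} {u m h v k a : ℝ → ℝ → ℝ}

/-- For small `γ`, the linearization along `u(·,γ)` has no nontrivial solution that satisfies the
Neumann condition at the first critical point. -/
theorem eventually_linSol_ne (hN : 3 ≤ N) (hp : pS N < p) (R : RegularFamily N p u m h v k a) :
    ∀ᶠ γ in 𝓝[>] (0 : ℝ), ∀ ψ χ : ℝ → ℝ,
      LinSol N p (fun s => u s γ) ψ χ (critPoint N v k a 1 γ) → 0 < ψ 0 →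
        χ (critPoint N v k a 1 γ) ≠ 0 := by
  have hp1 := one_lt_of_pS_lt hN hp
  have hp0 : 0 < p - 1 := by linarith
  have hN3 : (3 : ℝ) ≤ N := by exact_mod_cast hN
  set P := peak p with hP
  have hP1 : 1 < P := one_lt_peak hp1
  set n : ℝ := (N : ℝ) - 1 with hn
  have hn0 : 0 < n := by linarith
  set L : ℝ := 1 + p * P ^ (p - 1) with hL
  have hL0 : 0 < L := by positivity
  -- The length on which the mixed boundary value problem has only the zero solution; `L` bounds
  -- `f'` on `[0, peak]` in absolute value.
  set δ : ℝ := 1 / (2 * (N + L)) with hδ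
  have hδ0 : 0 < δ := by positivity
  have hδN : δ * (N + L) = 1 / 2 := by rw [hδ]; field_simp
  have hδ1 : δ ≤ 1 := by nlinarith
  have hδs : δ * (n + L * δ) < 1 := by
    have e1 : L * δ ≤ L := mul_le_of_le_one_right hL0.le hδ1
    have e2 : δ * (n + L * δ) ≤ δ * (N + L) := mul_le_mul_of_nonneg_left (by linarith) hδ0.le
    linarith
  -- The threshold `p u₀^{p-1} = 1/4`, below which `f'(u) ≤ -3/4`.
  set u₀ : ℝ := (1 / (4 * p)) ^ (1 / (p - 1)) with hu₀
  have hu₀0 : 0 < u₀ := by positivity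
  have hu₀p : u₀ ^ (p - 1) = 1 / (4 * p) := by
    rw [hu₀, ← Real.rpow_mul (by positivity), one_div_mul_cancel hp0.ne', Real.rpow_one]
  obtain ⟨Y, hY, hY1⟩ := ((((tendsto_groundState hp1).eventually
    (eventually_lt_nhds (show 0 < u₀ / 2 by linarith)))).and (eventually_ge_atTop 1)).exists
  obtain ⟨y₀, hy₀, hmin⟩ := isCompact_Icc.exists_isMinOn ⟨δ, left_mem_Icc.2 (hδ1.trans hY1)⟩
    (continuous_groundSlope hp1).neg.continuousOn
  -- Half of the minimal steepness of the ground state on `[δ,Y]`: a lower bound for `u'` there once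
  -- `u` follows the ground state.
  set μ : ℝ := -groundSlope p y₀ / 2 with hμ
  have hμ0 : 0 < μ := by
    have := groundSlope_neg hp1 (hδ0.trans_le hy₀.1)
    linarith
  -- Chosen so that `P² · 2ε · Y = μ²/2`, strictly below the threshold `μ²` of
  -- `pos_of_wronskian_le`.
  set ε : ℝ := μ ^ 2 / (4 * Y * P ^ 2) with hε
  have hε0 : 0 < ε := by positivity
  set s₁ : ℝ := 4 * n + 4 * n / ε + 1 with hs₁
  have hq0 : 0 < 4 * n / ε := by positivity
  have hs₁1 : 1 ≤ s₁ := by linarith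
  have hs₁2 : 2 * n / s₁ ^ 2 ≤ ε / 2 := by
    have e1 : 4 * n / ε ≤ s₁ ^ 2 := by nlinarith
    rw [div_le_iff₀ hε0] at e1
    rw [div_le_iff₀ (by positivity)]
    linarith
  set C : ℝ := 4 * N * Real.exp s₁ / (3 * s₁) with hC
  have hlim1 : Tendsto (fun b : ℝ => C * Real.exp (-(1 / 2 * (b - s₁)))) atTop (𝓝 0) := by
    have : Tendsto (fun b : ℝ => Real.exp (-(1 / 2 * (b - s₁)))) atTop (𝓝 0) :=
      Real.tendsto_exp_neg_atTop_nhds_zero.comp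
        ((tendsto_atTop_add_const_right _ (-s₁) tendsto_id).const_mul_atTop
          (show (0 : ℝ) < 1 / 2 by norm_num))
    simpa using this.const_mul C
  have hlim2 : Tendsto (fun b : ℝ => n * Y / b ^ 2) atTop (𝓝 0) :=
    Tendsto.div_atTop tendsto_const_nhds (tendsto_pow_atTop two_ne_zero)
  have hbt : Tendsto (fun γ => critPoint N v k a 1 γ - Y) (𝓝[>] 0) atTop :=
    tendsto_atTop_add_const_right _ (-Y) (R.tendsto_critPoint_one hN hp)
  filter_upwards [Ioo_mem_nhdsGT (zero_lt_one (α := ℝ)),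
    R.eventually_near_groundState hN hp Y (lt_min (half_pos hu₀0) hμ0),
    hbt.eventually (hlim1.eventually (eventually_lt_nhds (half_pos hε0))),
    hbt.eventually (hlim2.eventually (eventually_lt_nhds hε0)),
    hbt.eventually (eventually_ge_atTop s₁)] with γ hγ hnear hb1 hb2 hb3 ψ χ hψ hψ0 hχc
  set c := critPoint N v k a 1 γ with hc
  set b := c - Y with hb
  have hb0 : 0 < b := by linarith
  have hbc : b < c := by linarith
  have hc0 : 0 < c := hb0.trans hbc
  have hub : p * u b γ ^ (p - 1) ≤ 1 / 4 := by
    have e1 := (hnear Y ⟨by linarith, le_rfl⟩).1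
    have e2 : u b γ ≤ u₀ := by
      have := (abs_lt.1 (e1.trans_le (min_le_left _ _))).2
      linarith
    have e3 := Real.rpow_le_rpow (R.u_pos γ hγ.1 b hb0.le).le e2 hp0.le
    rw [hu₀p] at e3
    calc p * u b γ ^ (p - 1) ≤ p * (1 / (4 * p)) := by gcongr
      _ = 1 / 4 := by field_simp
  have hfb : ∀ s ∈ Ioo 0 b, f' p (u s γ) ≤ 0 := fun s hs => by
    have e1 := R.u_mono hN hp hγ.1 hγ.2 hs.1.le hs.2.le hbc.le
    have e2 := f'_mono hp1 (R.u_pos γ hγ.1 s hs.1.le).le e1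
    have e3 : f' p (u b γ) ≤ 0 := by rw [f']; linarith
    exact e2.trans e3
  have hposb := linSol_pos hN hψ hψ0 hbc.le hfb
  have hgb := R.wronskian_le hN hp hγ.1 hγ.2 hψ hψ0 (by linarith) hb3 hbc hub
  have hf'L : ∀ s ∈ Ioo 0 c, |f' p (u s γ)| ≤ L := fun s hs =>
    abs_f'_le hp1 (R.u_pos γ hγ.1 s hs.1.le).le (R.u_le_peak hp1 hγ.1 hγ.2 hs.1.le)
  -- If `ψ` has no zero before `c`, the Wronskian at `c` equals `-ψ(c) f(u(c)) ≤ 0` because `u(c) >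
  -- 1`; but it must be positive.
  by_cases hall : ∀ x ∈ Ioo 0 c, 0 < ψ x
  · have e1 := R.wronskian_pos hN hp hγ.1 hγ.2 hψ hc0 le_rfl hall
    rw [hχc, R.m_critPoint hN hp le_rfl hγ.1, R.h_eq γ hγ.1 c hc0.le] at e1
    have e2 := f_pos hp1 (R.one_lt_u_critPoint_one hN hp hγ.1 hγ.2)
    have e3 : 0 ≤ ψ c := by
      by_contra hneg
      obtain ⟨σ, hσ, e4, -⟩ := exists_first_zero_of_pos hψ.cont_ψ hψ0 (right_mem_Icc.2 hc0.le)
        (not_le.1 hneg).le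
      rcases hσ.2.eq_or_lt with rfl | hlt
      · exact hneg e4.ge
      · exact (hall σ ⟨hσ.1, hlt⟩).ne' e4
    have := mul_nonneg e3 e2.le
    simp only [mul_zero, sub_zero, neg_zero] at e1
    linarith
  push Not at hall
  obtain ⟨x, hx, hx0⟩ := hall
  obtain ⟨z, hz, hz0, hzpos⟩ := exists_first_zero_of_pos hψ.cont_ψ hψ0 (Ioo_subset_Icc_self hx) hx0
  have hzc : z < c := hz.2.trans_lt hx.2
  have hbz : b < z := by
    by_contra hle
    exact (hposb z ⟨hz.1.le, not_lt.1 hle⟩).1.ne' hz0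
  -- The first zero lies beyond `b`. If it is at distance at least `δ` from `c`, the small Wronskian
  -- and the lower bound on `u'` exclude it.
  rcases le_or_gt z (c - δ) with hzδ | hzδ
  · have hmem : ∀ s ∈ Icc b z, s ∈ Ioo 0 c := fun s hs => ⟨hb0.trans_le hs.1, hs.2.trans_lt hzc⟩
    have hw : ∀ s ∈ Icc b z, μ ≤ -(s * m s γ) ∧ -(s * m s γ) ≤ P := fun s hs => by
      have hs0 := (hmem s hs).1
      refine ⟨?_, ?_⟩
      · have e1 := (hnear (c - s) ⟨by linarith [hs.2], by linarith [hs.1]⟩).2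
        rw [sub_sub_cancel] at e1
        have e2 := (abs_lt.1 (e1.trans_le (min_le_right _ _))).2
        have e3 : -groundSlope p y₀ ≤ -groundSlope p (c - s) :=
          hmin (show c - s ∈ Icc δ Y from ⟨by linarith [hs.2], by linarith [hs.1]⟩)
        linarith
      · exact ((neg_le_abs _).trans (R.abs_mul_m_le hN hp1 hγ.1 hγ.2 hs0.le)).trans
          (R.u_le_peak hp1 hγ.1 hγ.2 hs0.le)
    have := pos_of_wronskian_le (ε := ε) (μ := μ) (P := P) (ψ := ψ) (w := fun s => -(s * m s γ))
      (g := fun s => ψ s * -(h s γ - n * m s γ) - χ s * -(s * m s γ)) hn0.le hb0 hbz.le hμ0 hε0.le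
      (fun s hs => by
        refine ((hψ.deriv_ψ s (hmem s hs)).fun_div (R.deriv_m γ s).fun_neg
          (hμ0.trans_le (hw s hs).1).ne').congr_deriv ?_
        rw [← neg_div]
        congr 1
        ring)
      (fun s hs => by
        refine (((hψ.deriv_ψ s (hmem s hs)).fun_mul (R.hasDerivAt_second hp1 hγ.1
          (hmem s hs).1)).fun_sub ((hψ.deriv_χ s (hmem s hs)).fun_mul
          (R.deriv_m γ s).fun_neg)).congr_deriv ?_
        rw [← hn]
        ring)
      (fun s hs => (R.wronskian_pos hN hp hγ.1 hγ.2 hψ (hmem s hs).1 (hmem s hs).2.le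
        fun t ht => hzpos t ⟨ht.1.le, ht.2.trans_le hs.2⟩).le)
      hw (hposb b ⟨hb0.le, le_rfl⟩).1
      (hgb.trans (mul_le_mul_of_nonneg_right (by linarith)
        (mul_nonneg (hposb b ⟨hb0.le, le_rfl⟩).1.le
          (hμ0.le.trans (hw b (left_mem_Icc.2 hbz.le)).1))))
      (by
        have e1 : z - b ≤ Y := by linarith
        have e2 : n * (z - b) / b ^ 2 ≤ n * Y / b ^ 2 := by gcongr
        have e3 : P ^ 2 * (ε + n * (z - b) / b ^ 2) * (z - b) ≤ P ^ 2 * (ε + ε) * Y := by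
          have : 0 ≤ z - b := by linarith
          gcongr
          exact e2.trans hb2.le
        have e4 : P ^ 2 * (ε + ε) * Y = μ ^ 2 / 2 := by rw [hε]; field_simp; norm_num
        have : 0 < μ ^ 2 := by positivity
        linarith)
    exact this.ne' hz0
  -- Closer to `c`, the conditions `ψ(z) = 0` and `χ(c) = 0` on a short interval force a double zero
  -- at `z`, contradicting `ψ 0 ≠ 0`.
  · have hsub : Icc z c ⊆ Icc 0 c := Icc_subset_Icc_left hz.1.le
    have hsub' : Ioo z c ⊆ Ioo 0 c := Ioo_subset_Ioo_left hz.1.le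
    have e1 := eq_zero_of_short hn0.le hL0.le hδ0.le hδs (by linarith) hzc.le (by linarith)
      (hψ.cont_ψ.mono hsub) (hψ.cont_χ.mono hsub) (fun s hs => hψ.deriv_ψ s (hsub' hs))
      (fun s hs => hψ.deriv_χ s (hsub' hs)) (fun s hs => hf'L s (hsub' hs)) hz0 hχc
    refine radial_sq_add_sq_ne_zero hn0.le hL0.le hψ.cont_ψ hψ.cont_χ hψ0.ne' hψ.deriv_ψ
      hψ.deriv_χ (fun s hs => ?_) z ⟨hz.1.le, hzc.le⟩ (by rw [hz0, e1]; norm_num)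
    rw [abs_mul]
    exact mul_le_mul_of_nonneg_right (hf'L s hs) (abs_nonneg _)

/-- The solutions on the first branch are nondegenerate for small `γ`. -/
theorem eventually_isNondegenerate (hN : 3 ≤ N) (hp : pS N < p)
    (R : RegularFamily N p u m h v k a) : ∀ᶠ γ in 𝓝[>] (0 : ℝ),
      IsNondegenerate N p (critPoint N v k a 1 γ ^ 2) (R.profile (critPoint N v k a 1 γ) γ) := by
  have hp1 := one_lt_of_pS_lt hN hp
  have hN3 : (3 : ℝ) ≤ N := by exact_mod_cast hN
  filter_upwards [Ioo_mem_nhdsGT (zero_lt_one (α := ℝ)), R.eventually_linSol_ne hN hp]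
    with γ hγ hne φ hφ heq
  have hc0 := R.critPoint_pos hN hp hγ.1 le_rfl (n := 1)
  set c := critPoint N v k a 1 γ with hc
  obtain ⟨w, hwc, hw0, hw1, hw⟩ := hφ.exists_deriv N
  have hmaps : MapsTo (fun s : ℝ => s / c) (Icc 0 c) (Icc 0 1) := fun s hs =>
    ⟨div_nonneg hs.1 hc0.le, (div_le_one hc0).2 hs.2⟩
  have hmem : ∀ s ∈ Ioo 0 c, s / c ∈ Ioo (0 : ℝ) 1 := fun s hs =>
    ⟨div_pos hs.1 hc0, (div_lt_one hc0).2 hs.2⟩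
  have hcs : ContinuousOn (fun s : ℝ => s / c) (Icc 0 c) := (continuous_id.div_const c).continuousOn
  have hd : ∀ s : ℝ, HasDerivAt (fun s : ℝ => s / c) (1 / c) s := fun s =>
    (hasDerivAt_id s).div_const c
  have hψ : LinSol N p (fun s => u s γ) (fun s => φ (s / c)) (fun s => w (s / c) / c) c := by
    refine ⟨hφ.contDiffOn.continuousOn.comp hcs hmaps, (hwc.comp hcs hmaps).div_const c,
      by simp [hw0], fun s hs => ?_, fun s hs => ?_⟩
    · exact ((hw _ (hmem s hs)).1.comp s (hd s)).congr_deriv (by ring)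
    · refine (((hw _ (hmem s hs)).2.comp s (hd s)).div_const c).congr_deriv ?_
      have e1 := heq _ (hmem s hs)
      rw [ext_apply_of_mem _ (Ioo_subset_Icc_self (hmem s hs)), profile_apply,
        mul_div_cancel₀ _ hc0.ne'] at e1
      have e2 : radialLaplacian N φ (s / c) = -(c ^ 2 * f' p (u s γ) * φ (s / c)) := by linarith
      rw [e2]
      have := hs.1.ne'
      field_simp
      ring
  have hχc : w (c / c) / c = 0 := by rw [div_self hc0.ne', hw1, zero_div]
  -- A solution with nonzero value at the center is excluded, after a change of sign if necessary;
  -- zero initial data give the zero solution.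
  have h0 : φ (0 / c) = 0 := by
    rcases lt_trichotomy (φ (0 / c)) 0 with hlt | he | hgt
    · exact absurd (by simp only [hχc, neg_zero]) (hne _ _ hψ.neg (by simpa using hlt))
    · exact he
    · exact (hne _ _ hψ hgt hχc).elim
  have key := eq_zero_of_radial_ineq (n := (N : ℝ) - 1) (L := 1 + p * peak p ^ (p - 1))
    (by linarith) (by have := one_lt_peak hp1; positivity) hψ.cont_ψ hψ.cont_χ h0 hψ.χ_zero
    hψ.deriv_ψ hψ.deriv_χ
    (fun s hs => by
      rw [abs_mul]
      exact mul_le_mul_of_nonneg_right (abs_f'_le hp1 (R.u_pos γ hγ.1 s hs.1.le).le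
        (R.u_le_peak hp1 hγ.1 hγ.2 hs.1.le)) (abs_nonneg _))
  intro r hr
  have := (key (c * r) ⟨mul_nonneg hc0.le hr.1, mul_le_of_le_one_right hc0.le hr.2⟩).1
  rwa [mul_div_cancel_left₀ _ hc0.ne'] at this

end RegularFamily

end SupercriticalNeumann

end

/-! ### Assembly of the theorem -/

open SupercriticalNeumann in
theorem theorem2 (N : ℕ) (hN : 3 ≤ N) (p : ℝ) (hp : pS N < p) :
    ∃ (μ : ℕ → ℝ) (lamStar : ℕ → ℝ) (lam : ℕ → ℝ → ℝ) (U : ℕ → ℝ → C(unitInterval, ℝ)),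
      -- `μ` is the increasing enumeration of the radial Neumann eigenvalues
      (StrictMono μ ∧ range μ = radialNeumannEigenvalues N) ∧
      -- `lamStar n` is the unique parameter of a singular solution with `n` intersections with `1`
      (∀ n ≥ 1, ∀ l : ℝ, (∃ V : ℝ → ℝ, IsSingularSolution N p n l V) ↔ l = lamStar n) ∧
      -- all regular solutions
      regularSolutions N p = trivialBranch ∪
        ⋃ n ≥ 1, (branchPlus N p (μ n / (p - 1)) ∪ branchMinus N p (μ n / (p - 1))) ∧
      -- parametrization of each branch by `γ = U(0)`
      (∀ n ≥ 1, branch N p (μ n / (p - 1)) = (fun γ => (lam n γ, U n γ)) '' Ioi 0 ∧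
        (∀ γ > 0, U n γ 0 = γ) ∧ ContDiffOn ℝ 1 (lam n) (Ioi 0) ∧
        ContinuousOn (U n) (Ioi 0)) ∧
      -- (i)
      (∀ n ≥ 1, lam n 1 = μ n / (p - 1)) ∧
      -- (ii)
      (∀ n ≥ 1, Tendsto (lam n) atTop (𝓝 (lamStar n))) ∧
      -- (iii)
      ((p : EReal) < pJL N → ∀ n ≥ 1,
        (∃ᶠ γ in atTop, lamStar n < lam n γ) ∧ (∃ᶠ γ in atTop, lam n γ < lamStar n)) ∧
      -- (iv)
      (∀ n ≥ 1, Tendsto (lam n) (𝓝[>] 0) atTop) ∧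
      -- (v)
      ((∀ᶠ γ in 𝓝[>] (0 : ℝ), IsNondegenerate N p (lam 1 γ) (U 1 γ)) ∧
        IsBoundaryConcentrating p (lam 1) (U 1)) ∧
      -- (vi)
      (∀ γ > 0, ∀ n ≥ 1, lam n γ < lam (n + 1) γ) := by
  obtain ⟨u, m, h, v, k, a, R⟩ := exists_regularFamily hN hp
  obtain ⟨V, W, s₀, L⟩ := R.exists_singularLimit hN hp
  have hp1 : 0 < p - 1 := sub_pos.2 (one_lt_of_pS_lt hN hp)
  have hμ : ∀ n, (p - 1) * critPoint N v k a n 1 ^ 2 / (p - 1) = critPoint N v k a n 1 ^ 2 :=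
    fun n => mul_div_cancel_left₀ _ hp1.ne'
  have hnonneg : ∀ n, ∀ γ > 0, 0 ≤ critPoint N v k a n γ := fun n γ hγ =>
    (R.critPoint_spec hN hp hγ n).1
  have hlt : ∀ γ > 0, ∀ i j, i < j → critPoint N v k a i γ ^ 2 < critPoint N v k a j γ ^ 2 :=
    fun γ hγ i j hij =>
      pow_lt_pow_left₀ (R.critPoint_strictMono hN hp hγ hij) (hnonneg i γ hγ) two_ne_zero
  have hpos : ∀ n ≥ 1, 0 < singPoint N p V W s₀ (2 * n) := fun n hn =>
    L.s₀_pos.trans (L.singPoint_spec hN hp (by omega)).1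
  -- The critical point of index `0` is `s = 0`, which gives the eigenvalue `μ 0 = 0`. The singular
  -- parameters use the even index `2n` because the angles of the singular solution are counted in
  -- units of `π/2`.
  refine ⟨fun n => (p - 1) * critPoint N v k a n 1 ^ 2, fun n => singPoint N p V W s₀ (2 * n) ^ 2,
    fun n γ => critPoint N v k a n γ ^ 2, fun n γ => R.profile (critPoint N v k a n γ) γ,
    ⟨fun i j hij => mul_lt_mul_of_pos_left (hlt 1 one_pos i j hij) hp1, R.range_eigenvalues hN hp⟩,
    fun n hn l => L.exists_isSingularSolution_iff hN hp hn l, ?_, fun n hn => ⟨?_, ?_, ?_, ?_⟩,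
    fun n _ => (hμ n).symm, fun n hn => (L.tendsto_critPoint hN hp R hn).pow 2,
    fun hJL n hn => ⟨?_, ?_⟩,
    fun n hn => (tendsto_pow_atTop two_ne_zero).comp (R.tendsto_critPoint hN hp hn),
    ⟨R.eventually_isNondegenerate hN hp, R.isBoundaryConcentrating hN hp⟩,
    fun γ hγ n _ => hlt γ hγ n (n + 1) n.lt_succ_self⟩
  · simp only [hμ]
    exact R.regularSolutions_eq hN hp
  · simp only [hμ]
    exact R.branch_eq hN hp hn
  · exact fun γ _ => R.profile_zero _ γ
  · exact (R.contDiffOn_critPoint hN hp hn).pow 2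
  · exact R.continuousOn_profile_critPoint hN hp n
  · refine (L.frequently_critPoint hN hp hJL R hn).1.mono fun γ hγ => ?_
    exact pow_lt_pow_left₀ hγ (hpos n hn).le two_ne_zero
  · refine ((L.frequently_critPoint hN hp hJL R hn).2.and_eventually
      (eventually_gt_atTop 0)).mono fun γ hγ => ?_
    exact pow_lt_pow_left₀ hγ.1 (hnonneg n γ hγ.2) two_ne_zero
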